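/- Let $d\in\mathbb N$, let $\|\cdot\|$ be a fixed norm on $\mathbb R^d$, and let $1\le p<d/2$ be real (so $d\ge 3$). For finite measures $\mu,\nu$ on $\mathbb R^d$ of equal mass let $\mathcal M(\mu,\nu)$ be the set of measures on $\mathbb R^d\times\mathbb R^d$ with first marginal $\mu$ and second marginal $\nu$, and let $$\rho_p(\mu,\nu)=\inf_{\xi\in\mathcal M(\mu,\nu)}\Bigl(\int\|x-y\|^p\,\xi(dx,dy)\Bigr)^{1/p}.$$ For a probability measure $\mu$ on $\mathbb R^d$ let $\hat\mu_N=\frac1N\sum_{j=1}^N\delta_{X_j}$ with $X_1,\dots,X_N$ independent and $\mu$-distributed, and let $V^{\mathrm{rand}}_{N,p}(\mu)=\mathbb E[\rho_p(\mu,\hat\mu_N)^p]^{1/p}$. Let $\mathcal U$ be the uniform distribution on $[0,1)^d$, let $\Lambda$ be the set of probability measures $\mathcal U'$ on $[0,1]^d$ with $\mathcal U'(A)\le\mathcal U(A)$ for every Borel set $A\subset(0,1)^d$, and let $$\underline V^{\mathrm{rand}}_{N,p}=\mathbb E\Bigl[\inf_{\mathcal U'\in\Lambda,\ \xi\in\mathcal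 M(\mathcal U',\hat{\mathcal U}_N)}\int\|x-y\|^p\,\xi(dx,dy)\Bigr]^{1/p}.$$ A finite measure $\mu$ on $\mathbb R^d$ is called approachable from below (respectively from above) if for every $\varepsilon>0$ there are finitely many cubes $B_1,\dots,B_n$ parallel to the coordinate axes and positive reals $\alpha_1,\dots,\alpha_n$ such that $\nu=\sum_k\alpha_k\,\mathcal U(B_k)$, where $\mathcal U(B_k)$ is the uniform distribution on $B_k$, satisfies $\nu\le\mu$ (respectively $\nu\ge\mu$) and $\|\mu-\nu\|\le\varepsilon$ in total variation; $n=0$, $\nu=0$ is allowed. **Theorem.** The limits $$\kappa^{\mathrm{unif}}_p=\lim_{N\to\infty}N^{1/d}\,V^{\mathrm{rand}}_{N,p}(\mathcal U),\qquad \underline\kappa^{\mathrm{unif}}_p=\lim_{N\to\infty}N^{1/d}\,\underline V^{\mathrm{rand}}_{N,p}$$ exist in $(0,\infty)$, and the following holds for every probability measure $\mu$ on $\mathbb R^d$ with $\int\|x\|^q\,d\mu(x)<\infty$ for some $q>\frac{dp}{d-p}$. Let $\mu_a$ be the absolutely continuous part of $\mu$ with respect to Lebesgue measure and $f$ its density.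 If $\mu_a$ is approachable from below, then $$\limsup_{N\to\infty}N^{1/d}\,V^{\mathrm{rand}}_{N,p}(\mu)\le\kappa^{\mathrm{unif}}_p\Bigl(\int_{\mathbb R^d}f(x)^{1-p/d}\,dx\Bigr)^{1/p}.$$ If $\mu_a$ is approachable from above, then $$\liminf_{N\to\infty}N^{1/d}\,V^{\mathrm{rand}}_{N,p}(\mu)\ge\underline\kappa^{\mathrm{unif}}_p\Bigl(\int_{\mathbb R^d}f(x)^{1-p/d}\,dx\Bigr)^{1/p}.$$ -/

import Mathlib

open MeasureTheory Filter Topology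
open scoped ENNReal NNReal

namespace EmpQuant

noncomputable section

/-- The set of transports between two measures on `ℝ^d`: the measures on the product with
first marginal `μ` and second marginal `ν`. -/
def transports {d : ℕ} (μ ν : Measure (Fin d → ℝ)) :
    Set (Measure ((Fin d → ℝ) × (Fin d → ℝ))) :=
  {ξ | ξ.map Prod.fst = μ ∧ ξ.map Prod.snd = ν}

/-- The cost `∫ ‖x - y‖ ^ p dξ(x, y)` of a transport, for the norm `nrm`. -/
def transportCost {d : ℕ} (nrm : Seminorm ℝ (Fin d → ℝ)) (p : ℝ)
    (ξ : Measure ((Fin d → ℝ) × (Fin d → ℝ))) : ℝ≥0∞ :=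
  ∫⁻ z, ENNReal.ofReal (nrm (z.1 - z.2)) ^ p ∂ξ

/-- The `p`-th Wasserstein metric with respect to the norm `nrm`. -/
def wasserstein {d : ℕ} (nrm : Seminorm ℝ (Fin d → ℝ)) (p : ℝ)
    (μ ν : Measure (Fin d → ℝ)) : ℝ≥0∞ :=
  ⨅ ξ ∈ transports μ ν, transportCost nrm p ξ ^ (1 / p)

/-- The empirical measure `(1/N) ∑ δ_{x_j}` of the points `x_1, …, x_N`. -/
def empirical {d N : ℕ} (x : Fin N → Fin d → ℝ) : Measure (Fin d → ℝ) :=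
  (N : ℝ≥0∞)⁻¹ • ∑ j, Measure.dirac (x j)

/-- The random quantization error `E[ρ_p^p(μ, μ̂_N)]^{1/p}`, the expectation being taken over `N`
independent `μ`-distributed points (realised on the canonical product space). -/
def randError {d : ℕ} (nrm : Seminorm ℝ (Fin d → ℝ)) (p : ℝ) (N : ℕ)
    (μ : Measure (Fin d → ℝ)) : ℝ≥0∞ :=
  (∫⁻ x : Fin N → Fin d → ℝ, wasserstein nrm p μ (empirical x) ^ p
    ∂(Measure.pi fun _ => μ)) ^ (1 / p)

/-- The axis-parallel cube `∏ᵢ [aᵢ, aᵢ + l)` with lower corner `a` and edge length `l`. -/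
def cube {d : ℕ} (a : Fin d → ℝ) (l : ℝ) : Set (Fin d → ℝ) :=
  Set.univ.pi fun i => Set.Ico (a i) (a i + l)

/-- The uniform distribution on a Borel set of finite nonzero Lebesgue measure. -/
def uniform {d : ℕ} (A : Set (Fin d → ℝ)) : Measure (Fin d → ℝ) :=
  (volume A)⁻¹ • volume.restrict A

/-- The uniform distribution on the unit cube `[0,1)^d`. -/
def unifCube (d : ℕ) : Measure (Fin d → ℝ) :=
  uniform (cube 0 1)

/-- The probability measures `U'` on the closed cube `[0,1]^d` with `U' A ≤ U A` for all Borel sets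
`A` in the open cube `(0,1)^d`, where `U` is the uniform distribution on the unit cube. -/
def leaking (d : ℕ) : Set (Measure (Fin d → ℝ)) :=
  {U' | IsProbabilityMeasure U' ∧
    U' (Set.univ.pi fun _ => Set.Icc (0 : ℝ) 1)ᶜ = 0 ∧
    ∀ A : Set (Fin d → ℝ), MeasurableSet A → (A ⊆ Set.univ.pi fun _ => Set.Ioo (0 : ℝ) 1) →
      U' A ≤ unifCube d A}

/-- The random quantization error of the unit cube in which leakage at the boundary is allowed. -/
def leakError (d : ℕ) (nrm : Seminorm ℝ (Fin d → ℝ)) (p : ℝ) (N : ℕ) : ℝ≥0∞ :=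
  (∫⁻ x : Fin N → Fin d → ℝ,
    (⨅ U' ∈ leaking d, ⨅ ξ ∈ transports U' (empirical x), transportCost nrm p ξ)
    ∂(Measure.pi fun _ => unifCube d)) ^ (1 / p)

/-- `ν` is a finite combination, with positive coefficients, of uniform distributions on
axis-parallel (nondegenerate) cubes. -/
def IsCubeMixture {d : ℕ} (ν : Measure (Fin d → ℝ)) : Prop :=
  ∃ (n : ℕ) (a : Fin n → Fin d → ℝ) (l : Fin n → ℝ) (α : Fin n → ℝ),
    (∀ k, 0 < l k) ∧ (∀ k, 0 < α k) ∧
    ν = ∑ k, ENNReal.ofReal (α k) • uniform (cube (a k) (l k))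

/-- Since `ν ≤ μ`, the measure `μ - ν` is the difference of the two measures, and its total mass is
the total variation distance of `μ` and `ν`. -/
def ApproachableFromBelow {d : ℕ} (μ : Measure (Fin d → ℝ)) : Prop :=
  ∀ ε : ℝ, 0 < ε → ∃ ν, IsCubeMixture ν ∧ ν ≤ μ ∧ (μ - ν) Set.univ ≤ ENNReal.ofReal ε

/-- The analogue of `ApproachableFromBelow` with dominating cube mixtures. -/
def ApproachableFromAbove {d : ℕ} (μ : Measure (Fin d → ℝ)) : Prop :=
  ∀ ε : ℝ, 0 < ε → ∃ ν, IsCubeMixture ν ∧ μ ≤ ν ∧ (ν - μ) Set.univ ≤ ENNReal.ofReal ε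

/-- The density of the absolutely continuous part of `μ` with respect to Lebesgue measure. -/
def acDensity {d : ℕ} (μ : Measure (Fin d → ℝ)) : (Fin d → ℝ) → ℝ≥0∞ :=
  μ.rnDeriv volume

/-- The absolutely continuous part of `μ` in its Lebesgue decomposition. -/
def acPart {d : ℕ} (μ : Measure (Fin d → ℝ)) : Measure (Fin d → ℝ) :=
  volume.withDensity (acDensity μ)

end

end EmpQuant

open EmpQuant

/-! Put `s = p / d`, so that `0 < s < 1/2`. The proof works with `meanCost`, the expectation of the
`p`-th power of the Wasserstein distance, and takes `p`-th roots only at the end. The cost of `N`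
points is of order `N ^ (-s)`. The frequency of sample points in a fixed set fluctuates only by
order `N ^ (-1/2)`, which is smaller because `s < 1/2`. This gap is what makes localisation to cells
possible.

A priori bounds. Transport cost is subadditive, and a partition bounds it by the costs inside the
cells plus the cost of moving the mass by which the cells disagree (`otCost_le_partition`). Along a
chain of dyadic grids on a cube, the disagreement costs form a geometric series dominated by the
finest level, because `p < d/2` (`meanCost_le_grid`). With about one point per finest cell, every
law on a cube of edge `l` has cost at most a constant times `l ^ p * N ^ (-s)` (`meanCost_le_cube`).
Cutting space into dyadic shells extends this to laws with a finite `shellSum`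
(`meanCost_le_shellSum`), and the moment condition is what makes that sum finite
(`shellSum_ne_top_of_moment`).

The constants. The mean cost decreases in `N`, since an empirical measure is the average of its
leave-one-out subsamples and optimal cost is convex (`avgEmp_infCost_succ_le`). For the uniform law,
splitting the cube into `k ^ d` cells with slightly more than `m₀` points each bounds the scaled
cost at `N` by the scaled cost at `m₀`, so the limsup is at most the liminf. The leaking cost
behaves in the opposite way: a transport for the whole cube restricts to leaking transports for the
cells, because mass that crosses the border of a cell may be stopped at a boundary point
(`infCost_leaking_le`). Hence the leaking cost of `m₀` points bounds that of `N` points from below,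
and its scaled limit exists as well. This limit is positive because a ball of volume below `1 / (2 *
N)` cannot supply the mass `1 / N` that a point needs.

Upper bound. After scaling, the asymptotic cost is subadditive over arbitrary decompositions `μ = ∑
i, ν i` (`limsup_meanCost_le_sum_costRate`). Take a cube mixture below `μ_a` and a fine grid. Cells
on which the mixture is constant contribute the uniform constant times the integral of the density
to the power `1 - s`. The singular part sits, up to small mass, on a compact null set, whose grid
cover has small volume, and Hölder's inequality makes its contribution small. The remainder has
small mass, hence a small shell sum.

Lower bound. Take a cube mixture `g` above `μ_a` and grid cells of volume `M / N`, so that the mean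
number of points in a cell stays fixed as `N` grows. Couple the sample with one whose law is
proportional to `g` on the good cells (`exists_coupling_withDensity`). A transport from `μ` to its
sample then yields leaking transports in all cells simultaneously (`sum_leakMean_le`), with an error
proportional to `ε` for fixed `M`. Let `N` tend to infinity, then `ε` to zero, then `M` to infinity.
-/

namespace EmpQuant

noncomputable section

/-! ### Optimal transport cost: subadditivity and comparison along partitions. -/

section Coupling

variable {Z Z' : Type*} [MeasurableSpace Z] [MeasurableSpace Z']

/-- The couplings of two measures on a measurable space. -/
def couplings (μ ν : Measure Z) : Set (Measure (Z × Z)) :=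
  {ξ | ξ.map Prod.fst = μ ∧ ξ.map Prod.snd = ν}

/-- The optimal transport cost for the cost function `c`. -/
def otCost (c : Z → Z → ℝ≥0∞) (μ ν : Measure Z) : ℝ≥0∞ :=
  ⨅ ξ ∈ couplings μ ν, ∫⁻ z, c z.1 z.2 ∂ξ

lemma otCost_le {c : Z → Z → ℝ≥0∞} {μ ν : Measure Z} {ξ : Measure (Z × Z)}
    (h1 : ξ.map Prod.fst = μ) (h2 : ξ.map Prod.snd = ν) :
    otCost c μ ν ≤ ∫⁻ z, c z.1 z.2 ∂ξ :=
  iInf₂_le ξ ⟨h1, h2⟩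

lemma otCost_zero (c : Z → Z → ℝ≥0∞) : otCost c 0 0 = 0 := by
  have := otCost_le (c := c) (ξ := (0 : Measure (Z × Z))) (Measure.map_zero _)
    (Measure.map_zero _)
  simpa using this

lemma exists_coupling_of_otCost_lt {c : Z → Z → ℝ≥0∞} {μ ν : Measure Z} {t : ℝ≥0∞}
    (h : otCost c μ ν < t) :
    ∃ ξ : Measure (Z × Z), ξ.map Prod.fst = μ ∧ ξ.map Prod.snd = ν ∧
      ∫⁻ z, c z.1 z.2 ∂ξ < t := by
  simp only [otCost, iInf_lt_iff] at h
  obtain ⟨ξ, ⟨h1, h2⟩, h3⟩ := h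
  exact ⟨ξ, h1, h2, h3⟩

/-- Sums of couplings couple the sums. The slack `ε` is needed because the infimum need not be
attained. -/
lemma otCost_add_le (c : Z → Z → ℝ≥0∞) (μ ν μ' ν' : Measure Z) :
    otCost c (μ + μ') (ν + ν') ≤ otCost c μ ν + otCost c μ' ν' := by
  refine ENNReal.le_of_forall_pos_le_add fun ε hε hlt => ?_
  have hε' : (ε / 2 : ℝ≥0∞) ≠ 0 := by simp [hε.ne']
  have h1 : otCost c μ ν ≠ ∞ := ne_top_of_le_ne_top hlt.ne le_self_add
  have h2 : otCost c μ' ν' ≠ ∞ := ne_top_of_le_ne_top hlt.ne le_add_self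
  obtain ⟨ξ, a1, a2, a3⟩ := exists_coupling_of_otCost_lt (ENNReal.lt_add_right h1 hε')
  obtain ⟨ξ', b1, b2, b3⟩ := exists_coupling_of_otCost_lt (ENNReal.lt_add_right h2 hε')
  calc otCost c (μ + μ') (ν + ν') ≤ ∫⁻ z, c z.1 z.2 ∂(ξ + ξ') :=
        otCost_le (by rw [Measure.map_add _ _ measurable_fst, a1, b1])
          (by rw [Measure.map_add _ _ measurable_snd, a2, b2])
    _ = ∫⁻ z, c z.1 z.2 ∂ξ + ∫⁻ z, c z.1 z.2 ∂ξ' := lintegral_add_measure _ _ _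
    _ ≤ (otCost c μ ν + ε / 2) + (otCost c μ' ν' + ε / 2) := add_le_add a3.le b3.le
    _ = otCost c μ ν + otCost c μ' ν' + ε := by
        rw [add_add_add_comm, ENNReal.add_halves]

lemma otCost_smul_le (c : Z → Z → ℝ≥0∞) (μ ν : Measure Z) {t : ℝ≥0∞} (ht : t ≠ ∞) :
    otCost c (t • μ) (t • ν) ≤ t * otCost c μ ν := by
  rcases eq_or_ne t 0 with rfl | h0
  · simp [otCost_zero]
  simp only [otCost]
  rw [ENNReal.mul_iInf_of_ne h0 ht]
  refine le_iInf fun ξ => ?_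
  rw [ENNReal.mul_iInf_of_ne h0 ht]
  refine le_iInf fun hξ => ?_
  have h1 : (t • ξ).map Prod.fst = t • μ := by rw [Measure.map_smul, hξ.1]
  have h2 : (t • ξ).map Prod.snd = t • ν := by rw [Measure.map_smul, hξ.2]
  refine (iInf₂_le (t • ξ) ⟨h1, h2⟩).trans ?_
  rw [lintegral_smul_measure, smul_eq_mul]

lemma otCost_sum_le {ι : Type*} (s : Finset ι) (c : Z → Z → ℝ≥0∞) (μ ν : ι → Measure Z) :
    otCost c (∑ i ∈ s, μ i) (∑ i ∈ s, ν i) ≤ ∑ i ∈ s, otCost c (μ i) (ν i) := by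
  classical
  induction s using Finset.induction_on with
  | empty => simp [otCost_zero]
  | insert a s ha ih =>
    rw [Finset.sum_insert ha, Finset.sum_insert ha, Finset.sum_insert ha]
    exact (otCost_add_le _ _ _ _ _).trans (by gcongr)

/-- Push a coupling forward by `T × T`. The inequality `lintegral_map_le` suffices, so the cost
functions need not be measurable. -/
lemma otCost_map_le {c : Z → Z → ℝ≥0∞} {c' : Z' → Z' → ℝ≥0∞} {T : Z → Z'} (hT : Measurable T)
    {K : ℝ≥0∞} (h0 : K ≠ 0) (hK : K ≠ ∞) (h : ∀ x y, c' (T x) (T y) ≤ K * c x y) (μ ν : Measure Z) :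
    otCost c' (μ.map T) (ν.map T) ≤ K * otCost c μ ν := by
  have hTT : Measurable (Prod.map T T) := hT.prodMap hT
  have key : ∀ ξ ∈ couplings μ ν,
      otCost c' (μ.map T) (ν.map T) ≤ K * ∫⁻ z, c z.1 z.2 ∂ξ := by
    intro ξ hξ
    refine (otCost_le (ξ := ξ.map (Prod.map T T)) ?_ ?_).trans ?_
    · rw [Measure.map_map measurable_fst hTT, ← hξ.1, Measure.map_map hT measurable_fst]; rfl
    · rw [Measure.map_map measurable_snd hTT, ← hξ.2, Measure.map_map hT measurable_snd]; rfl
    · refine (lintegral_map_le _ _).trans ?_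
      rw [← lintegral_const_mul' _ _ hK]
      exact lintegral_mono fun z => h z.1 z.2
  simp only [otCost] at key ⊢
  rw [ENNReal.mul_iInf_of_ne h0 hK]
  refine le_iInf fun ξ => ?_
  rw [ENNReal.mul_iInf_of_ne h0 hK]
  exact le_iInf fun hξ => key ξ hξ

/-- The crudest transport, the product measure divided by the common mass. It serves to pay for mass
that has to be moved between cells. -/
lemma otCost_le_lintegral_add {c : Z → Z → ℝ≥0∞} {b : Z → ℝ≥0∞} (hb : Measurable b)
    (h : ∀ x y, c x y ≤ b x + b y) {α β : Measure Z} (hαβ : α Set.univ = β Set.univ)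
    (hα : α Set.univ ≠ ∞) :
    otCost c α β ≤ ∫⁻ x, b x ∂α + ∫⁻ x, b x ∂β := by
  rcases eq_or_ne (α Set.univ) 0 with h0 | h0
  · have hα0 : α = 0 := Measure.measure_univ_eq_zero.1 h0
    have hβ0 : β = 0 := Measure.measure_univ_eq_zero.1 (hαβ ▸ h0)
    simp [hα0, hβ0, otCost_zero]
  have : IsFiniteMeasure α := ⟨hα.lt_top⟩
  have : IsFiniteMeasure β := ⟨hαβ ▸ hα.lt_top⟩
  refine (otCost_le (ξ := (α Set.univ)⁻¹ • α.prod β) ?_ ?_).trans ?_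
  · rw [Measure.map_smul, Measure.map_fst_prod, ← hαβ, smul_smul,
      ENNReal.inv_mul_cancel h0 hα, one_smul]
  · rw [Measure.map_smul, Measure.map_snd_prod, smul_smul,
      ENNReal.inv_mul_cancel h0 hα, one_smul]
  · rw [lintegral_smul_measure, smul_eq_mul]
    have e1 : ∫⁻ z, c z.1 z.2 ∂(α.prod β) ≤
        (α Set.univ) * (∫⁻ x, b x ∂α + ∫⁻ x, b x ∂β) := by
      calc ∫⁻ z, c z.1 z.2 ∂(α.prod β) ≤ ∫⁻ z, (b z.1 + b z.2) ∂(α.prod β) :=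
            lintegral_mono fun z => h z.1 z.2
        _ = ∫⁻ z, b z.1 ∂(α.prod β) + ∫⁻ z, b z.2 ∂(α.prod β) :=
            lintegral_add_left (hb.comp measurable_fst) _
        _ = ∫⁻ x, b x ∂((α.prod β).map Prod.fst) + ∫⁻ x, b x ∂((α.prod β).map Prod.snd) := by
            rw [lintegral_map hb measurable_fst, lintegral_map hb measurable_snd]
        _ = _ := by
            rw [Measure.map_fst_prod, Measure.map_snd_prod, lintegral_smul_measure,
              lintegral_smul_measure, ← hαβ, smul_eq_mul, smul_eq_mul, mul_add]
    calc _ ≤ (α Set.univ)⁻¹ * ((α Set.univ) * (∫⁻ x, b x ∂α + ∫⁻ x, b x ∂β)) := by gcongr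
      _ = _ := by rw [← mul_assoc, ENNReal.inv_mul_cancel h0 hα, one_mul]

lemma measure_smul_cond (μ : Measure Z) [IsFiniteMeasure μ] {B : Set Z}  :
    μ B • ProbabilityTheory.cond μ B = μ.restrict B := by
  rcases eq_or_ne (μ B) 0 with h | h
  · rw [h, zero_smul, Measure.restrict_eq_zero.2 h]
  · rw [ProbabilityTheory.cond, smul_smul, ENNReal.mul_inv_cancel h (measure_ne_top _ _), one_smul]

lemma sum_restrict_preimage {ι : Type*} [Fintype ι] [MeasurableSpace ι]
    [MeasurableSingletonClass ι] (μ : Measure Z) {T : Z → ι} (hT : Measurable T) :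
    ∑ i, μ.restrict (T ⁻¹' {i}) = μ := by
  ext A hA
  rw [Measure.finsetSum_apply]
  simp_rw [Measure.restrict_apply hA]
  rw [← measure_biUnion_finset]
  · congr 1
    ext x; simp
  · intro i _ j _ hij
    refine Set.disjoint_left.2 fun x hx hx' => hij ?_
    exact hx.2.symm.trans hx'.2
  · exact fun i _ => hA.inter (hT (measurableSet_singleton i))

/-- A partition of the space bounds the transport cost by the costs within the cells and the cost
of moving the mass by which the two measures differ on the cells. -/
lemma otCost_le_partition {ι : Type*} [Fintype ι] [MeasurableSpace ι]
    [MeasurableSingletonClass ι] {c : Z → Z → ℝ≥0∞} {b : Z → ℝ≥0∞} (hb : Measurable b)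
    (h : ∀ x y, c x y ≤ b x + b y) (μ ν : Measure Z) [IsProbabilityMeasure μ]
    [IsProbabilityMeasure ν] {T : Z → ι} (hT : Measurable T) :
    otCost c μ ν ≤
      ∑ i, min (μ (T ⁻¹' {i})) (ν (T ⁻¹' {i})) *
        otCost c (ProbabilityTheory.cond μ (T ⁻¹' {i})) (ProbabilityTheory.cond ν (T ⁻¹' {i})) +
      ∑ i, ((μ (T ⁻¹' {i}) - ν (T ⁻¹' {i})) * ∫⁻ x, b x ∂(ProbabilityTheory.cond μ (T ⁻¹' {i})) +
        (ν (T ⁻¹' {i}) - μ (T ⁻¹' {i})) * ∫⁻ x, b x ∂(ProbabilityTheory.cond ν (T ⁻¹' {i}))) := by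
  set B : ι → Set Z := fun i => T ⁻¹' {i} with hB
  have hBm : ∀ i, MeasurableSet (B i) := fun i => hT (measurableSet_singleton i)
  set μc := fun i => ProbabilityTheory.cond μ (B i)
  set νc := fun i => ProbabilityTheory.cond ν (B i)
  -- The mass `min (α (B i)) (β (B i))` can stay in its cell; only the excess over it has to change
  -- cells.
  have split : ∀ (α β : Measure Z) [IsProbabilityMeasure α] [IsProbabilityMeasure β],
      α = ∑ i, min (α (B i)) (β (B i)) • ProbabilityTheory.cond α (B i) +
        ∑ i, (α (B i) - β (B i)) • ProbabilityTheory.cond α (B i) := by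
    intro α β _ _
    rw [← Finset.sum_add_distrib]
    conv_lhs => rw [← sum_restrict_preimage α hT]
    refine Finset.sum_congr rfl fun i _ => ?_
    rw [← add_smul, ← measure_smul_cond]
    congr 1
    rcases le_total (α (B i)) (β (B i)) with hle | hle
    · rw [min_eq_left hle, tsub_eq_zero_of_le hle, add_zero]
    · rw [min_eq_right hle, add_tsub_cancel_of_le hle]
  have hexc : ∀ (α β : Measure Z) [IsProbabilityMeasure α] [IsProbabilityMeasure β],
      (∑ i, (α (B i) - β (B i)) • ProbabilityTheory.cond α (B i)) Set.univ
        = ∑ i, (α (B i) - β (B i)) := by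
    intro α β _ _
    rw [Measure.finsetSum_apply]
    refine Finset.sum_congr rfl fun i _ => ?_
    rw [Measure.smul_apply, smul_eq_mul]
    rcases eq_or_ne (α (B i)) 0 with h0 | h0
    · simp [h0]
    · have := ProbabilityTheory.cond_isProbabilityMeasure h0
      simp
  have hsum : ∀ (α : Measure Z) [IsProbabilityMeasure α], ∑ i, α (B i) = 1 := by
    intro α _
    have := congrArg (fun m => m Set.univ) (sum_restrict_preimage α hT)
    simpa [Measure.finsetSum_apply] using this
  -- Both excesses equal one minus the common mass, so they can be coupled with each other.
  have hmass : ∑ i, (μ (B i) - ν (B i)) = ∑ i, (ν (B i) - μ (B i)) := by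
    have e : ∀ (α β : Measure Z) [IsProbabilityMeasure α] [IsProbabilityMeasure β],
        ∑ i, (α (B i) - β (B i)) + ∑ i, min (α (B i)) (β (B i)) = 1 := by
      intro α β _ _
      rw [← Finset.sum_add_distrib, ← hsum α]
      refine Finset.sum_congr rfl fun i _ => ?_
      rcases le_total (α (B i)) (β (B i)) with hle | hle
      · rw [min_eq_left hle, tsub_eq_zero_of_le hle, zero_add]
      · rw [min_eq_right hle, tsub_add_cancel_of_le hle]
    have e1 := e μ ν
    have e2 := e ν μ
    simp_rw [min_comm (ν _)] at e2
    refine (ENNReal.add_left_inj ?_).1 (e1.trans e2.symm)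
    exact ne_top_of_le_ne_top ENNReal.one_ne_top (e1 ▸ le_add_self)
  have hfin : ∑ i, (μ (B i) - ν (B i)) ≠ ∞ :=
    ne_top_of_le_ne_top (ENNReal.one_ne_top)
      ((Finset.sum_le_sum fun i _ => tsub_le_self).trans (hsum μ).le)
  have e0 : otCost c μ ν = otCost c
      (∑ i, min (μ (B i)) (ν (B i)) • ProbabilityTheory.cond μ (B i) +
        ∑ i, (μ (B i) - ν (B i)) • ProbabilityTheory.cond μ (B i))
      (∑ i, min (ν (B i)) (μ (B i)) • ProbabilityTheory.cond ν (B i) +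
        ∑ i, (ν (B i) - μ (B i)) • ProbabilityTheory.cond ν (B i)) := by
    rw [← split μ ν, ← split ν μ]
  rw [e0]
  refine (otCost_add_le _ _ _ _ _).trans (add_le_add ?_ ?_)
  · simp_rw [min_comm (ν _)]
    refine (otCost_sum_le _ _ _ _).trans (Finset.sum_le_sum fun i _ => ?_)
    exact otCost_smul_le _ _ _ (ne_top_of_le_ne_top (measure_ne_top μ _) (min_le_left _ _))
  · refine (otCost_le_lintegral_add hb h ?_ ?_).trans ?_
    · rw [hexc, hexc, hmass]
    · rwa [hexc]
    · rw [lintegral_finsetSum_measure, lintegral_finsetSum_measure, Finset.sum_add_distrib]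
      simp only [lintegral_smul_measure, smul_eq_mul]
      exact le_rfl

/-- The symmetric distance of two extended nonnegative reals. -/
def adist (a b : ℝ≥0∞) : ℝ≥0∞ := (a - b) + (b - a)

/-- The transport cost within the cells of a partition. -/
def cellCost {ι : Type*} [Fintype ι] (c : Z → Z → ℝ≥0∞) (T : Z → ι) (μ ν : Measure Z) : ℝ≥0∞ :=
  ∑ i, min (μ (T ⁻¹' {i})) (ν (T ⁻¹' {i})) *
    otCost c (ProbabilityTheory.cond μ (T ⁻¹' {i})) (ProbabilityTheory.cond ν (T ⁻¹' {i}))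

/-- The ratios are the conditional masses of a subcell in a cell of mass `a` or `a'`. After
weighting with `min a a'`, their difference is the unnormalised difference plus the share of the
defect `a' - a` that falls to the subcell. -/
lemma min_mul_div_sub_div_le {a a' : ℝ≥0∞} (ha : a ≠ 0) (hat : a ≠ ∞) (ha' : a' ≠ 0)
    (hat' : a' ≠ ∞) (x y : ℝ≥0∞) :
    min a a' * (a⁻¹ * x - a'⁻¹ * y) ≤ (x - y) + (a'⁻¹ * y) * (a' - a) := by
  rcases le_total a a' with hle | hle
  · rw [min_eq_left hle, ENNReal.mul_sub (fun _ _ => hat), ← mul_assoc,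
      ENNReal.mul_inv_cancel ha hat, one_mul, tsub_le_iff_right, add_assoc, mul_comm a,
      ← mul_add, tsub_add_cancel_of_le hle, mul_comm a'⁻¹, mul_assoc,
      ENNReal.inv_mul_cancel ha' hat', mul_one]
    exact le_tsub_add
  · rw [min_eq_right hle, ENNReal.mul_sub (fun _ _ => hat'), ← mul_assoc a' a'⁻¹,
      ENNReal.mul_inv_cancel ha' hat', one_mul]
    refine le_trans (tsub_le_tsub_right ?_ _) le_self_add
    rw [← mul_assoc]
    calc a' * a⁻¹ * x ≤ a * a⁻¹ * x := by gcongr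
      _ = x := by rw [ENNReal.mul_inv_cancel ha hat, one_mul]

lemma lintegral_cond_le {μ : Measure Z} {B S : Set Z} {b : Z → ℝ≥0∞} {D : ℝ≥0∞}
    (hμ : μ Sᶜ = 0) (h : ∀ x ∈ S, x ∈ B → b x ≤ D) (hB : MeasurableSet B) :
    ∫⁻ x, b x ∂(ProbabilityTheory.cond μ B) ≤ D := by
  have hae : ∀ᵐ x ∂(ProbabilityTheory.cond μ B), b x ≤ D := by
    refine Measure.ae_smul_measure ?_ _
    rw [ae_restrict_iff' hB]
    filter_upwards [mem_ae_iff.2 hμ] with x hx hxB using h x hx hxB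
  refine (lintegral_mono_ae hae).trans ?_
  rw [lintegral_const, ProbabilityTheory.cond, Measure.smul_apply, smul_eq_mul,
    Measure.restrict_apply_univ]
  exact mul_le_of_le_one_right' (ENNReal.inv_mul_le_one _)

/-- Refining a partition with cells of cost diameter at most `D`. -/
lemma cellCost_le_refine {ι ι' : Type*} [Fintype ι] [Fintype ι'] [MeasurableSpace ι]
    [MeasurableSingletonClass ι] [MeasurableSpace ι'] [MeasurableSingletonClass ι']
    {c : Z → Z → ℝ≥0∞} {μ ν : Measure Z} [IsFiniteMeasure μ]
    [IsFiniteMeasure ν] {T : Z → ι} {T' : Z → ι'} {g : ι' → ι} (hT' : Measurable T')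
    (hT : Measurable T) (hg : ∀ x, T x = g (T' x)) {S : Set Z} (hS : MeasurableSet S)
    (hμ : μ Sᶜ = 0) (hν : ν Sᶜ = 0) {D : ℝ≥0∞}
    (hD : ∀ x ∈ S, ∀ y ∈ S, T x = T y → c x y ≤ D) :
    cellCost c T μ ν ≤ cellCost c T' μ ν +
      2 * D * ∑ i, adist (μ (T' ⁻¹' {i})) (ν (T' ⁻¹' {i})) := by
  classical
  set B : ι' → Set Z := fun i => T' ⁻¹' {i} with hB
  have hBm : ∀ i, MeasurableSet (B i) := fun i => hT' (measurableSet_singleton i)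
  have hfib : ∀ F : ι' → ℝ≥0∞, ∑ i, F i = ∑ j, ∑ i ∈ Finset.univ.filter (fun i => g i = j), F i :=
    fun F => (Finset.sum_fiberwise _ _ _).symm
  rw [cellCost, cellCost, hfib, hfib, Finset.mul_sum, ← Finset.sum_add_distrib]
  refine Finset.sum_le_sum fun j _ => ?_
  set A : Set Z := T ⁻¹' {j} with hA
  have hAm : MeasurableSet A := hT (measurableSet_singleton j)
  rcases eq_or_ne (μ A) 0 with ha | ha
  · simp [ha]
  rcases eq_or_ne (ν A) 0 with ha' | ha'
  · simp [ha']
  have hat := measure_ne_top μ A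
  have hat' := measure_ne_top ν A
  have i1 := ProbabilityTheory.cond_isProbabilityMeasure ha
  have i2 := ProbabilityTheory.cond_isProbabilityMeasure ha'
  have hBA : ∀ i, g i = j → B i ⊆ A := by
    intro i hi x hx
    have hx' : T' x = i := hx
    change T x = j
    rw [hg, hx', hi]
  have hBA' : ∀ i, g i ≠ j → A ∩ B i = ∅ := by
    intro i hi
    ext x
    simp only [Set.mem_inter_iff, Set.mem_empty_iff_false, iff_false, not_and]
    intro h1 h2
    have h1' : T x = j := h1
    have h2' : T' x = i := h2
    exact hi (by rw [← h2', ← hg, h1'])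
  have hval : ∀ (α : Measure Z) i, g i = j →
      ProbabilityTheory.cond α A (B i) = (α A)⁻¹ * α (B i) := by
    intro α i hi
    rw [ProbabilityTheory.cond_apply hAm, Set.inter_eq_right.2 (hBA i hi)]
  have hval' : ∀ (α : Measure Z) i, g i ≠ j → ProbabilityTheory.cond α A (B i) = 0 := by
    intro α i hi
    rw [ProbabilityTheory.cond_apply hAm, hBA' i hi]; simp
  -- The value `∞` off `A ∩ S` makes the bound on `c` hold everywhere; it costs nothing, since the
  -- conditional measures do not charge that set.
  set b : Z → ℝ≥0∞ := (A ∩ S).piecewise (fun _ => D) (fun _ => ∞) with hb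
  have hbm : Measurable b := measurable_const.piecewise (hAm.inter hS) measurable_const
  have hcb : ∀ x y, c x y ≤ b x + b y := by
    intro x y
    by_cases hx : x ∈ A ∩ S
    · by_cases hy : y ∈ A ∩ S
      · rw [hb, Set.piecewise_eq_of_mem _ _ _ hx]
        exact (hD x hx.2 y hy.2 (hx.1.trans hy.1.symm)).trans le_self_add
      · rw [hb, Set.piecewise_eq_of_notMem _ _ _ hy]; simp
    · rw [hb, Set.piecewise_eq_of_notMem _ _ _ hx]; simp
  have hbD : ∀ (α : Measure Z), α Sᶜ = 0 → ∀ i, g i = j →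
      ∫⁻ x, b x ∂(ProbabilityTheory.cond (ProbabilityTheory.cond α A) (B i)) ≤ D := by
    intro α hα i hi
    have h0 : ProbabilityTheory.cond α A Sᶜ = 0 := ProbabilityTheory.cond_absolutelyContinuous hα
    refine lintegral_cond_le h0 (fun x hx hxB => ?_) (hBm i)
    have hxx : x ∈ A ∩ S := ⟨hBA i hi hxB, hx⟩
    exact (Set.piecewise_eq_of_mem _ _ _ hxx).le
  have main := otCost_le_partition (c := c) hbm hcb (ProbabilityTheory.cond μ A)
    (ProbabilityTheory.cond ν A) hT'
  refine (mul_le_mul_of_nonneg_left main zero_le).trans ?_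
  -- Fine cells outside `A` drop out. Inside `A` the outer weight `min (μ A) (ν A)` turns
  -- conditional masses back into masses, with the corrections of `min_mul_div_sub_div_le`.
  calc _ ≤ ∑ i ∈ Finset.univ.filter (fun i => g i = j), min (μ (B i)) (ν (B i)) *
          otCost c (ProbabilityTheory.cond μ (B i)) (ProbabilityTheory.cond ν (B i)) +
        D * ∑ i ∈ Finset.univ.filter (fun i => g i = j),
          (((μ (B i) - ν (B i)) + ((ν A)⁻¹ * ν (B i)) * (ν A - μ A)) +
            ((ν (B i) - μ (B i)) + ((μ A)⁻¹ * μ (B i)) * (μ A - ν A))) := by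
        rw [mul_add, Finset.mul_sum, Finset.mul_sum, Finset.mul_sum, Finset.sum_filter,
          Finset.sum_filter]
        refine add_le_add (Finset.sum_le_sum fun i _ => ?_) (Finset.sum_le_sum fun i _ => ?_)
        · split_ifs with hi
          · change min (μ A) (ν A) * (min (ProbabilityTheory.cond μ A (B i))
              (ProbabilityTheory.cond ν A (B i)) * _) ≤ _
            rw [hval μ i hi, hval ν i hi, ProbabilityTheory.cond_cond_eq_cond_inter hAm (hBm i),
              ProbabilityTheory.cond_cond_eq_cond_inter hAm (hBm i),
              Set.inter_eq_right.2 (hBA i hi), ← mul_assoc]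
            gcongr
            refine le_min ?_ ?_
            · calc _ ≤ μ A * ((μ A)⁻¹ * μ (B i)) := mul_le_mul' (min_le_left _ _) (min_le_left _ _)
                _ = _ := by rw [← mul_assoc, ENNReal.mul_inv_cancel ha hat, one_mul]
            · calc _ ≤ ν A * ((ν A)⁻¹ * ν (B i)) :=
                  mul_le_mul' (min_le_right _ _) (min_le_right _ _)
                _ = _ := by rw [← mul_assoc, ENNReal.mul_inv_cancel ha' hat', one_mul]
          · change min (μ A) (ν A) * (min (ProbabilityTheory.cond μ A (B i)) _ * _) ≤ _
            rw [hval' μ i hi]; simp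
        · change min (μ A) (ν A) * ((ProbabilityTheory.cond μ A (B i) -
              ProbabilityTheory.cond ν A (B i)) * _ + (ProbabilityTheory.cond ν A (B i) -
              ProbabilityTheory.cond μ A (B i)) * _) ≤ _
          split_ifs with hi
          · rw [hval μ i hi, hval ν i hi, mul_add, mul_add, ← mul_assoc, ← mul_assoc, mul_comm D,
              mul_comm D]
            gcongr
            · exact min_mul_div_sub_div_le ha hat ha' hat' _ _
            · exact hbD μ hμ i hi
            · rw [min_comm]
              exact min_mul_div_sub_div_le ha' hat' ha hat _ _
            · exact hbD ν hν i hi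
          · rw [hval' μ i hi, hval' ν i hi]; simp
    _ ≤ _ := by
        refine add_le_add le_rfl ?_
        rw [mul_comm 2 D, mul_assoc]
        gcongr
        have hfibsum : ∀ (α : Measure Z),
            ∑ i ∈ Finset.univ.filter (fun i => g i = j), α (B i) = α A := by
          intro α
          rw [← measure_biUnion_finset]
          · congr 1
            ext x
            simp only [Finset.mem_filter, Finset.mem_univ, true_and, Set.mem_iUnion, exists_prop,
              hB, hA, Set.mem_preimage, Set.mem_singleton_iff, hg]
            exact ⟨fun ⟨i, h1, h2⟩ => by rw [h2, h1], fun h => ⟨_, h, rfl⟩⟩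
          · intro i _ j _ hij
            refine Set.disjoint_left.2 fun x hx hx' => hij ?_
            exact hx.symm.trans hx'
          · exact fun i _ => hBm i
        have hle : ∀ (α β : Measure Z), α A - β A ≤
            ∑ i ∈ Finset.univ.filter (fun i => g i = j), (α (B i) - β (B i)) := by
          intro α β
          rw [tsub_le_iff_right, ← hfibsum α, ← hfibsum β, ← Finset.sum_add_distrib]
          exact Finset.sum_le_sum fun i _ => le_tsub_add
        -- Summed over the fine cells in `A`, the corrections add up to the discrepancy of `μ A` and
        -- `ν A`, which the fine discrepancies dominate. This is the second half of the factor 2.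
        have hmul : ∀ (α : Measure Z) (t : ℝ≥0∞), α A ≠ 0 → α A ≠ ∞ →
            ∑ i ∈ Finset.univ.filter (fun i => g i = j), ((α A)⁻¹ * α (B i)) * t = t := by
          intro α t h1 h2
          rw [← Finset.sum_mul, ← Finset.mul_sum, hfibsum, ENNReal.inv_mul_cancel h1 h2, one_mul]
        rw [Finset.sum_add_distrib, Finset.sum_add_distrib, Finset.sum_add_distrib,
          hmul ν _ ha' hat', hmul μ _ ha hat]
        simp only [adist]
        rw [Finset.sum_add_distrib, two_mul, add_add_add_comm]
        refine add_le_add le_rfl ?_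
        rw [add_comm]
        exact add_le_add (hle μ ν) (hle ν μ)

end Coupling

/-! ### Empirical measures and conditioning on the number of points in a set. -/

section Empirical

variable {Z : Type*} [MeasurableSpace Z]

/-- The empirical measure of points in a measurable space. -/
def emp {N : ℕ} (z : Fin N → Z) : Measure Z :=
  (N : ℝ≥0∞)⁻¹ • ∑ j, Measure.dirac (z j)

open Classical in
/-- The indices of the points that lie in `B`. -/
def idx {N : ℕ} (B : Set Z) (z : Fin N → Z) : Finset (Fin N) :=
  Finset.univ.filter (fun j => z j ∈ B)

/-- The number of points in `B`. -/
def cnt {N : ℕ} (B : Set Z) (z : Fin N → Z) : ℕ := (idx B z).card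

/-- The average of a functional over the empirical measure of `N` independent points. -/
def avgEmp (F : Measure Z → ℝ≥0∞) (N : ℕ) (μ : Measure Z) : ℝ≥0∞ :=
  ∫⁻ z : Fin N → Z, F (emp z) ∂(Measure.pi fun _ => μ)

lemma emp_apply {N : ℕ} (z : Fin N → Z) {B : Set Z} (hB : MeasurableSet B) :
    emp z B = (N : ℝ≥0∞)⁻¹ * cnt B z := by
  classical
  rw [emp, Measure.smul_apply, Measure.finsetSum_apply, smul_eq_mul, cnt, idx,
    Finset.card_filter]
  push_cast
  congr 1
  refine Finset.sum_congr rfl fun j _ => ?_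
  rw [Measure.dirac_apply' _ hB, Set.indicator_apply]
  simp

lemma isProbabilityMeasure_emp {N : ℕ} (hN : N ≠ 0) (z : Fin N → Z) :
    IsProbabilityMeasure (emp z) := by
  refine ⟨?_⟩
  rw [emp_apply z MeasurableSet.univ]
  have : cnt Set.univ z = N := by simp [cnt, idx]
  rw [this, ENNReal.inv_mul_cancel (by exact_mod_cast hN) (ENNReal.natCast_ne_top N)]

/-- Being a product set, this event restricts a product measure to a product measure. -/
lemma setOf_idx_eq {N : ℕ} (B : Set Z) (J : Finset (Fin N)) :
    {z : Fin N → Z | idx B z = J} =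
      Set.univ.pi (fun j => if j ∈ J then B else Bᶜ) := by
  classical
  ext z
  simp only [Set.mem_ofPred_eq, Set.mem_univ_pi, idx, Finset.ext_iff, Finset.mem_filter,
    Finset.mem_univ, true_and]
  refine forall_congr' fun j => ?_
  by_cases hj : j ∈ J <;> simp [hj]

/-- The forgotten coordinates leave their total masses as a factor. If that factor vanishes, so does
the whole product; otherwise one can divide by it and check the values on boxes. -/
lemma pi_map_comp {ι κ : Type*} [Fintype ι] [Fintype κ] [DecidableEq ι] (m : ι → Measure Z)
    [∀ i, IsFiniteMeasure (m i)] (e : κ ↪ ι) :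
    (Measure.pi m).map (fun z k => z (e k)) =
      (∏ i ∈ Finset.univ \ Finset.univ.map e, m i Set.univ) • Measure.pi (fun k => m (e k)) := by
  set t : ℝ≥0∞ := ∏ i ∈ Finset.univ \ Finset.univ.map e, m i Set.univ with ht
  have hmeas : Measurable (fun (z : ι → Z) (k : κ) => z (e k)) := by fun_prop
  have htt : t ≠ ∞ := ENNReal.prod_ne_top fun i _ => measure_ne_top _ _
  have hprod : ∀ F : ι → ℝ≥0∞, ∏ i, F i =
      (∏ i ∈ Finset.univ \ Finset.univ.map e, F i) * ∏ k, F (e k) := by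
    intro F
    rw [← Finset.prod_map, Finset.prod_sdiff (Finset.subset_univ _)]
  rcases eq_or_ne t 0 with h0 | h0
  · have : Measure.pi m = 0 := by
      rw [← Measure.measure_univ_eq_zero, Measure.pi_univ, hprod, ← ht, h0, zero_mul]
    rw [this, h0, Measure.map_zero, zero_smul]
  have hpi : Measure.pi (fun k => m (e k)) =
      t⁻¹ • (Measure.pi m).map (fun z k => z (e k)) := by
    refine Measure.pi_eq fun s hs => ?_
    rw [Measure.smul_apply, Measure.map_apply hmeas (MeasurableSet.univ_pi hs)]
    have hpre : (fun (z : ι → Z) (k : κ) => z (e k)) ⁻¹' Set.univ.pi s =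
        Set.univ.pi (Function.extend e s (fun _ => Set.univ)) := by
      ext z
      simp only [Set.mem_preimage, Set.mem_univ_pi]
      constructor
      · intro h i
        by_cases hi : ∃ k, e k = i
        · obtain ⟨k, rfl⟩ := hi
          rw [e.injective.extend_apply]; exact h k
        · rw [Function.extend_apply' _ _ _ hi]; trivial
      · intro h k
        have := h (e k)
        rwa [e.injective.extend_apply] at this
    rw [hpre, Measure.pi_pi, hprod, smul_eq_mul]
    have e1 : ∏ i ∈ Finset.univ \ Finset.univ.map e,
        m i (Function.extend e s (fun _ => Set.univ) i) = t := by
      refine Finset.prod_congr rfl fun i hi => ?_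
      rw [Function.extend_apply']
      simpa using hi
    rw [e1, ← mul_assoc, ENNReal.inv_mul_cancel h0 htt, one_mul]
    refine Finset.prod_congr rfl fun k _ => ?_
    rw [e.injective.extend_apply]
  rw [hpi, smul_smul, ENNReal.mul_inv_cancel h0 htt, one_smul]

lemma pi_const_smul {κ : Type*} [Fintype κ] (μ : Measure Z) [IsFiniteMeasure μ] {t : ℝ≥0∞}
    (ht : t ≠ ∞) :
    Measure.pi (fun _ : κ => t • μ) = t ^ Fintype.card κ • Measure.pi (fun _ : κ => μ) := by
  have : IsFiniteMeasure (t • μ) := Measure.smul_finite μ ht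
  refine Measure.pi_eq fun s _ => ?_
  simp [Measure.pi_pi, Finset.prod_mul_distrib]

/-- Conditioning deletes the atoms outside `B` and renormalises; the remaining points are enumerated
in increasing order of index. If no point lies in `B`, both sides are the zero measure. -/
lemma cond_emp {N : ℕ} (z : Fin N → Z) {B : Set Z} (hB : MeasurableSet B) :
    ProbabilityTheory.cond (emp z) B =
      emp (fun k => z ((idx B z).orderEmbOfFin rfl k)) := by
  classical
  have hsum : (emp z).restrict B = (N : ℝ≥0∞)⁻¹ • ∑ j ∈ idx B z, Measure.dirac (z j) := by
    rw [emp, Measure.restrict_smul]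
    congr 1
    ext A hA
    rw [Measure.restrict_apply hA, Measure.finsetSum_apply, Measure.finsetSum_apply, idx,
      Finset.sum_filter]
    refine Finset.sum_congr rfl fun j _ => ?_
    rw [Measure.dirac_apply' _ (hA.inter hB), Set.indicator_apply]
    by_cases h : z j ∈ B
    · simp [h, Measure.dirac_apply' _ hA, Set.indicator_apply]
    · simp [h]
  have hsum2 : ∑ k, Measure.dirac (z ((idx B z).orderEmbOfFin rfl k)) =
      ∑ j ∈ idx B z, Measure.dirac (z j) := by
    conv_rhs => rw [← Finset.map_orderEmbOfFin_univ (idx B z) rfl, Finset.sum_map]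
    rfl
  have hr : emp (fun k => z ((idx B z).orderEmbOfFin rfl k)) =
      (cnt B z : ℝ≥0∞)⁻¹ • ∑ j ∈ idx B z, Measure.dirac (z j) := by
    rw [← hsum2]; rfl
  rw [ProbabilityTheory.cond, hsum, hr, smul_smul, emp_apply z hB]
  rcases Nat.eq_zero_or_pos (cnt B z) with h0 | h0
  · have : idx B z = ∅ := Finset.card_eq_zero.1 h0
    simp [this]
  congr 1
  have hN : N ≠ 0 := by
    rintro rfl
    have : cnt B z ≤ 0 := by simpa [cnt] using Finset.card_le_univ (idx B z)
    omega
  rw [ENNReal.mul_inv (Or.inr (ENNReal.natCast_ne_top _)) (Or.inr (by exact_mod_cast h0.ne')),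
    inv_inv, mul_comm, ← mul_assoc, ENNReal.inv_mul_cancel (by exact_mod_cast hN)
    (ENNReal.natCast_ne_top _), one_mul]

/-- The contribution of the event that exactly the points with index in `J` lie in `B`. -/
lemma restrict_idx_map {N : ℕ} (μ : Measure Z) [IsFiniteMeasure μ] {B : Set Z}
    (J : Finset (Fin N)) :
    ((Measure.pi fun _ : Fin N => μ).restrict {z | idx B z = J}).map
        (fun z k => z (J.orderEmbOfFin rfl k)) =
      ((Measure.pi fun _ : Fin N => μ) {z | idx B z = J}) •
        Measure.pi (fun _ : Fin J.card => ProbabilityTheory.cond μ B) := by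
  classical
  rw [setOf_idx_eq B, Measure.restrict_pi_pi, Measure.pi_pi]
  have h1 := pi_map_comp (fun j : Fin N => μ.restrict (if j ∈ J then B else Bᶜ))
    (J.orderEmbOfFin rfl).toEmbedding
  change Measure.map (fun (z : Fin N → Z) k => z (J.orderEmbOfFin rfl k)) _ =
    _ • Measure.pi (fun k => μ.restrict (if J.orderEmbOfFin rfl k ∈ J then B else Bᶜ)) at h1
  simp only [Finset.orderEmbOfFin_mem, if_true] at h1
  rw [h1, ← measure_smul_cond, pi_const_smul _ (measure_ne_top _ _), smul_smul,
    Finset.map_orderEmbOfFin_univ]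
  congr 1
  rw [← Finset.prod_sdiff (Finset.subset_univ J)]
  congr 1
  · simp
  · rw [Finset.prod_congr rfl (fun j hj => by rw [if_pos hj]), Finset.prod_const]
    simp

/-- There are finitely many events `idx B z = J`, and on each of them the function depends
measurably on the coordinates in `J`. -/
lemma measurable_weight_cond {N : ℕ} {B : Set Z} (hB : MeasurableSet B) (w : ℕ → ℝ≥0∞)
    {F : Measure Z → ℝ≥0∞} (hF : ∀ n, Measurable fun z : Fin n → Z => F (emp z)) :
    Measurable fun z : Fin N → Z => w (cnt B z) * F (ProbabilityTheory.cond (emp z) B) := by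
  classical
  have hset : ∀ J : Finset (Fin N), MeasurableSet {z : Fin N → Z | idx B z = J} := by
    intro J
    rw [setOf_idx_eq B]
    refine MeasurableSet.univ_pi fun j => ?_
    split_ifs
    exacts [hB, hB.compl]
  have hrep : (fun z : Fin N → Z => w (cnt B z) * F (ProbabilityTheory.cond (emp z) B)) =
      fun z => ∑ J : Finset (Fin N), {z : Fin N → Z | idx B z = J}.indicator
        (fun z => w J.card * F (emp (fun k => z (J.orderEmbOfFin rfl k)))) z := by
    funext z
    rw [Finset.sum_eq_single (idx B z)]
    · rw [Set.indicator_of_mem (by simp), cond_emp z hB]; rfl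
    · intro J _ hJ
      rw [Set.indicator_of_notMem (fun h => hJ h.symm)]
    · simp
  rw [hrep]
  refine Finset.measurable_sum _ fun J _ => Measurable.indicator ?_ (hset J)
  refine ((hF J.card).comp ?_).const_mul _
  fun_prop

/-- Conditionally on their number, the points in `B` are independent with the conditional
distribution on `B`. -/
lemma lintegral_weight_cond {N : ℕ} (μ : Measure Z) [IsFiniteMeasure μ] {B : Set Z}
    (hB : MeasurableSet B) (w : ℕ → ℝ≥0∞)
    {F : Measure Z → ℝ≥0∞} (hF : ∀ n, Measurable fun z : Fin n → Z => F (emp z)) :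
    ∫⁻ z : Fin N → Z, w (cnt B z) * F (ProbabilityTheory.cond (emp z) B)
        ∂(Measure.pi fun _ => μ) =
      ∫⁻ z : Fin N → Z, w (cnt B z) * avgEmp F (cnt B z) (ProbabilityTheory.cond μ B)
        ∂(Measure.pi fun _ => μ) := by
  classical
  have hset : ∀ J : Finset (Fin N), MeasurableSet {z : Fin N → Z | idx B z = J} := by
    intro J
    rw [setOf_idx_eq B]
    refine MeasurableSet.univ_pi fun j => ?_
    split_ifs
    exacts [hB, hB.compl]
  have hsplit : ∀ f : (Fin N → Z) → ℝ≥0∞, ∫⁻ z, f z ∂(Measure.pi fun _ => μ) =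
      ∑ J : Finset (Fin N), ∫⁻ z in {z | idx B z = J}, f z ∂(Measure.pi fun _ => μ) := by
    intro f
    rw [← lintegral_biUnion_finset]
    · rw [← setLIntegral_univ]
      congr 2
      ext z; simp
    · intro J _ J' _ hJ
      exact Set.disjoint_left.2 fun z hz hz' => hJ (hz.symm.trans hz')
    · exact fun J _ => hset J
  rw [hsplit, hsplit]
  refine Finset.sum_congr rfl fun J _ => ?_
  have e1 : ∫⁻ z in {z | idx B z = J}, w (cnt B z) * F (ProbabilityTheory.cond (emp z) B)
      ∂(Measure.pi fun _ => μ) = ∫⁻ z in {z | idx B z = J},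
        w J.card * F (emp (fun k => z (J.orderEmbOfFin rfl k))) ∂(Measure.pi fun _ => μ) := by
    refine setLIntegral_congr_fun (hset J) fun z hz => ?_
    have hz' : idx B z = J := hz
    subst hz'
    simp only [cond_emp z hB]
    rfl
  have e2 : ∫⁻ z in {z | idx B z = J}, w (cnt B z) *
        avgEmp F (cnt B z) (ProbabilityTheory.cond μ B) ∂(Measure.pi fun _ => μ) =
      ∫⁻ z in {z | idx B z = J}, w J.card *
        avgEmp F J.card (ProbabilityTheory.cond μ B) ∂(Measure.pi fun _ => μ) := by
    refine setLIntegral_congr_fun (hset J) fun z hz => ?_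
    have hz' : idx B z = J := hz
    subst hz'
    rfl
  have hm : Measurable (fun (z : Fin N → Z) (k : Fin J.card) => z (J.orderEmbOfFin rfl k)) := by
    fun_prop
  rw [e1, e2, lintegral_const, Measure.restrict_apply_univ,
    ← lintegral_map (f := fun u => w J.card * F (emp u)) ((hF _).const_mul _) hm,
    restrict_idx_map μ, lintegral_smul_measure, lintegral_const_mul _ (hF _), avgEmp,
    smul_eq_mul, mul_comm]

end Empirical

/-! ### Mean deviation of the number of points in a set. -/

section Fluctuation

set_option linter.unusedSectionVars false

variable {Z : Type*} [MeasurableSpace Z]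

lemma natCast_cnt_eq {N : ℕ} (B : Set Z) (z : Fin N → Z) :
    (cnt B z : ℝ≥0∞) = ∑ j, B.indicator 1 (z j) := by
  classical
  rw [cnt, idx, Finset.card_filter]
  push_cast
  refine Finset.sum_congr rfl fun j _ => ?_
  simp [Set.indicator_apply]

lemma natCast_cnt_eq_real {N : ℕ} (B : Set Z) (z : Fin N → Z) :
    (cnt B z : ℝ) = ∑ j, B.indicator (fun _ => (1 : ℝ)) (z j) := by
  classical
  rw [cnt, idx, Finset.card_filter]
  push_cast
  refine Finset.sum_congr rfl fun j _ => ?_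
  simp [Set.indicator_apply]

lemma measurable_cnt {N : ℕ} {B : Set Z} (hB : MeasurableSet B) :
    Measurable fun z : Fin N → Z => cnt B z := by
  classical
  have : (fun z : Fin N → Z => cnt B z) = fun z => ∑ j, B.indicator (fun _ => 1) (z j) := by
    funext z
    rw [cnt, idx, Finset.card_filter]
    refine Finset.sum_congr rfl fun j _ => ?_
    simp [Set.indicator_apply]
  rw [this]
  exact Finset.measurable_sum _ fun j _ =>
    (measurable_const.indicator hB).comp (measurable_pi_apply j)

lemma measurable_comp_cnt {N : ℕ} {B : Set Z} (hB : MeasurableSet B) (w : ℕ → ℝ≥0∞) :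
    Measurable fun z : Fin N → Z => w (cnt B z) :=
  (measurable_from_top (f := w)).comp (measurable_cnt hB)

lemma lintegral_cnt {N : ℕ} (μ : Measure Z) [IsProbabilityMeasure μ] {B : Set Z}
    (hB : MeasurableSet B) :
    ∫⁻ z : Fin N → Z, (cnt B z : ℝ≥0∞) ∂(Measure.pi fun _ => μ) = N * μ B := by
  simp_rw [natCast_cnt_eq]
  have hm : Measurable (B.indicator (1 : Z → ℝ≥0∞)) := measurable_one.indicator hB
  rw [lintegral_finsetSum (f := fun (j : Fin N) (z : Fin N → Z) => B.indicator 1 (z j)) _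
    (fun j _ => hm.comp (measurable_pi_apply j))]
  have : ∀ j : Fin N, ∫⁻ z : Fin N → Z, B.indicator (1 : Z → ℝ≥0∞) (z j)
      ∂(Measure.pi fun _ => μ) = μ B := by
    intro j
    rw [(measurePreserving_eval (fun _ : Fin N => μ) j).lintegral_comp hm, lintegral_indicator_one hB]
  simp [this]

lemma adist_eq_ofReal {a b : ℝ≥0∞} (ha : a ≠ ∞) (hb : b ≠ ∞) :
    adist a b = ENNReal.ofReal |a.toReal - b.toReal| := by
  rw [adist]
  rcases le_total a b with h | h
  · rw [tsub_eq_zero_of_le h, zero_add, abs_of_nonpos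
      (sub_nonpos.2 ((ENNReal.toReal_le_toReal ha hb).2 h)), neg_sub,
      ENNReal.ofReal_sub _ ENNReal.toReal_nonneg, ENNReal.ofReal_toReal ha,
      ENNReal.ofReal_toReal hb]
  · rw [tsub_eq_zero_of_le h, add_zero, abs_of_nonneg
      (sub_nonneg.2 ((ENNReal.toReal_le_toReal hb ha).2 h)),
      ENNReal.ofReal_sub _ ENNReal.toReal_nonneg, ENNReal.ofReal_toReal ha,
      ENNReal.ofReal_toReal hb]

/-- Hölder against the constant 1. It is used with `r = 2` for the variance and with `r = 1 / t` as
Jensen's inequality for powers of counts. -/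
lemma lintegral_le_sqrt_lintegral_sq {Ω : Type*} [MeasurableSpace Ω] (P : Measure Ω)
    [IsProbabilityMeasure P] {f : Ω → ℝ≥0∞} (hf : AEMeasurable f P) {r : ℝ} (hr : 1 ≤ r) :
    ∫⁻ ω, f ω ∂P ≤ (∫⁻ ω, f ω ^ r ∂P) ^ (1 / r) := by
  have h := ENNReal.lintegral_mul_le_Lp_mul_Lq P (p := r) (q := r / (r - 1))
  rcases hr.eq_or_lt with rfl | hr'
  · simp
  have hpq : r.HolderConjugate (r / (r - 1)) := Real.HolderConjugate.conjExponent hr'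
  have := ENNReal.lintegral_mul_le_Lp_mul_Lq P hpq hf (aemeasurable_const (b := 1))
  simpa using this

/-- The count of independent points in a set deviates from its mean by at most the square root
of the mean, on average. -/
lemma lintegral_adist_cnt_le {N : ℕ} (μ : Measure Z) [IsProbabilityMeasure μ] {B : Set Z}
    (hB : MeasurableSet B) :
    ∫⁻ z : Fin N → Z, adist (cnt B z) (N * μ B) ∂(Measure.pi fun _ => μ) ≤
      (N * μ B) ^ (1 / 2 : ℝ) := by
  set P := Measure.pi fun _ : Fin N => μ
  set X : Z → ℝ := B.indicator (fun _ => (1 : ℝ)) with hX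
  have hXm : Measurable X := measurable_const.indicator hB
  have hXL : MemLp X 2 μ := memLp_indicator_const 2 hB 1 (Or.inr (measure_ne_top _ _))
  set Y : (Fin N → Z) → ℝ := fun z => ∑ j, X (z j) with hY
  have hYm : Measurable Y := Finset.measurable_sum _ fun j _ => hXm.comp (measurable_pi_apply j)
  have hcomp : ∀ j : Fin N, MemLp (fun z : Fin N → Z => X (z j)) 2 P := fun j =>
    hXL.comp_measurePreserving (measurePreserving_eval (fun _ : Fin N => μ) j)
  have hYL : MemLp Y 2 P := memLp_finsetSum _ fun j _ => hcomp j
  have hYE : (∫ z, Y z ∂P) = N * μ.real B := by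
    have e : ∀ j : Fin N, ∫ z : Fin N → Z, X (z j) ∂P = μ.real B := by
      intro j
      rw [← integral_indicator_one hB]
      have hmp := measurePreserving_eval (fun _ : Fin N => μ) j
      conv_rhs => rw [← hmp.map_eq]
      rw [integral_map hmp.aemeasurable
        (by rw [hmp.map_eq]; exact (measurable_one.indicator hB).aestronglyMeasurable)]
      rfl
    rw [hY, integral_finsetSum _ fun j _ => (hcomp j).integrable (by norm_num)]
    simp [e]
  -- Variances of independent indicators add up, and each is at most the second moment `μ.real B`.
  have hvar : ProbabilityTheory.variance Y P ≤ N * μ.real B := by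
    have e := ProbabilityTheory.variance_sum_pi (μ := fun _ : Fin N => μ) (X := fun _ => X)
      (fun _ => hXL)
    have e' : Y = ∑ i : Fin N, fun ω : Fin N → Z => X (ω i) := by
      funext z; simp [hY]
    rw [e', e]
    have : ProbabilityTheory.variance X μ ≤ μ.real B := by
      refine (ProbabilityTheory.variance_le_expectation_sq hXm.aestronglyMeasurable).trans ?_
      rw [← integral_indicator_one hB]
      refine le_of_eq (integral_congr_ae (Eventually.of_forall fun x => ?_))
      by_cases hx : x ∈ B <;> simp [hX, hx]
    simpa using mul_le_mul_of_nonneg_left this (Nat.cast_nonneg N)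
  have hfin : (N : ℝ≥0∞) * μ B ≠ ∞ := ENNReal.mul_ne_top (ENNReal.natCast_ne_top _) (measure_ne_top _ _)
  have hpt : ∀ z : Fin N → Z, adist (cnt B z) (N * μ B) = ENNReal.ofReal |Y z - (∫ z, Y z ∂P)| := by
    intro z
    rw [adist_eq_ofReal (ENNReal.natCast_ne_top _) hfin, hYE]
    simp only [ENNReal.toReal_natCast, ENNReal.toReal_mul]
    rw [natCast_cnt_eq_real]; rfl
  simp_rw [hpt]
  refine (lintegral_le_sqrt_lintegral_sq P (r := 2) (by fun_prop) (by norm_num)).trans ?_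
  refine ENNReal.rpow_le_rpow ?_ (by norm_num)
  have : ∫⁻ z, ENNReal.ofReal |Y z - (∫ z, Y z ∂P)| ^ (2 : ℝ) ∂P =
      ENNReal.ofReal (ProbabilityTheory.variance Y P) := by
    rw [hYL.ofReal_variance_eq, ProbabilityTheory.evariance]
    refine lintegral_congr fun z => ?_
    rw [← Real.enorm_eq_ofReal_abs]
    norm_cast
  rw [this]
  refine (ENNReal.ofReal_le_ofReal hvar).trans_eq ?_
  rw [ENNReal.ofReal_mul (Nat.cast_nonneg N), ENNReal.ofReal_natCast, ofReal_measureReal]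

lemma adist_mul {t a b : ℝ≥0∞} (ht : t ≠ ∞) : adist (t * a) (t * b) = t * adist a b := by
  simp only [adist]
  rw [mul_add, ENNReal.mul_sub (fun _ _ => ht), ENNReal.mul_sub (fun _ _ => ht)]

lemma adist_le_add (a b : ℝ≥0∞) : adist a b ≤ a + b :=
  add_le_add tsub_le_self tsub_le_self

lemma emp_apply_adist {N : ℕ} (hN : N ≠ 0) (μ : Measure Z) (z : Fin N → Z) {B : Set Z}
    (hB : MeasurableSet B) :
    adist (emp z B) (μ B) = (N : ℝ≥0∞)⁻¹ * adist (cnt B z) (N * μ B) := by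
  rw [emp_apply z hB, ← adist_mul (ENNReal.inv_ne_top.2 (by exact_mod_cast hN)), ← mul_assoc,
    ENNReal.inv_mul_cancel (by exact_mod_cast hN) (ENNReal.natCast_ne_top N), one_mul]

lemma measurable_adist_cnt {N : ℕ} {B : Set Z} (hB : MeasurableSet B) (t : ℝ≥0∞) :
    Measurable fun z : Fin N → Z => adist (cnt B z) t :=
  measurable_comp_cnt hB (fun n => adist n t)

lemma lintegral_adist_emp_le_sqrt {N : ℕ} (hN : N ≠ 0) (μ : Measure Z) [IsProbabilityMeasure μ]
    {B : Set Z} (hB : MeasurableSet B) :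
    ∫⁻ z : Fin N → Z, adist (emp z B) (μ B) ∂(Measure.pi fun _ => μ) ≤
      (N : ℝ≥0∞) ^ (-(1 / 2) : ℝ) * μ B ^ (1 / 2 : ℝ) := by
  have hN0 : (N : ℝ≥0∞) ≠ 0 := by exact_mod_cast hN
  simp_rw [emp_apply_adist hN μ _ hB]
  rw [lintegral_const_mul _ (measurable_adist_cnt hB _)]
  calc _ ≤ (N : ℝ≥0∞)⁻¹ * (N * μ B) ^ (1 / 2 : ℝ) := by gcongr; exact lintegral_adist_cnt_le μ hB
    _ = _ := by
      rw [ENNReal.mul_rpow_of_nonneg _ _ (by norm_num), ← mul_assoc, ← ENNReal.rpow_neg_one,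
        ← ENNReal.rpow_add _ _ hN0 (ENNReal.natCast_ne_top _)]
      norm_num

lemma lintegral_adist_emp_le_two {N : ℕ} (hN : N ≠ 0) (μ : Measure Z) [IsProbabilityMeasure μ]
    {B : Set Z} (hB : MeasurableSet B) :
    ∫⁻ z : Fin N → Z, adist (emp z B) (μ B) ∂(Measure.pi fun _ => μ) ≤ 2 * μ B := by
  have hN0 : (N : ℝ≥0∞) ≠ 0 := by exact_mod_cast hN
  calc _ ≤ ∫⁻ z : Fin N → Z, (N : ℝ≥0∞)⁻¹ * cnt B z + μ B ∂(Measure.pi fun _ => μ) := by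
        refine lintegral_mono fun z => ?_
        rw [← emp_apply z hB]
        exact adist_le_add _ _
    _ = _ := by
        rw [lintegral_add_right _ measurable_const, lintegral_const_mul _
          (measurable_comp_cnt hB _), lintegral_cnt μ hB, ← mul_assoc,
          ENNReal.inv_mul_cancel hN0 (ENNReal.natCast_ne_top N), lintegral_const]
        simp [two_mul]

/-- Interpolates between the trivial bound, which is better when fewer than one point is expected in
`B`, and the square-root bound, which is better otherwise. The exponent `s = p / d` matches the rate
of the cost. -/
lemma lintegral_adist_emp_le {N : ℕ} (hN : N ≠ 0) (μ : Measure Z) [IsProbabilityMeasure μ]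
    {B : Set Z} (hB : MeasurableSet B) {s : ℝ} (hs0 : 0 ≤ s) (hs : s ≤ 1 / 2) :
    ∫⁻ z : Fin N → Z, adist (emp z B) (μ B) ∂(Measure.pi fun _ => μ) ≤
      2 * ((N : ℝ≥0∞) ^ (-s) * μ B ^ (1 - s)) := by
  have hN0 : (N : ℝ≥0∞) ≠ 0 := by exact_mod_cast hN
  have hNt := ENNReal.natCast_ne_top N
  rcases eq_or_ne (μ B) 0 with h0 | h0
  · refine (lintegral_adist_emp_le_two hN μ hB).trans ?_
    simp [h0]
  have ht := measure_ne_top μ B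
  rcases le_total (N * μ B) 1 with h1 | h1
  · refine (lintegral_adist_emp_le_two hN μ hB).trans ?_
    gcongr
    have : (N : ℝ≥0∞) ^ (-s) * μ B ^ (1 - s) = μ B * (N * μ B) ^ (-s) := by
      rw [ENNReal.mul_rpow_of_ne_top hNt ht, sub_eq_add_neg, ENNReal.rpow_add _ _ h0 ht,
        ENNReal.rpow_one]
      ring
    rw [this]
    refine le_mul_of_one_le_right' ?_
    rw [ENNReal.rpow_neg, ENNReal.one_le_inv]
    exact ENNReal.rpow_le_one h1 hs0
  · refine (lintegral_adist_emp_le_sqrt hN μ hB).trans ?_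
    refine le_trans ?_ (le_mul_of_one_le_left' (by norm_num))
    have : (N : ℝ≥0∞) ^ (-s) * μ B ^ (1 - s) =
        ((N : ℝ≥0∞) ^ (-(1 / 2) : ℝ) * μ B ^ (1 / 2 : ℝ)) * (N * μ B) ^ (1 / 2 - s) := by
      rw [ENNReal.mul_rpow_of_ne_top hNt ht, mul_mul_mul_comm, ← ENNReal.rpow_add _ _ h0 ht,
        ← ENNReal.rpow_add _ _ hN0 hNt]
      congr 2 <;> ring
    rw [this]
    refine le_mul_of_one_le_right' ?_
    simpa using ENNReal.rpow_le_rpow h1 (show (0 : ℝ) ≤ 1 / 2 - s by linarith)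

end Fluctuation

/-! ### Transports to empirical measures as families; measurability and monotonicity. -/

section Families

variable {Z : Type*} [MeasurableSpace Z]

/-- The smallest transport cost from a measure in the class `C` to `ν`. -/
def infCost (c : Z → Z → ℝ≥0∞) (C : Set (Measure Z)) (ν : Measure Z) : ℝ≥0∞ :=
  ⨅ ρ ∈ C, otCost c ρ ν

lemma infCost_singleton (c : Z → Z → ℝ≥0∞) (μ ν : Measure Z) :
    infCost c {μ} ν = otCost c μ ν := by
  simp [infCost]

lemma emp_eq_sum {N : ℕ} (x : Fin N → Z) :
    emp x = ∑ j, (N : ℝ≥0∞)⁻¹ • Measure.dirac (x j) := by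
  rw [emp, Finset.smul_sum]

/-- Couple by sending the whole of `m j` to the point `x j`. -/
lemma otCost_family_le {N : ℕ} (c : Z → Z → ℝ≥0∞) (x : Fin N → Z) (m : Fin N → Measure Z)
    (hm : ∀ j, m j Set.univ = (N : ℝ≥0∞)⁻¹) :
    otCost c (∑ j, m j) (emp x) ≤ ∑ j, ∫⁻ z, c z (x j) ∂(m j) := by
  rw [emp_eq_sum]
  refine (otCost_sum_le _ _ _ _).trans (Finset.sum_le_sum fun j _ => ?_)
  have hmeas : Measurable fun z : Z => (z, x j) := by fun_prop
  refine (otCost_le (ξ := (m j).map (fun z => (z, x j))) ?_ ?_).trans ?_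
  · rw [Measure.map_map measurable_fst hmeas]
    exact Measure.map_id
  · rw [Measure.map_map measurable_snd hmeas, ← hm j]
    exact Measure.map_const _ _
  · exact lintegral_map_le _ _

/-- Slice the coupling by its second coordinate. Points may coincide, so the slice over `x j` is
divided by the multiplicity of `x j` and shared equally among the indices with that value. -/
lemma exists_family_of_coupling [MeasurableSingletonClass Z] {N : ℕ}
    (c : Z → Z → ℝ≥0∞) (x : Fin N → Z) {ρ : Measure Z} {ξ : Measure (Z × Z)}
    (h1 : ξ.map Prod.fst = ρ) (h2 : ξ.map Prod.snd = emp x) :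
    ∃ m : Fin N → Measure Z, ∑ j, m j = ρ ∧ (∀ j, m j Set.univ = (N : ℝ≥0∞)⁻¹) ∧
      ∑ j, ∫⁻ z, c z (x j) ∂(m j) ≤ ∫⁻ z, c z.1 z.2 ∂ξ := by
  classical
  set n : Z → ℕ := fun y => (Finset.univ.filter (fun k => x k = y)).card with hn
  have hnpos : ∀ j, (n (x j) : ℝ≥0∞) ≠ 0 := by
    intro j
    have : n (x j) ≠ 0 := Finset.card_ne_zero_of_mem (a := j) (by simp)
    exact_mod_cast this
  have hsing : ∀ y : Z, MeasurableSet ((Prod.snd : Z × Z → Z) ⁻¹' {y}) :=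
    fun y => measurable_snd (measurableSet_singleton y)
  set η : Fin N → Measure (Z × Z) :=
    fun j => (n (x j) : ℝ≥0∞)⁻¹ • ξ.restrict (Prod.snd ⁻¹' {x j}) with hη
  have hsum : ∑ j, η j = ξ := by
    ext A hA
    have hnull : ξ (Prod.snd ⁻¹' (Finset.univ.image x : Set Z)ᶜ) = 0 := by
      rw [← Measure.map_apply measurable_snd (Finset.measurableSet _).compl, h2,
        emp_apply x (Finset.measurableSet _).compl]
      have : cnt (↑(Finset.univ.image x) : Set Z)ᶜ x = 0 := by
        simp [cnt, idx]
      rw [this]; simp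
    calc (∑ j, η j) A = ∑ j, (n (x j) : ℝ≥0∞)⁻¹ * ξ (A ∩ Prod.snd ⁻¹' {x j}) := by
          rw [Measure.finsetSum_apply]
          refine Finset.sum_congr rfl fun j _ => ?_
          rw [hη, Measure.smul_apply, Measure.restrict_apply hA, smul_eq_mul]
      _ = ∑ y ∈ Finset.univ.image x, n y • ((n y : ℝ≥0∞)⁻¹ * ξ (A ∩ Prod.snd ⁻¹' {y})) :=
          Finset.sum_comp (fun y => (n y : ℝ≥0∞)⁻¹ * ξ (A ∩ Prod.snd ⁻¹' {y})) x
      _ = ∑ y ∈ Finset.univ.image x, ξ (A ∩ Prod.snd ⁻¹' {y}) := by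
          refine Finset.sum_congr rfl fun y hy => ?_
          obtain ⟨j, _, rfl⟩ := Finset.mem_image.1 hy
          rw [nsmul_eq_mul, ← mul_assoc, ENNReal.mul_inv_cancel (hnpos j)
            (ENNReal.natCast_ne_top _), one_mul]
      _ = ξ (⋃ y ∈ Finset.univ.image x, A ∩ Prod.snd ⁻¹' {y}) := by
          rw [measure_biUnion_finset]
          · intro y _ y' _ hyy
            exact Set.disjoint_left.2 fun z hz hz' => hyy (hz.2.symm.trans hz'.2)
          · exact fun y _ => hA.inter (hsing y)
      _ = ξ A := by
          refine measure_congr ?_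
          filter_upwards [mem_ae_iff.2 (show ξ (Prod.snd ⁻¹' (Finset.univ.image x : Set Z))ᶜ = 0
            from hnull)] with z hz
          refine propext ⟨fun h => ?_, fun h => ?_⟩
          · obtain ⟨y, hy, hz'⟩ := Set.mem_iUnion₂.1 h
            exact hz'.1
          · exact Set.mem_iUnion₂.2 ⟨z.2, hz, h, rfl⟩
  refine ⟨fun j => (η j).map Prod.fst, ?_, fun j => ?_, ?_⟩
  · rw [← h1, ← hsum, Measure.map_finset_sum]
    · exact measurable_fst.aemeasurable
  · rw [Measure.map_apply measurable_fst MeasurableSet.univ, Set.preimage_univ, hη,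
      Measure.smul_apply, Measure.restrict_apply_univ,
      ← Measure.map_apply measurable_snd (measurableSet_singleton _), h2,
      emp_apply x (measurableSet_singleton _), smul_eq_mul]
    have : cnt {x j} x = n (x j) := by simp only [cnt, idx, hn, Set.mem_singleton_iff]
    rw [this, mul_comm (N : ℝ≥0∞)⁻¹, ← mul_assoc, ENNReal.inv_mul_cancel (hnpos j)
      (ENNReal.natCast_ne_top _), one_mul]
  · conv_rhs => rw [← hsum, lintegral_finsetSum_measure]
    refine Finset.sum_le_sum fun j _ => (lintegral_map_le _ _).trans ?_
    refine le_of_eq (lintegral_congr_ae ?_)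
    refine Measure.ae_smul_measure ?_ _
    filter_upwards [ae_restrict_mem (hsing (x j))] with z hz
    have hz' : z.2 = x j := hz
    rw [hz']

/-- In this form the index set of the infimum no longer depends on `x`, which yields measurability
below; for the leaking cost it also lets the pieces `m j` be regrouped by cells. -/
lemma infCost_emp [MeasurableSingletonClass Z] {N : ℕ} (c : Z → Z → ℝ≥0∞) (C : Set (Measure Z))
    (x : Fin N → Z) :
    infCost c C (emp x) = ⨅ m : Fin N → Measure Z,
      ⨅ (_ : ∑ j, m j ∈ C ∧ ∀ j, m j Set.univ = (N : ℝ≥0∞)⁻¹), ∑ j, ∫⁻ z, c z (x j) ∂(m j) := by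
  refine le_antisymm ?_ ?_
  · refine le_iInf₂ fun m hm => ?_
    exact (iInf₂_le _ hm.1).trans (otCost_family_le c x m hm.2)
  · refine le_iInf₂ fun ρ hρ => le_iInf₂ fun ξ hξ => ?_
    obtain ⟨m, hm1, hm2, hm3⟩ := exists_family_of_coupling c x hξ.1 hξ.2
    exact (iInf₂_le m ⟨hm1 ▸ hρ, hm2⟩).trans hm3

/-- A continuous cost function dominated by a sum of finite continuous functions. -/
structure GoodCost [TopologicalSpace Z] (c : Z → Z → ℝ≥0∞) (b : Z → ℝ≥0∞) : Prop where
  cont : Continuous (Function.uncurry c)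
  bcont : Continuous b
  bfin : ∀ x, b x ≠ ∞
  le : ∀ x y, c x y ≤ b x + b y

lemma GoodCost.continuous_lintegral [TopologicalSpace Z] [OpensMeasurableSpace Z]
    [FirstCountableTopology Z] {c : Z → Z → ℝ≥0∞} {b : Z → ℝ≥0∞} (hc : GoodCost c b)
    {m : Measure Z} [IsFiniteMeasure m] (hm : ∫⁻ z, b z ∂m ≠ ∞) :
    Continuous fun y => ∫⁻ z, c z y ∂m := by
  refine continuous_iff_continuousAt.2 fun y => ?_
  refine tendsto_lintegral_filter_of_dominated_convergence (fun z => b z + (b y + 1)) ?_ ?_ ?_ ?_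
  · refine Eventually.of_forall fun y' => ?_
    exact (hc.cont.comp (continuous_id.prodMk continuous_const)).measurable
  · have h1 : ∀ᶠ y' in 𝓝 y, b y' < b y + 1 :=
      hc.bcont.continuousAt.eventually_lt continuousAt_const
        (ENNReal.lt_add_right (hc.bfin y) one_ne_zero)
    filter_upwards [h1] with y' hy'
    refine Eventually.of_forall fun z => (hc.le z y').trans ?_
    gcongr
  · rw [lintegral_add_left hc.bcont.measurable, lintegral_const]
    exact ENNReal.add_ne_top.2 ⟨hm, ENNReal.mul_ne_top
      (ENNReal.add_ne_top.2 ⟨hc.bfin y, ENNReal.one_ne_top⟩) (measure_ne_top _ _)⟩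
  · refine Eventually.of_forall fun z => ?_
    exact (hc.cont.comp (continuous_const.prodMk continuous_id)).continuousAt

/-- An infimum of continuous functions, over however large an index set, is upper semicontinuous and
hence Borel. For `N = 0` the domain is a single point. -/
lemma measurable_infCost_emp [TopologicalSpace Z] [BorelSpace Z] [SecondCountableTopology Z]
    [MeasurableSingletonClass Z] {c : Z → Z → ℝ≥0∞} {b : Z → ℝ≥0∞} (hc : GoodCost c b)
    {C : Set (Measure Z)} (hC : ∀ ρ ∈ C, ∫⁻ z, b z ∂ρ ≠ ∞) (N : ℕ) :
    Measurable fun x : Fin N → Z => infCost c C (emp x) := by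
  rcases Nat.eq_zero_or_pos N with rfl | hN
  · exact Subsingleton.measurable
  simp_rw [infCost_emp]
  refine UpperSemicontinuous.measurable ?_
  refine upperSemicontinuous_biInf fun m hm => Continuous.upperSemicontinuous ?_
  refine continuous_finsetSum _ fun j _ => ?_
  have : IsFiniteMeasure (m j) := ⟨by
    rw [hm.2 j]; exact (ENNReal.inv_ne_top.2 (by exact_mod_cast hN.ne')).lt_top⟩
  have hj : ∫⁻ z, b z ∂(m j) ≠ ∞ := by
    refine ne_top_of_le_ne_top (hC _ hm.1) ?_
    rw [lintegral_finsetSum_measure]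
    exact Finset.single_le_sum (f := fun j => ∫⁻ z, b z ∂(m j)) (fun _ _ => zero_le)
      (Finset.mem_univ j)
  exact (hc.continuous_lintegral hj).comp (continuous_apply j)

/-- Convexity of the optimal cost, for classes `C` that are closed under the same averages: average
nearly optimal sources and couplings. -/
lemma infCost_average_le (c : Z → Z → ℝ≥0∞) {C : Set (Measure Z)} {n : ℕ} {t : ℝ≥0∞}
    (h0 : t ≠ 0) (ht : t ≠ ∞)
    (hC : ∀ ρ : Fin n → Measure Z, (∀ j, ρ j ∈ C) → t • ∑ j, ρ j ∈ C)
    (ν : Fin n → Measure Z) :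
    infCost c C (t • ∑ j, ν j) ≤ t * ∑ j, infCost c C (ν j) := by
  refine ENNReal.le_of_forall_pos_le_add fun ε hε hlt => ?_
  have hsum : ∑ j, infCost c C (ν j) ≠ ∞ := fun h => by
    rw [h, ENNReal.mul_top h0] at hlt
    exact lt_irrefl _ hlt
  -- Chosen so that `n` errors `δ`, scaled by `t`, total at most `ε`; the denominator `n + 1` also
  -- covers `n = 0`.
  set δ : ℝ≥0∞ := t⁻¹ * (ε / (n + 1 : ℝ≥0∞)) with hδ
  have hn1 : (n + 1 : ℝ≥0∞) ≠ 0 := by simp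
  have hn1' : (n + 1 : ℝ≥0∞) ≠ ∞ := by simp
  have hδ0 : δ ≠ 0 := mul_ne_zero (ENNReal.inv_ne_zero.2 ht)
    (ENNReal.div_ne_zero.2 ⟨by exact_mod_cast hε.ne', hn1'⟩)
  have hex : ∀ j, ∃ ρ ∈ C, otCost c ρ (ν j) < infCost c C (ν j) + δ := by
    intro j
    have hj : infCost c C (ν j) ≠ ∞ := ENNReal.sum_ne_top.1 hsum j (Finset.mem_univ j)
    have := ENNReal.lt_add_right hj hδ0
    conv at this => lhs; rw [infCost]
    simpa only [iInf_lt_iff, exists_prop] using this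
  choose ρ hρ hlt' using hex
  calc infCost c C (t • ∑ j, ν j) ≤ otCost c (t • ∑ j, ρ j) (t • ∑ j, ν j) := iInf₂_le _ (hC ρ hρ)
    _ ≤ t * otCost c (∑ j, ρ j) (∑ j, ν j) := otCost_smul_le _ _ _ ht
    _ ≤ t * ∑ j, (infCost c C (ν j) + δ) := by
        gcongr
        exact (otCost_sum_le _ _ _ _).trans (Finset.sum_le_sum fun j _ => (hlt' j).le)
    _ = t * ∑ j, infCost c C (ν j) + t * (n * δ) := by
        rw [Finset.sum_add_distrib, mul_add]
        simp
    _ ≤ _ := by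
        gcongr
        rw [hδ, mul_left_comm, ← mul_assoc t, ENNReal.mul_inv_cancel h0 ht, one_mul,
          ← mul_div_assoc]
        refine ENNReal.div_le_of_le_mul ?_
        rw [mul_comm]
        gcongr
        exact le_self_add

/-- Every point survives in exactly `N` of the `N + 1` subsamples that omit one point. -/
lemma emp_succ {N : ℕ} (hN : N ≠ 0) (z : Fin (N + 1) → Z) :
    emp z = ((N + 1 : ℕ) : ℝ≥0∞)⁻¹ • ∑ j : Fin (N + 1), emp (fun k => z (j.succAbove k)) := by
  classical
  rw [emp]
  congr 1
  have e1 : ∀ j : Fin (N + 1), ∑ k, Measure.dirac (z (j.succAbove k)) =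
      ∑ i ∈ Finset.univ.erase j, Measure.dirac (z i) := by
    intro j
    have : Finset.univ.erase j = Finset.univ.map (Fin.succAboveEmb j) := by
      ext i; simp [Fin.exists_succAbove_eq_iff]
    rw [this, Finset.sum_map]
    rfl
  simp only [emp, e1]
  rw [← Finset.smul_sum]
  have e2 : ∑ j : Fin (N + 1), ∑ i ∈ Finset.univ.erase j, Measure.dirac (z i) =
      (N : ℝ≥0∞) • ∑ i, Measure.dirac (z i) := by
    rw [Finset.sum_comm' (t' := Finset.univ) (s' := fun i => Finset.univ.erase i)
      (by intro x y; simp [eq_comm]), Finset.smul_sum]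
    refine Finset.sum_congr rfl fun i _ => ?_
    rw [Finset.sum_const, Finset.card_erase_of_mem (Finset.mem_univ i)]
    simp [Nat.cast_smul_eq_nsmul]
  rw [e2, smul_smul, ENNReal.inv_mul_cancel (by exact_mod_cast hN) (ENNReal.natCast_ne_top N),
    one_smul]

lemma pi_map_comp_prob {ι κ : Type*} [Fintype ι] [Fintype κ] (μ : Measure Z)
    [IsProbabilityMeasure μ] {e : κ → ι} (he : Function.Injective e) :
    (Measure.pi (fun _ : ι => μ)).map (fun z k => z (e k)) = Measure.pi (fun _ : κ => μ) := by
  classical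
  have := pi_map_comp (fun _ : ι => μ) ⟨e, he⟩
  simpa using this

/-- Averaging over the subsamples that omit one point shows that the mean cost decreases in the
number of points. -/
lemma avgEmp_infCost_succ_le {c : Z → Z → ℝ≥0∞} {C : Set (Measure Z)} {N : ℕ} (hN : N ≠ 0)
    (hC : ∀ ρ : Fin (N + 1) → Measure Z, (∀ j, ρ j ∈ C) → ((N + 1 : ℕ) : ℝ≥0∞)⁻¹ • ∑ j, ρ j ∈ C)
    (hF : Measurable fun z : Fin N → Z => infCost c C (emp z))
    (μ : Measure Z) [IsProbabilityMeasure μ] :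
    avgEmp (infCost c C) (N + 1) μ ≤ avgEmp (infCost c C) N μ := by
  have ht0 : ((N + 1 : ℕ) : ℝ≥0∞) ≠ 0 := by exact_mod_cast Nat.succ_ne_zero N
  have htt : ((N + 1 : ℕ) : ℝ≥0∞) ≠ ∞ := ENNReal.natCast_ne_top _
  have hm : ∀ j : Fin (N + 1), Measurable fun (z : Fin (N + 1) → Z) (k : Fin N) =>
      z (j.succAbove k) := fun j => by fun_prop
  calc avgEmp (infCost c C) (N + 1) μ
      ≤ ∫⁻ z : Fin (N + 1) → Z, ((N + 1 : ℕ) : ℝ≥0∞)⁻¹ *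
          ∑ j : Fin (N + 1), infCost c C (emp (fun k => z (j.succAbove k)))
          ∂(Measure.pi fun _ => μ) := by
        refine lintegral_mono fun z => ?_
        simp only [emp_succ hN z]
        exact infCost_average_le c (ENNReal.inv_ne_zero.2 htt) (ENNReal.inv_ne_top.2 ht0) hC _
    _ = ((N + 1 : ℕ) : ℝ≥0∞)⁻¹ * ∑ j : Fin (N + 1), ∫⁻ z : Fin (N + 1) → Z,
          infCost c C (emp (fun k => z (j.succAbove k))) ∂(Measure.pi fun _ => μ) := by
        rw [lintegral_const_mul' _ _ (ENNReal.inv_ne_top.2 ht0), lintegral_finsetSum]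
        exact fun j _ => hF.comp (hm j)
    _ = ((N + 1 : ℕ) : ℝ≥0∞)⁻¹ * ∑ j : Fin (N + 1), avgEmp (infCost c C) N μ := by
        congr 1
        refine Finset.sum_congr rfl fun j _ => ?_
        rw [avgEmp, ← pi_map_comp_prob μ (Fin.succAbove_right_injective (p := j)),
          lintegral_map hF (hm j)]
    _ = _ := by
        rw [Finset.sum_const, Finset.card_univ, Fintype.card_fin, nsmul_eq_mul, ← mul_assoc,
          ENNReal.inv_mul_cancel ht0 htt, one_mul]

end Families

/-! ### Mean costs and their localisation to the cells of a partition. -/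

section MeanCost

variable {Z : Type*} [MeasurableSpace Z]

/-- The mean transport cost from `μ` to the empirical measure of `N` independent points. -/
def meanCost (c : Z → Z → ℝ≥0∞) (N : ℕ) (μ : Measure Z) : ℝ≥0∞ :=
  avgEmp (otCost c μ) N μ

lemma lintegral_emp {N : ℕ} (z : Fin N → Z) {b : Z → ℝ≥0∞} (hb : Measurable b) :
    ∫⁻ x, b x ∂(emp z) = (N : ℝ≥0∞)⁻¹ * ∑ j, b (z j) := by
  rw [emp, lintegral_smul_measure, lintegral_finsetSum_measure, smul_eq_mul]
  simp_rw [lintegral_dirac' _ hb]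

lemma measurable_lintegral_emp {N : ℕ} {b : Z → ℝ≥0∞} (hb : Measurable b) :
    Measurable fun z : Fin N → Z => ∫⁻ x, b x ∂(emp z) := by
  simp_rw [lintegral_emp _ hb]
  exact (Finset.measurable_sum _ fun j _ => hb.comp (measurable_pi_apply j)).const_mul _

lemma avgEmp_lintegral_le {b : Z → ℝ≥0∞} (hb : Measurable b) (n : ℕ) (μ : Measure Z)
    [IsProbabilityMeasure μ] :
    avgEmp (fun ν => ∫⁻ x, b x ∂ν) n μ ≤ ∫⁻ x, b x ∂μ := by
  rw [avgEmp]
  simp_rw [lintegral_emp _ hb]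
  have hsm : Measurable fun z : Fin n → Z => ∑ j, b (z j) :=
    Finset.measurable_sum _ fun j _ => hb.comp (measurable_pi_apply j)
  rw [lintegral_const_mul _ hsm,
    lintegral_finsetSum (f := fun (j : Fin n) (z : Fin n → Z) => b (z j)) _
      (fun j _ => hb.comp (measurable_pi_apply j))]
  have : ∀ j : Fin n, ∫⁻ z : Fin n → Z, b (z j) ∂(Measure.pi fun _ => μ) = ∫⁻ x, b x ∂μ :=
    fun j => (measurePreserving_eval (fun _ : Fin n => μ) j).lintegral_comp hb
  simp only [this, Finset.sum_const, Finset.card_univ, Fintype.card_fin, nsmul_eq_mul]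
  rw [← mul_assoc]
  exact mul_le_of_le_one_left' (ENNReal.inv_mul_le_one _)

/-- Iterates `cellCost_le_refine` from the finest partition `T 0` to the coarsest `T J`.
Discrepancies of the cells of level `j` are evened out within cells of level `j + 1`, hence the
diameter `D (j + 1)`. -/
lemma cellCost_chain {ι : Type*} [Fintype ι] [MeasurableSpace ι]
    [MeasurableSingletonClass ι] {c : Z → Z → ℝ≥0∞} {μ ν : Measure Z} [IsFiniteMeasure μ]
    [IsFiniteMeasure ν] {T : ℕ → Z → ι} {g : ι → ι} (hT : ∀ j, Measurable (T j))
    (hg : ∀ j x, T (j + 1) x = g (T j x)) {S : Set Z} (hS : MeasurableSet S)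
    (hμ : μ Sᶜ = 0) (hν : ν Sᶜ = 0) {D : ℕ → ℝ≥0∞}
    (hD : ∀ j, ∀ x ∈ S, ∀ y ∈ S, T j x = T j y → c x y ≤ D j) (J : ℕ) :
    cellCost c (T J) μ ν ≤ cellCost c (T 0) μ ν +
      ∑ j ∈ Finset.range J, 2 * D (j + 1) * ∑ i, adist (μ (T j ⁻¹' {i})) (ν (T j ⁻¹' {i})) := by
  induction J with
  | zero => simp
  | succ J ih =>
    rw [Finset.sum_range_succ, ← add_assoc]
    refine (cellCost_le_refine (hT J) (hT (J + 1)) (hg J) hS hμ hν (hD (J + 1))).trans ?_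
    gcongr

lemma otCost_le_cellCost_const {ι : Type*} [Fintype ι] {c : Z → Z → ℝ≥0∞} {μ ν : Measure Z} [IsProbabilityMeasure μ]
    [IsProbabilityMeasure ν] {T : Z → ι} {i₀ : ι} (hT : ∀ x, T x = i₀) :
    otCost c μ ν ≤ cellCost c T μ ν := by
  rw [cellCost]
  refine le_trans ?_ (Finset.single_le_sum (fun _ _ => zero_le) (Finset.mem_univ i₀))
  have : T ⁻¹' {i₀} = Set.univ := by ext x; simp [hT]
  rw [this]
  simp

lemma lintegral_cond_ne_top {b : Z → ℝ≥0∞} {μ : Measure Z} (hμ : ∫⁻ z, b z ∂μ ≠ ∞) (B : Set Z) :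
    ∫⁻ z, b z ∂(ProbabilityTheory.cond μ B) ≠ ∞ := by
  rcases eq_or_ne (μ B) 0 with h | h
  · simp [ProbabilityTheory.cond_eq_zero_of_meas_eq_zero h]
  · rw [ProbabilityTheory.cond, lintegral_smul_measure, smul_eq_mul]
    exact ENNReal.mul_ne_top (ENNReal.inv_ne_top.2 h)
      (ne_top_of_le_ne_top hμ (setLIntegral_le_lintegral _ _))

/-- The excess depends only on the number of points in `B`. Given that number, the points are
independent with law `cond μ B`, so the empirical mean of `b` may be replaced by its expectation. -/
lemma lintegral_emp_excess_le {b : Z → ℝ≥0∞} {μ : Measure Z} [IsProbabilityMeasure μ] (hb : Measurable b)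
    {N : ℕ} {B : Set Z} (hB : MeasurableSet B) :
    ∫⁻ z : Fin N → Z, (emp z B - μ B) * ∫⁻ x, b x ∂(ProbabilityTheory.cond (emp z) B)
        ∂(Measure.pi fun _ => μ) ≤
      ∫⁻ z : Fin N → Z, (emp z B - μ B) * ∫⁻ x, b x ∂(ProbabilityTheory.cond μ B)
        ∂(Measure.pi fun _ => μ) := by
  simp_rw [emp_apply _ hB]
  rw [lintegral_weight_cond μ hB (fun n => (N : ℝ≥0∞)⁻¹ * (n : ℝ≥0∞) - μ B)
    (F := fun ν => ∫⁻ x, b x ∂ν) (fun n => measurable_lintegral_emp hb)]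
  refine lintegral_mono fun z => ?_
  rcases eq_or_ne (μ B) 0 with h0 | h0
  · rw [ProbabilityTheory.cond_eq_zero_of_meas_eq_zero h0]
    rcases Nat.eq_zero_or_pos (cnt B z) with hn | hn
    · simp [hn]
    · refine mul_le_mul_of_nonneg_left ?_ zero_le
      rw [avgEmp]
      have : Measure.pi (fun _ : Fin (cnt B z) => (0 : Measure Z)) = 0 := by
        rw [← Measure.measure_univ_eq_zero, Measure.pi_univ]
        simp [hn.ne']
      rw [this]
      simp
  · have := ProbabilityTheory.cond_isProbabilityMeasure h0
    exact mul_le_mul_of_nonneg_left (avgEmp_lintegral_le hb _ _) zero_le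

variable [TopologicalSpace Z] [BorelSpace Z] [SecondCountableTopology Z]
  [MeasurableSingletonClass Z] {c : Z → Z → ℝ≥0∞} {b : Z → ℝ≥0∞}

lemma measurable_otCost_emp (hc : GoodCost c b) {μ : Measure Z} (hμ : ∫⁻ z, b z ∂μ ≠ ∞) (N : ℕ) :
    Measurable fun x : Fin N → Z => otCost c μ (emp x) := by
  simp_rw [← infCost_singleton]
  exact measurable_infCost_emp hc (by simpa using hμ) N

/-- The part of the mean cost that arises within the cell `B`. -/
def cellMean (c : Z → Z → ℝ≥0∞) (N : ℕ) (μ : Measure Z) (B : Set Z) : ℝ≥0∞ :=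
  ∫⁻ z : Fin N → Z, (N : ℝ≥0∞)⁻¹ * (cnt B z : ℝ≥0∞) *
    meanCost c (cnt B z) (ProbabilityTheory.cond μ B) ∂(Measure.pi fun _ => μ)

lemma lintegral_emp_mul_otCost (hc : GoodCost c b) {μ : Measure Z} [IsFiniteMeasure μ]
    (hμ : ∫⁻ z, b z ∂μ ≠ ∞) {N : ℕ} {B : Set Z} (hB : MeasurableSet B) :
    ∫⁻ z : Fin N → Z, emp z B * otCost c (ProbabilityTheory.cond μ B)
      (ProbabilityTheory.cond (emp z) B) ∂(Measure.pi fun _ => μ) = cellMean c N μ B := by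
  simp_rw [emp_apply _ hB]
  exact lintegral_weight_cond μ hB (fun n => (N : ℝ≥0∞)⁻¹ * (n : ℝ≥0∞))
    (fun n => measurable_otCost_emp hc (lintegral_cond_ne_top hμ B) n)

lemma measurable_emp_mul_otCost (hc : GoodCost c b) {μ : Measure Z}
    (hμ : ∫⁻ z, b z ∂μ ≠ ∞) {N : ℕ} {B : Set Z} (hB : MeasurableSet B) :
    Measurable fun z : Fin N → Z => emp z B * otCost c (ProbabilityTheory.cond μ B)
      (ProbabilityTheory.cond (emp z) B) := by
  simp_rw [emp_apply _ hB]
  exact measurable_weight_cond hB (fun n => (N : ℝ≥0∞)⁻¹ * (n : ℝ≥0∞))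
    (fun n => measurable_otCost_emp hc (lintegral_cond_ne_top hμ B) n)

variable {ι : Type*} [Fintype ι] [MeasurableSpace ι] [MeasurableSingletonClass ι]

/-- The mean cost is bounded by the mean costs of the cells of a partition and the mean deviation
of the numbers of points in the cells. -/
lemma meanCost_le_partition (hc : GoodCost c b) (μ : Measure Z) [IsProbabilityMeasure μ]
    (hμ : ∫⁻ z, b z ∂μ ≠ ∞) {N : ℕ} (hN : N ≠ 0) {T : Z → ι} (hT : Measurable T) :
    meanCost c N μ ≤ ∑ i, cellMean c N μ (T ⁻¹' {i}) +
      ∑ i, (∫⁻ z : Fin N → Z, adist (emp z (T ⁻¹' {i})) (μ (T ⁻¹' {i})) ∂(Measure.pi fun _ => μ)) *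
        ∫⁻ x, b x ∂(ProbabilityTheory.cond μ (T ⁻¹' {i})) := by
  have hBm : ∀ i, MeasurableSet (T ⁻¹' {i}) := fun i => hT (measurableSet_singleton i)
  have hbm := hc.bcont.measurable
  have hempm : ∀ i, Measurable fun z : Fin N → Z => emp z (T ⁻¹' {i}) := fun i => by
    simp_rw [emp_apply _ (hBm i)]
    exact measurable_comp_cnt (hBm i) (fun n => (N : ℝ≥0∞)⁻¹ * (n : ℝ≥0∞))
  calc meanCost c N μ ≤ ∫⁻ z : Fin N → Z,
        (∑ i, emp z (T ⁻¹' {i}) * otCost c (ProbabilityTheory.cond μ (T ⁻¹' {i}))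
            (ProbabilityTheory.cond (emp z) (T ⁻¹' {i})) +
          ∑ i, ((μ (T ⁻¹' {i}) - emp z (T ⁻¹' {i})) *
              ∫⁻ x, b x ∂(ProbabilityTheory.cond μ (T ⁻¹' {i})) +
            (emp z (T ⁻¹' {i}) - μ (T ⁻¹' {i})) *
              ∫⁻ x, b x ∂(ProbabilityTheory.cond (emp z) (T ⁻¹' {i}))))
        ∂(Measure.pi fun _ => μ) := by
        refine lintegral_mono fun z => ?_
        have := isProbabilityMeasure_emp hN z
        refine (otCost_le_partition hbm hc.le μ (emp z) hT).trans ?_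
        gcongr
        -- The empirical mass is kept rather than the minimum, so that the integral over the sample
        -- is exactly `cellMean`.
        exact min_le_right _ _
    _ = ∑ i, cellMean c N μ (T ⁻¹' {i}) + ∑ i, ((∫⁻ z : Fin N → Z, (μ (T ⁻¹' {i}) -
            emp z (T ⁻¹' {i})) * ∫⁻ x, b x ∂(ProbabilityTheory.cond μ (T ⁻¹' {i}))
            ∂(Measure.pi fun _ => μ)) +
          ∫⁻ z : Fin N → Z, (emp z (T ⁻¹' {i}) - μ (T ⁻¹' {i})) *
              ∫⁻ x, b x ∂(ProbabilityTheory.cond (emp z) (T ⁻¹' {i}))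
            ∂(Measure.pi fun _ => μ)) := by
        have hm2 : ∀ i, Measurable fun z : Fin N → Z => (μ (T ⁻¹' {i}) - emp z (T ⁻¹' {i})) *
            ∫⁻ x, b x ∂(ProbabilityTheory.cond μ (T ⁻¹' {i})) := fun i =>
          (measurable_const.sub (hempm i)).mul_const _
        have hm3 : ∀ i, Measurable fun z : Fin N → Z => (emp z (T ⁻¹' {i}) - μ (T ⁻¹' {i})) *
            ∫⁻ x, b x ∂(ProbabilityTheory.cond (emp z) (T ⁻¹' {i})) := fun i => by
          simp_rw [emp_apply _ (hBm i)]
          exact measurable_weight_cond (hBm i)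
            (fun n => (N : ℝ≥0∞)⁻¹ * (n : ℝ≥0∞) - μ (T ⁻¹' {i}))
            (F := fun ν => ∫⁻ x, b x ∂ν) (fun n => measurable_lintegral_emp hbm)
        have hm4 : ∀ i ∈ Finset.univ, Measurable fun z : Fin N → Z =>
            (μ (T ⁻¹' {i}) - emp z (T ⁻¹' {i})) *
              ∫⁻ x, b x ∂(ProbabilityTheory.cond μ (T ⁻¹' {i})) +
            (emp z (T ⁻¹' {i}) - μ (T ⁻¹' {i})) *
              ∫⁻ x, b x ∂(ProbabilityTheory.cond (emp z) (T ⁻¹' {i})) :=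
          fun i _ => (hm2 i).add (hm3 i)
        rw [lintegral_add_left (Finset.measurable_sum _ fun i _ =>
            measurable_emp_mul_otCost hc hμ (hBm i)),
          lintegral_finsetSum _ (fun i _ => measurable_emp_mul_otCost hc hμ (hBm i)),
          lintegral_finsetSum _ hm4]
        congr 1
        · exact Finset.sum_congr rfl fun i _ => lintegral_emp_mul_otCost hc hμ (hBm i)
        · exact Finset.sum_congr rfl fun i _ => lintegral_add_left (hm2 i) _
    _ ≤ _ := by
        gcongr with i
        refine (add_le_add_right (lintegral_emp_excess_le hbm (hBm i)) _).trans_eq ?_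
        have hm2 : Measurable fun z : Fin N → Z => (μ (T ⁻¹' {i}) - emp z (T ⁻¹' {i})) *
            ∫⁻ x, b x ∂(ProbabilityTheory.cond μ (T ⁻¹' {i})) :=
          (measurable_const.sub (hempm i)).mul_const _
        rw [← lintegral_add_left hm2,
          ← lintegral_mul_const' _ _ (lintegral_cond_ne_top hμ _)]
        refine lintegral_congr fun z => ?_
        rw [adist, add_comm, add_mul]

/-- The expectation of `cellCost_chain`, whose coarsest partition has a single cell. Here almost
every sample lies in `S`, so the diameters `D` alone control the cost. -/
lemma meanCost_le_chain (hc : GoodCost c b) (μ : Measure Z) [IsProbabilityMeasure μ]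
    (hμ : ∫⁻ z, b z ∂μ ≠ ∞) {N : ℕ} (hN : N ≠ 0)
    {T : ℕ → Z → ι} {g : ι → ι} (hT : ∀ j, Measurable (T j))
    (hg : ∀ j x, T (j + 1) x = g (T j x)) {S : Set Z} (hS : MeasurableSet S)
    (hμS : μ Sᶜ = 0) {D : ℕ → ℝ≥0∞}
    (hD : ∀ j, ∀ x ∈ S, ∀ y ∈ S, T j x = T j y → c x y ≤ D j) {J : ℕ} {i₀ : ι}
    (hJ : ∀ x, T J x = i₀) :
    meanCost c N μ ≤ ∑ i, cellMean c N μ (T 0 ⁻¹' {i}) +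
      ∑ j ∈ Finset.range J, 2 * D (j + 1) * ∑ i,
        ∫⁻ z : Fin N → Z, adist (emp z (T j ⁻¹' {i})) (μ (T j ⁻¹' {i}))
          ∂(Measure.pi fun _ => μ) := by
  have hBm : ∀ j i, MeasurableSet (T j ⁻¹' {i}) := fun j i => hT j (measurableSet_singleton i)
  have hadm : ∀ j i, Measurable fun z : Fin N → Z => adist (emp z (T j ⁻¹' {i}))
      (μ (T j ⁻¹' {i})) := fun j i => by
    simp_rw [emp_apply _ (hBm j i)]
    exact measurable_comp_cnt (hBm j i) (fun n => adist ((N : ℝ≥0∞)⁻¹ * (n : ℝ≥0∞)) _)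
  have hae : ∀ᵐ z ∂(Measure.pi fun _ : Fin N => μ), ∀ j, z j ∈ S := by
    refine ae_all_iff.2 fun j => ?_
    exact (measurePreserving_eval (fun _ : Fin N => μ) j).quasiMeasurePreserving.ae
      (mem_ae_iff.2 hμS)
  calc meanCost c N μ ≤ ∫⁻ z : Fin N → Z,
        (∑ i, emp z (T 0 ⁻¹' {i}) * otCost c (ProbabilityTheory.cond μ (T 0 ⁻¹' {i}))
            (ProbabilityTheory.cond (emp z) (T 0 ⁻¹' {i})) +
          ∑ j ∈ Finset.range J, 2 * D (j + 1) * ∑ i,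
            adist (emp z (T j ⁻¹' {i})) (μ (T j ⁻¹' {i})))
        ∂(Measure.pi fun _ => μ) := by
        refine lintegral_mono_ae ?_
        filter_upwards [hae] with z hz
        have := isProbabilityMeasure_emp hN z
        have hνS : emp z Sᶜ = 0 := by
          rw [emp_apply _ hS.compl]
          have : cnt Sᶜ z = 0 := by simp [cnt, idx, hz]
          rw [this]; simp
        refine (otCost_le_cellCost_const hJ).trans
          ((cellCost_chain hT hg hS hμS hνS hD J).trans ?_)
        simp only [adist, add_comm (μ _ - _)]
        refine add_le_add (Finset.sum_le_sum fun i _ => ?_) le_rfl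
        gcongr
        exact min_le_right _ _
    _ = _ := by
        rw [lintegral_add_left (Finset.measurable_sum _ fun i _ =>
            measurable_emp_mul_otCost hc hμ (hBm 0 i)),
          lintegral_finsetSum _ (fun i _ => measurable_emp_mul_otCost hc hμ (hBm 0 i)),
          lintegral_finsetSum _ (fun j _ => (Finset.measurable_sum _ fun i _ =>
            hadm j i).const_mul _)]
        congr 1
        · exact Finset.sum_congr rfl fun i _ => lintegral_emp_mul_otCost hc hμ (hBm 0 i)
        · refine Finset.sum_congr rfl fun j _ => ?_
          rw [lintegral_const_mul _ (Finset.measurable_sum _ fun i _ => hadm j i),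
            lintegral_finsetSum _ (fun i _ => hadm j i)]

end MeanCost

/-! ### The norm cost and the dyadic grid estimate. -/

section NormCost

variable {d : ℕ}

/-- The cost function `‖x - y‖ ^ p` of the norm `nrm`. -/
def normCost (nrm : Seminorm ℝ (Fin d → ℝ)) (p : ℝ) (x y : Fin d → ℝ) : ℝ≥0∞ :=
  ENNReal.ofReal (nrm (x - y)) ^ p

/-- The bound of the cost function by a function of one variable. -/
def normBound (Λ p : ℝ) (x : Fin d → ℝ) : ℝ≥0∞ := ENNReal.ofReal (2 * Λ * ‖x‖) ^ p

lemma exists_seminorm_le (nrm : Seminorm ℝ (Fin d → ℝ)) :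
    ∃ Λ : ℝ, 0 < Λ ∧ ∀ x, nrm x ≤ Λ * ‖x‖ := by
  -- The added 1 keeps the constant positive in every case, including dimension zero.
  refine ⟨∑ i, nrm (Pi.single i 1) + 1, by positivity, fun x => ?_⟩
  calc nrm x = nrm (∑ i, x i • Pi.single i (1 : ℝ)) := by
        congr 1
        exact pi_eq_sum_univ' x
    _ ≤ ∑ i, nrm (x i • Pi.single i (1 : ℝ)) := by
        classical
        exact Finset.le_sum_of_subadditive nrm (map_zero nrm).le (map_add_le_add nrm) _ _
    _ = ∑ i, ‖x i‖ * nrm (Pi.single i 1) := by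
        simp_rw [map_smul_eq_mul]
    _ ≤ ∑ i, ‖x‖ * nrm (Pi.single i 1) := by
        gcongr with i
        exact norm_le_pi_norm x i
    _ ≤ _ := by
        rw [← Finset.mul_sum, mul_comm]
        gcongr
        linarith

lemma continuous_seminorm (nrm : Seminorm ℝ (Fin d → ℝ)) : Continuous nrm := by
  obtain ⟨Λ, hΛ, h⟩ := exists_seminorm_le nrm
  refine LipschitzWith.continuous (K := ⟨Λ, hΛ.le⟩) (LipschitzWith.of_dist_le_mul fun x y => ?_)
  rw [Real.dist_eq, dist_eq_norm]
  exact (abs_sub_map_le_sub nrm x y).trans (h _)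

/-- The minimum of `nrm` over the compact unit sphere is positive by definiteness. In dimension zero
the sphere is empty and any constant works. -/
lemma exists_le_seminorm (nrm : Seminorm ℝ (Fin d → ℝ)) (hnrm : ∀ x, nrm x = 0 → x = 0) :
    ∃ l : ℝ, 0 < l ∧ ∀ x, l * ‖x‖ ≤ nrm x := by
  rcases (Metric.sphere (0 : Fin d → ℝ) 1).eq_empty_or_nonempty with he | hne
  · refine ⟨1, one_pos, fun x => ?_⟩
    have : x = 0 := by
      by_contra hx
      have : ‖x‖⁻¹ • x ∈ Metric.sphere (0 : Fin d → ℝ) 1 := by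
        rw [mem_sphere_zero_iff_norm, norm_smul, norm_inv, norm_norm,
          inv_mul_cancel₀ (norm_ne_zero_iff.2 hx)]
      rw [he] at this
      exact this
    simp [this]
  · obtain ⟨x₀, hx₀, hmin⟩ := (isCompact_sphere (0 : Fin d → ℝ) 1).exists_isMinOn hne
      (continuous_seminorm nrm).continuousOn
    have hx₀' : x₀ ≠ 0 := by
      rintro rfl
      simp at hx₀
    refine ⟨nrm x₀, lt_of_le_of_ne (apply_nonneg _ _) (fun h => hx₀' (hnrm _ h.symm)),
      fun x => ?_⟩
    rcases eq_or_ne x 0 with rfl | hx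
    · simp
    have hx' := norm_ne_zero_iff.2 hx
    have hs : ‖x‖⁻¹ • x ∈ Metric.sphere (0 : Fin d → ℝ) 1 := by
      rw [mem_sphere_zero_iff_norm, norm_smul, norm_inv, norm_norm, inv_mul_cancel₀ hx']
    have h1 := hmin hs
    have h2 : nrm x₀ ≤ ‖x‖⁻¹ * nrm x := by
      have := map_smul_eq_mul nrm (‖x‖⁻¹) x
      rw [norm_inv, norm_norm] at this
      rw [← this]; exact h1
    calc nrm x₀ * ‖x‖ ≤ (‖x‖⁻¹ * nrm x) * ‖x‖ := by gcongr
      _ = nrm x := by field_simp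

variable {nrm : Seminorm ℝ (Fin d → ℝ)} {p Λ : ℝ}

lemma normCost_le_of_norm_le (hp : 0 ≤ p) (hΛ : ∀ x, nrm x ≤ Λ * ‖x‖)
    (hΛ0 : 0 ≤ Λ) {x y : Fin d → ℝ} {t : ℝ} (h : ‖x - y‖ ≤ t) :
    normCost nrm p x y ≤ ENNReal.ofReal (Λ * t) ^ p := by
  refine ENNReal.rpow_le_rpow (ENNReal.ofReal_le_ofReal ?_) hp
  exact (hΛ _).trans (by gcongr)

lemma goodCost_normCost (hp : 0 < p) (hΛ : ∀ x, nrm x ≤ Λ * ‖x‖) (hΛ0 : 0 ≤ Λ) :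
    GoodCost (normCost nrm p) (normBound Λ p) where
  cont := by
    refine (ENNReal.continuous_rpow_const.comp (ENNReal.continuous_ofReal.comp ?_))
    exact (continuous_seminorm nrm).comp (continuous_fst.sub continuous_snd)
  bcont := by
    refine (ENNReal.continuous_rpow_const.comp (ENNReal.continuous_ofReal.comp ?_))
    fun_prop
  bfin x := ENNReal.rpow_ne_top_of_nonneg hp.le ENNReal.ofReal_ne_top
  le x y := by
    rcases le_total ‖x‖ ‖y‖ with h | h
    · refine le_trans ?_ le_add_self
      have := normCost_le_of_norm_le (nrm := nrm) hp.le hΛ hΛ0 (x := x) (y := y) (t := 2 * ‖y‖)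
        ((norm_sub_le x y).trans (by linarith))
      refine this.trans_eq ?_
      rw [normBound]; congr 2; ring
    · refine le_trans ?_ le_self_add
      have := normCost_le_of_norm_le (nrm := nrm) hp.le hΛ hΛ0 (x := x) (y := y) (t := 2 * ‖x‖)
        ((norm_sub_le x y).trans (by linarith))
      refine this.trans_eq ?_
      rw [normBound]; congr 2; ring

/-- The power map is an order isomorphism of `[0, ∞]`, so it commutes with the two infima. -/
lemma wasserstein_rpow (hp : 0 < p) (μ ν : Measure (Fin d → ℝ)) :
    wasserstein nrm p μ ν ^ p = otCost (normCost nrm p) μ ν := by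
  have h : ∀ t : ℝ≥0∞, (t ^ (1 / p)) ^ p = t := fun t => by
    rw [← ENNReal.rpow_mul, one_div, inv_mul_cancel₀ hp.ne', ENNReal.rpow_one]
  have := (ENNReal.orderIsoRpow p hp).map_iInf
    (fun ξ => ⨅ (_ : ξ ∈ transports μ ν), transportCost nrm p ξ ^ (1 / p))
  simp only [ENNReal.orderIsoRpow_apply] at this
  rw [wasserstein, this]
  refine iInf_congr fun ξ => ?_
  have := (ENNReal.orderIsoRpow p hp).map_iInf
    (fun _ : ξ ∈ transports μ ν => transportCost nrm p ξ ^ (1 / p))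
  simp only [ENNReal.orderIsoRpow_apply] at this
  rw [this]
  refine iInf_congr fun _ => ?_
  rw [h]; rfl

lemma randError_eq (hp : 0 < p) (N : ℕ) (μ : Measure (Fin d → ℝ)) :
    randError nrm p N μ = meanCost (normCost nrm p) N μ ^ (1 / p) := by
  rw [randError, meanCost, avgEmp]
  simp_rw [wasserstein_rpow hp]
  rfl

/-- The mean transport cost for the unit cube in which leakage at the boundary is allowed. -/
def leakMean (d : ℕ) (nrm : Seminorm ℝ (Fin d → ℝ)) (p : ℝ) (N : ℕ) : ℝ≥0∞ :=
  avgEmp (infCost (normCost nrm p) (leaking d)) N (unifCube d)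

lemma leakError_eq (N : ℕ) : leakError d nrm p N = leakMean d nrm p N ^ (1 / p) := rfl

/-- The label in `{0, …, K - 1}ᵈ` of the cell of the grid with lower corner `a` and edge length
`r` that contains a point. -/
def gridLabel (a : Fin d → ℝ) (r : ℝ) (K : ℕ) (x : Fin d → ℝ) : Fin d → Fin (K + 1) :=
  fun i => ⟨min ⌊(x i - a i) / r⌋₊ K, Nat.lt_succ_of_le (min_le_right _ _)⟩

/-- The label of the coarser cell of edge length `2 ^ j * r`. -/
def coarseLabel (a : Fin d → ℝ) (r : ℝ) (K j : ℕ) (x : Fin d → ℝ) : Fin d → Fin (K + 1) :=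
  fun i => ⟨(gridLabel a r K x i : ℕ) / 2 ^ j, (Nat.div_le_self _ _).trans_lt (Fin.is_lt _)⟩

lemma measurable_gridLabel (a : Fin d → ℝ) (r : ℝ) (K : ℕ) : Measurable (gridLabel a r K) := by
  refine measurable_pi_lambda _ fun i => ?_
  have h1 : Measurable fun x : Fin d → ℝ => ⌊(x i - a i) / r⌋₊ :=
    Nat.measurable_floor.comp (by fun_prop)
  exact (measurable_from_top (f := fun n : ℕ =>
    (⟨min n K, Nat.lt_succ_of_le (min_le_right _ _)⟩ : Fin (K + 1)))).comp h1

lemma measurable_coarseLabel (a : Fin d → ℝ) (r : ℝ) (K j : ℕ) :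
    Measurable (coarseLabel a r K j) := by
  have : coarseLabel a r K j = (fun v : Fin d → Fin (K + 1) => fun i =>
    (⟨(v i : ℕ) / 2 ^ j, (Nat.div_le_self _ _).trans_lt (Fin.is_lt _)⟩ : Fin (K + 1))) ∘
      gridLabel a r K := rfl
  rw [this]
  exact (measurable_of_countable _).comp (measurable_gridLabel a r K)

/-- Inside the cube the truncation at `K` in `gridLabel` is inactive. -/
lemma gridLabel_bounds {a : Fin d → ℝ} {r : ℝ} (hr : 0 < r) {K : ℕ} {x : Fin d → ℝ}
    (hx : x ∈ cube a ((K + 1) * r)) (i : Fin d) :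
    (gridLabel a r K x i : ℝ) * r ≤ x i - a i ∧ x i - a i < ((gridLabel a r K x i : ℕ) + 1 : ℝ) * r := by
  have hxi := hx i (Set.mem_univ i)
  have h0 : 0 ≤ (x i - a i) / r := div_nonneg (by linarith [hxi.1]) hr.le
  have hlt : ⌊(x i - a i) / r⌋₊ < K + 1 := by
    rw [Nat.floor_lt h0, div_lt_iff₀ hr]
    push_cast
    linarith [hxi.2]
  have hval : (gridLabel a r K x i : ℕ) = ⌊(x i - a i) / r⌋₊ := min_eq_left (Nat.lt_succ_iff.1 hlt)
  rw [hval]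
  constructor
  · rw [← le_div_iff₀ hr]; exact Nat.floor_le h0
  · rw [← div_lt_iff₀ hr]; exact Nat.lt_floor_add_one _

lemma norm_sub_le_of_coarseLabel_eq {a : Fin d → ℝ} {r : ℝ} (hr : 0 < r) {K j : ℕ}
    {x y : Fin d → ℝ} (hx : x ∈ cube a ((K + 1) * r)) (hy : y ∈ cube a ((K + 1) * r))
    (h : coarseLabel a r K j x = coarseLabel a r K j y) : ‖x - y‖ ≤ 2 ^ j * r := by
  have hpos : (0 : ℝ) ≤ 2 ^ j * r := by positivity
  refine (pi_norm_le_iff_of_nonneg hpos).2 fun i => ?_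
  obtain ⟨h1, h2⟩ := gridLabel_bounds hr hx i
  obtain ⟨h3, h4⟩ := gridLabel_bounds hr hy i
  have hq : (gridLabel a r K x i : ℕ) / 2 ^ j = (gridLabel a r K y i : ℕ) / 2 ^ j := by
    have := congrFun h i
    exact congrArg Fin.val this
  set s := (gridLabel a r K x i : ℕ)
  set t := (gridLabel a r K y i : ℕ)
  have hp2 : 0 < 2 ^ j := by positivity
  have key : ∀ s t : ℕ, s / 2 ^ j = t / 2 ^ j → s + 1 ≤ t + 2 ^ j := by
    intro s t hst
    have e1 := Nat.div_add_mod s (2 ^ j)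
    have e2 := Nat.div_add_mod t (2 ^ j)
    have e3 := Nat.mod_lt s hp2
    rw [hst] at e1
    omega
  have k1 : (s : ℝ) + 1 ≤ t + 2 ^ j := by exact_mod_cast key s t hq
  have k2 : (t : ℝ) + 1 ≤ s + 2 ^ j := by exact_mod_cast key t s hq.symm
  rw [Real.norm_eq_abs, Pi.sub_apply, abs_le]
  constructor <;> nlinarith

lemma coarseLabel_zero (a : Fin d → ℝ) (r : ℝ) (K : ℕ) :
    coarseLabel a r K 0 = gridLabel a r K := by
  funext x i; simp [coarseLabel]

/-- Cauchy–Schwarz over the labels that occur. -/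
lemma sum_sqrt_measure_le {ι : Type*} [Fintype ι] [MeasurableSpace ι]
    [MeasurableSingletonClass ι] (μ : Measure (Fin d → ℝ)) [IsProbabilityMeasure μ]
    {T : (Fin d → ℝ) → ι} (hT : Measurable T) {s : Finset ι} (hs : ∀ x, T x ∈ s) :
    ∑ i, μ (T ⁻¹' {i}) ^ (1 / 2 : ℝ) ≤ (s.card : ℝ≥0∞) ^ (1 / 2 : ℝ) := by
  have hsum : ∑ i, μ (T ⁻¹' {i}) = 1 := by
    have := congrArg (fun m => m Set.univ) (sum_restrict_preimage μ hT)
    simpa [Measure.finsetSum_apply] using this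
  have h0 : ∀ i ∉ s, μ (T ⁻¹' {i}) = 0 := by
    intro i hi
    have : T ⁻¹' {i} = ∅ := by
      ext x
      simp only [Set.mem_preimage, Set.mem_singleton_iff, Set.mem_empty_iff_false, iff_false]
      rintro rfl
      exact hi (hs x)
    rw [this, measure_empty]
  rw [← Finset.sum_subset (Finset.subset_univ s)]
  · have := ENNReal.inner_le_Lp_mul_Lq s (fun _ => (1 : ℝ≥0∞))
      (fun i => μ (T ⁻¹' {i}) ^ (1 / 2 : ℝ)) (p := 2) (q := 2) Real.HolderConjugate.two_two
    simp only [one_mul, ENNReal.one_rpow, Finset.sum_const, nsmul_eq_mul, mul_one] at this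
    refine this.trans ?_
    refine mul_le_of_le_one_right' ?_
    refine ENNReal.rpow_le_one ?_ (by norm_num)
    rw [← hsum]
    refine (Finset.sum_le_sum_of_subset (Finset.subset_univ s)).trans
      (Finset.sum_le_sum fun i _ => ?_)
    rw [← ENNReal.rpow_mul]
    norm_num
  · intro i _ hi
    rw [h0 i hi]
    exact ENNReal.zero_rpow_of_pos (by norm_num)

/-- The constant in the bound of the fluctuations between the cells of a grid. -/
def fluctConst (d : ℕ) (p Λ : ℝ) : ℝ≥0∞ :=
  2 * ENNReal.ofReal (2 * Λ) ^ p * (1 - (2 : ℝ≥0∞) ^ (p - (d : ℝ) / 2))⁻¹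

lemma fluctConst_ne_top (hp : 0 < p) (hpd : p < (d : ℝ) / 2) : fluctConst d p Λ ≠ ∞ := by
  refine ENNReal.mul_ne_top (ENNReal.mul_ne_top (by norm_num)
    (ENNReal.rpow_ne_top_of_nonneg hp.le ENNReal.ofReal_ne_top)) (ENNReal.inv_ne_top.2 ?_)
  refine (tsub_pos_iff_lt.2 ?_).ne'
  exact ENNReal.rpow_lt_one_of_one_lt_of_neg (by norm_num) (by linarith)

/-- Comparison of the mean cost on a cube with the mean costs of the cells of a grid. -/
lemma meanCost_le_grid (hp : 0 < p) (hΛ : ∀ x, nrm x ≤ Λ * ‖x‖)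
    (hΛ0 : 0 ≤ Λ) {a : Fin d → ℝ} {r : ℝ} (hr : 0 < r) {J : ℕ} (μ : Measure (Fin d → ℝ))
    [IsProbabilityMeasure μ] (hμ : μ (cube a (2 ^ J * r))ᶜ = 0)
    (hμb : ∫⁻ x, normBound Λ p x ∂μ ≠ ∞) {N : ℕ} (hN : N ≠ 0) :
    meanCost (normCost nrm p) N μ ≤
      ∑ v, cellMean (normCost nrm p) N μ (gridLabel a r (2 ^ J - 1) ⁻¹' {v}) +
      fluctConst d p Λ * ENNReal.ofReal r ^ p * (2 : ℝ≥0∞) ^ ((J : ℝ) * ((d : ℝ) / 2)) *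
        (N : ℝ≥0∞) ^ (-(1 / 2) : ℝ) := by
  have hK : ((2 ^ J - 1 : ℕ) : ℝ) + 1 = 2 ^ J := by
    have : 1 ≤ 2 ^ J := Nat.one_le_two_pow
    rw [Nat.cast_sub this]; push_cast; ring
  -- Labels run through `0, …, K`, which are `2 ^ J` values per coordinate, so `J` halvings merge
  -- everything into one cell.
  set K := 2 ^ J - 1 with hKdef
  have hKK : K + 1 = 2 ^ J := by have : 1 ≤ 2 ^ J := Nat.one_le_two_pow
                                 omega
  have hcube : cube a (2 ^ J * r) = cube a ((K + 1) * r) := by rw [hK]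
  have hS : MeasurableSet (cube a (2 ^ J * r)) :=
    MeasurableSet.univ_pi fun i => measurableSet_Ico
  have main := meanCost_le_chain (goodCost_normCost hp hΛ hΛ0) μ hμb hN
    (T := coarseLabel a r K)
    (g := fun v i => ⟨(v i : ℕ) / 2, (Nat.div_le_self _ _).trans_lt (Fin.is_lt _)⟩)
    (measurable_coarseLabel a r K) (fun j x => by
      funext i
      simp only [coarseLabel, Fin.mk.injEq]
      rw [pow_succ, Nat.div_div_eq_div_mul]) hS hμ
    (D := fun j => ENNReal.ofReal (Λ * (2 ^ j * r)) ^ p)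
    (fun j x hx y hy hxy => by
      rw [hcube] at hx hy
      exact normCost_le_of_norm_le hp.le hΛ hΛ0 (norm_sub_le_of_coarseLabel_eq hr hx hy hxy))
    (J := J) (i₀ := fun _ => 0) (fun x => by
      funext i
      simp only [coarseLabel]
      apply Fin.ext
      simp only [Fin.val_zero]
      exact Nat.div_eq_of_lt ((Fin.is_lt _).trans_le hKK.le))
  rw [coarseLabel_zero] at main
  refine main.trans (add_le_add le_rfl ?_)
  -- Level `j` pays the diameter factor `(2 ^ j * r) ^ p`, up to a constant, for a discrepancy `N ^
  -- (-1/2)` times the root of the `2 ^ ((J - j) * d)` cells. Successive levels have the ratio `2 ^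
  -- (p - d / 2) < 1`, so the finest level dominates.
  have hterm : ∀ j ∈ Finset.range J, 2 * ENNReal.ofReal (Λ * (2 ^ (j + 1) * r)) ^ p *
      ∑ v, ∫⁻ z : Fin N → Fin d → ℝ, adist (emp z (coarseLabel a r K j ⁻¹' {v}))
        (μ (coarseLabel a r K j ⁻¹' {v})) ∂(Measure.pi fun _ => μ) ≤
      2 * ENNReal.ofReal (2 * Λ) ^ p * ENNReal.ofReal r ^ p *
        (2 : ℝ≥0∞) ^ ((J : ℝ) * ((d : ℝ) / 2)) * (N : ℝ≥0∞) ^ (-(1 / 2) : ℝ) *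
        ((2 : ℝ≥0∞) ^ (p - (d : ℝ) / 2)) ^ j := by
    intro j hj
    have hjJ : j < J := Finset.mem_range.1 hj
    have hcount : ∑ v, μ (coarseLabel a r K j ⁻¹' {v}) ^ (1 / 2 : ℝ) ≤
        (2 : ℝ≥0∞) ^ (((J : ℝ) - j) * ((d : ℝ) / 2)) := by
      set s : Finset (Fin d → Fin (K + 1)) := Fintype.piFinset fun _ =>
        Finset.univ.filter (fun m : Fin (K + 1) => (m : ℕ) < 2 ^ (J - j)) with hs
      have h1 := sum_sqrt_measure_le μ (measurable_coarseLabel a r K j) (s := s) (fun x => by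
        rw [hs, Fintype.mem_piFinset]
        intro i
        simp only [coarseLabel, Finset.mem_filter, Finset.mem_univ, true_and]
        rw [Nat.div_lt_iff_lt_mul (by positivity), ← pow_add, Nat.sub_add_cancel hjJ.le, ← hKK]
        exact Fin.is_lt _)
      refine h1.trans ?_
      have hcard : s.card ≤ (2 ^ (J - j)) ^ d := by
        rw [hs, Fintype.card_piFinset]
        simp only [Finset.prod_const, Finset.card_univ, Fintype.card_fin]
        refine Nat.pow_le_pow_left ?_ d
        calc (Finset.univ.filter (fun m : Fin (K + 1) => (m : ℕ) < 2 ^ (J - j))).card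
            = ((Finset.univ.filter (fun m : Fin (K + 1) => (m : ℕ) < 2 ^ (J - j))).map
              Fin.valEmbedding).card := (Finset.card_map _).symm
          _ ≤ (Finset.range (2 ^ (J - j))).card := by
              refine Finset.card_le_card fun n hn => ?_
              simp only [Finset.mem_map, Finset.mem_filter, Finset.mem_univ, true_and,
                Fin.valEmbedding_apply] at hn
              obtain ⟨m, hm, rfl⟩ := hn
              exact Finset.mem_range.2 hm
          _ = 2 ^ (J - j) := Finset.card_range _
      have hcast : ((s.card : ℕ) : ℝ≥0∞) ≤ (2 : ℝ≥0∞) ^ (((J : ℝ) - j) * d) := by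
        have : ((J : ℝ) - j) * d = (((J - j) * d : ℕ) : ℝ) := by
          push_cast [Nat.cast_sub hjJ.le]; ring
        rw [this, ENNReal.rpow_natCast, pow_mul]
        exact_mod_cast hcard
      refine (ENNReal.rpow_le_rpow hcast (by norm_num)).trans_eq ?_
      rw [← ENNReal.rpow_mul]
      congr 1; ring
    calc _ ≤ 2 * ENNReal.ofReal (Λ * (2 ^ (j + 1) * r)) ^ p *
          ∑ v, (N : ℝ≥0∞) ^ (-(1 / 2) : ℝ) * μ (coarseLabel a r K j ⁻¹' {v}) ^ (1 / 2 : ℝ) := by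
          gcongr with v
          exact lintegral_adist_emp_le_sqrt hN μ
            (measurable_coarseLabel a r K j (measurableSet_singleton v))
      _ ≤ 2 * ENNReal.ofReal (Λ * (2 ^ (j + 1) * r)) ^ p * ((N : ℝ≥0∞) ^ (-(1 / 2) : ℝ) *
          (2 : ℝ≥0∞) ^ (((J : ℝ) - j) * ((d : ℝ) / 2))) := by
          rw [← Finset.mul_sum]
          gcongr
      _ = _ := by
          have e1 : ENNReal.ofReal (Λ * (2 ^ (j + 1) * r)) ^ p = ENNReal.ofReal (2 * Λ) ^ p *
              ENNReal.ofReal r ^ p * (2 : ℝ≥0∞) ^ ((j : ℝ) * p) := by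
            have : Λ * (2 ^ (j + 1) * r) = (2 * Λ) * r * 2 ^ j := by ring
            rw [this, ENNReal.ofReal_mul (by positivity), ENNReal.ofReal_mul (by positivity),
              ENNReal.mul_rpow_of_nonneg _ _ hp.le, ENNReal.mul_rpow_of_nonneg _ _ hp.le,
              ENNReal.ofReal_pow (by norm_num), ENNReal.ofReal_ofNat, ENNReal.rpow_mul,
              ENNReal.rpow_natCast]
          have e2 : (2 : ℝ≥0∞) ^ ((j : ℝ) * p) * (2 : ℝ≥0∞) ^ (((J : ℝ) - j) * ((d : ℝ) / 2)) =
              (2 : ℝ≥0∞) ^ ((J : ℝ) * ((d : ℝ) / 2)) * ((2 : ℝ≥0∞) ^ (p - (d : ℝ) / 2)) ^ j := by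
            rw [← ENNReal.rpow_natCast, ← ENNReal.rpow_mul,
              ← ENNReal.rpow_add _ _ (by norm_num) (by norm_num),
              ← ENNReal.rpow_add _ _ (by norm_num) (by norm_num)]
            congr 1; ring
          rw [e1]
          calc _ = 2 * ENNReal.ofReal (2 * Λ) ^ p * ENNReal.ofReal r ^ p *
                (N : ℝ≥0∞) ^ (-(1 / 2) : ℝ) * ((2 : ℝ≥0∞) ^ ((j : ℝ) * p) *
                (2 : ℝ≥0∞) ^ (((J : ℝ) - j) * ((d : ℝ) / 2))) := by ring
            _ = _ := by rw [e2]; ring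
  refine (Finset.sum_le_sum hterm).trans ?_
  rw [← Finset.mul_sum]
  calc _ ≤ 2 * ENNReal.ofReal (2 * Λ) ^ p * ENNReal.ofReal r ^ p *
        (2 : ℝ≥0∞) ^ ((J : ℝ) * ((d : ℝ) / 2)) * (N : ℝ≥0∞) ^ (-(1 / 2) : ℝ) *
        (1 - (2 : ℝ≥0∞) ^ (p - (d : ℝ) / 2))⁻¹ := by
        gcongr
        rw [← ENNReal.tsum_geometric]
        exact ENNReal.sum_le_tsum _
    _ = _ := by rw [fluctConst]; ring

end NormCost

/-! ### Bounds for the contribution of a single cell. -/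

section CellMean

variable {Z : Type*} [MeasurableSpace Z] {c : Z → Z → ℝ≥0∞} {b : Z → ℝ≥0∞}

lemma meanCost_le_two_mul_lintegral (hb : Measurable b) (h : ∀ x y, c x y ≤ b x + b y)
    (μ : Measure Z) [IsProbabilityMeasure μ] {N : ℕ} (hN : N ≠ 0) :
    meanCost c N μ ≤ 2 * ∫⁻ x, b x ∂μ := by
  calc meanCost c N μ ≤ ∫⁻ z : Fin N → Z, (∫⁻ x, b x ∂μ + ∫⁻ x, b x ∂(emp z))
        ∂(Measure.pi fun _ => μ) := by
        refine lintegral_mono fun z => ?_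
        have := isProbabilityMeasure_emp hN z
        exact otCost_le_lintegral_add hb h (by simp) (by simp)
    _ = ∫⁻ x, b x ∂μ + avgEmp (fun ν => ∫⁻ x, b x ∂ν) N μ := by
        rw [lintegral_add_left measurable_const, lintegral_const]
        simp [avgEmp]
    _ ≤ _ := by
        rw [two_mul]
        gcongr
        exact avgEmp_lintegral_le hb N μ

/-- Apply the preceding bound with a majorant that is `D` on `S` and `∞` elsewhere; it equals `D`
almost everywhere. -/
lemma meanCost_le_of_le_on {S : Set Z} (hS : MeasurableSet S) {D : ℝ≥0∞}
    (hD : ∀ x ∈ S, ∀ y ∈ S, c x y ≤ D) (μ : Measure Z) [IsProbabilityMeasure μ]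
    (hμ : μ Sᶜ = 0) {N : ℕ} (hN : N ≠ 0) :
    meanCost c N μ ≤ 2 * D := by
  classical
  set b : Z → ℝ≥0∞ := S.piecewise (fun _ => D) (fun _ => ∞) with hb
  have hbm : Measurable b := measurable_const.piecewise hS measurable_const
  have hcb : ∀ x y, c x y ≤ b x + b y := by
    intro x y
    by_cases hx : x ∈ S
    · by_cases hy : y ∈ S
      · rw [hb, Set.piecewise_eq_of_mem _ _ _ hx]
        exact (hD x hx y hy).trans le_self_add
      · rw [hb, Set.piecewise_eq_of_notMem _ _ _ hy]; simp
    · rw [hb, Set.piecewise_eq_of_notMem _ _ _ hx]; simp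
  refine (meanCost_le_two_mul_lintegral hbm hcb μ hN).trans ?_
  gcongr
  have : ∫⁻ x, b x ∂μ = ∫⁻ _, D ∂μ := by
    refine lintegral_congr_ae ?_
    filter_upwards [mem_ae_iff.2 hμ] with x hx
    exact Set.piecewise_eq_of_mem _ _ _ hx
  rw [this]; simp

lemma ae_cnt_eq_zero {μ : Measure Z} [IsProbabilityMeasure μ] {N : ℕ} {B : Set Z}
    (hB : MeasurableSet B) (h0 : μ B = 0) :
    ∀ᵐ z ∂(Measure.pi fun _ : Fin N => μ), cnt B z = 0 := by
  have := lintegral_cnt (N := N) μ hB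
  rw [h0, mul_zero, lintegral_eq_zero_iff (measurable_comp_cnt hB _)] at this
  filter_upwards [this] with z hz
  have hz' : (cnt B z : ℝ≥0∞) = 0 := hz
  exact_mod_cast hz'

lemma cellMean_le {μ : Measure Z} [IsProbabilityMeasure μ] {N : ℕ} {B : Set Z}
    (hB : MeasurableSet B) {G : ℕ → ℝ≥0∞}
    (hG : ∀ n ≠ 0, μ B ≠ 0 → meanCost c n (ProbabilityTheory.cond μ B) ≤ G n) :
    cellMean c N μ B ≤ ∫⁻ z : Fin N → Z, (N : ℝ≥0∞)⁻¹ * (cnt B z : ℝ≥0∞) * G (cnt B z)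
      ∂(Measure.pi fun _ => μ) := by
  rcases eq_or_ne (μ B) 0 with h0 | h0
  · refine lintegral_mono_ae ?_
    filter_upwards [ae_cnt_eq_zero hB h0] with z hz
    simp [hz]
  · refine lintegral_mono fun z => ?_
    rcases Nat.eq_zero_or_pos (cnt B z) with hn | hn
    · simp [hn]
    · exact mul_le_mul_of_nonneg_left (hG _ hn.ne' h0) zero_le

lemma cellMean_le_const {μ : Measure Z} [IsProbabilityMeasure μ] {N : ℕ} (hN : N ≠ 0) {B : Set Z}
    (hB : MeasurableSet B) {D : ℝ≥0∞}
    (hG : ∀ n ≠ 0, μ B ≠ 0 → meanCost c n (ProbabilityTheory.cond μ B) ≤ D) :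
    cellMean c N μ B ≤ μ B * D := by
  refine (cellMean_le hB (G := fun _ => D) hG).trans_eq ?_
  have hm : Measurable fun z : Fin N → Z => (cnt B z : ℝ≥0∞) := measurable_comp_cnt hB _
  rw [lintegral_mul_const _ (hm.const_mul _), lintegral_const_mul _ hm, lintegral_cnt μ hB,
    ← mul_assoc, ENNReal.inv_mul_cancel (by exact_mod_cast hN) (ENNReal.natCast_ne_top N), one_mul]

/-- Jensen's inequality for the concave power `t`. -/
lemma lintegral_cnt_rpow_le {μ : Measure Z} [IsProbabilityMeasure μ] {N : ℕ} {B : Set Z}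
    (hB : MeasurableSet B) {t : ℝ} (h0 : 0 < t) (h1 : t ≤ 1) :
    ∫⁻ z : Fin N → Z, (cnt B z : ℝ≥0∞) ^ t ∂(Measure.pi fun _ => μ) ≤ (N * μ B) ^ t := by
  have hm : Measurable fun z : Fin N → Z => (cnt B z : ℝ≥0∞) ^ t :=
    measurable_comp_cnt hB (fun n => (n : ℝ≥0∞) ^ t)
  have := lintegral_le_sqrt_lintegral_sq (Measure.pi fun _ : Fin N => μ) hm.aemeasurable
    (r := 1 / t) (by rw [le_div_iff₀ h0]; linarith)
  refine this.trans_eq ?_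
  simp_rw [← ENNReal.rpow_mul, mul_one_div_cancel h0.ne', ENNReal.rpow_one]
  rw [lintegral_cnt μ hB, one_div_one_div]

/-- The cell contribution under a polynomial rate in the cell. -/
lemma cellMean_le_rate {μ : Measure Z} [IsProbabilityMeasure μ] {N : ℕ} (hN : N ≠ 0) {B : Set Z}
    (hB : MeasurableSet B) {A : ℝ≥0∞} {s : ℝ} (hs0 : 0 ≤ s) (hs1 : s < 1)
    (hG : ∀ n ≠ 0, μ B ≠ 0 →
      meanCost c n (ProbabilityTheory.cond μ B) ≤ A * (n : ℝ≥0∞) ^ (-s)) :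
    cellMean c N μ B ≤ A * ((N : ℝ≥0∞) ^ (-s) * μ B ^ (1 - s)) := by
  have hN0 : (N : ℝ≥0∞) ≠ 0 := by exact_mod_cast hN
  have hNt := ENNReal.natCast_ne_top N
  refine (cellMean_le hB (G := fun n => A * (n : ℝ≥0∞) ^ (-s)) hG).trans ?_
  have hm : Measurable fun z : Fin N → Z => (cnt B z : ℝ≥0∞) ^ (1 - s) :=
    measurable_comp_cnt hB (fun n => (n : ℝ≥0∞) ^ (1 - s))
  calc _ = ∫⁻ z : Fin N → Z, A * (N : ℝ≥0∞)⁻¹ * (cnt B z : ℝ≥0∞) ^ (1 - s)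
        ∂(Measure.pi fun _ => μ) := by
        refine lintegral_congr fun z => ?_
        rcases Nat.eq_zero_or_pos (cnt B z) with hn | hn
        · simp [hn, ENNReal.zero_rpow_of_pos (sub_pos.2 hs1)]
        · have h0 : (cnt B z : ℝ≥0∞) ≠ 0 := by exact_mod_cast hn.ne'
          rw [sub_eq_add_neg, ENNReal.rpow_add _ _ h0 (ENNReal.natCast_ne_top _),
            ENNReal.rpow_one]
          ring
    _ ≤ A * (N : ℝ≥0∞)⁻¹ * (N * μ B) ^ (1 - s) := by
        rw [lintegral_const_mul _ hm]
        gcongr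
        exact lintegral_cnt_rpow_le hB (by linarith) (by linarith)
    _ = _ := by
        rw [ENNReal.mul_rpow_of_nonneg _ _ (by linarith), sub_eq_add_neg,
          ENNReal.rpow_add _ _ hN0 hNt, ENNReal.rpow_one]
        calc _ = A * ((N : ℝ≥0∞)⁻¹ * N) * ((N : ℝ≥0∞) ^ (-s) * μ B ^ (1 + -s)) := by ring
          _ = _ := by rw [ENNReal.inv_mul_cancel hN0 hNt, mul_one]

end CellMean

/-! ### A priori rates: measures on a cube, and measures on the whole space. -/

section Pierce

variable {d : ℕ} {nrm : Seminorm ℝ (Fin d → ℝ)} {p Λ : ℝ}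

lemma measurableSet_cube (a : Fin d → ℝ) (l : ℝ) : MeasurableSet (cube a l) :=
  MeasurableSet.univ_pi fun _ => measurableSet_Ico

lemma sum_measure_fiber {Z ι : Type*} [MeasurableSpace Z] [Fintype ι] [MeasurableSpace ι]
    [MeasurableSingletonClass ι] (μ : Measure Z) {T : Z → ι} (hT : Measurable T) :
    ∑ i, μ (T ⁻¹' {i}) = μ Set.univ := by
  have := congrArg (fun m => m Set.univ) (sum_restrict_preimage μ hT)
  simpa [Measure.finsetSum_apply] using this

lemma normBound_le (hp : 0 ≤ p) (hΛ0 : 0 ≤ Λ) {x : Fin d → ℝ} {t : ℝ} (h : ‖x‖ ≤ t) :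
    normBound Λ p x ≤ ENNReal.ofReal (2 * Λ * t) ^ p :=
  ENNReal.rpow_le_rpow (ENNReal.ofReal_le_ofReal (by gcongr)) hp

lemma norm_le_of_mem_cube {a x : Fin d → ℝ} {l : ℝ} (hl : 0 ≤ l) (hx : x ∈ cube a l) :
    ‖x‖ ≤ ‖a‖ + l := by
  refine (pi_norm_le_iff_of_nonneg (by positivity)).2 fun i => ?_
  have h1 := hx i (Set.mem_univ i)
  have h2 := norm_le_pi_norm a i
  rw [Real.norm_eq_abs, abs_le] at *
  constructor <;> linarith [h1.1, h1.2, h2.1, h2.2]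

lemma lintegral_normBound_ne_top_of_cube (hp : 0 ≤ p) (hΛ0 : 0 ≤ Λ) {a : Fin d → ℝ} {l : ℝ}
    (hl : 0 ≤ l) {μ : Measure (Fin d → ℝ)} [IsFiniteMeasure μ] (hμ : μ (cube a l)ᶜ = 0) :
    ∫⁻ x, normBound Λ p x ∂μ ≠ ∞ := by
  have : ∫⁻ x, normBound Λ p x ∂μ ≤ ∫⁻ _, ENNReal.ofReal (2 * Λ * (‖a‖ + l)) ^ p ∂μ := by
    refine lintegral_mono_ae ?_
    filter_upwards [mem_ae_iff.2 hμ] with x hx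
    exact normBound_le hp hΛ0 (norm_le_of_mem_cube hl hx)
  refine ne_top_of_le_ne_top ?_ this
  rw [lintegral_const]
  exact ENNReal.mul_ne_top (ENNReal.rpow_ne_top_of_nonneg hp ENNReal.ofReal_ne_top)
    (measure_ne_top _ _)

/-- The constant in the bound of the mean cost for measures on a cube. -/
def cubeConst (d : ℕ) (p Λ : ℝ) : ℝ≥0∞ :=
  (2 * ENNReal.ofReal Λ ^ p + fluctConst d p Λ) * 2 ^ p

lemma cubeConst_ne_top (hp : 0 < p) (hpd : p < (d : ℝ) / 2) : cubeConst d p Λ ≠ ∞ :=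
  ENNReal.mul_ne_top (ENNReal.add_ne_top.2 ⟨ENNReal.mul_ne_top (by norm_num)
    (ENNReal.rpow_ne_top_of_nonneg hp.le ENNReal.ofReal_ne_top), fluctConst_ne_top hp hpd⟩)
    (ENNReal.rpow_ne_top_of_nonneg hp.le (by norm_num))

/-- Every probability measure on a cube of edge length `l` is approximated by its empirical
measures at the rate `l N ^ (-1 / d)`. -/
lemma meanCost_le_cube (hp : 0 < p) (hpd : p < (d : ℝ) / 2) (hΛ : ∀ x, nrm x ≤ Λ * ‖x‖)
    (hΛ0 : 0 ≤ Λ) {a : Fin d → ℝ} {l : ℝ} (hl : 0 < l) (μ : Measure (Fin d → ℝ))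
    [IsProbabilityMeasure μ] (hμ : μ (cube a l)ᶜ = 0) {N : ℕ} (hN : N ≠ 0) :
    meanCost (normCost nrm p) N μ ≤
      cubeConst d p Λ * ENNReal.ofReal l ^ p * (N : ℝ≥0∞) ^ (-(p / d)) := by
  have hd : 0 < (d : ℝ) := by linarith
  have hd' : d ≠ 0 := by rintro rfl; simp at hd
  -- About one point per finest cell: `2 ^ (d * J) ≤ N` makes the fluctuation factor at most one,
  -- and `N < 2 ^ (d * (J + 1))` bounds the edge `r` by `2 * l * N ^ (-1 / d)`.
  set J := Nat.log (2 ^ d) N with hJ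
  have h2d : 1 < 2 ^ d := Nat.one_lt_two_pow hd'
  have hJ1 : (2 ^ d) ^ J ≤ N := Nat.pow_log_le_self _ hN
  have hJ2 : N < (2 ^ d) ^ (J + 1) := Nat.lt_pow_succ_log_self h2d N
  set r : ℝ := l / 2 ^ J with hr
  have hr0 : 0 < r := by positivity
  have hcube : cube a (2 ^ J * r) = cube a l := by
    rw [hr, mul_div_cancel₀ _ (by positivity)]
  have main := meanCost_le_grid hp hΛ hΛ0 hr0 (J := J) μ (a := a) (by rw [hcube]; exact hμ)
    (lintegral_normBound_ne_top_of_cube hp.le hΛ0 hl.le hμ) hN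
  have hK : ((2 ^ J - 1 : ℕ) : ℝ) + 1 = 2 ^ J := by
    have : 1 ≤ 2 ^ J := Nat.one_le_two_pow
    rw [Nat.cast_sub this]; push_cast; ring
  set K := 2 ^ J - 1
  have hcube' : cube a l = cube a ((K + 1) * r) := by rw [hK, hcube]
  have hBm : ∀ v, MeasurableSet (gridLabel a r K ⁻¹' {v}) :=
    fun v => measurable_gridLabel a r K (measurableSet_singleton v)
  have hcell : ∀ v, cellMean (normCost nrm p) N μ (gridLabel a r K ⁻¹' {v}) ≤
      μ (gridLabel a r K ⁻¹' {v}) * (2 * ENNReal.ofReal (Λ * r) ^ p) := by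
    intro v
    refine cellMean_le_const hN (hBm v) fun n hn h0 => ?_
    have := ProbabilityTheory.cond_isProbabilityMeasure h0
    refine meanCost_le_of_le_on (S := gridLabel a r K ⁻¹' {v} ∩ cube a l)
      ((hBm v).inter (measurableSet_cube a l)) (fun x hx y hy => ?_) _ ?_ hn
    · refine normCost_le_of_norm_le hp.le hΛ hΛ0 ?_
      have := norm_sub_le_of_coarseLabel_eq hr0 (K := K) (j := 0) (hcube' ▸ hx.2) (hcube' ▸ hy.2)
        (by rw [coarseLabel_zero]; exact hx.1.trans hy.1.symm)
      simpa using this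
    · rw [Set.compl_inter]
      refine measure_union_null ?_ (ProbabilityTheory.cond_absolutelyContinuous hμ)
      rw [ProbabilityTheory.cond_apply (hBm v)]
      simp
  have hrp : ENNReal.ofReal r ^ p ≤
      ENNReal.ofReal l ^ p * (2 ^ p * (N : ℝ≥0∞) ^ (-(p / d))) := by
    have e1 : ENNReal.ofReal r = ENNReal.ofReal l * (2 * (2 : ℝ≥0∞) ^ (-((J : ℝ) + 1))) := by
      rw [hr, ENNReal.ofReal_div_of_pos (by positivity), ENNReal.ofReal_pow (by norm_num),
        ENNReal.ofReal_ofNat, div_eq_mul_inv]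
      congr 1
      rw [neg_add, ENNReal.rpow_add _ _ (by norm_num) (by norm_num), ENNReal.rpow_neg,
        ENNReal.rpow_natCast, ENNReal.rpow_neg_one, mul_comm ((2 ^ J : ℝ≥0∞)⁻¹), ← mul_assoc,
        ENNReal.mul_inv_cancel (by norm_num) (by norm_num), one_mul]
    rw [e1, ENNReal.mul_rpow_of_nonneg _ _ hp.le, ENNReal.mul_rpow_of_nonneg _ _ hp.le]
    gcongr
    rw [← ENNReal.rpow_mul]
    have e2 : (2 : ℝ≥0∞) ^ (-((J : ℝ) + 1) * p) = (((2 ^ d) ^ (J + 1) : ℕ) : ℝ≥0∞) ^ (-(p / d)) := by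
      push_cast
      rw [← ENNReal.rpow_natCast, ← ENNReal.rpow_natCast, ← ENNReal.rpow_mul, ← ENNReal.rpow_mul]
      congr 1
      push_cast
      field_simp
    rw [e2, ENNReal.rpow_neg, ENNReal.rpow_neg, ENNReal.inv_le_inv]
    exact ENNReal.rpow_le_rpow (by exact_mod_cast hJ2.le) (by positivity)
  have hJN : (2 : ℝ≥0∞) ^ ((J : ℝ) * ((d : ℝ) / 2)) * (N : ℝ≥0∞) ^ (-(1 / 2) : ℝ) ≤ 1 := by
    have e : (2 : ℝ≥0∞) ^ ((J : ℝ) * ((d : ℝ) / 2)) = (((2 ^ d) ^ J : ℕ) : ℝ≥0∞) ^ (1 / 2 : ℝ) := by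
      push_cast
      rw [← ENNReal.rpow_natCast, ← ENNReal.rpow_natCast, ← ENNReal.rpow_mul, ← ENNReal.rpow_mul]
      congr 1
      ring
    rw [e]
    calc _ ≤ (N : ℝ≥0∞) ^ (1 / 2 : ℝ) * (N : ℝ≥0∞) ^ (-(1 / 2) : ℝ) := by
          gcongr
      _ = 1 := by
          rw [← ENNReal.rpow_add _ _ (by exact_mod_cast hN) (ENNReal.natCast_ne_top N)]
          simp
  calc _ ≤ _ := main
    _ ≤ 2 * ENNReal.ofReal (Λ * r) ^ p + fluctConst d p Λ * ENNReal.ofReal r ^ p := by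
        refine add_le_add ?_ ?_
        · refine (Finset.sum_le_sum fun v _ => hcell v).trans_eq ?_
          rw [← Finset.sum_mul, sum_measure_fiber μ (measurable_gridLabel a r K), measure_univ,
            one_mul]
        · rw [mul_assoc]
          exact mul_le_of_le_one_right' hJN
    _ = (2 * ENNReal.ofReal Λ ^ p + fluctConst d p Λ) * ENNReal.ofReal r ^ p := by
        rw [ENNReal.ofReal_mul hΛ0, ENNReal.mul_rpow_of_nonneg _ _ hp.le]
        ring
    _ ≤ (2 * ENNReal.ofReal Λ ^ p + fluctConst d p Λ) *
          (ENNReal.ofReal l ^ p * (2 ^ p * (N : ℝ≥0∞) ^ (-(p / d)))) := by gcongr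
    _ = _ := by rw [cubeConst]; ring

/-- The index of the dyadic shell that contains a point. -/
def shell (x : Fin d → ℝ) : ℕ := Nat.clog 2 (⌊‖x‖⌋₊ + 1)

lemma measurable_shell : Measurable (shell (d := d)) :=
  (measurable_from_top (f := fun n : ℕ => Nat.clog 2 (n + 1))).comp
    (Nat.measurable_floor.comp measurable_norm)

lemma norm_lt_shell (x : Fin d → ℝ) : ‖x‖ < 2 ^ shell x := by
  have h1 : ⌊‖x‖⌋₊ + 1 ≤ 2 ^ shell x := Nat.le_pow_clog (by norm_num) _
  calc ‖x‖ < ⌊‖x‖⌋₊ + 1 := Nat.lt_floor_add_one _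
    _ ≤ 2 ^ shell x := by exact_mod_cast h1

lemma shell_le_norm {x : Fin d → ℝ} {n : ℕ} (h : shell x = n + 1) : 2 ^ n ≤ ‖x‖ := by
  have h1 : 2 ^ n < ⌊‖x‖⌋₊ + 1 := by
    have := (Nat.lt_clog_iff_pow_lt (b := 2) (by norm_num) (x := ⌊‖x‖⌋₊ + 1) (y := n)).1
      (by change n < shell x; omega)
    exact this
  have h2 : 2 ^ n ≤ ⌊‖x‖⌋₊ := Nat.lt_succ_iff.1 h1
  calc (2 : ℝ) ^ n ≤ ⌊‖x‖⌋₊ := by exact_mod_cast h2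
    _ ≤ ‖x‖ := Nat.floor_le (norm_nonneg x)

/-- The functional of a measure that controls the rate of its empirical approximation. -/
def shellSum (p s : ℝ) (μ : Measure (Fin d → ℝ)) : ℝ≥0∞ :=
  ∑' n : ℕ, ((2 : ℝ≥0∞) ^ n) ^ p * μ (shell ⁻¹' {n}) ^ (1 - s)

/-- The constant in the bound of the mean cost for measures on the whole space. -/
def pierceConst (d : ℕ) (p Λ : ℝ) : ℝ≥0∞ :=
  cubeConst d p Λ * 2 ^ p + 2 * ENNReal.ofReal (2 * Λ) ^ p

lemma pierceConst_ne_top (hp : 0 < p) (hpd : p < (d : ℝ) / 2) : pierceConst d p Λ ≠ ∞ :=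
  ENNReal.add_ne_top.2 ⟨ENNReal.mul_ne_top (cubeConst_ne_top hp hpd)
    (ENNReal.rpow_ne_top_of_nonneg hp.le (by norm_num)), ENNReal.mul_ne_top (by norm_num)
    (ENNReal.rpow_ne_top_of_nonneg hp.le ENNReal.ofReal_ne_top)⟩

/-- Partition into the shells below `K` and the rest. A shell of radius `2 ^ n` contributes order `2
^ (n * p) * N ^ (-s) * μ(shell) ^ (1 - s)` with `s = p / d`, both through the rate inside it
(`meanCost_le_cube`) and through the deviation of its number of points (`lintegral_adist_emp_le`).
The rest is bounded crudely by an integral of `b` that vanishes as `K` grows. -/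
lemma meanCost_le_shellSum (hp : 0 < p) (hpd : p < (d : ℝ) / 2) (hΛ : ∀ x, nrm x ≤ Λ * ‖x‖)
    (hΛ0 : 0 ≤ Λ) (μ : Measure (Fin d → ℝ)) [IsProbabilityMeasure μ]
    (hμ : ∫⁻ x, normBound Λ p x ∂μ ≠ ∞) {N : ℕ} (hN : N ≠ 0) :
    meanCost (normCost nrm p) N μ ≤
      pierceConst d p Λ * shellSum p (p / d) μ * (N : ℝ≥0∞) ^ (-(p / d)) := by
  have hd : 0 < (d : ℝ) := by linarith
  have hs0 : 0 ≤ p / d := by positivity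
  have hs2 : p / d ≤ 1 / 2 := by rw [div_le_iff₀ hd]; linarith
  have hgood := goodCost_normCost (nrm := nrm) hp hΛ hΛ0
  have hbm := hgood.bcont.measurable
  set c := normCost nrm p
  set b := normBound (d := d) Λ p
  have hshm : ∀ n, MeasurableSet (shell (d := d) ⁻¹' {n}) :=
    fun n => measurable_shell (measurableSet_singleton n)
  have htailm : ∀ K, MeasurableSet {x : Fin d → ℝ | K ≤ shell x} :=
    fun K => measurable_shell measurableSet_Ici
  have hK : ∀ K : ℕ, meanCost c N μ ≤
      pierceConst d p Λ * shellSum p (p / d) μ * (N : ℝ≥0∞) ^ (-(p / d)) +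
        4 * ∫⁻ x in {x | K ≤ shell x}, b x ∂μ := by
    intro K
    set T : (Fin d → ℝ) → Fin (K + 1) :=
      fun x => ⟨min (shell x) K, Nat.lt_succ_of_le (min_le_right _ _)⟩ with hT
    have hTm : Measurable T := (measurable_from_top (f := fun n : ℕ =>
      (⟨min n K, Nat.lt_succ_of_le (min_le_right _ _)⟩ : Fin (K + 1)))).comp measurable_shell
    have hlt : ∀ i : Fin K, T ⁻¹' {i.castSucc} = shell ⁻¹' {(i : ℕ)} := by
      intro i
      ext x
      simp only [hT, Set.mem_preimage, Set.mem_singleton_iff, Fin.ext_iff, Fin.val_castSucc]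
      have := i.is_lt
      omega
    have hlast : T ⁻¹' {Fin.last K} = {x | K ≤ shell x} := by
      ext x
      simp only [hT, Set.mem_preimage, Set.mem_singleton_iff, Fin.ext_iff, Fin.val_last,
        Set.mem_ofPred_eq]
      omega
    have main := meanCost_le_partition hgood μ hμ hN hTm
    rw [Fin.sum_univ_castSucc, Fin.sum_univ_castSucc, hlast] at main
    simp only [hlt] at main
    have hin : ∀ i : Fin K, cellMean c N μ (shell ⁻¹' {(i : ℕ)}) +
        (∫⁻ z : Fin N → Fin d → ℝ, adist (emp z (shell ⁻¹' {(i : ℕ)})) (μ (shell ⁻¹' {(i : ℕ)}))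
          ∂(Measure.pi fun _ => μ)) *
          ∫⁻ x, b x ∂(ProbabilityTheory.cond μ (shell ⁻¹' {(i : ℕ)})) ≤
        pierceConst d p Λ * (N : ℝ≥0∞) ^ (-(p / d)) *
          (((2 : ℝ≥0∞) ^ (i : ℕ)) ^ p * μ (shell ⁻¹' {(i : ℕ)}) ^ (1 - p / d)) := by
      intro i
      set B : Set (Fin d → ℝ) := shell ⁻¹' {(i : ℕ)} with hB
      have hnorm : ∀ x ∈ B, ‖x‖ < 2 ^ (i : ℕ) := by
        intro x hx
        have h1 := norm_lt_shell x
        have h2 : shell x = i := hx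
        rwa [h2] at h1
      have h1 : cellMean c N μ B ≤ cubeConst d p Λ * ENNReal.ofReal (2 ^ ((i : ℕ) + 1)) ^ p *
          ((N : ℝ≥0∞) ^ (-(p / d)) * μ B ^ (1 - p / d)) := by
        refine cellMean_le_rate hN (hshm i) hs0 (by linarith) fun n hn h0 => ?_
        have := ProbabilityTheory.cond_isProbabilityMeasure h0
        refine meanCost_le_cube hp hpd hΛ hΛ0 (a := fun _ => -2 ^ (i : ℕ)) (by positivity) _ ?_ hn
        rw [ProbabilityTheory.cond_apply (hshm i)]
        have : B ∩ (cube (fun _ : Fin d => -2 ^ (i : ℕ)) (2 ^ ((i : ℕ) + 1)))ᶜ = ∅ := by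
          refine Set.eq_empty_iff_forall_notMem.2 fun x hx => hx.2 fun k _ => ?_
          have hk := (norm_le_pi_norm x k).trans_lt (hnorm x hx.1)
          rw [Real.norm_eq_abs, abs_lt] at hk
          refine ⟨hk.1.le, ?_⟩
          rw [pow_succ]
          linarith [hk.2]
        rw [this, measure_empty, mul_zero]
      have h2 : ∫⁻ x, b x ∂(ProbabilityTheory.cond μ B) ≤
          ENNReal.ofReal (2 * Λ * 2 ^ (i : ℕ)) ^ p :=
        lintegral_cond_le (S := Set.univ) (by simp)
          (fun x _ hx => normBound_le hp.le hΛ0 (hnorm x hx).le) (hshm i)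
      have h3 := lintegral_adist_emp_le hN μ (hshm i) hs0 hs2
      have e1 : ENNReal.ofReal (2 ^ ((i : ℕ) + 1)) ^ p = 2 ^ p * ((2 : ℝ≥0∞) ^ (i : ℕ)) ^ p := by
        rw [pow_succ, ENNReal.ofReal_mul (by positivity), ENNReal.mul_rpow_of_nonneg _ _ hp.le,
          ENNReal.ofReal_pow (by norm_num), ENNReal.ofReal_ofNat, mul_comm]
      have e2 : ENNReal.ofReal (2 * Λ * 2 ^ (i : ℕ)) ^ p =
          ENNReal.ofReal (2 * Λ) ^ p * ((2 : ℝ≥0∞) ^ (i : ℕ)) ^ p := by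
        rw [ENNReal.ofReal_mul (by positivity), ENNReal.mul_rpow_of_nonneg _ _ hp.le,
          ENNReal.ofReal_pow (by norm_num), ENNReal.ofReal_ofNat]
      rw [e1] at h1
      rw [e2] at h2
      refine (add_le_add h1 (mul_le_mul' h3 h2)).trans_eq ?_
      rw [pierceConst]
      ring
    have hout : cellMean c N μ {x | K ≤ shell x} +
        (∫⁻ z : Fin N → Fin d → ℝ, adist (emp z {x | K ≤ shell x}) (μ {x | K ≤ shell x})
          ∂(Measure.pi fun _ => μ)) *
          ∫⁻ x, b x ∂(ProbabilityTheory.cond μ {x | K ≤ shell x}) ≤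
        -- One factor 2 comes from the cost inside the tail, the other from the deviation of its
        -- number of points.
        4 * ∫⁻ x in {x | K ≤ shell x}, b x ∂μ := by
      have e : μ {x | K ≤ shell x} * ∫⁻ x, b x ∂(ProbabilityTheory.cond μ {x | K ≤ shell x}) =
          ∫⁻ x in {x | K ≤ shell x}, b x ∂μ := by
        rw [← smul_eq_mul, ← lintegral_smul_measure, measure_smul_cond]
      have h1 : cellMean c N μ {x | K ≤ shell x} ≤ μ {x | K ≤ shell x} *
          (2 * ∫⁻ x, b x ∂(ProbabilityTheory.cond μ {x | K ≤ shell x})) := by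
        refine cellMean_le_const hN (htailm K) fun n hn h0 => ?_
        have := ProbabilityTheory.cond_isProbabilityMeasure h0
        exact meanCost_le_two_mul_lintegral hbm hgood.le _ hn
      have h2 := mul_le_mul' (lintegral_adist_emp_le_two hN μ (htailm K))
        (le_refl (∫⁻ x, b x ∂(ProbabilityTheory.cond μ {x | K ≤ shell x})))
      refine (add_le_add h1 h2).trans_eq ?_
      rw [← e]
      ring
    calc _ ≤ _ := main
      _ = ∑ i : Fin K, (cellMean c N μ (shell ⁻¹' {(i : ℕ)}) +
          (∫⁻ z : Fin N → Fin d → ℝ, adist (emp z (shell ⁻¹' {(i : ℕ)})) (μ (shell ⁻¹' {(i : ℕ)}))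
            ∂(Measure.pi fun _ => μ)) *
            ∫⁻ x, b x ∂(ProbabilityTheory.cond μ (shell ⁻¹' {(i : ℕ)}))) +
          (cellMean c N μ {x | K ≤ shell x} +
          (∫⁻ z : Fin N → Fin d → ℝ, adist (emp z {x | K ≤ shell x}) (μ {x | K ≤ shell x})
            ∂(Measure.pi fun _ => μ)) *
            ∫⁻ x, b x ∂(ProbabilityTheory.cond μ {x | K ≤ shell x})) := by
          rw [Finset.sum_add_distrib, add_add_add_comm]
      _ ≤ _ := by
          refine add_le_add ((Finset.sum_le_sum fun i _ => hin i).trans ?_) hout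
          rw [← Finset.mul_sum, mul_right_comm]
          gcongr
          rw [shellSum, Fin.sum_univ_eq_sum_range
            (fun n => ((2 : ℝ≥0∞) ^ n) ^ p * μ (shell ⁻¹' {n}) ^ (1 - p / d))]
          exact ENNReal.sum_le_tsum _
  have htail : Tendsto (fun K : ℕ => ∫⁻ x in {x | K ≤ shell x}, b x ∂μ) atTop (𝓝 0) := by
    refine tendsto_setLIntegral_zero hμ ?_
    have hanti : Antitone fun K : ℕ => {x : Fin d → ℝ | K ≤ shell x} :=
      fun K K' h x hx => le_trans h hx
    have := tendsto_measure_iInter_atTop (μ := μ) (fun K => (htailm K).nullMeasurableSet) hanti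
      ⟨0, measure_ne_top _ _⟩
    have he : ⋂ K : ℕ, {x : Fin d → ℝ | K ≤ shell x} = ∅ := by
      refine Set.eq_empty_iff_forall_notMem.2 fun x hx => ?_
      have := Set.mem_iInter.1 hx (shell x + 1)
      exact absurd this (by simp)
    rwa [he, measure_empty] at this
  have hlim := (ENNReal.Tendsto.const_mul htail (Or.inr (by norm_num : (4 : ℝ≥0∞) ≠ ∞))).const_add
    (pierceConst d p Λ * shellSum p (p / d) μ * (N : ℝ≥0∞) ^ (-(p / d)))
  rw [mul_zero, add_zero] at hlim
  exact ge_of_tendsto' hlim hK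

end Pierce

/-! ### Images of samples, and monotonicity of the mean cost. -/

section Maps

variable {Z Z' : Type*} [MeasurableSpace Z] [MeasurableSpace Z']

lemma emp_map {N : ℕ} {T : Z → Z'} (hT : Measurable T) (z : Fin N → Z) :
    (emp z).map T = emp (fun j => T (z j)) := by
  rw [emp, Measure.map_smul, Measure.map_finset_sum hT.aemeasurable, emp]
  simp_rw [Measure.map_dirac' hT]

/-- Only this inequality is needed, and it requires no measurability of `F`. -/
lemma avgEmp_map_le {T : Z → Z'} (hT : Measurable T) (F : Measure Z' → ℝ≥0∞) (N : ℕ)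
    (μ : Measure Z) [IsFiniteMeasure μ] :
    avgEmp F N (μ.map T) ≤ avgEmp (fun ν => F (ν.map T)) N μ := by
  rw [avgEmp, avgEmp]
  have h := Measure.pi_map_pi (μ := fun _ : Fin N => μ) (f := fun _ => T)
    (fun _ => hT.aemeasurable)
  rw [← h]
  refine (lintegral_map_le _ _).trans_eq (lintegral_congr fun z => ?_)
  rw [emp_map hT]

lemma meanCost_map_le {c : Z → Z → ℝ≥0∞} {c' : Z' → Z' → ℝ≥0∞} {T : Z → Z'} (hT : Measurable T)
    {K : ℝ≥0∞} (h0 : K ≠ 0) (hK : K ≠ ∞) (h : ∀ x y, c' (T x) (T y) ≤ K * c x y) (N : ℕ)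
    (μ : Measure Z) [IsFiniteMeasure μ] :
    meanCost c' N (μ.map T) ≤ K * meanCost c N μ := by
  refine (avgEmp_map_le hT _ N μ).trans ?_
  rw [meanCost, avgEmp, avgEmp, ← lintegral_const_mul' _ _ hK]
  exact lintegral_mono fun z => otCost_map_le hT h0 hK h μ (emp z)

/-- The singleton `{μ}` is closed under averages, so `avgEmp_infCost_succ_le` applies. -/
lemma meanCost_succ_le [TopologicalSpace Z] [BorelSpace Z] [SecondCountableTopology Z]
    [MeasurableSingletonClass Z] {c : Z → Z → ℝ≥0∞} {b : Z → ℝ≥0∞} (hc : GoodCost c b)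
    (μ : Measure Z) [IsProbabilityMeasure μ] (hμ : ∫⁻ z, b z ∂μ ≠ ∞) {N : ℕ} (hN : N ≠ 0) :
    meanCost c (N + 1) μ ≤ meanCost c N μ := by
  have e : ∀ n, meanCost c n μ = avgEmp (infCost c {μ}) n μ := fun n => by
    simp only [meanCost, avgEmp, infCost_singleton]
  rw [e, e]
  refine avgEmp_infCost_succ_le hN (fun ρ hρ => ?_)
    (measurable_infCost_emp hc (by simpa using hμ) N) μ
  have : ∀ j, ρ j = μ := hρ
  simp only [this, Finset.sum_const, Finset.card_univ, Fintype.card_fin, Set.mem_singleton_iff]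
  rw [← Nat.cast_smul_eq_nsmul ℝ≥0∞, smul_smul,
    ENNReal.inv_mul_cancel (by exact_mod_cast Nat.succ_ne_zero N) (ENNReal.natCast_ne_top _),
    one_smul]

/-- A decreasing mean cost, evaluated at the number of points in a set whose mean exceeds `m₀`. -/
lemma lintegral_cnt_mul_le {μ : Measure Z} [IsProbabilityMeasure μ] {N : ℕ} {B : Set Z}
    (hB : MeasurableSet B) {φ : ℕ → ℝ≥0∞} {A : ℝ≥0∞} {s : ℝ} (hs : s < 1)
    (hφ : ∀ n m, n ≠ 0 → n ≤ m → φ m ≤ φ n) (hA : ∀ n, n ≠ 0 → φ n ≤ A * (n : ℝ≥0∞) ^ (-s))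
    {m₀ : ℕ} (hm₀ : m₀ ≠ 0) (hm : (m₀ : ℝ≥0∞) < N * μ B) :
    ∫⁻ z : Fin N → Z, (cnt B z : ℝ≥0∞) * φ (cnt B z) ∂(Measure.pi fun _ => μ) ≤
      (N * μ B) * φ m₀ + A * (m₀ : ℝ≥0∞) ^ (1 - s) * (N * μ B - m₀)⁻¹ *
        (N * μ B) ^ (1 / 2 : ℝ) := by
  have hfin : (N : ℝ≥0∞) * μ B ≠ ∞ :=
    ENNReal.mul_ne_top (ENNReal.natCast_ne_top _) (measure_ne_top _ _)
  have hd0 : (N * μ B - m₀ : ℝ≥0∞) ≠ 0 := (tsub_pos_iff_lt.2 hm).ne'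
  have hdt : (N * μ B - m₀ : ℝ≥0∞) ≠ ∞ := ne_top_of_le_ne_top hfin tsub_le_self
  -- If `n ≥ m₀`, monotonicity suffices. If `n < m₀`, the rate bounds the left side by `A * m₀ ^ (1
  -- - s)`, and the deviation of `n` from its mean exceeds `N * μ B - m₀`, so the second term pays
  -- for it.
  have hpt : ∀ n : ℕ, (n : ℝ≥0∞) * φ n ≤ n * φ m₀ +
      A * (m₀ : ℝ≥0∞) ^ (1 - s) * (N * μ B - m₀)⁻¹ * adist n (N * μ B) := by
    intro n
    rcases le_or_gt m₀ n with h | h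
    · exact (mul_le_mul_of_nonneg_left (hφ _ _ hm₀ h) zero_le).trans le_self_add
    · refine le_trans ?_ le_add_self
      rcases Nat.eq_zero_or_pos n with h0 | h0
      · simp [h0]
      have hn0 : (n : ℝ≥0∞) ≠ 0 := by exact_mod_cast h0.ne'
      have hnm : (n : ℝ≥0∞) ≤ m₀ := by exact_mod_cast h.le
      calc (n : ℝ≥0∞) * φ n ≤ n * (A * (n : ℝ≥0∞) ^ (-s)) := by gcongr; exact hA n h0.ne'
        _ = A * (n : ℝ≥0∞) ^ (1 - s) := by
            rw [sub_eq_add_neg, ENNReal.rpow_add _ _ hn0 (ENNReal.natCast_ne_top _),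
              ENNReal.rpow_one]; ring
        _ ≤ A * (m₀ : ℝ≥0∞) ^ (1 - s) * 1 := by
            rw [mul_one]
            gcongr
        _ = A * (m₀ : ℝ≥0∞) ^ (1 - s) * ((N * μ B - m₀)⁻¹ * (N * μ B - m₀)) := by
            rw [ENNReal.inv_mul_cancel hd0 hdt]
        _ ≤ A * (m₀ : ℝ≥0∞) ^ (1 - s) * ((N * μ B - m₀)⁻¹ * adist n (N * μ B)) := by
            gcongr
            refine le_trans ?_ le_add_self
            gcongr
        _ = _ := by ring
  have hm1 : Measurable fun z : Fin N → Z => (cnt B z : ℝ≥0∞) := measurable_comp_cnt hB _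
  calc _ ≤ ∫⁻ z : Fin N → Z, ((cnt B z : ℝ≥0∞) * φ m₀ +
        A * (m₀ : ℝ≥0∞) ^ (1 - s) * (N * μ B - m₀)⁻¹ * adist (cnt B z) (N * μ B))
        ∂(Measure.pi fun _ => μ) := lintegral_mono fun z => hpt _
    _ = (N * μ B) * φ m₀ + A * (m₀ : ℝ≥0∞) ^ (1 - s) * (N * μ B - m₀)⁻¹ *
        ∫⁻ z : Fin N → Z, adist (cnt B z) (N * μ B) ∂(Measure.pi fun _ => μ) := by
        rw [lintegral_add_left (hm1.mul_const _), lintegral_mul_const _ hm1, lintegral_cnt μ hB,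
          lintegral_const_mul _ (measurable_adist_cnt hB _)]
    _ ≤ _ := by
        gcongr
        exact lintegral_adist_cnt_le μ hB

end Maps

/-! ### Uniform distributions on cubes and affine scaling. -/

section Cubes

variable {d : ℕ}

/-- The affine map that carries the unit cube to the cube with corner `a` and edge length `l`. -/
def cubeMap (a : Fin d → ℝ) (l : ℝ) (x : Fin d → ℝ) : Fin d → ℝ := a + l • x

lemma measurable_cubeMap (a : Fin d → ℝ) (l : ℝ) : Measurable (cubeMap a l) := by
  unfold cubeMap; fun_prop

lemma volume_cube (a : Fin d → ℝ) (l : ℝ) : volume (cube a l) = ENNReal.ofReal l ^ d := by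
  rw [cube, Real.volume_pi_Ico]
  simp

lemma volume_cube_ne_zero (a : Fin d → ℝ) {l : ℝ} (hl : 0 < l) : volume (cube a l) ≠ 0 := by
  rw [volume_cube]
  exact pow_ne_zero _ (ENNReal.ofReal_pos.2 hl).ne'

lemma volume_cube_ne_top (a : Fin d → ℝ) (l : ℝ) : volume (cube a l) ≠ ∞ := by
  rw [volume_cube]
  exact ENNReal.pow_ne_top ENNReal.ofReal_ne_top

lemma uniform_eq_cond (A : Set (Fin d → ℝ)) : uniform A = ProbabilityTheory.cond volume A := rfl

lemma isProbabilityMeasure_uniform_cube (a : Fin d → ℝ) {l : ℝ} (hl : 0 < l) :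
    IsProbabilityMeasure (uniform (cube a l)) :=
  ProbabilityTheory.cond_isProbabilityMeasure_of_finite (volume_cube_ne_zero a hl)
    (volume_cube_ne_top a l)

instance : IsProbabilityMeasure (unifCube d) := isProbabilityMeasure_uniform_cube 0 one_pos

lemma unifCube_eq : unifCube d = volume.restrict (cube 0 1) := by
  rw [unifCube, uniform, volume_cube]; simp

lemma cubeMap_preimage (a b : Fin d → ℝ) {l : ℝ} (hl : 0 < l) (r : ℝ) :
    cubeMap a l ⁻¹' (cube b r) = cube (l⁻¹ • (b - a)) (l⁻¹ * r) := by
  ext x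
  simp only [cubeMap, cube, Set.mem_preimage, Set.mem_univ_pi, Set.mem_Ico, Pi.add_apply,
    Pi.smul_apply, Pi.sub_apply, smul_eq_mul]
  refine forall_congr' fun i => ?_
  rw [inv_mul_le_iff₀ hl, ← mul_add, lt_inv_mul_iff₀ hl]
  constructor <;> rintro ⟨h1, h2⟩ <;> constructor <;> linarith

lemma map_cubeMap_volume (a : Fin d → ℝ) {l : ℝ} (hl : 0 < l) :
    (volume : Measure (Fin d → ℝ)).map (cubeMap a l) = (ENNReal.ofReal l ^ d)⁻¹ • volume := by
  have h1 : cubeMap a l = (fun x => a + x) ∘ (fun x => l • x) := rfl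
  rw [h1, ← Measure.map_map (by fun_prop) (by fun_prop), Measure.map_addHaar_smul _ hl.ne',
    Measure.map_smul, (measurePreserving_add_left volume a).map_eq]
  congr 1
  rw [Module.finrank_fin_fun, abs_of_pos (by positivity), ENNReal.ofReal_inv_of_pos (by positivity),
    ENNReal.ofReal_pow hl.le]

lemma map_cubeMap_uniform (a b : Fin d → ℝ) {l : ℝ} (hl : 0 < l) (r : ℝ) (hr : 0 < r) :
    (uniform (cube b r)).map (cubeMap a l) = uniform (cube (a + l • b) (l * r)) := by
  have hpre : cube b r = cubeMap a l ⁻¹' (cube (a + l • b) (l * r)) := by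
    rw [cubeMap_preimage _ _ hl, add_sub_cancel_left, smul_smul, ← mul_assoc,
      inv_mul_cancel₀ hl.ne', one_mul, one_smul]
  rw [uniform, uniform, Measure.map_smul]
  conv_lhs => rw [hpre]
  rw [← Measure.restrict_map (measurable_cubeMap a l) (measurableSet_cube _ _),
    map_cubeMap_volume a hl, Measure.restrict_smul, smul_smul, ← hpre, volume_cube, volume_cube,
    ENNReal.ofReal_mul hl.le, mul_pow, ENNReal.mul_inv (Or.inr (ENNReal.pow_ne_top
      ENNReal.ofReal_ne_top)) (Or.inr (pow_ne_zero _ (ENNReal.ofReal_pos.2 hr).ne')), mul_comm]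

lemma uniform_cube_eq_map (a : Fin d → ℝ) {l : ℝ} (hl : 0 < l) :
    uniform (cube a l) = (unifCube d).map (cubeMap a l) := by
  rw [unifCube, map_cubeMap_uniform a 0 hl 1 one_pos]
  simp

lemma unifCube_eq_map (a : Fin d → ℝ) {l : ℝ} (hl : 0 < l) :
    unifCube d = (uniform (cube a l)).map (cubeMap (-(l⁻¹ • a)) l⁻¹) := by
  rw [map_cubeMap_uniform _ _ (inv_pos.2 hl) _ hl, unifCube, inv_mul_cancel₀ hl.ne']
  simp

lemma normCost_cubeMap {nrm : Seminorm ℝ (Fin d → ℝ)} {p : ℝ} (hp : 0 ≤ p) (a : Fin d → ℝ) {l : ℝ}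
    (hl : 0 < l) (x y : Fin d → ℝ) :
    normCost nrm p (cubeMap a l x) (cubeMap a l y) = ENNReal.ofReal l ^ p * normCost nrm p x y := by
  have : cubeMap a l x - cubeMap a l y = l • (x - y) := by
    simp [cubeMap, smul_sub]
  rw [normCost, this, map_smul_eq_mul, Real.norm_of_nonneg hl.le, ENNReal.ofReal_mul hl.le,
    ENNReal.mul_rpow_of_nonneg _ _ hp, normCost]

lemma ofReal_rpow_ne_zero {l p : ℝ} (hl : 0 < l) : ENNReal.ofReal l ^ p ≠ 0 := by
  rw [ENNReal.ofReal_rpow_of_pos hl]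
  exact (ENNReal.ofReal_pos.2 (Real.rpow_pos_of_pos hl _)).ne'

lemma ofReal_rpow_ne_top {l p : ℝ} (hl : 0 < l) : ENNReal.ofReal l ^ p ≠ ∞ := by
  rw [ENNReal.ofReal_rpow_of_pos hl]
  exact ENNReal.ofReal_ne_top

lemma meanCost_uniform_cube_le {nrm : Seminorm ℝ (Fin d → ℝ)} {p : ℝ} (hp : 0 ≤ p)
    (a : Fin d → ℝ) {l : ℝ} (hl : 0 < l) (N : ℕ) :
    meanCost (normCost nrm p) N (uniform (cube a l)) ≤
      ENNReal.ofReal l ^ p * meanCost (normCost nrm p) N (unifCube d) := by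
  rw [uniform_cube_eq_map a hl]
  exact meanCost_map_le (measurable_cubeMap a l) (ofReal_rpow_ne_zero hl) (ofReal_rpow_ne_top hl)
    (fun x y => (normCost_cubeMap hp a hl x y).le) N _

lemma cond_congr_restrict {Z : Type*} [MeasurableSpace Z] {μ ν : Measure Z} {B : Set Z} {t : ℝ≥0∞}
    (ht : t ≠ 0) (ht' : t ≠ ∞) (h : μ.restrict B = t • ν.restrict B) :
    ProbabilityTheory.cond μ B = ProbabilityTheory.cond ν B := by
  have hm : μ B = t * ν B := by
    have := congrArg (fun m => m Set.univ) h
    simpa using this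
  rw [ProbabilityTheory.cond, ProbabilityTheory.cond, h, hm, smul_smul,
    ENNReal.mul_inv (Or.inl ht) (Or.inl ht'), mul_right_comm, ENNReal.inv_mul_cancel ht ht',
    one_mul]

end Cubes

/-! ### Criteria for the existence of limits. -/

section Convergence

/-- Choose `m` with `v m` close to the liminf; there are arbitrarily large such `m`, so `δ m` may be
made small as well. Then let `ε` tend to zero. -/
lemma limsup_le_liminf_of_forall_eventually_le {u v : ℕ → ℝ≥0∞}
    (h : ∀ ε : ℝ, 0 < ε → ∃ δ : ℕ → ℝ≥0∞, Tendsto δ atTop (𝓝 0) ∧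
      ∀ m, m ≠ 0 → ∀ᶠ N in atTop, u N ≤ ENNReal.ofReal (1 + ε) * v m + δ m) :
    limsup u atTop ≤ liminf v atTop := by
  refine le_of_forall_gt_imp_ge_of_dense fun L hL => ?_
  have key : ∀ ε : ℝ, 0 < ε → limsup u atTop ≤ ENNReal.ofReal (1 + ε) * L := by
    intro ε hε
    obtain ⟨δ, hδ, hm⟩ := h ε hε
    have hfreq : ∃ᶠ m in atTop, v m < L := frequently_lt_of_liminf_lt (h := hL)
    have hfreq' : ∃ᶠ m in atTop, limsup u atTop ≤ ENNReal.ofReal (1 + ε) * L + δ m := by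
      refine (hfreq.and_eventually (eventually_ne_atTop 0)).mono fun m hm' => ?_
      refine (limsup_le_of_le (h := hm m hm'.2)).trans ?_
      gcongr
      exact hm'.1.le
    have hlim : Tendsto (fun m => ENNReal.ofReal (1 + ε) * L + δ m) atTop
        (𝓝 (ENNReal.ofReal (1 + ε) * L + 0)) := hδ.const_add _
    rw [add_zero] at hlim
    by_contra hcon
    rw [not_le] at hcon
    exact hfreq' ((hlim.eventually_lt_const hcon).mono fun m hm => not_le.2 hm)
  have hlim : Tendsto (fun ε : ℝ => ENNReal.ofReal (1 + ε) * L) (𝓝[>] 0)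
      (𝓝 (ENNReal.ofReal (1 + 0) * L)) := by
    refine ENNReal.Tendsto.mul_const ?_ (Or.inl (by simp))
    refine (ENNReal.continuous_ofReal.tendsto _).comp ?_
    exact (tendsto_const_nhds.add tendsto_id).mono_left nhdsWithin_le_nhds
  rw [add_zero, ENNReal.ofReal_one, one_mul] at hlim
  exact ge_of_tendsto hlim (eventually_mem_nhdsWithin.mono fun ε hε => key ε hε)

lemma exists_tendsto_of_limsup_le_liminf {u : ℕ → ℝ≥0∞} (h : limsup u atTop ≤ liminf u atTop) :
    Tendsto u atTop (𝓝 (limsup u atTop)) :=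
  tendsto_of_le_liminf_of_limsup_le h le_rfl

/-- Every large `N` is close to a given multiple of a `d`-th power. -/
lemma eventually_exists_div_pow {d : ℕ} (hd : d ≠ 0) {t η : ℝ} (ht : 0 < t) (hη : 0 < η) :
    ∀ᶠ N : ℕ in atTop, ∃ k : ℕ, k ≠ 0 ∧ t ≤ (N : ℝ) / (k : ℝ) ^ d ∧
      (N : ℝ) / (k : ℝ) ^ d ≤ t * (1 + η) := by
  have hlim : Tendsto (fun k : ℕ => (((k : ℝ) + 1) / k) ^ d) atTop (𝓝 1) := by
    have h1 : Tendsto (fun k : ℕ => 1 + 1 / (k : ℝ)) atTop (𝓝 (1 + 0)) :=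
      tendsto_const_nhds.add tendsto_one_div_atTop_nhds_zero_nat
    have h2 := h1.pow d
    rw [add_zero, one_pow] at h2
    refine h2.congr' ?_
    filter_upwards [eventually_ne_atTop 0] with k hk
    have : (k : ℝ) ≠ 0 := by exact_mod_cast hk
    congr 1
    field_simp
  obtain ⟨k₀, hk₀⟩ := eventually_atTop.1
    ((hlim.eventually_le_const (show (1 : ℝ) < 1 + η by linarith)).and (eventually_ne_atTop 0))
  filter_upwards [eventually_ge_atTop ⌈t * ((k₀ : ℝ) + 1) ^ d⌉₊] with N hN
  have hN' : t * ((k₀ : ℝ) + 1) ^ d ≤ N := (Nat.le_ceil _).trans (by exact_mod_cast hN)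
  -- With `k = ⌊x⌋`, the quotient `N / k ^ d` is at least `t` and exceeds it by at most the factor
  -- `((k + 1) / k) ^ d`, which tends to one.
  set x : ℝ := ((N : ℝ) / t) ^ (1 / (d : ℝ)) with hx
  have hd' : (0 : ℝ) < d := by positivity
  have hNt : 0 ≤ (N : ℝ) / t := by positivity
  have hxd : x ^ d = N / t := by
    rw [hx, ← Real.rpow_natCast, ← Real.rpow_mul hNt, one_div, inv_mul_cancel₀ hd'.ne',
      Real.rpow_one]
  have hx0 : 0 ≤ x := by positivity
  have hkx : (k₀ : ℝ) + 1 ≤ x := by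
    rw [← pow_le_pow_iff_left₀ (by positivity) hx0 hd, hxd, le_div_iff₀ ht]
    linarith
  set k := ⌊x⌋₊ with hk
  have hkk : k₀ ≤ k := by
    refine Nat.le_floor ?_
    linarith
  obtain ⟨h1, h2⟩ := hk₀ k hkk
  have hkpos : (0 : ℝ) < k := by positivity
  have hle : (k : ℝ) ≤ x := Nat.floor_le hx0
  have hlt : x < k + 1 := Nat.lt_floor_add_one x
  refine ⟨k, h2, ?_, ?_⟩
  · rw [le_div_iff₀ (by positivity)]
    have : (k : ℝ) ^ d ≤ N / t := hxd ▸ pow_le_pow_left₀ hkpos.le hle d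
    rw [le_div_iff₀ ht] at this
    linarith
  · have h3 : (N : ℝ) / t ≤ (k + 1 : ℝ) ^ d := hxd ▸ pow_le_pow_left₀ hx0 hlt.le d
    rw [div_le_iff₀ ht] at h3
    rw [div_pow, div_le_iff₀ (by positivity)] at h1
    rw [div_le_iff₀ (by positivity)]
    nlinarith

end Convergence

/-! ### The uniform distribution: comparing `N` points with `m₀` points per cell. -/

section UniformLimit

variable {d : ℕ} {nrm : Seminorm ℝ (Fin d → ℝ)} {p Λ : ℝ}

lemma unifCube_compl : unifCube d (cube 0 1)ᶜ = 0 := by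
  rw [unifCube_eq, Measure.restrict_apply (measurableSet_cube _ _).compl]
  simp

/-- A cell of the grid of edge length `1 / k` is either null or a translate of the small cube. -/
lemma unifCube_gridLabel {k K : ℕ} (hk : k ≠ 0) (hkK : k ≤ K + 1) (v : Fin d → Fin (K + 1)) :
    unifCube d (gridLabel 0 (1 / (k : ℝ)) K ⁻¹' {v}) = 0 ∨
    (unifCube d (gridLabel 0 (1 / (k : ℝ)) K ⁻¹' {v}) = ((k : ℝ≥0∞) ^ d)⁻¹ ∧
      ∃ a, ProbabilityTheory.cond (unifCube d) (gridLabel 0 (1 / (k : ℝ)) K ⁻¹' {v}) =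
        uniform (cube a (1 / (k : ℝ)))) := by
  set B := gridLabel (d := d) 0 (1 / (k : ℝ)) K ⁻¹' {v} with hB
  have hBm : MeasurableSet B := measurable_gridLabel _ _ _ (measurableSet_singleton v)
  have hk0 : (0 : ℝ) < k := by positivity
  have hr : 0 < 1 / (k : ℝ) := by positivity
  have hsub : cube (0 : Fin d → ℝ) 1 ⊆ cube 0 ((K + 1) * (1 / (k : ℝ))) := by
    intro x hx i _
    have := hx i (Set.mem_univ i)
    refine ⟨this.1, this.2.trans_le ?_⟩
    have : (k : ℝ) ≤ K + 1 := by exact_mod_cast hkK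
    have : (1 : ℝ) ≤ (K + 1) * (1 / k) := by rw [mul_one_div, le_div_iff₀ hk0]; linarith
    simpa using this
  by_cases hv : ∀ i, (v i : ℕ) < k
  · right
    set a : Fin d → ℝ := fun i => (v i : ℝ) / k with ha
    have hint : cube 0 1 ∩ B = cube a (1 / (k : ℝ)) := by
      ext x
      constructor
      · rintro ⟨hx, hxB⟩ i _
        obtain ⟨h1, h2⟩ := gridLabel_bounds hr (hsub hx) i
        have hxB' : gridLabel 0 (1 / (k : ℝ)) K x = v := hxB
        rw [hxB'] at h1 h2
        simp only [ha, Pi.zero_apply, sub_zero] at h1 h2 ⊢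
        refine ⟨by linarith [mul_one_div (v i : ℝ) k], ?_⟩
        have : ((v i : ℕ) + 1 : ℝ) * (1 / k) = (v i : ℝ) / k + 1 / k := by ring
        linarith
      · intro hx
        have hx1 : x ∈ cube (0 : Fin d → ℝ) 1 := by
          intro i _
          obtain ⟨h1, h2⟩ := hx i (Set.mem_univ i)
          refine ⟨le_trans (by simp only [ha, Pi.zero_apply]; positivity) h1, h2.trans_le ?_⟩
          have : (v i : ℝ) + 1 ≤ k := by exact_mod_cast hv i
          simp only [ha, Pi.zero_apply, zero_add]
          rw [← add_div, div_le_one hk0]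
          exact this
        refine ⟨hx1, ?_⟩
        change gridLabel 0 (1 / (k : ℝ)) K x = v
        funext i
        obtain ⟨h1, h2⟩ := gridLabel_bounds hr (hsub hx1) i
        obtain ⟨h3, h4⟩ := hx i (Set.mem_univ i)
        simp only [ha, Pi.zero_apply, sub_zero] at h1 h2 h3 h4
        set g := gridLabel 0 (1 / (k : ℝ)) K x i
        have e1 : (g : ℝ) < (v i : ℝ) + 1 := by
          rw [mul_one_div] at h1
          rw [← add_div] at h4
          exact (div_lt_div_iff_of_pos_right hk0).1 (h1.trans_lt h4)
        have e2 : (v i : ℝ) < (g : ℝ) + 1 := by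
          rw [mul_one_div] at h2
          exact (div_lt_div_iff_of_pos_right hk0).1 (h3.trans_lt h2)
        apply Fin.ext
        have e1' : (g : ℕ) < v i + 1 := by exact_mod_cast e1
        have e2' : (v i : ℕ) < g + 1 := by exact_mod_cast e2
        omega
    refine ⟨?_, a, ?_⟩
    · rw [unifCube_eq, Measure.restrict_apply hBm, Set.inter_comm, hint, volume_cube,
        ENNReal.ofReal_div_of_pos hk0, ENNReal.ofReal_one, ENNReal.ofReal_natCast, one_div,
        ENNReal.inv_pow]
    · rw [unifCube, uniform_eq_cond, ProbabilityTheory.cond_cond_eq_cond_inter'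
        (measurableSet_cube _ _) hBm (volume_cube_ne_top _ _), hint, uniform_eq_cond]
  · left
    push Not at hv
    obtain ⟨i, hi⟩ := hv
    rw [unifCube_eq, Measure.restrict_apply hBm]
    have : B ∩ cube 0 1 = ∅ := by
      refine Set.eq_empty_iff_forall_notMem.2 fun x hx => ?_
      obtain ⟨h1, -⟩ := gridLabel_bounds hr (hsub hx.2) i
      have hxB' : gridLabel 0 (1 / (k : ℝ)) K x = v := hx.1
      rw [hxB'] at h1
      have h2 := (hx.2 i (Set.mem_univ i)).2
      simp only [Pi.zero_apply, sub_zero, zero_add] at h1 h2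
      rw [mul_one_div, div_le_iff₀ hk0] at h1
      have : (k : ℝ) ≤ v i := by exact_mod_cast hi
      nlinarith
    rw [this, measure_empty]

lemma lintegral_normBound_unifCube (hp : 0 ≤ p) (hΛ0 : 0 ≤ Λ) :
    ∫⁻ x, normBound Λ p x ∂(unifCube d) ≠ ∞ :=
  lintegral_normBound_ne_top_of_cube hp hΛ0 zero_le_one unifCube_compl

lemma meanCost_unif_antitone (hp : 0 < p) (hΛ : ∀ x, nrm x ≤ Λ * ‖x‖) (hΛ0 : 0 ≤ Λ)
    {n m : ℕ} (hn : n ≠ 0) (hnm : n ≤ m) :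
    meanCost (normCost nrm p) m (unifCube d) ≤ meanCost (normCost nrm p) n (unifCube d) := by
  induction m, hnm using Nat.le_induction with
  | base => exact le_rfl
  | succ m hm ih =>
    exact (meanCost_succ_le (goodCost_normCost hp hΛ hΛ0) _
      (lintegral_normBound_unifCube hp.le hΛ0) (by omega)).trans ih

lemma meanCost_unif_le (hp : 0 < p) (hpd : p < (d : ℝ) / 2) (hΛ : ∀ x, nrm x ≤ Λ * ‖x‖)
    (hΛ0 : 0 ≤ Λ) {N : ℕ} (hN : N ≠ 0) :
    meanCost (normCost nrm p) N (unifCube d) ≤ cubeConst d p Λ * (N : ℝ≥0∞) ^ (-(p / d)) := by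
  have := meanCost_le_cube hp hpd hΛ hΛ0 one_pos (unifCube d) unifCube_compl hN
  simpa using this

/-- The mean cost of `N` points is bounded by the mean cost of `m₀` points in each of `k ^ d`
cells. -/
lemma meanCost_unif_recursion (hp : 0 < p) (hpd : p < (d : ℝ) / 2) (hΛ : ∀ x, nrm x ≤ Λ * ‖x‖)
    (hΛ0 : 0 ≤ Λ) {N k m₀ : ℕ} (hk : k ≠ 0) (hm₀ : m₀ ≠ 0) {m : ℝ≥0∞}
    (hm : m = N * ((k : ℝ≥0∞) ^ d)⁻¹) (hmm : (m₀ : ℝ≥0∞) < m) :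
    (N : ℝ≥0∞) ^ (p / d) * meanCost (normCost nrm p) N (unifCube d) ≤
      m ^ (p / d) * (meanCost (normCost nrm p) m₀ (unifCube d) +
        (cubeConst d p Λ * (m₀ : ℝ≥0∞) ^ (1 - p / d) * (m - m₀)⁻¹ +
          fluctConst d p Λ * 2 ^ ((d : ℝ) / 2)) * m ^ (-(1 / 2) : ℝ)) := by
  have hd : 0 < (d : ℝ) := by linarith
  have hs0 : 0 ≤ p / d := by positivity
  have hs2 : p / d < 1 / 2 := by rw [div_lt_iff₀ hd]; linarith
  have hkE : (k : ℝ≥0∞) ≠ 0 := by exact_mod_cast hk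
  have hkt := ENNReal.natCast_ne_top k
  have hm0 : m ≠ 0 := (zero_le.trans_lt hmm).ne'
  have hN : N ≠ 0 := by
    rintro rfl
    simp [hm] at hm0
  have hNE : (N : ℝ≥0∞) ≠ 0 := by exact_mod_cast hN
  have hNt := ENNReal.natCast_ne_top N
  have hkd0 : (k : ℝ≥0∞) ^ d ≠ 0 := pow_ne_zero _ hkE
  have hkdt : (k : ℝ≥0∞) ^ d ≠ ∞ := ENNReal.pow_ne_top hkt
  have hmt : m ≠ ∞ := hm ▸ ENNReal.mul_ne_top hNt (ENNReal.inv_ne_top.2 hkd0)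
  have hmd0 : m - m₀ ≠ 0 := (tsub_pos_iff_lt.2 hmm).ne'
  set φ : ℕ → ℝ≥0∞ := fun n => meanCost (normCost nrm p) n (unifCube d) with hφ
  set A := cubeConst d p Λ
  -- The grid estimate needs a dyadic number of cells, so the `k`-grid is extended beyond the unit
  -- cube to `2 ^ J` cells per side. The additional cells are null, and `2 ^ J ≤ 2 * k` costs only
  -- the factor `2 ^ (d / 2)`.
  set J := Nat.clog 2 k with hJ
  have hJ1 : k ≤ 2 ^ J := Nat.le_pow_clog (by norm_num) k
  have hJ2 : 2 ^ J ≤ 2 * k := by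
    rcases Nat.lt_or_ge 1 k with h | h
    · have h1 := Nat.pow_pred_clog_lt_self (b := 2) (by norm_num) h
      have hpos : 0 < J := Nat.clog_pos (by norm_num) (by omega)
      have : 2 ^ J = 2 ^ (J - 1) * 2 := by
        rw [← pow_succ]; congr 1; omega
      rw [this]
      have h1' : 2 ^ (J - 1) < k := h1
      omega
    · have : k = 1 := by omega
      simp [hJ, this]
  set r : ℝ := 1 / (k : ℝ) with hr
  have hk0 : (0 : ℝ) < k := by positivity
  have hr0 : 0 < r := by positivity
  have hK : ((2 ^ J - 1 : ℕ) : ℝ) + 1 = 2 ^ J := by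
    have : 1 ≤ 2 ^ J := Nat.one_le_two_pow
    rw [Nat.cast_sub this]; push_cast; ring
  have hsub : cube (0 : Fin d → ℝ) 1 ⊆ cube 0 (2 ^ J * r) := by
    intro x hx i _
    have h := hx i (Set.mem_univ i)
    refine ⟨h.1, h.2.trans_le ?_⟩
    have h1 : (k : ℝ) ≤ 2 ^ J := by exact_mod_cast hJ1
    have h2 : (1 : ℝ) ≤ 2 ^ J * r := by rw [hr, mul_one_div, le_div_iff₀ hk0]; linarith
    simpa using h2
  have main := meanCost_le_grid hp hΛ hΛ0 hr0 (J := J) (unifCube d) (a := 0)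
    (measure_mono_null (Set.compl_subset_compl.2 hsub) unifCube_compl)
    (lintegral_normBound_unifCube hp.le hΛ0) hN
  set K := 2 ^ J - 1 with hKd
  have hkK : k ≤ K + 1 := by have : 1 ≤ 2 ^ J := Nat.one_le_two_pow
                             omega
  have hrk : ENNReal.ofReal r = (k : ℝ≥0∞)⁻¹ := by
    rw [hr, ENNReal.ofReal_div_of_pos hk0, ENNReal.ofReal_one, ENNReal.ofReal_natCast, one_div]
  -- The bound of `lintegral_cnt_mul_le`; it is the same for all nonnull cells, since each has mean
  -- number of points `m`.
  set X := m * φ m₀ + A * (m₀ : ℝ≥0∞) ^ (1 - p / d) * (m - m₀)⁻¹ * m ^ (1 / 2 : ℝ) with hX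
  have hcell : ∀ v, cellMean (normCost nrm p) N (unifCube d) (gridLabel 0 r K ⁻¹' {v}) ≤
      unifCube d (gridLabel 0 r K ⁻¹' {v}) * (ENNReal.ofReal r ^ p * (m⁻¹ * X)) := by
    intro v
    have hBm : MeasurableSet (gridLabel (d := d) 0 r K ⁻¹' {v}) :=
      measurable_gridLabel _ _ _ (measurableSet_singleton v)
    rcases unifCube_gridLabel hk hkK v with h0 | ⟨h1, a, ha⟩
    · rw [h0, zero_mul]
      refine (cellMean_le hBm (G := fun _ => 0) fun n _ h => absurd h0 h).trans ?_
      simp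
    · have hmB : (N : ℝ≥0∞) * unifCube d (gridLabel 0 r K ⁻¹' {v}) = m := by rw [h1, hm]
      have hcm : Measurable fun z : Fin N → Fin d → ℝ =>
          (cnt (gridLabel 0 r K ⁻¹' {v}) z : ℝ≥0∞) * φ (cnt (gridLabel 0 r K ⁻¹' {v}) z) :=
        measurable_comp_cnt hBm (fun n => (n : ℝ≥0∞) * φ n)
      have hNm : (N : ℝ≥0∞)⁻¹ = unifCube d (gridLabel 0 r K ⁻¹' {v}) * m⁻¹ := by
        rw [h1, hm, ENNReal.mul_inv (Or.inl hNE) (Or.inl hNt), inv_inv, mul_left_comm,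
          ENNReal.inv_mul_cancel hkd0 hkdt, mul_one]
      calc _ ≤ _ := cellMean_le hBm (G := fun n => ENNReal.ofReal r ^ p * φ n) (fun n _ _ => by
            rw [ha]
            exact meanCost_uniform_cube_le hp.le a hr0 n)
        _ = (N : ℝ≥0∞)⁻¹ * ENNReal.ofReal r ^ p * ∫⁻ z : Fin N → Fin d → ℝ,
            (cnt (gridLabel 0 r K ⁻¹' {v}) z : ℝ≥0∞) * φ (cnt (gridLabel 0 r K ⁻¹' {v}) z)
            ∂(Measure.pi fun _ => unifCube d) := by
            rw [← lintegral_const_mul _ hcm]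
            refine lintegral_congr fun z => ?_
            ring
        _ ≤ (N : ℝ≥0∞)⁻¹ * ENNReal.ofReal r ^ p * X := by
            gcongr
            have := lintegral_cnt_mul_le (μ := unifCube d) (N := N) hBm (φ := φ) (A := A)
              (s := p / d) (by linarith)
              (fun n m hn hnm => meanCost_unif_antitone hp hΛ hΛ0 hn hnm)
              (fun n hn => meanCost_unif_le hp hpd hΛ hΛ0 hn) hm₀ (hmB.symm ▸ hmm)
            rwa [hmB] at this
        _ = _ := by rw [hNm]; ring
  have hrs : (N : ℝ≥0∞) ^ (p / d) * ENNReal.ofReal r ^ p = m ^ (p / d) := by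
    rw [hm, ENNReal.mul_rpow_of_nonneg _ _ hs0, hrk]
    congr 1
    rw [ENNReal.inv_rpow, ENNReal.inv_rpow, ← ENNReal.rpow_natCast, ← ENNReal.rpow_mul,
      mul_div_cancel₀ _ hd.ne']
  have hJm : (2 : ℝ≥0∞) ^ ((J : ℝ) * ((d : ℝ) / 2)) * (N : ℝ≥0∞) ^ (-(1 / 2) : ℝ) ≤
      2 ^ ((d : ℝ) / 2) * m ^ (-(1 / 2) : ℝ) := by
    have e1 : (2 : ℝ≥0∞) ^ ((J : ℝ) * ((d : ℝ) / 2)) ≤ (2 * k : ℝ≥0∞) ^ ((d : ℝ) / 2) := by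
      rw [ENNReal.rpow_mul, ENNReal.rpow_natCast]
      exact ENNReal.rpow_le_rpow (by exact_mod_cast hJ2) (by positivity)
    refine (mul_le_mul' e1 le_rfl).trans_eq ?_
    rw [ENNReal.mul_rpow_of_nonneg _ _ (by positivity), mul_assoc, hm,
      ENNReal.mul_rpow_of_ne_top hNt (ENNReal.inv_ne_top.2 hkd0), mul_comm ((k : ℝ≥0∞) ^ _)]
    congr 2
    rw [ENNReal.inv_rpow, ← ENNReal.rpow_neg, neg_neg, ← ENNReal.rpow_natCast, ← ENNReal.rpow_mul]
    congr 1
    ring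
  have hmX : m⁻¹ * X = φ m₀ + A * (m₀ : ℝ≥0∞) ^ (1 - p / d) * (m - m₀)⁻¹ * m ^ (-(1 / 2) : ℝ) := by
    have e : m⁻¹ * m ^ (1 / 2 : ℝ) = m ^ (-(1 / 2) : ℝ) := by
      rw [← ENNReal.rpow_neg_one, ← ENNReal.rpow_add _ _ hm0 hmt]
      norm_num
    rw [hX, mul_add, ← mul_assoc, ENNReal.inv_mul_cancel hm0 hmt, one_mul, ← e]
    ring
  calc (N : ℝ≥0∞) ^ (p / d) * meanCost (normCost nrm p) N (unifCube d)
      ≤ (N : ℝ≥0∞) ^ (p / d) * (ENNReal.ofReal r ^ p * (m⁻¹ * X) +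
          fluctConst d p Λ * ENNReal.ofReal r ^ p * (2 ^ ((d : ℝ) / 2) * m ^ (-(1 / 2) : ℝ))) := by
        gcongr
        refine main.trans (add_le_add ?_ ?_)
        · refine (Finset.sum_le_sum fun v _ => hcell v).trans_eq ?_
          rw [← Finset.sum_mul, sum_measure_fiber _ (measurable_gridLabel 0 r K), measure_univ,
            one_mul]
        · rw [mul_assoc]
          gcongr
    _ = ((N : ℝ≥0∞) ^ (p / d) * ENNReal.ofReal r ^ p) * (m⁻¹ * X +
          fluctConst d p Λ * (2 ^ ((d : ℝ) / 2) * m ^ (-(1 / 2) : ℝ))) := by ring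
    _ = _ := by
        rw [hrs, hmX]
        ring

end UniformLimit

/-! ### Existence of the constant for the uniform distribution. -/

section UniformConstant

variable {d : ℕ} {nrm : Seminorm ℝ (Fin d → ℝ)} {p Λ : ℝ}

lemma natCast_div_pow_eq (N : ℕ) {k : ℕ} (hk : k ≠ 0) (d : ℕ) :
    (N : ℝ≥0∞) * ((k : ℝ≥0∞) ^ d)⁻¹ = ENNReal.ofReal ((N : ℝ) / (k : ℝ) ^ d) := by
  rw [ENNReal.ofReal_div_of_pos (by positivity), ENNReal.ofReal_natCast,
    ENNReal.ofReal_pow (by positivity), ENNReal.ofReal_natCast, div_eq_mul_inv]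

lemma tendsto_natCast_rpow_neg {s : ℝ} (hs : s < 0) :
    Tendsto (fun n : ℕ => (n : ℝ≥0∞) ^ s) atTop (𝓝 0) := by
  have h := (ENNReal.continuous_rpow_const (y := -s)).tendsto ∞
  rw [ENNReal.top_rpow_of_pos (by linarith)] at h
  have h2 := (tendsto_inv_iff.2 (h.comp ENNReal.tendsto_nat_nhds_top))
  rw [ENNReal.inv_top] at h2
  refine h2.congr fun n => ?_
  simp [ENNReal.rpow_neg]

/-- The scaled mean costs of the uniform distribution converge. -/
lemma exists_tendsto_meanCost_unif (hp : 0 < p) (hpd : p < (d : ℝ) / 2)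
    (hΛ : ∀ x, nrm x ≤ Λ * ‖x‖) (hΛ0 : 0 ≤ Λ) :
    ∃ L, L ≤ cubeConst d p Λ ∧
      Tendsto (fun N : ℕ => (N : ℝ≥0∞) ^ (p / d) * meanCost (normCost nrm p) N (unifCube d))
        atTop (𝓝 L) := by
  have hd : 0 < (d : ℝ) := by linarith
  have hd0 : d ≠ 0 := by rintro rfl; simp at hd
  have hs0 : 0 < p / d := by positivity
  have hs2 : p / d < 1 / 2 := by rw [div_lt_iff₀ hd]; linarith
  set s := p / d with hs
  set A := cubeConst d p Λ
  have hle : ∀ N : ℕ, N ≠ 0 →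
      (N : ℝ≥0∞) ^ s * meanCost (normCost nrm p) N (unifCube d) ≤ A := by
    intro N hN
    have hNE : (N : ℝ≥0∞) ≠ 0 := by exact_mod_cast hN
    refine (mul_le_mul_of_nonneg_left (meanCost_unif_le hp hpd hΛ hΛ0 hN) zero_le).trans_eq ?_
    rw [mul_left_comm, ← ENNReal.rpow_add _ _ hNE (ENNReal.natCast_ne_top N), ← hs,
      add_neg_cancel, ENNReal.rpow_zero, mul_one]
  have hconv := exists_tendsto_of_limsup_le_liminf
    (u := fun N : ℕ => (N : ℝ≥0∞) ^ s * meanCost (normCost nrm p) N (unifCube d)) ?_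
  · exact ⟨_, le_of_tendsto hconv ((eventually_ne_atTop 0).mono fun N hN => hle N hN), hconv⟩
  refine limsup_le_liminf_of_forall_eventually_le fun ε hε => ?_
  set F := fluctConst d p Λ * 2 ^ ((d : ℝ) / 2) with hF
  have hFt : F ≠ ∞ := ENNReal.mul_ne_top (fluctConst_ne_top hp hpd) (by
    exact ENNReal.rpow_ne_top_of_nonneg (by positivity) (by norm_num))
  have hε0 : ENNReal.ofReal ε ≠ 0 := (ENNReal.ofReal_pos.2 hε).ne'
  have hεt : (ENNReal.ofReal ε)⁻¹ ≠ ∞ := ENNReal.inv_ne_top.2 hε0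
  -- The mean number `m` per cell will lie between `(1 + ε) * m₀` and `(1 + ε) ^ 2 * m₀`. Hence `m -
  -- m₀` is at least `ε * m₀`, and both error terms are of order `m₀ ^ (s - 1/2)`.
  refine ⟨fun m => (A * (ENNReal.ofReal ε)⁻¹ + F) * (m : ℝ≥0∞) ^ (s - 1 / 2), ?_, ?_⟩
  · have h := ENNReal.Tendsto.const_mul (a := A * (ENNReal.ofReal ε)⁻¹ + F)
      (tendsto_natCast_rpow_neg (s := s - 1 / 2) (by linarith)) (Or.inr (ENNReal.add_ne_top.2
        ⟨ENNReal.mul_ne_top (cubeConst_ne_top hp hpd) hεt, hFt⟩))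
    rwa [mul_zero] at h
  intro m₀ hm₀
  have hm₀r : (0 : ℝ) < m₀ := by positivity
  have hm₀E : (m₀ : ℝ≥0∞) ≠ 0 := by exact_mod_cast hm₀
  have hm₀t := ENNReal.natCast_ne_top m₀
  filter_upwards [eventually_exists_div_pow hd0 (t := (1 + ε) * m₀) (by positivity) hε]
    with N ⟨k, hk, h1, h2⟩
  set m : ℝ≥0∞ := N * ((k : ℝ≥0∞) ^ d)⁻¹ with hm
  have hm' : m = ENNReal.ofReal ((N : ℝ) / (k : ℝ) ^ d) := natCast_div_pow_eq N hk d
  have hlow : (m₀ : ℝ≥0∞) + ENNReal.ofReal ε * m₀ ≤ m := by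
    rw [hm', ← ENNReal.ofReal_natCast, ← ENNReal.ofReal_mul hε.le,
      ← ENNReal.ofReal_add (by positivity) (by positivity)]
    exact ENNReal.ofReal_le_ofReal (by linarith)
  have hup : m ≤ ENNReal.ofReal (1 + ε) ^ (2 : ℝ) * m₀ := by
    rw [hm', ENNReal.ofReal_rpow_of_pos (by positivity), ← ENNReal.ofReal_natCast,
      ← ENNReal.ofReal_mul (by positivity)]
    refine ENNReal.ofReal_le_ofReal (h2.trans_eq ?_)
    rw [Real.rpow_two]; ring
  have hεm : ENNReal.ofReal ε * m₀ ≠ 0 := mul_ne_zero hε0 hm₀E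
  have hlt : (m₀ : ℝ≥0∞) < m :=
    (ENNReal.lt_add_right hm₀t hεm).trans_le hlow
  have hdiff : ENNReal.ofReal ε * m₀ ≤ m - m₀ := by
    refine ENNReal.le_sub_of_add_le_left hm₀t hlow
  refine (meanCost_unif_recursion hp hpd hΛ hΛ0 hk hm₀ hm hlt).trans ?_
  have hm0 : m ≠ 0 := (zero_le.trans_lt hlt).ne'
  have hmt : m ≠ ∞ := hm' ▸ ENNReal.ofReal_ne_top
  rw [mul_add]
  refine add_le_add ?_ ?_
  · rw [← mul_assoc]
    gcongr
    refine (ENNReal.rpow_le_rpow hup hs0.le).trans ?_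
    rw [ENNReal.mul_rpow_of_nonneg _ _ hs0.le, ← ENNReal.rpow_mul]
    gcongr
    -- Since `2 * s < 1`, the factor lost through `m ≤ (1 + ε) ^ 2 * m₀` is at most `1 + ε`.
    calc ENNReal.ofReal (1 + ε) ^ (2 * s) ≤ ENNReal.ofReal (1 + ε) ^ (1 : ℝ) := by
          refine ENNReal.rpow_le_rpow_of_exponent_le ?_ (by linarith)
          rw [ENNReal.one_le_ofReal]; linarith
      _ = _ := ENNReal.rpow_one _
  · have e1 : A * (m₀ : ℝ≥0∞) ^ (1 - s) * (m - m₀)⁻¹ ≤ A * (ENNReal.ofReal ε)⁻¹ := by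
      rw [mul_assoc]
      gcongr
      calc (m₀ : ℝ≥0∞) ^ (1 - s) * (m - m₀)⁻¹
          ≤ (m₀ : ℝ≥0∞) ^ (1 : ℝ) * (ENNReal.ofReal ε * m₀)⁻¹ := by
            gcongr
            · exact_mod_cast Nat.one_le_iff_ne_zero.2 hm₀
            · linarith
        _ = _ := by
            rw [ENNReal.rpow_one, ENNReal.mul_inv (Or.inl hε0) (Or.inl ENNReal.ofReal_ne_top),
              mul_left_comm, ENNReal.mul_inv_cancel hm₀E hm₀t, mul_one]
    rw [mul_left_comm, ← ENNReal.rpow_add _ _ hm0 hmt, ← sub_eq_add_neg]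
    refine mul_le_mul' (by gcongr) ?_
    have e2 : s - 1 / 2 = -(1 / 2 - s) := by ring
    rw [e2, ENNReal.rpow_neg, ENNReal.rpow_neg]
    gcongr

end UniformConstant

/-! ### Grid cells, covers of compact null sets, and step functions. -/

section GridCells

variable {d : ℕ}

/-- The cell with index `v` of the grid of edge length `r`. -/
def gridCell (r : ℝ) (v : Fin d → ℤ) : Set (Fin d → ℝ) := cube (fun i => v i * r) r

/-- The index of the grid cell that contains `x`. -/
def gridIdx (r : ℝ) (x : Fin d → ℝ) : Fin d → ℤ := fun i => ⌊x i / r⌋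

/-- The union of the grid cells that meet `K`. -/
def badCells (r : ℝ) (K : Set (Fin d → ℝ)) : Set (Fin d → ℝ) :=
  {x | (gridCell r (gridIdx r x) ∩ K).Nonempty}

lemma mem_gridCell {r : ℝ} (hr : 0 < r) {v : Fin d → ℤ} {x : Fin d → ℝ} :
    x ∈ gridCell r v ↔ gridIdx r x = v := by
  simp only [gridCell, cube, gridIdx, Set.mem_univ_pi, Set.mem_Ico, funext_iff, Int.floor_eq_iff,
    le_div_iff₀ hr, div_lt_iff₀ hr, add_mul, one_mul]

lemma measurable_gridIdx (r : ℝ) : Measurable (gridIdx (d := d) r) :=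
  measurable_pi_lambda _ fun i => (((measurable_pi_apply i : Measurable fun x : Fin d → ℝ => x i)).div_const r).floor

lemma measurableSet_gridCell (r : ℝ) (v : Fin d → ℤ) : MeasurableSet (gridCell r v) :=
  measurableSet_cube _ _

lemma measurableSet_badCells (r : ℝ) (K : Set (Fin d → ℝ)) : MeasurableSet (badCells r K) :=
  measurable_gridIdx r (MeasurableSet.of_discrete (s := {v | (gridCell r v ∩ K).Nonempty}))

lemma disjoint_gridCell {r : ℝ} (hr : 0 < r) {v w : Fin d → ℤ} (h : v ≠ w) :
    Disjoint (gridCell r v) (gridCell r w) :=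
  Set.disjoint_left.2 fun _ hx hy => h (((mem_gridCell hr).1 hx).symm.trans ((mem_gridCell hr).1 hy))

lemma volume_gridCell (r : ℝ) (v : Fin d → ℤ) : volume (gridCell r v) = ENNReal.ofReal r ^ d :=
  volume_cube _ _

lemma convex_cube (a : Fin d → ℝ) (l : ℝ) : Convex ℝ (cube a l) :=
  convex_pi fun i _ => convex_Ico (a i) (a i + l)

lemma dist_le_of_mem_cube {a x y : Fin d → ℝ} {r : ℝ} (hr : 0 ≤ r) (hx : x ∈ cube a r)
    (hy : y ∈ cube a r) : dist x y ≤ r := by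
  refine (dist_pi_le_iff hr).2 fun i => ?_
  have h1 := hx i (Set.mem_univ i)
  have h2 := hy i (Set.mem_univ i)
  rw [Real.dist_eq, abs_le]
  constructor <;> linarith [h1.1, h1.2, h2.1, h2.2]

lemma finite_gridCell_inter {K : Set (Fin d → ℝ)} (hK : Bornology.IsBounded K) {r : ℝ}
    (hr : 0 < r) : {v : Fin d → ℤ | (gridCell r v ∩ K).Nonempty}.Finite := by
  obtain ⟨R, hR⟩ := hK.exists_norm_le
  refine (Set.finite_Icc (fun _ => ⌊-R / r⌋) (fun _ => ⌊R / r⌋)).subset ?_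
  rintro v ⟨x, hx, hxK⟩
  rw [mem_gridCell hr] at hx
  rw [← hx]
  have h : ∀ i, |x i| ≤ R := fun i => (norm_le_pi_norm x i).trans (hR x hxK)
  refine ⟨fun i => Int.floor_le_floor ?_, fun i => Int.floor_le_floor ?_⟩
  · exact div_le_div_of_nonneg_right (neg_le_of_abs_le (h i)) hr.le
  · exact div_le_div_of_nonneg_right (le_of_abs_le (h i)) hr.le

lemma badCells_subset_cthickening {r : ℝ} (hr : 0 < r) (K : Set (Fin d → ℝ)) :
    badCells r K ⊆ Metric.cthickening r K := by
  rintro x ⟨y, hy, hyK⟩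
  exact Metric.mem_cthickening_of_dist_le x y r K hyK
    (dist_le_of_mem_cube hr.le ((mem_gridCell hr).2 rfl) hy)

lemma subset_badCells {r : ℝ} (hr : 0 < r) (K : Set (Fin d → ℝ)) : K ⊆ badCells r K :=
  fun x hx => ⟨x, (mem_gridCell hr).2 rfl, hx⟩

/-- The cells that meet `K` lie in its closed `r`-thickening, and the thickenings of a compact set
have measure tending to that of the set. -/
lemma tendsto_volume_badCells {K : Set (Fin d → ℝ)} (hK : IsCompact K) (h0 : volume K = 0) :
    Tendsto (fun r => volume (badCells r K)) (𝓝[>] 0) (𝓝 0) := by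
  have h := (tendsto_measure_cthickening_of_isCompact (μ := volume) hK).mono_left
    (nhdsWithin_le_nhds (s := Set.Ioi 0))
  rw [h0] at h
  refine tendsto_of_tendsto_of_tendsto_of_le_of_le' tendsto_const_nhds h
    (Eventually.of_forall fun _ => zero_le) ?_
  exact eventually_mem_nhdsWithin.mono fun r hr => measure_mono (badCells_subset_cthickening hr K)

lemma badCells_eq_biUnion {r : ℝ} (hr : 0 < r) {K : Set (Fin d → ℝ)} {S : Finset (Fin d → ℤ)}
    (hS : ∀ v, v ∈ S ↔ (gridCell r v ∩ K).Nonempty) :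
    badCells r K = ⋃ v ∈ S, gridCell r v := by
  ext x
  simp only [badCells, Set.mem_ofPred_eq, Set.mem_iUnion, exists_prop]
  constructor
  · exact fun h => ⟨gridIdx r x, (hS _).2 h, (mem_gridCell hr).2 rfl⟩
  · rintro ⟨v, hv, hx⟩
    rw [(mem_gridCell hr).1 hx]
    exact (hS v).1 hv

/-- Off the frontier, the interior and the complement of the closure form a separation. -/
lemma subset_or_disjoint_of_disjoint_frontier {X : Type*} [TopologicalSpace X] {s B : Set X}
    (hs : IsPreconnected s) (h : Disjoint s (frontier B)) : s ⊆ B ∨ Disjoint s B := by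
  have hsub : s ⊆ interior B ∪ (closure B)ᶜ := by
    intro x hx
    by_cases hc : x ∈ closure B
    · by_contra hcon
      exact Set.disjoint_left.1 h hx ⟨hc, fun hi => hcon (Or.inl hi)⟩
    · exact Or.inr hc
  rcases IsPreconnected.subset_or_subset isOpen_interior isClosed_closure.isOpen_compl
    (Set.disjoint_left.2 fun x hx hx' => hx' (subset_closure (interior_subset hx))) hsub hs
    with h1 | h1
  · exact Or.inl (h1.trans interior_subset)
  · exact Or.inr (Set.disjoint_left.2 fun x hx hB => h1 hx (subset_closure hB))

/-- `g` is bounded, has bounded support, and is constant on connected sets that do not meet the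
compact null set `K`. -/
structure IsStepOff (K : Set (Fin d → ℝ)) (g : (Fin d → ℝ) → ℝ≥0∞) : Prop where
  meas : Measurable g
  bdd : ∃ C : ℝ≥0∞, C ≠ ∞ ∧ ∀ x, g x ≤ C
  supp : Bornology.IsBounded {x | g x ≠ 0}
  compact : IsCompact K
  null : volume K = 0
  const : ∀ s, IsPreconnected s → Disjoint s K → ∀ x ∈ s, ∀ y ∈ s, g x = g y

/-- Allows a single exceptional set to serve both the discontinuities of the density and the
singular part. -/
lemma IsStepOff.union {K K' : Set (Fin d → ℝ)} {g : (Fin d → ℝ) → ℝ≥0∞} (h : IsStepOff K g)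
    (hK' : IsCompact K') (h0 : volume K' = 0) : IsStepOff (K ∪ K') g where
  meas := h.meas
  bdd := h.bdd
  supp := h.supp
  compact := h.compact.union hK'
  null := measure_union_null h.null h0
  const s hs hd := h.const s hs (hd.mono_right Set.subset_union_left)

lemma isBounded_cube (a : Fin d → ℝ) (l : ℝ) : Bornology.IsBounded (cube a l) :=
  (Metric.isBounded_Icc a (fun i => a i + l)).subset fun _ hx =>
    ⟨fun i => (hx i (Set.mem_univ i)).1, fun i => (hx i (Set.mem_univ i)).2.le⟩

lemma isBounded_biUnion_cube {n : ℕ} (a : Fin n → Fin d → ℝ) (l : Fin n → ℝ) :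
    Bornology.IsBounded (⋃ k, cube (a k) (l k)) :=
  Bornology.isBounded_iUnion.2 fun _ => isBounded_cube _ _

/-- The density can change only across the frontiers of the cubes, which are compact and, by
convexity, null. -/
lemma IsCubeMixture.exists_isStepOff {ν : Measure (Fin d → ℝ)} (h : IsCubeMixture ν) :
    ∃ K g, IsStepOff K g ∧ ν = volume.withDensity g := by
  obtain ⟨n, a, l, α, hl, -, rfl⟩ := h
  set β : Fin n → ℝ≥0∞ := fun k => ENNReal.ofReal (α k) * (volume (cube (a k) (l k)))⁻¹ with hβ
  have hβt : ∀ k, β k ≠ ∞ := fun k => ENNReal.mul_ne_top ENNReal.ofReal_ne_top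
    (ENNReal.inv_ne_top.2 (volume_cube_ne_zero _ (hl k)))
  set g : (Fin d → ℝ) → ℝ≥0∞ := fun x => ∑ k, (cube (a k) (l k)).indicator (fun _ => β k) x with hg
  have hmk : ∀ k, Measurable ((cube (a k) (l k)).indicator (fun _ => β k)) := fun k =>
    measurable_const.indicator (measurableSet_cube _ _)
  refine ⟨⋃ k, frontier (cube (a k) (l k)), g, ⟨?_, ?_, ?_, ?_, ?_, ?_⟩, ?_⟩
  · exact Finset.measurable_sum _ fun k _ => hmk k
  · refine ⟨∑ k, β k, ENNReal.sum_ne_top.2 fun k _ => hβt k, fun x => ?_⟩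
    exact Finset.sum_le_sum fun k _ => Set.indicator_le_self _ _ x
  · refine (isBounded_biUnion_cube a l).subset fun x hx => ?_
    obtain ⟨k, -, hk⟩ := Finset.exists_ne_zero_of_sum_ne_zero hx
    exact Set.mem_iUnion.2 ⟨k, Set.mem_of_indicator_ne_zero hk⟩
  · exact isCompact_iUnion fun k => (Metric.isCompact_of_isClosed_isBounded isClosed_frontier
      ((isBounded_cube _ _).closure.subset frontier_subset_closure))
  · exact measure_iUnion_null fun k => (convex_cube _ _).addHaar_frontier volume
  · intro s hs hd x hx y hy
    refine Finset.sum_congr rfl fun k _ => ?_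
    rcases subset_or_disjoint_of_disjoint_frontier hs
      (hd.mono_right (Set.subset_iUnion (fun k => frontier (cube (a k) (l k))) k)) with h1 | h1
    · rw [Set.indicator_of_mem (h1 hx), Set.indicator_of_mem (h1 hy)]
    · rw [Set.indicator_of_notMem (Set.disjoint_left.1 h1 hx),
        Set.indicator_of_notMem (Set.disjoint_left.1 h1 hy)]
  · ext A hA
    rw [withDensity_apply _ hA, hg, lintegral_finsetSum _ fun k _ => hmk k,
      Measure.finsetSum_apply]
    refine Finset.sum_congr rfl fun k _ => ?_
    rw [lintegral_indicator (measurableSet_cube _ _), lintegral_const, Measure.smul_apply, uniform,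
      Measure.smul_apply, Measure.restrict_apply hA, Measure.restrict_apply MeasurableSet.univ,
      Set.univ_inter, Measure.restrict_apply (measurableSet_cube _ _), Set.inter_comm A, hβ,
      smul_eq_mul, smul_eq_mul, mul_assoc]

end GridCells

/-! ### The asymptotic cost rate and its subadditivity. -/

section Rate

lemma limsup_add_le_of_ennreal (u v : ℕ → ℝ≥0∞) :
    limsup (fun n => u n + v n) atTop ≤ limsup u atTop + limsup v atTop := by
  refine ENNReal.le_of_forall_pos_le_add fun ε hε h => ?_
  have hε' : (ε : ℝ≥0∞) / 2 ≠ 0 := (ENNReal.half_pos (by exact_mod_cast hε.ne')).ne'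
  obtain ⟨hu, hv⟩ := ENNReal.add_lt_top.1 h
  refine limsup_le_of_le (h := ?_)
  filter_upwards [eventually_lt_of_limsup_lt (ENNReal.lt_add_right hu.ne hε'),
    eventually_lt_of_limsup_lt (ENNReal.lt_add_right hv.ne hε')] with n h1 h2
  refine (add_le_add h1.le h2.le).trans_eq ?_
  rw [add_add_add_comm, ENNReal.add_halves]

lemma limsup_sum_le_of_ennreal {ι : Type*} (s : Finset ι) (u : ι → ℕ → ℝ≥0∞) :
    limsup (fun n => ∑ i ∈ s, u i n) atTop ≤ ∑ i ∈ s, limsup (u i) atTop := by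
  induction s using Finset.cons_induction with
  | empty => simp
  | cons i s hi ih =>
    simp_rw [Finset.sum_cons]
    exact (limsup_add_le_of_ennreal _ _).trans (add_le_add le_rfl ih)

variable {Z : Type*} [MeasurableSpace Z]

/-- A bound of the contribution of the points in a set with positive asymptotic frequency. -/
lemma limsup_lintegral_cnt_mul_le {μ : Measure Z} [IsProbabilityMeasure μ] {B : Set Z}
    (hB : MeasurableSet B) {G : ℕ → ℝ≥0∞} {M : ℝ≥0∞} (hM : M ≠ ∞) (hG : ∀ n ≠ 0, G n ≤ M) {s : ℝ}
    (hs0 : 0 ≤ s) (hs1 : s < 1) :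
    limsup (fun N : ℕ => (N : ℝ≥0∞) ^ s * ∫⁻ z : Fin N → Z,
        (N : ℝ≥0∞)⁻¹ * (cnt B z : ℝ≥0∞) * G (cnt B z) ∂(Measure.pi fun _ => μ)) atTop ≤
      μ B ^ (1 - s) * limsup (fun n : ℕ => (n : ℝ≥0∞) ^ s * G n) atTop := by
  have hs' : 0 < 1 - s := by linarith
  rcases eq_or_ne (μ B) 0 with h0 | h0
  · refine le_trans (le_of_eq ?_) zero_le
    have : ∀ N : ℕ, (N : ℝ≥0∞) ^ s * ∫⁻ z : Fin N → Z,
        (N : ℝ≥0∞)⁻¹ * (cnt B z : ℝ≥0∞) * G (cnt B z) ∂(Measure.pi fun _ => μ) = 0 := by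
      intro N
      rw [lintegral_congr_ae (g := fun _ => 0), lintegral_zero, mul_zero]
      filter_upwards [ae_cnt_eq_zero hB h0] with z hz
      simp [hz]
    simp [this]
  set L := limsup (fun n : ℕ => (n : ℝ≥0∞) ^ s * G n) atTop with hL
  have hw0 : μ B ^ (1 - s) ≠ 0 := by
    simp [ENNReal.rpow_eq_zero_iff, h0, hs'.not_gt]
  have hwt : μ B ^ (1 - s) ≠ ∞ := ENNReal.rpow_ne_top_of_nonneg hs'.le (measure_ne_top _ _)
  rcases eq_or_ne L ∞ with hLt | hLt
  · rw [hLt, ENNReal.mul_top hw0]; exact le_top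
  have key : ∀ L' > L, limsup (fun N : ℕ => (N : ℝ≥0∞) ^ s * ∫⁻ z : Fin N → Z,
        (N : ℝ≥0∞)⁻¹ * (cnt B z : ℝ≥0∞) * G (cnt B z) ∂(Measure.pi fun _ => μ)) atTop ≤
      μ B ^ (1 - s) * L' := by
    intro L' hL'
    obtain ⟨n₀, hn₀⟩ := eventually_atTop.1 (eventually_lt_of_limsup_lt hL')
    -- From `n₀` on the limsup governs the term. Smaller counts contribute at most the constant `n₀
    -- * M`, which disappears after multiplication with `N ^ (s - 1)`.
    have hpt : ∀ n : ℕ, (n : ℝ≥0∞) * G n ≤ L' * (n : ℝ≥0∞) ^ (1 - s) + n₀ * M := by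
      intro n
      rcases Nat.eq_zero_or_pos n with hn | hn
      · simp [hn]
      have hnE : (n : ℝ≥0∞) ≠ 0 := by exact_mod_cast hn.ne'
      rcases le_or_gt n₀ n with h | h
      · refine le_trans ?_ le_self_add
        calc (n : ℝ≥0∞) * G n = (n : ℝ≥0∞) ^ s * G n * (n : ℝ≥0∞) ^ (1 - s) := by
              rw [mul_right_comm, ← ENNReal.rpow_add _ _ hnE (ENNReal.natCast_ne_top n)]
              simp
          _ ≤ _ := mul_le_mul_of_nonneg_right (hn₀ n h).le zero_le
      · refine le_trans ?_ le_add_self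
        exact mul_le_mul' (by exact_mod_cast h.le) (hG n hn.ne')
    have hm : Measurable fun n : ℕ => (n : ℝ≥0∞) ^ (1 - s) := measurable_from_top
    have hbound : ∀ N : ℕ, N ≠ 0 → (N : ℝ≥0∞) ^ s * ∫⁻ z : Fin N → Z,
        (N : ℝ≥0∞)⁻¹ * (cnt B z : ℝ≥0∞) * G (cnt B z) ∂(Measure.pi fun _ => μ) ≤
        μ B ^ (1 - s) * L' + n₀ * M * (N : ℝ≥0∞) ^ (s - 1) := by
      intro N hN
      have hN0 : (N : ℝ≥0∞) ≠ 0 := by exact_mod_cast hN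
      have hNt := ENNReal.natCast_ne_top N
      have hcm : Measurable fun z : Fin N → Z => (cnt B z : ℝ≥0∞) ^ (1 - s) :=
        measurable_comp_cnt hB (fun n => (n : ℝ≥0∞) ^ (1 - s))
      have e1 : (N : ℝ≥0∞) ^ s * (N : ℝ≥0∞)⁻¹ = (N : ℝ≥0∞) ^ (s - 1) := by
        rw [← ENNReal.rpow_neg_one, ← ENNReal.rpow_add _ _ hN0 hNt, sub_eq_add_neg]
      calc _ ≤ (N : ℝ≥0∞) ^ s * ∫⁻ z : Fin N → Z, (N : ℝ≥0∞)⁻¹ *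
            (L' * (cnt B z : ℝ≥0∞) ^ (1 - s) + n₀ * M) ∂(Measure.pi fun _ => μ) := by
            refine mul_le_mul_of_nonneg_left (lintegral_mono fun z => ?_) zero_le
            rw [mul_assoc]
            exact mul_le_mul_of_nonneg_left (hpt _) zero_le
        _ = (N : ℝ≥0∞) ^ s * ((N : ℝ≥0∞)⁻¹ * (L' * ∫⁻ z : Fin N → Z,
            (cnt B z : ℝ≥0∞) ^ (1 - s) ∂(Measure.pi fun _ => μ) + n₀ * M)) := by
            have hm1 : Measurable fun z : Fin N → Z => L' * (cnt B z : ℝ≥0∞) ^ (1 - s) :=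
              hcm.const_mul _
            rw [lintegral_const_mul _ (hm1.add_const _), lintegral_add_left hm1,
              lintegral_const_mul _ hcm]
            simp
        _ ≤ (N : ℝ≥0∞) ^ s * ((N : ℝ≥0∞)⁻¹ * (L' * (N * μ B) ^ (1 - s) + n₀ * M)) := by
            gcongr
            exact lintegral_cnt_rpow_le hB hs' (by linarith)
        _ = ((N : ℝ≥0∞) ^ (s - 1) * (N : ℝ≥0∞) ^ (1 - s)) * (μ B ^ (1 - s) * L') +
            n₀ * M * (N : ℝ≥0∞) ^ (s - 1) := by
            rw [← mul_assoc, e1, ENNReal.mul_rpow_of_nonneg _ _ hs'.le]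
            ring
        _ = _ := by
            rw [← ENNReal.rpow_add _ _ hN0 hNt]
            simp
    have hlim : Tendsto (fun N : ℕ => μ B ^ (1 - s) * L' + n₀ * M * (N : ℝ≥0∞) ^ (s - 1)) atTop
        (𝓝 (μ B ^ (1 - s) * L' + n₀ * M * 0)) := by
      refine tendsto_const_nhds.add (ENNReal.Tendsto.const_mul
        (tendsto_natCast_rpow_neg (by linarith)) (Or.inr ?_))
      exact ENNReal.mul_ne_top (ENNReal.natCast_ne_top _) hM
    rw [mul_zero, add_zero] at hlim
    refine (limsup_le_limsup ((eventually_ne_atTop 0).mono hbound)).trans hlim.limsup_eq.le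
  have hne : (𝓝[>] L).NeBot := nhdsGT_neBot_of_exists_gt ⟨∞, lt_top_iff_ne_top.2 hLt⟩
  have hlim : Tendsto (fun L' => μ B ^ (1 - s) * L') (𝓝[>] L) (𝓝 (μ B ^ (1 - s) * L)) :=
    (ENNReal.Tendsto.const_mul tendsto_id (Or.inr hwt)).mono_left nhdsWithin_le_nhds
  exact ge_of_tendsto hlim (eventually_mem_nhdsWithin.mono fun L' h => key L' h)

/-- The asymptotic size of the mean costs of a finite measure, scaled so as to be subadditive. -/
def costRate (c : Z → Z → ℝ≥0∞) (s : ℝ) (ν : Measure Z) : ℝ≥0∞ :=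
  ν Set.univ ^ (1 - s) *
    limsup (fun n : ℕ => (n : ℝ≥0∞) ^ s * meanCost c n ((ν Set.univ)⁻¹ • ν)) atTop

lemma costRate_le {c : Z → Z → ℝ≥0∞} {s : ℝ} {ν : Measure Z} {A : ℝ≥0∞}
    (h : ν Set.univ ≠ 0 → ∀ n : ℕ, n ≠ 0 →
      meanCost c n ((ν Set.univ)⁻¹ • ν) ≤ A * (n : ℝ≥0∞) ^ (-s)) (hs1 : s < 1) :
    costRate c s ν ≤ ν Set.univ ^ (1 - s) * A := by
  rcases eq_or_ne (ν Set.univ) 0 with h0 | h0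
  · simp [costRate, h0, ENNReal.zero_rpow_of_pos (sub_pos.2 hs1)]
  unfold costRate
  gcongr
  refine limsup_le_of_le (h := ?_)
  filter_upwards [eventually_ne_atTop 0] with n hn
  have hnE : (n : ℝ≥0∞) ≠ 0 := by exact_mod_cast hn
  refine (mul_le_mul_of_nonneg_left (h h0 n hn) zero_le).trans_eq ?_
  rw [mul_left_comm, ← ENNReal.rpow_add _ _ hnE (ENNReal.natCast_ne_top n)]
  simp

lemma isProbabilityMeasure_inv_smul {ν : Measure Z} [IsFiniteMeasure ν] (h : ν Set.univ ≠ 0) :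
    IsProbabilityMeasure ((ν Set.univ)⁻¹ • ν) :=
  ⟨by simp [ENNReal.inv_mul_cancel h (measure_ne_top _ _)]⟩

/-- The pieces may overlap, so they need not come from a partition of `Z`. Lift them to the disjoint
copies `{i} × Z` inside `ι × Z`, with a cost that ignores the label. There the fibres of the first
projection form a partition with conditional laws the normalised `ν i`; deviations of the numbers of
points are of order `N ^ (-1/2)` and vanish because `s < 1/2`. -/
lemma limsup_meanCost_le_sum_costRate [TopologicalSpace Z] [BorelSpace Z]
    [SecondCountableTopology Z] [MeasurableSingletonClass Z] {c : Z → Z → ℝ≥0∞} {b : Z → ℝ≥0∞}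
    (hc : GoodCost c b) {ι : Type*} [Fintype ι] (μ : Measure Z) [IsProbabilityMeasure μ]
    (hμ : ∫⁻ z, b z ∂μ ≠ ∞) (ν : ι → Measure Z) (hν : ∑ i, ν i = μ) {s : ℝ} (hs0 : 0 ≤ s)
    (hs1 : s < 1 / 2) :
    limsup (fun N : ℕ => (N : ℝ≥0∞) ^ s * meanCost c N μ) atTop ≤ ∑ i, costRate c s (ν i) := by
  classical
  let : MeasurableSpace ι := ⊤
  let : TopologicalSpace ι := ⊥
  have : DiscreteTopology ι := ⟨rfl⟩
  have hνμ : ∀ i, ν i ≤ μ := fun i => by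
    rw [← hν]
    exact Finset.single_le_sum (f := ν) (fun _ _ => Measure.zero_le _) (Finset.mem_univ i)
  have : ∀ i, IsFiniteMeasure (ν i) := fun i => isFiniteMeasure_of_le μ (hνμ i)
  have hmk : ∀ i : ι, Measurable (Prod.mk i : Z → ι × Z) := fun i => measurable_prodMk_left
  set M : Measure (ι × Z) := ∑ i, (ν i).map (Prod.mk i) with hM
  have hMsnd : M.map Prod.snd = μ := by
    rw [hM, Measure.map_finset_sum measurable_snd.aemeasurable, ← hν]
    refine Finset.sum_congr rfl fun i _ => ?_
    rw [Measure.map_map measurable_snd (hmk i)]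
    exact Measure.map_id
  have : IsProbabilityMeasure M := by
    refine ⟨?_⟩
    have := congrArg (fun m : Measure Z => m Set.univ) hMsnd
    simpa [Measure.map_apply measurable_snd MeasurableSet.univ] using this
  set c' : ι × Z → ι × Z → ℝ≥0∞ := fun x y => c x.2 y.2 with hc'
  have hgc : GoodCost c' (fun x => b x.2) := by
    refine ⟨?_, ?_, ?_, ?_⟩
    · exact hc.cont.comp (Continuous.prodMk (continuous_snd.comp continuous_fst)
        (continuous_snd.comp continuous_snd))
    · exact hc.bcont.comp continuous_snd
    · exact fun x => hc.bfin x.2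
    · exact fun x y => hc.le x.2 y.2
  set B : ι → Set (ι × Z) := fun i => Prod.fst ⁻¹' {i} with hB
  have hBm : ∀ i, MeasurableSet (B i) := fun i => measurable_fst (measurableSet_singleton i)
  have hMr : ∀ i, M.restrict (B i) = (ν i).map (Prod.mk i) := by
    intro i
    have hsum : M.restrict (B i) = ∑ j, ((ν j).map (Prod.mk j)).restrict (B i) := by
      ext A hA
      simp only [hM, Measure.restrict_apply hA, Measure.finsetSum_apply]
    rw [hsum, Finset.sum_eq_single i]
    · rw [Measure.restrict_map (hmk i) (hBm i)]
      congr 1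
      rw [show Prod.mk i ⁻¹' (B i) = (Set.univ : Set Z) by ext; simp [hB], Measure.restrict_univ]
    · intro j _ hj
      rw [Measure.restrict_map (hmk j) (hBm i),
        show Prod.mk j ⁻¹' (B i) = (∅ : Set Z) by ext; simp [hB, hj]]
      simp
    · simp
  have hMB : ∀ i, M (B i) = ν i Set.univ := by
    intro i
    rw [← Measure.restrict_apply_self, hMr, Measure.map_apply (hmk i) (hBm i)]
    congr 1
    ext; simp [hB]
  have hcond : ∀ i, ProbabilityTheory.cond M (B i) =
      ((ν i Set.univ)⁻¹ • ν i).map (Prod.mk i) := by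
    intro i
    rw [ProbabilityTheory.cond, hMr, hMB, Measure.map_smul]
  have hint : ∀ i, ∫⁻ x, b x ∂((ν i Set.univ)⁻¹ • ν i) ≠ ∞ := by
    intro i
    rw [lintegral_smul_measure]
    rcases eq_or_ne (ν i Set.univ) 0 with h0 | h0
    · rw [Measure.measure_univ_eq_zero.1 h0]; simp
    · exact ENNReal.mul_ne_top (ENNReal.inv_ne_top.2 h0)
        (ne_top_of_le_ne_top hμ (lintegral_mono' (hνμ i) le_rfl))
  have hbm : Measurable b := hc.bcont.measurable
  have hbm' : Measurable fun x : ι × Z => b x.2 := hbm.comp measurable_snd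
  have hMint : ∫⁻ x, b x.2 ∂M ≠ ∞ := by
    rw [← hMsnd, lintegral_map hbm measurable_snd] at hμ
    exact hμ
  set G : ι → ℕ → ℝ≥0∞ := fun i n => meanCost c n ((ν i Set.univ)⁻¹ • ν i) with hG
  set D := ∑ i, ∫⁻ x, b x.2 ∂(ProbabilityTheory.cond M (B i)) with hD
  have hcondint : ∀ i, ∫⁻ x, b x.2 ∂(ProbabilityTheory.cond M (B i)) ≠ ∞ := by
    intro i
    rw [hcond, lintegral_map hbm' (hmk i)]
    exact hint i
  have hDt : D ≠ ∞ := ENNReal.sum_ne_top.2 fun i _ => hcondint i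
  have hbound : ∀ N : ℕ, N ≠ 0 → (N : ℝ≥0∞) ^ s * meanCost c N μ ≤
      (∑ i, (N : ℝ≥0∞) ^ s * ∫⁻ z : Fin N → ι × Z,
        (N : ℝ≥0∞)⁻¹ * (cnt (B i) z : ℝ≥0∞) * G i (cnt (B i) z) ∂(Measure.pi fun _ => M)) +
      D * (N : ℝ≥0∞) ^ (s - 1 / 2) := by
    intro N hN
    have hN0 : (N : ℝ≥0∞) ≠ 0 := by exact_mod_cast hN
    -- Forgetting the labels does not increase the cost.
    have h1 : meanCost c N μ ≤ meanCost c' N M := by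
      rw [← hMsnd]
      refine (meanCost_map_le (c := c') measurable_snd one_ne_zero ENNReal.one_ne_top
        (fun x y => by rw [one_mul]) N M).trans_eq (one_mul _)
    have h2 := meanCost_le_partition hgc M hMint hN (T := Prod.fst) measurable_fst
    rw [← Finset.mul_sum]
    calc _ ≤ (N : ℝ≥0∞) ^ s * (∑ i, ∫⁻ z : Fin N → ι × Z,
          (N : ℝ≥0∞)⁻¹ * (cnt (B i) z : ℝ≥0∞) * G i (cnt (B i) z) ∂(Measure.pi fun _ => M) +
          (N : ℝ≥0∞) ^ (-(1 / 2) : ℝ) * D) := by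
          gcongr
          refine (h1.trans h2).trans (add_le_add (Finset.sum_le_sum fun i _ => ?_) ?_)
          · refine cellMean_le (hBm i) fun n _ _ => ?_
            rw [hcond]
            refine (meanCost_map_le (c := c) (hmk i) one_ne_zero ENNReal.one_ne_top
              (fun x y => by rw [one_mul]) n _).trans_eq (one_mul _)
          · rw [hD, Finset.mul_sum]
            refine Finset.sum_le_sum fun i _ => ?_
            gcongr
            refine (lintegral_adist_emp_le_sqrt hN M (hBm i)).trans ?_
            refine (mul_le_mul_of_nonneg_left ?_ zero_le).trans_eq (mul_one _)
            exact ENNReal.rpow_le_one prob_le_one (by norm_num)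
      _ = _ := by
          rw [mul_add, ← mul_assoc, ← ENNReal.rpow_add _ _ hN0 (ENNReal.natCast_ne_top N),
            mul_comm D, sub_eq_add_neg]
  refine (limsup_le_limsup ((eventually_ne_atTop 0).mono hbound)).trans
    ((limsup_add_le_of_ennreal _ _).trans ?_)
  have hlim : Tendsto (fun N : ℕ => D * (N : ℝ≥0∞) ^ (s - 1 / 2)) atTop (𝓝 (D * 0)) :=
    ENNReal.Tendsto.const_mul (tendsto_natCast_rpow_neg (by linarith)) (Or.inr hDt)
  rw [hlim.limsup_eq, mul_zero, add_zero]
  refine (limsup_sum_le_of_ennreal _ _).trans (Finset.sum_le_sum fun i _ => ?_)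
  rw [costRate, ← hMB]
  rcases eq_or_ne (ν i Set.univ) 0 with h0 | h0
  · have h0' : M (B i) = 0 := by rw [hMB, h0]
    refine le_trans (le_of_eq ?_) zero_le
    have : ∀ N : ℕ, (N : ℝ≥0∞) ^ s * ∫⁻ z : Fin N → ι × Z, (N : ℝ≥0∞)⁻¹ *
        (cnt (B i) z : ℝ≥0∞) * G i (cnt (B i) z) ∂(Measure.pi fun _ => M) = 0 := by
      intro N
      rw [lintegral_congr_ae (g := fun _ => 0), lintegral_zero, mul_zero]
      filter_upwards [ae_cnt_eq_zero (hBm i) h0'] with z hz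
      simp [hz]
    simp [this]
  have := isProbabilityMeasure_inv_smul h0
  rw [hMB]
  have := limsup_lintegral_cnt_mul_le (μ := M) (hBm i) (G := G i)
    (M := 2 * ∫⁻ x, b x ∂((ν i Set.univ)⁻¹ • ν i)) (ENNReal.mul_ne_top (by norm_num) (hint i))
    (fun n hn => meanCost_le_two_mul_lintegral hbm hc.le _ hn) hs0 (by linarith : s < 1)
  rwa [hMB] at this

end Rate

/-! ### Cost rates of measures on cubes, of general measures, and of uniform pieces. -/

section RateBounds

variable {d : ℕ} {nrm : Seminorm ℝ (Fin d → ℝ)} {p Λ : ℝ}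

lemma costRate_le_cube (hp : 0 < p) (hpd : p < (d : ℝ) / 2) (hΛ : ∀ x, nrm x ≤ Λ * ‖x‖)
    (hΛ0 : 0 ≤ Λ) {a : Fin d → ℝ} {l : ℝ} (hl : 0 < l) (ν : Measure (Fin d → ℝ))
    [IsFiniteMeasure ν] (hν : ν (cube a l)ᶜ = 0) :
    costRate (normCost nrm p) (p / d) ν ≤
      ν Set.univ ^ (1 - p / d) * (cubeConst d p Λ * ENNReal.ofReal l ^ p) := by
  have hd : 0 < (d : ℝ) := by linarith
  refine costRate_le (fun h0 n hn => ?_) (by rw [div_lt_one hd]; linarith)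
  have := isProbabilityMeasure_inv_smul h0
  exact meanCost_le_cube (a := a) hp hpd hΛ hΛ0 hl _ (by simp [hν]) hn

/-- The shell sum is homogeneous of degree `1 - p / d`, so the normalisation in `costRate` cancels.
-/
lemma costRate_le_shellSum (hp : 0 < p) (hpd : p < (d : ℝ) / 2) (hΛ : ∀ x, nrm x ≤ Λ * ‖x‖)
    (hΛ0 : 0 ≤ Λ) (ν : Measure (Fin d → ℝ)) [IsFiniteMeasure ν]
    (hν : ∫⁻ x, normBound Λ p x ∂ν ≠ ∞) :
    costRate (normCost nrm p) (p / d) ν ≤ pierceConst d p Λ * shellSum p (p / d) ν := by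
  have hd : 0 < (d : ℝ) := by linarith
  have hs1 : p / d < 1 := by rw [div_lt_one hd]; linarith
  rcases eq_or_ne (ν Set.univ) 0 with h0 | h0
  · simp [costRate, h0, ENNReal.zero_rpow_of_pos (sub_pos.2 hs1)]
  have ht : ν Set.univ ≠ ∞ := measure_ne_top _ _
  refine (costRate_le (A := pierceConst d p Λ * shellSum p (p / d) ((ν Set.univ)⁻¹ • ν))
    (fun _ n hn => ?_) hs1).trans_eq ?_
  · have := isProbabilityMeasure_inv_smul h0
    refine meanCost_le_shellSum hp hpd hΛ hΛ0 _ ?_ hn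
    rw [lintegral_smul_measure]
    exact ENNReal.mul_ne_top (ENNReal.inv_ne_top.2 h0) hν
  · rw [mul_left_comm, shellSum, ← ENNReal.tsum_mul_left, shellSum]
    congr 2
    funext n
    rw [Measure.smul_apply, smul_eq_mul, ENNReal.mul_rpow_of_nonneg _ _ (by linarith),
      mul_left_comm, ← mul_assoc (ν Set.univ ^ _), ← ENNReal.mul_rpow_of_nonneg _ _ (by linarith),
      ENNReal.mul_inv_cancel h0 ht, ENNReal.one_rpow, one_mul]

/-- The powers of the edge length combine: mass to the power `1 - p / d` gives `r ^ (d - p)`, the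
cost scaling gives `r ^ p`, and together they form the volume. -/
lemma costRate_smul_volume_cube_le (hp : 0 < p) (hpd : p < (d : ℝ) / 2) {L : ℝ≥0∞}
    (hL : Tendsto (fun N : ℕ => (N : ℝ≥0∞) ^ (p / d) * meanCost (normCost nrm p) N (unifCube d))
        atTop (𝓝 L)) (a : Fin d → ℝ) {r : ℝ} (hr : 0 < r) {γ : ℝ≥0∞} (hγ : γ ≠ ∞) :
    costRate (normCost nrm p) (p / d) (γ • volume.restrict (cube a r)) ≤
      L * (γ ^ (1 - p / d) * volume (cube a r)) := by
  have hd : 0 < (d : ℝ) := by linarith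
  have hs1 : p / d < 1 := by rw [div_lt_one hd]; linarith
  have hs' : 0 < 1 - p / d := by linarith
  rcases eq_or_ne γ 0 with rfl | h0
  · simp [costRate, ENNReal.zero_rpow_of_pos hs']
  have hv0 := volume_cube_ne_zero a hr
  have hvt := volume_cube_ne_top a r
  have hmass : (γ • volume.restrict (cube a r)) Set.univ = γ * volume (cube a r) := by simp
  have hnorm : (γ * volume (cube a r))⁻¹ • γ • volume.restrict (cube a r) = uniform (cube a r) := by
    rw [smul_smul, ENNReal.mul_inv (Or.inl h0) (Or.inl hγ), mul_right_comm,
      ENNReal.inv_mul_cancel h0 hγ, one_mul, uniform]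
  have hrt : ENNReal.ofReal r ^ p ≠ ∞ := ENNReal.rpow_ne_top_of_nonneg hp.le ENNReal.ofReal_ne_top
  have hlim := ENNReal.Tendsto.const_mul hL (Or.inr hrt)
  have hls : limsup (fun n : ℕ => (n : ℝ≥0∞) ^ (p / d) *
      meanCost (normCost nrm p) n (uniform (cube a r))) atTop ≤ ENNReal.ofReal r ^ p * L := by
    rw [← hlim.limsup_eq]
    refine limsup_le_limsup (Eventually.of_forall fun n => ?_)
    have := meanCost_uniform_cube_le (nrm := nrm) hp.le a hr n
    calc _ ≤ (n : ℝ≥0∞) ^ (p / d) * (ENNReal.ofReal r ^ p *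
          meanCost (normCost nrm p) n (unifCube d)) := mul_le_mul_of_nonneg_left this zero_le
      _ = _ := by ring
  rw [costRate, hmass, hnorm]
  refine (mul_le_mul_of_nonneg_left hls zero_le).trans_eq ?_
  rw [ENNReal.mul_rpow_of_nonneg _ _ hs'.le, mul_comm L]
  have hr0 : ENNReal.ofReal r ≠ 0 := (ENNReal.ofReal_pos.2 hr).ne'
  have : volume (cube a r) ^ (1 - p / d) * ENNReal.ofReal r ^ p = volume (cube a r) := by
    rw [volume_cube, ← ENNReal.rpow_natCast, ← ENNReal.rpow_mul,
      ← ENNReal.rpow_add _ _ hr0 ENNReal.ofReal_ne_top]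
    congr 1
    field_simp
    ring
  calc _ = γ ^ (1 - p / d) * (volume (cube a r) ^ (1 - p / d) * ENNReal.ofReal r ^ p) * L := by ring
    _ = _ := by rw [this]

end RateBounds

/-! ### Consequences of the moment condition. -/

section Moments

variable {d : ℕ} {nrm : Seminorm ℝ (Fin d → ℝ)} {p Λ : ℝ}

/-- Submeasures of small mass have a small shell sum. -/
lemma exists_shellSum_le {s : ℝ} (hp : 0 ≤ p) (hs : s < 1) {μ : Measure (Fin d → ℝ)}
    (hμ : shellSum p s μ ≠ ∞) {η : ℝ≥0∞} (hη : η ≠ 0) :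
    ∃ ε : ℝ, 0 < ε ∧ ∀ R ≤ μ, R Set.univ ≤ ENNReal.ofReal ε → shellSum p s R ≤ η := by
  have hs' : 0 < 1 - s := by linarith
  have hη2 : η / 2 ≠ 0 := (ENNReal.half_pos hη).ne'
  -- Outside the finite set `F` the sum for `R` is dominated by the tail for `μ`; inside, finitely
  -- many terms are small with the mass of `R`.
  obtain ⟨F, hF⟩ := ((ENNReal.tendsto_tsum_compl_atTop_zero hμ).eventually_lt_const
    (pos_iff_ne_zero.2 hη2)).exists
  set C : ℝ≥0∞ := ∑ n ∈ F, ((2 : ℝ≥0∞) ^ n) ^ p with hC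
  have hCt : C ≠ ∞ := ENNReal.sum_ne_top.2 fun n _ => ENNReal.rpow_ne_top_of_nonneg hp
    (ENNReal.pow_ne_top (by norm_num))
  have hlim : Tendsto (fun ε : ℝ => C * ENNReal.ofReal ε ^ (1 - s)) (𝓝[>] 0) (𝓝 (C * 0)) := by
    refine ENNReal.Tendsto.const_mul ?_ (Or.inr hCt)
    have h := ((ENNReal.continuous_rpow_const (y := 1 - s)).comp
      ENNReal.continuous_ofReal).tendsto (0 : ℝ)
    simp only [Function.comp_apply, ENNReal.ofReal_zero, ENNReal.zero_rpow_of_pos hs'] at h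
    exact h.mono_left nhdsWithin_le_nhds
  rw [mul_zero] at hlim
  obtain ⟨ε, hε, hε0⟩ := ((hlim.eventually_lt_const (pos_iff_ne_zero.2 hη2)).and
    eventually_mem_nhdsWithin).exists
  refine ⟨ε, hε0, fun R hR hRε => ?_⟩
  rw [shellSum, ← ENNReal.sum_add_tsum_compl F, ← ENNReal.add_halves η]
  refine add_le_add ?_ ?_
  · refine le_trans ?_ hε.le
    rw [hC, Finset.sum_mul]
    refine Finset.sum_le_sum fun n _ => ?_
    gcongr
    exact (measure_mono (Set.subset_univ _)).trans hRε
  · refine le_trans (ENNReal.tsum_le_tsum fun n => ?_) hF.le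
    gcongr

/-- Markov's inequality bounds the mass of shell `n + 1` by a constant times `2 ^ (-n * q)`. The
series is then dominated by a geometric one of ratio `2 ^ (p - q * (1 - p / d))`, and this ratio is
below one exactly when `q > d * p / (d - p)`. -/
lemma shellSum_ne_top_of_moment (hp : 0 < p) (hpd : p < (d : ℝ) / 2) {l : ℝ} (hl0 : 0 < l)
    (hl : ∀ x, l * ‖x‖ ≤ nrm x) {q : ℝ} (hq : (d : ℝ) * p / (d - p) < q)
    {μ : Measure (Fin d → ℝ)} [IsProbabilityMeasure μ]
    (hμ : ∫⁻ x, ENNReal.ofReal (nrm x) ^ q ∂μ ≠ ∞) :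
    shellSum p (p / d) μ ≠ ∞ := by
  have hd : 0 < (d : ℝ) := by linarith
  have hdp : 0 < (d : ℝ) - p := by linarith
  have hs1 : p / d < 1 := by rw [div_lt_one hd]; linarith
  set t := 1 - p / d with ht
  have ht0 : 0 < t := by linarith
  have hq0 : 0 < q := lt_trans (by positivity) hq
  have hqt : p < q * t := by
    rw [div_lt_iff₀ hdp] at hq
    rw [ht, mul_one_sub, mul_div_assoc', lt_sub_iff_add_lt, ← lt_sub_iff_add_lt', div_lt_iff₀ hd]
    linarith
  set I := ∫⁻ x, ENNReal.ofReal (nrm x) ^ q ∂μ with hI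
  have hlE : ENNReal.ofReal l ≠ 0 := (ENNReal.ofReal_pos.2 hl0).ne'
  have htail : ∀ n : ℕ, μ (shell ⁻¹' {n + 1}) ≤
      (I * (ENNReal.ofReal l ^ q)⁻¹) * ((2 : ℝ≥0∞) ^ (-q)) ^ n := by
    intro n
    have hm : Measurable fun x => ENNReal.ofReal (nrm x) ^ q :=
      ((continuous_seminorm nrm).measurable.ennreal_ofReal).pow_const _
    have h1 := mul_meas_ge_le_lintegral (μ := μ) hm ((ENNReal.ofReal l * 2 ^ n) ^ q)
    have h2 : μ (shell ⁻¹' {n + 1}) ≤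
        μ {x | (ENNReal.ofReal l * 2 ^ n) ^ q ≤ ENNReal.ofReal (nrm x) ^ q} := by
      refine measure_mono fun x hx => ?_
      have h3 : 2 ^ n ≤ ‖x‖ := shell_le_norm hx
      refine ENNReal.rpow_le_rpow ?_ hq0.le
      have e : (2 : ℝ≥0∞) ^ n = ENNReal.ofReal (2 ^ n) := by
        rw [ENNReal.ofReal_pow (by norm_num)]; norm_num
      rw [e, ← ENNReal.ofReal_mul hl0.le]
      refine ENNReal.ofReal_le_ofReal (le_trans ?_ (hl x))
      gcongr
    have h20 : ((2 : ℝ≥0∞) ^ n) ≠ 0 := pow_ne_zero _ (by norm_num)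
    have h2t : ((2 : ℝ≥0∞) ^ n) ≠ ∞ := ENNReal.pow_ne_top (by norm_num)
    have hb0 : (ENNReal.ofReal l * 2 ^ n) ^ q ≠ 0 := by
      simp [ENNReal.rpow_eq_zero_iff, hlE, hq0.not_gt, ENNReal.mul_eq_top]
    have hbt : (ENNReal.ofReal l * 2 ^ n) ^ q ≠ ∞ := ENNReal.rpow_ne_top_of_nonneg hq0.le
      (ENNReal.mul_ne_top ENNReal.ofReal_ne_top h2t)
    calc μ (shell ⁻¹' {n + 1}) ≤ I / (ENNReal.ofReal l * 2 ^ n) ^ q := by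
          rw [ENNReal.le_div_iff_mul_le (Or.inl hb0) (Or.inl hbt), mul_comm]
          exact (mul_le_mul_of_nonneg_left h2 zero_le).trans h1
      _ = _ := by
          rw [div_eq_mul_inv, ENNReal.mul_rpow_of_nonneg _ _ hq0.le,
            ENNReal.mul_inv (Or.inr (ENNReal.rpow_ne_top_of_nonneg hq0.le h2t))
            (Or.inl (ENNReal.rpow_ne_top_of_nonneg hq0.le ENNReal.ofReal_ne_top)),
            ← ENNReal.rpow_neg (2 ^ n), ← mul_assoc]
          congr 1
          rw [← ENNReal.rpow_natCast, ← ENNReal.rpow_natCast, ← ENNReal.rpow_mul,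
            ← ENNReal.rpow_mul, mul_comm]
  set C := (I * (ENNReal.ofReal l ^ q)⁻¹) ^ t with hC
  have hCt : C ≠ ∞ := by
    refine ENNReal.rpow_ne_top_of_nonneg ht0.le (ENNReal.mul_ne_top hμ (ENNReal.inv_ne_top.2 ?_))
    simp [ENNReal.rpow_eq_zero_iff, hlE, hq0.not_gt]
  set ρ : ℝ≥0∞ := 2 ^ (p - q * t) with hρ
  have hρ1 : ρ < 1 := ENNReal.rpow_lt_one_of_one_lt_of_neg (by norm_num) (by linarith)
  have hterm : ∀ n : ℕ, ((2 : ℝ≥0∞) ^ (n + 1)) ^ p * μ (shell ⁻¹' {n + 1}) ^ t ≤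
      2 ^ p * C * ρ ^ n := by
    intro n
    calc _ ≤ ((2 : ℝ≥0∞) ^ (n + 1)) ^ p *
          ((I * (ENNReal.ofReal l ^ q)⁻¹) * ((2 : ℝ≥0∞) ^ (-q)) ^ n) ^ t := by
          gcongr
          exact htail n
      _ = 2 ^ p * C * (((2 : ℝ≥0∞) ^ n) ^ p * (((2 : ℝ≥0∞) ^ (-q)) ^ n) ^ t) := by
          rw [ENNReal.mul_rpow_of_nonneg _ _ ht0.le, pow_succ,
            ENNReal.mul_rpow_of_nonneg _ _ hp.le]
          ring
      _ = _ := by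
          congr 1
          simp_rw [← ENNReal.rpow_natCast, ← ENNReal.rpow_mul]
          rw [← ENNReal.rpow_add _ _ (by norm_num) (by norm_num), hρ, ← ENNReal.rpow_mul]
          congr 1
          ring
  rw [shellSum, tsum_eq_zero_add' ENNReal.summable]
  refine ENNReal.add_ne_top.2 ⟨?_, ne_top_of_le_ne_top ?_ (ENNReal.tsum_le_tsum hterm)⟩
  · exact ENNReal.mul_ne_top (by simp) (ENNReal.rpow_ne_top_of_nonneg ht0.le (measure_ne_top _ _))
  · rw [ENNReal.tsum_mul_left, ENNReal.tsum_geometric]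
    refine ENNReal.mul_ne_top (ENNReal.mul_ne_top (ENNReal.rpow_ne_top_of_nonneg hp.le
      (by norm_num)) hCt) (ENNReal.inv_ne_top.2 (tsub_pos_iff_lt.2 hρ1).ne')

lemma lintegral_normBound_ne_top_of_moment (hp : 0 < p) (hpd : p < (d : ℝ) / 2) (hΛ0 : 0 ≤ Λ)
    {l : ℝ} (hl0 : 0 < l) (hl : ∀ x, l * ‖x‖ ≤ nrm x) {q : ℝ} (hq : (d : ℝ) * p / (d - p) < q)
    {μ : Measure (Fin d → ℝ)} [IsProbabilityMeasure μ]
    (hμ : ∫⁻ x, ENNReal.ofReal (nrm x) ^ q ∂μ ≠ ∞) :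
    ∫⁻ x, normBound Λ p x ∂μ ≠ ∞ := by
  have hd : 0 < (d : ℝ) := by linarith
  have hdp : 0 < (d : ℝ) - p := by linarith
  have hpq : p ≤ q := by
    refine le_trans ?_ hq.le
    rw [le_div_iff₀ hdp]
    nlinarith
  set C := ENNReal.ofReal (2 * Λ / l) ^ p with hC
  have hCt : C ≠ ∞ := ENNReal.rpow_ne_top_of_nonneg hp.le ENNReal.ofReal_ne_top
  have hpt : ∀ x, normBound Λ p x ≤ C * (1 + ENNReal.ofReal (nrm x) ^ q) := by
    intro x
    calc normBound Λ p x ≤ (ENNReal.ofReal (2 * Λ / l) * ENNReal.ofReal (nrm x)) ^ p := by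
          refine ENNReal.rpow_le_rpow ?_ hp.le
          rw [← ENNReal.ofReal_mul (by positivity)]
          refine ENNReal.ofReal_le_ofReal ?_
          rw [div_mul_eq_mul_div, le_div_iff₀ hl0]
          nlinarith [hl x]
      _ = C * ENNReal.ofReal (nrm x) ^ p := ENNReal.mul_rpow_of_nonneg _ _ hp.le
      _ ≤ _ := by
          gcongr
          rcases le_total (ENNReal.ofReal (nrm x)) 1 with h | h
          · exact (ENNReal.rpow_le_one h hp.le).trans le_self_add
          · exact (ENNReal.rpow_le_rpow_of_exponent_le h hpq).trans le_add_self
  refine ne_top_of_le_ne_top ?_ (lintegral_mono hpt)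
  rw [lintegral_const_mul' _ _ hCt, lintegral_add_left measurable_const]
  simp only [lintegral_const, measure_univ, mul_one]
  exact ENNReal.mul_ne_top hCt (ENNReal.add_ne_top.2 ⟨ENNReal.one_ne_top, hμ⟩)

end Moments

/-! ### Step functions on grids, and the Lebesgue decomposition. -/

section Steps

variable {d : ℕ}

lemma corner_mem_gridCell {r : ℝ} (hr : 0 < r) (v : Fin d → ℤ) :
    (fun i => (v i : ℝ) * r) ∈ gridCell r v := fun i _ => ⟨le_rfl, by simpa using hr⟩

/-- The value of a step function on a grid cell. -/
def stepVal (g : (Fin d → ℝ) → ℝ≥0∞) (r : ℝ) (v : Fin d → ℤ) : ℝ≥0∞ := g fun i => v i * r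

lemma IsStepOff.eq_stepVal {K : Set (Fin d → ℝ)} {g : (Fin d → ℝ) → ℝ≥0∞} (h : IsStepOff K g)
    {r : ℝ} (hr : 0 < r) {v : Fin d → ℤ} (hv : Disjoint (gridCell r v) K) {x : Fin d → ℝ}
    (hx : x ∈ gridCell r v) : g x = stepVal g r v :=
  h.const _ (convex_cube _ _).isPreconnected hv x hx _ (corner_mem_gridCell hr v)

lemma IsStepOff.stepVal_ne_top {K : Set (Fin d → ℝ)} {g : (Fin d → ℝ) → ℝ≥0∞} (h : IsStepOff K g)
    (r : ℝ) (v : Fin d → ℤ) : stepVal g r v ≠ ∞ := by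
  obtain ⟨C, hC, hg⟩ := h.bdd
  exact ne_top_of_le_ne_top hC (hg _)

/-- A function of the form `φ ∘ g` with `φ 0 = 0` is a finite combination of indicator functions
of the grid cells that do not meet `K`. -/
lemma IsStepOff.exists_finset {K : Set (Fin d → ℝ)} {g : (Fin d → ℝ) → ℝ≥0∞} (h : IsStepOff K g)
    {r : ℝ} (hr : 0 < r) {φ : ℝ≥0∞ → ℝ≥0∞} (hφ : φ 0 = 0) :
    ∃ S : Finset (Fin d → ℤ), (∀ v ∈ S, Disjoint (gridCell r v) K ∧ φ (stepVal g r v) ≠ 0) ∧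
      ∀ ψ : ℝ≥0∞ → ℝ≥0∞, (∀ t, φ t = 0 → ψ t = 0) → ∀ x,
        (badCells r K)ᶜ.indicator (fun x => ψ (g x)) x =
        ∑ v ∈ S, (gridCell r v).indicator (fun _ => ψ (stepVal g r v)) x := by
  classical
  have hfin := finite_gridCell_inter h.supp hr
  -- The set of cells depends on `φ` alone, so one choice represents both the density and its power
  -- `1 - s`.
  refine ⟨hfin.toFinset.filter fun v => Disjoint (gridCell r v) K ∧ φ (stepVal g r v) ≠ 0,
    fun v hv => (Finset.mem_filter.1 hv).2, fun ψ hψ x => ?_⟩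
  set v := gridIdx r x with hv
  have hxv : x ∈ gridCell r v := (mem_gridCell hr).2 rfl
  have hother : ∀ w, w ≠ v → (gridCell r w).indicator (fun _ => ψ (stepVal g r w)) x = 0 :=
    fun w hw => Set.indicator_of_notMem (fun hx => hw ((mem_gridCell hr).1 hx).symm) _
  by_cases hbad : x ∈ badCells r K
  · rw [Set.indicator_of_notMem (by simpa using hbad)]
    refine (Finset.sum_eq_zero fun w hw => hother w ?_).symm
    rintro rfl
    exact Set.not_disjoint_iff_nonempty_inter.2 hbad (Finset.mem_filter.1 hw).2.1
  · have hgood : Disjoint (gridCell r v) K := by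
      rw [Set.disjoint_iff_inter_eq_empty, ← Set.not_nonempty_iff_eq_empty]
      exact hbad
    rw [Set.indicator_of_mem (show x ∈ (badCells r K)ᶜ from hbad), h.eq_stepVal hr hgood hxv]
    by_cases h0 : φ (stepVal g r v) = 0
    · rw [hψ _ h0]
      refine (Finset.sum_eq_zero fun w hw => hother w ?_).symm
      rintro rfl
      exact (Finset.mem_filter.1 hw).2.2 h0
    · rw [Finset.sum_eq_single v (fun w _ hw => hother w hw), Set.indicator_of_mem hxv]
      intro hcon
      refine absurd (Finset.mem_filter.2 ⟨hfin.mem_toFinset.2 ⟨x, hxv, ?_⟩, hgood, h0⟩) hcon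
      intro hg0
      rw [← h.eq_stepVal hr hgood hxv, hg0] at h0
      exact h0 hφ

lemma lintegral_sum_indicator_gridCell (S : Finset (Fin d → ℤ)) (r : ℝ) (γ : (Fin d → ℤ) → ℝ≥0∞)
    (μ : Measure (Fin d → ℝ)) :
    ∫⁻ x, ∑ v ∈ S, (gridCell r v).indicator (fun _ => γ v) x ∂μ =
      ∑ v ∈ S, γ v * μ (gridCell r v) := by
  rw [lintegral_finsetSum _ fun v _ => measurable_const.indicator (measurableSet_gridCell r v)]
  refine Finset.sum_congr rfl fun v _ => ?_
  rw [lintegral_indicator_const (measurableSet_gridCell r v)]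

/-- The singular part of a finite measure is almost carried by a compact null set. -/
lemma exists_isCompact_singularPart (μ : Measure (Fin d → ℝ)) [IsFiniteMeasure μ] {ε : ℝ≥0∞}
    (hε : ε ≠ 0) : ∃ K, IsCompact K ∧ volume K = 0 ∧ μ.singularPart volume Kᶜ ≤ ε := by
  have h := μ.mutuallySingular_singularPart volume
  obtain ⟨K, hK, hKc, hlt⟩ := h.measurableSet_nullSet.compl.exists_isCompact_sdiff_lt
    (measure_ne_top (μ.singularPart volume) _) hε
  refine ⟨K, hKc, measure_mono_null hK h.measure_compl_nullSet, ?_⟩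
  calc μ.singularPart volume Kᶜ
      ≤ μ.singularPart volume (h.nullSet ∪ (h.nullSetᶜ \ K)) := by
        refine measure_mono fun x hx => ?_
        by_cases hn : x ∈ h.nullSet
        · exact Or.inl hn
        · exact Or.inr ⟨hn, hx⟩
    _ ≤ _ := (measure_union_le _ _).trans (by rw [h.measure_nullSet, zero_add]; exact hlt.le)

lemma singularPart_add_acPart (μ : Measure (Fin d → ℝ)) [IsFiniteMeasure μ] :
    μ.singularPart volume + acPart μ = μ :=
  (Measure.haveLebesgueDecomposition_add μ volume).symm

lemma measurable_acDensity (μ : Measure (Fin d → ℝ)) : Measurable (acDensity μ) :=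
  Measure.measurable_rnDeriv _ _

lemma ae_le_of_withDensity_le {f g : (Fin d → ℝ) → ℝ≥0∞} (hg : Measurable g)
    (h : volume.withDensity g ≤ volume.withDensity f) : g ≤ᵐ[volume] f := by
  refine ae_le_of_forall_setLIntegral_le_of_sigmaFinite hg fun s hs _ => ?_
  rw [← withDensity_apply _ hs, ← withDensity_apply _ hs]
  exact h s

lemma withDensity_sub_add {f g : (Fin d → ℝ) → ℝ≥0∞} (hg : Measurable g)
    (h : g ≤ᵐ[volume] f) :
    volume.withDensity (fun x => f x - g x) + volume.withDensity g = volume.withDensity f := by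
  rw [← withDensity_add_right _ hg]
  refine withDensity_congr_ae ?_
  filter_upwards [h] with x hx
  exact tsub_add_cancel_of_le hx

lemma lintegral_tsub_of_withDensity {f g : (Fin d → ℝ) → ℝ≥0∞} (hg : Measurable g)
    (hgi : ∫⁻ x, g x ≠ ∞) (h : g ≤ᵐ[volume] f) :
    (volume.withDensity f - volume.withDensity g) Set.univ = ∫⁻ x, (f x - g x) := by
  have : IsFiniteMeasure (volume.withDensity g) := isFiniteMeasure_withDensity hgi
  rw [← withDensity_sub_add hg h, Measure.add_sub_cancel, withDensity_apply _ MeasurableSet.univ,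
    Measure.restrict_univ]

/-- Hölder's inequality for the measures of cells. -/
lemma sum_rpow_mul_rpow_le {ι : Type*} (S : Finset ι) (w a : ι → ℝ≥0∞) {s : ℝ} (hs0 : 0 < s)
    (hs1 : s < 1) :
    ∑ v ∈ S, w v ^ s * a v ^ (1 - s) ≤ (∑ v ∈ S, w v) ^ s * (∑ v ∈ S, a v) ^ (1 - s) := by
  have hpq : (1 / s).HolderConjugate (1 / (1 - s)) := by
    rw [Real.holderConjugate_iff, one_lt_div hs0]
    exact ⟨hs1, by simp⟩
  have h := ENNReal.inner_le_Lp_mul_Lq S (fun v => w v ^ s) (fun v => a v ^ (1 - s)) hpq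
  simp only [← ENNReal.rpow_mul, mul_one_div_cancel hs0.ne', mul_one_div_cancel (sub_pos.2 hs1).ne',
    ENNReal.rpow_one, one_div_one_div] at h
  exact h

end Steps

/-- Gathers the three kinds of pieces of the upper bound, the remainder, the singular cells and the
uniform cells, into one family over a finite type. -/
lemma exists_option_sum_fun {α β X : Type*} (x : X) (f : α → X) (g : β → X) :
    ∃ m : Option (α ⊕ β) → X, m none = x ∧ (∀ a, m (some (Sum.inl a)) = f a) ∧
      ∀ b, m (some (Sum.inr b)) = g b :=
  ⟨fun o => o.elim x (Sum.elim f g), rfl, fun _ => rfl, fun _ => rfl⟩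

/-! ### The upper bound. -/

section UpperBound

variable {d : ℕ} {nrm : Seminorm ℝ (Fin d → ℝ)} {p Λ : ℝ}

-- Decompose `μ` into constant multiples of Lebesgue measure on cells away from `K`, the singular
-- part on each cell that meets `K`, and a remainder of mass at most `ε`. The rates of the first
-- kind add up to the main term, those of the second to at most `η`, and the remainder to at most
-- `pierceConst * η`.
set_option maxHeartbeats 800000 in
lemma limsup_meanCost_le_add (hp : 0 < p) (hpd : p < (d : ℝ) / 2) (hΛ : ∀ x, nrm x ≤ Λ * ‖x‖)
    (hΛ0 : 0 ≤ Λ) {L : ℝ≥0∞}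
    (hL : Tendsto (fun N : ℕ => (N : ℝ≥0∞) ^ (p / d) * meanCost (normCost nrm p) N (unifCube d))
        atTop (𝓝 L)) (μ : Measure (Fin d → ℝ)) [IsProbabilityMeasure μ]
    (hμ : ∫⁻ x, normBound Λ p x ∂μ ≠ ∞) (hsum : shellSum p (p / d) μ ≠ ∞)
    (happ : ApproachableFromBelow (acPart μ)) {η : ℝ≥0∞} (hη : η ≠ 0) :
    limsup (fun N : ℕ => (N : ℝ≥0∞) ^ (p / d) * meanCost (normCost nrm p) N μ) atTop ≤
      L * (∫⁻ x, acDensity μ x ^ (1 - p / d)) + (1 + pierceConst d p Λ) * η := by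
  have hd : 0 < (d : ℝ) := by linarith
  have hs0 : 0 < p / d := by positivity
  have hs2 : p / d < 1 / 2 := by rw [div_lt_iff₀ hd]; linarith
  set s := p / d with hs
  have hs1 : s < 1 := by linarith
  have hs' : 0 < 1 - s := by linarith
  obtain ⟨ε, hε, hεR⟩ := exists_shellSum_le hp.le hs1 hsum hη
  have hε3 : 0 < ε / 3 := by positivity
  have hε3E : ENNReal.ofReal (ε / 3) ≠ 0 := (ENNReal.ofReal_pos.2 hε3).ne'
  obtain ⟨ν, hmix, hνle, hνε⟩ := happ (ε / 3) hε3
  obtain ⟨K₀, g, hg₀, rfl⟩ := hmix.exists_isStepOff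
  obtain ⟨K₁, hK₁c, hK₁0, hK₁⟩ := exists_isCompact_singularPart μ hε3E
  set K := K₀ ∪ K₁ with hK
  have hg : IsStepOff K g := hg₀.union hK₁c hK₁0
  set f := acDensity μ with hf
  set μs := μ.singularPart volume with hμs
  have hfm : Measurable f := measurable_acDensity μ
  have hdec : μs + volume.withDensity f = μ := singularPart_add_acPart μ
  have hgf : g ≤ᵐ[volume] f := ae_le_of_withDensity_le hg.meas hνle
  have hfi : ∫⁻ x, f x ≠ ∞ := by
    have : volume.withDensity f Set.univ ≤ μ Set.univ := by rw [← hdec]; exact le_add_self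
    rw [withDensity_apply _ MeasurableSet.univ, Measure.restrict_univ] at this
    exact ne_top_of_le_ne_top (measure_ne_top _ _) this
  have hgi : ∫⁻ x, g x ≠ ∞ := ne_top_of_le_ne_top hfi (lintegral_mono_ae hgf)
  obtain ⟨C, hC, hgC⟩ := hg.bdd
  have hvol := tendsto_volume_badCells hg.compact hg.null
  have hlim1 : Tendsto (fun r => C * volume (badCells r K)) (𝓝[>] 0) (𝓝 (C * 0)) :=
    ENNReal.Tendsto.const_mul hvol (Or.inr hC)
  have hlim2 : Tendsto (fun r => cubeConst d p Λ * volume (badCells r K) ^ s) (𝓝[>] 0)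
      (𝓝 (cubeConst d p Λ * 0 ^ s)) :=
    ENNReal.Tendsto.const_mul (((ENNReal.continuous_rpow_const (y := s)).tendsto 0).comp hvol)
      (Or.inr (cubeConst_ne_top hp hpd))
  rw [mul_zero] at hlim1
  rw [ENNReal.zero_rpow_of_pos hs0, mul_zero] at hlim2
  -- The grid is fine enough that the cells meeting `K` carry little of the mixture and that their
  -- total volume makes the singular contribution at most `η`.
  obtain ⟨r, hr1, hr2, hr⟩ := ((hlim1.eventually_lt_const (pos_iff_ne_zero.2 hε3E)).and
    ((hlim2.eventually_lt_const (pos_iff_ne_zero.2 hη)).and eventually_mem_nhdsWithin)).exists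
  replace hr : 0 < r := hr
  obtain ⟨Bad, hBad⟩ : ∃ B, B = badCells r K := ⟨_, rfl⟩
  rw [← hBad] at hr1 hr2
  have hBadm : MeasurableSet Bad := hBad ▸ measurableSet_badCells r K
  set S₁ := (finite_gridCell_inter hg.compact.isBounded hr).toFinset with hS₁
  have hBadU : Bad = ⋃ v ∈ S₁, gridCell r v :=
    hBad.trans <| badCells_eq_biUnion hr fun v => by rw [hS₁, Set.Finite.mem_toFinset]; rfl
  have hdisj : (S₁ : Set (Fin d → ℤ)).PairwiseDisjoint (gridCell r) :=
    fun v _ w _ hvw => disjoint_gridCell hr hvw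
  have hBadsum : ∀ m : Measure (Fin d → ℝ), ∑ v ∈ S₁, m (gridCell r v) = m Bad := fun m => by
    rw [hBadU, measure_biUnion_finset hdisj fun v _ => measurableSet_gridCell r v]
  obtain ⟨S₂, hS₂, hψ⟩ := hg.exists_finset hr (φ := id) rfl
  rw [← hBad] at hψ
  set g' : (Fin d → ℝ) → ℝ≥0∞ := Badᶜ.indicator g with hg'
  have hg'm : Measurable g' := hg.meas.indicator hBadm.compl
  have hg'g : g' ≤ g := fun x => Set.indicator_le_self _ _ x
  have hg'f : g' ≤ᵐ[volume] f := hgf.mono fun x hx => (hg'g x).trans hx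
  have hg'sum : ∀ x, g' x = ∑ v ∈ S₂, (gridCell r v).indicator (fun _ => stepVal g r v) x :=
    hψ id fun t ht => ht
  have hg'pow : ∀ x, g' x ^ (1 - s) =
      ∑ v ∈ S₂, (gridCell r v).indicator (fun _ => stepVal g r v ^ (1 - s)) x := by
    intro x
    rw [← hψ (fun t => t ^ (1 - s)) (fun t ht => by
      rw [show t = 0 from ht]; exact ENNReal.zero_rpow_of_pos hs') x, hg']
    by_cases hx : x ∈ Badᶜ
    · rw [Set.indicator_of_mem hx, Set.indicator_of_mem hx]
    · rw [Set.indicator_of_notMem hx, Set.indicator_of_notMem hx, ENNReal.zero_rpow_of_pos hs']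
  set R := μs.restrict Badᶜ + volume.withDensity (fun x => f x - g' x) with hR
  obtain ⟨pieces, hp0, hp1, hp2⟩ : ∃ m : Option (S₁ ⊕ S₂) → Measure (Fin d → ℝ), m none = R ∧
      (∀ v, m (some (Sum.inl v)) = μs.restrict (gridCell r v)) ∧
      ∀ v, m (some (Sum.inr v)) = stepVal g r v • volume.restrict (gridCell r v) :=
    exists_option_sum_fun R _ _
  have hsumpieces : ∑ o, pieces o = μ := by
    rw [Fintype.sum_option, Fintype.sum_sum_type]
    have e1 : ∑ v : S₁, μs.restrict (gridCell r v) = μs.restrict Bad := by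
      ext A hA
      rw [Measure.finsetSum_apply, Finset.sum_coe_sort S₁ (fun v => μs.restrict (gridCell r v) A)]
      have := hBadsum (μs.restrict A)
      simp only [Measure.restrict_apply (measurableSet_gridCell r _),
        Measure.restrict_apply hBadm] at this
      simpa only [Measure.restrict_apply hA, Set.inter_comm A] using this
    have e2 : ∑ v : S₂, stepVal g r v • volume.restrict (gridCell r v) =
        volume.withDensity g' := by
      ext A hA
      rw [Measure.finsetSum_apply, withDensity_apply _ hA]
      simp_rw [hg'sum]
      rw [lintegral_sum_indicator_gridCell, Finset.sum_coe_sort S₂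
        (fun v => (stepVal g r v • volume.restrict (gridCell r v)) A)]
      refine Finset.sum_congr rfl fun v _ => ?_
      rw [Measure.smul_apply, smul_eq_mul, Measure.restrict_apply hA,
        Measure.restrict_apply (measurableSet_gridCell r v), Set.inter_comm]
    simp_rw [hp0, hp1, hp2]
    rw [e1, e2, hR, add_add_add_comm, withDensity_sub_add hg'm hg'f,
      Measure.restrict_compl_add_restrict hBadm, hdec]
  have hRμ : R ≤ μ := by
    have h : pieces none ≤ ∑ o, pieces o := by
      rw [Fintype.sum_option]
      exact Measure.le_add_right le_rfl
    rwa [hsumpieces, hp0] at h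
  have hRfin : IsFiniteMeasure R := isFiniteMeasure_of_le μ hRμ
  -- Three losses of at most `ε / 3`: singular mass away from `K`, the gap between `f` and `g`, and
  -- the mixture on the bad cells.
  have hRmass : R Set.univ ≤ ENNReal.ofReal ε := by
    have h1 : μs.restrict Badᶜ Set.univ ≤ ENNReal.ofReal (ε / 3) := by
      rw [Measure.restrict_apply_univ]
      refine le_trans (measure_mono (Set.compl_subset_compl.2 ?_)) hK₁
      exact hBad ▸ Set.subset_union_right.trans (subset_badCells hr K)
    have h2 : ∫⁻ x, (f x - g x) ≤ ENNReal.ofReal (ε / 3) := by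
      rw [← lintegral_tsub_of_withDensity hg.meas hgi hgf]
      exact hνε
    have h3 : ∫⁻ x in Bad, g x ≤ ENNReal.ofReal (ε / 3) := by
      refine le_trans ?_ hr1.le
      refine (lintegral_mono fun x => hgC x).trans_eq ?_
      rw [setLIntegral_const]
    have h4 : ∫⁻ x, (f x - g' x) ≤ (∫⁻ x, (f x - g x)) + ∫⁻ x in Bad, g x := by
      have hfg : Measurable fun x => f x - g x := hfm.sub hg.meas
      rw [← lintegral_indicator hBadm, ← lintegral_add_left hfg]
      refine lintegral_mono fun x => ?_
      by_cases hx : x ∈ Bad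
      · simp only [hg', Set.indicator_of_mem hx, Set.indicator_of_notMem (Set.notMem_compl_iff.2 hx)]
        rw [tsub_zero]
        exact le_tsub_add
      · simp only [hg', Set.indicator_of_notMem hx,
          Set.indicator_of_mem (show x ∈ Badᶜ from hx), add_zero, le_refl]
    rw [hR, Measure.add_apply, withDensity_apply _ MeasurableSet.univ, Measure.restrict_univ]
    refine (add_le_add h1 (h4.trans (add_le_add h2 h3))).trans_eq ?_
    rw [← ENNReal.ofReal_add hε3.le hε3.le, ← ENNReal.ofReal_add hε3.le (by positivity)]
    congr 1
    ring
  have hmain := limsup_meanCost_le_sum_costRate (goodCost_normCost hp hΛ hΛ0) μ hμ pieces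
    hsumpieces hs0.le hs2
  refine hmain.trans ?_
  rw [Fintype.sum_option, Fintype.sum_sum_type]
  simp_rw [hp0, hp1, hp2]
  have b1 : costRate (normCost nrm p) s R ≤ pierceConst d p Λ * η := by
    refine (costRate_le_shellSum hp hpd hΛ hΛ0 R
      (ne_top_of_le_ne_top hμ (lintegral_mono' hRμ le_rfl))).trans ?_
    exact mul_le_mul_of_nonneg_left (hεR R hRμ hRmass) zero_le
  -- Since `r ^ p` is the volume of a cell to the power `s`, Hölder's inequality sums the cell
  -- bounds to `volume Bad ^ s * μs Bad ^ (1 - s)`.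
  have b2 : ∑ v : S₁, costRate (normCost nrm p) s (μs.restrict (gridCell r v)) ≤ η := by
    refine le_trans ?_ hr2.le
    calc ∑ v : S₁, costRate (normCost nrm p) s (μs.restrict (gridCell r v))
        ≤ ∑ v : S₁, cubeConst d p Λ *
          (volume (gridCell r v.1) ^ s * μs (gridCell r v.1) ^ (1 - s)) := by
          refine Finset.sum_le_sum fun v _ => ?_
          refine (costRate_le_cube (l := r) (a := fun i => (v.1 i : ℝ) * r) hp hpd hΛ hΛ0 hr
            (μs.restrict (gridCell r v)) ?_).trans_eq ?_
          · rw [Measure.restrict_apply (measurableSet_cube _ _).compl]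
            change μs ((gridCell r v)ᶜ ∩ gridCell r v) = 0
            simp
          · rw [Measure.restrict_apply_univ, volume_gridCell, ← ENNReal.rpow_natCast,
              ← ENNReal.rpow_mul, hs, mul_div_cancel₀ _ hd.ne']
            ring
      _ = cubeConst d p Λ * ∑ v ∈ S₁, volume (gridCell r v) ^ s * μs (gridCell r v) ^ (1 - s) := by
          rw [← Finset.mul_sum, Finset.sum_coe_sort S₁
            (fun v => volume (gridCell r v) ^ s * μs (gridCell r v) ^ (1 - s))]
      _ ≤ cubeConst d p Λ * (volume Bad ^ s * μs Bad ^ (1 - s)) := by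
          gcongr
          rw [← hBadsum volume, ← hBadsum μs]
          exact sum_rpow_mul_rpow_le S₁ _ _ hs0 hs1
      _ ≤ cubeConst d p Λ * (volume Bad ^ s * 1) := by
          gcongr
          refine ENNReal.rpow_le_one ?_ hs'.le
          refine le_trans ?_ (prob_le_one (μ := μ) (s := Bad))
          exact Measure.singularPart_le μ volume Bad
      _ = _ := by rw [mul_one]
  have b3 : ∑ v : S₂, costRate (normCost nrm p) s (stepVal g r v • volume.restrict (gridCell r v)) ≤
      L * ∫⁻ x, f x ^ (1 - s) := by
    calc _ ≤ ∑ v : S₂, L * (stepVal g r v ^ (1 - s) * volume (gridCell r v)) :=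
          Finset.sum_le_sum fun v _ => costRate_smul_volume_cube_le hp hpd hL _ hr
            (hg.stepVal_ne_top r v)
      _ = L * ∫⁻ x, g' x ^ (1 - s) := by
          simp_rw [hg'pow]
          rw [← Finset.mul_sum, lintegral_sum_indicator_gridCell S₂ r
            (fun v => stepVal g r v ^ (1 - s)), Finset.sum_coe_sort S₂
            (fun v => stepVal g r v ^ (1 - s) * volume (gridCell r v))]
      _ ≤ _ := by
          gcongr 1
          exact lintegral_mono_ae (hg'f.mono fun x hx => ENNReal.rpow_le_rpow hx hs'.le)
  refine (add_le_add b1 (add_le_add b2 b3)).trans_eq ?_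
  ring

/-- The upper bound for measures whose absolutely continuous part is approachable from below. -/
theorem limsup_meanCost_le (hp : 0 < p) (hpd : p < (d : ℝ) / 2) (hΛ : ∀ x, nrm x ≤ Λ * ‖x‖)
    (hΛ0 : 0 ≤ Λ) {L : ℝ≥0∞}
    (hL : Tendsto (fun N : ℕ => (N : ℝ≥0∞) ^ (p / d) * meanCost (normCost nrm p) N (unifCube d))
        atTop (𝓝 L)) (μ : Measure (Fin d → ℝ)) [IsProbabilityMeasure μ]
    (hμ : ∫⁻ x, normBound Λ p x ∂μ ≠ ∞) (hsum : shellSum p (p / d) μ ≠ ∞)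
    (happ : ApproachableFromBelow (acPart μ)) :
    limsup (fun N : ℕ => (N : ℝ≥0∞) ^ (p / d) * meanCost (normCost nrm p) N μ) atTop ≤
      L * ∫⁻ x, acDensity μ x ^ (1 - p / d) := by
  set I := L * ∫⁻ x, acDensity μ x ^ (1 - p / d) with hI
  have hlim : Tendsto (fun η : ℝ≥0∞ => I + (1 + pierceConst d p Λ) * η) (𝓝[>] 0)
      (𝓝 (I + (1 + pierceConst d p Λ) * 0)) :=
    (tendsto_const_nhds.add (ENNReal.Tendsto.const_mul tendsto_id (Or.inr (ENNReal.add_ne_top.2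
      ⟨ENNReal.one_ne_top, pierceConst_ne_top hp hpd⟩)))).mono_left nhdsWithin_le_nhds
  rw [mul_zero, add_zero] at hlim
  exact ge_of_tendsto hlim (eventually_mem_nhdsWithin.mono fun η hη =>
    limsup_meanCost_le_add hp hpd hΛ hΛ0 hL μ hμ hsum happ (pos_iff_ne_zero.1 hη))

end UpperBound

/-! ### The leaking cost: monotonicity, and construction of leaking transports. -/

section Leaking

variable {d : ℕ} {nrm : Seminorm ℝ (Fin d → ℝ)} {p Λ : ℝ}

/-- The open unit cube. -/
def openCube (d : ℕ) : Set (Fin d → ℝ) := Set.univ.pi fun _ => Set.Ioo (0 : ℝ) 1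

/-- The closed unit cube. -/
def closedCube (d : ℕ) : Set (Fin d → ℝ) := Set.univ.pi fun _ => Set.Icc (0 : ℝ) 1

lemma measurableSet_openCube : MeasurableSet (openCube d) :=
  MeasurableSet.univ_pi fun _ => measurableSet_Ioo

lemma measurableSet_closedCube : MeasurableSet (closedCube d) :=
  MeasurableSet.univ_pi fun _ => measurableSet_Icc

lemma openCube_subset_cube : openCube d ⊆ cube 0 1 := fun x hx i hi => by
  have := hx i hi
  exact ⟨this.1.le, by simpa using this.2⟩

lemma openCube_subset_closedCube : openCube d ⊆ closedCube d :=
  Set.pi_mono fun _ _ => Set.Ioo_subset_Icc_self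

lemma cube_subset_closedCube : cube 0 1 ⊆ closedCube d := fun x hx i hi => by
  have := hx i hi
  exact ⟨this.1, by simpa using this.2.le⟩

lemma norm_sub_le_of_mem_closedCube {x y : Fin d → ℝ} (hx : x ∈ closedCube d)
    (hy : y ∈ closedCube d) : ‖x - y‖ ≤ 1 := by
  rw [pi_norm_le_iff_of_nonneg zero_le_one]
  intro i
  have h1 := hx i (Set.mem_univ i)
  have h2 := hy i (Set.mem_univ i)
  rw [Pi.sub_apply, Real.norm_eq_abs, abs_le]
  constructor <;> linarith [h1.1, h1.2, h2.1, h2.2]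

lemma normCost_le_of_mem_closedCube (hp : 0 ≤ p) (hΛ : ∀ x, nrm x ≤ Λ * ‖x‖) (hΛ0 : 0 ≤ Λ)
    {x y : Fin d → ℝ} (hx : x ∈ closedCube d) (hy : y ∈ closedCube d) :
    normCost nrm p x y ≤ ENNReal.ofReal Λ ^ p := by
  simpa using normCost_le_of_norm_le hp hΛ hΛ0 (norm_sub_le_of_mem_closedCube hx hy)

lemma lintegral_normBound_ne_top_of_leaking (hp : 0 ≤ p) (hΛ0 : 0 ≤ Λ) {ρ : Measure (Fin d → ℝ)}
    (hρ : ρ ∈ leaking d) : ∫⁻ x, normBound Λ p x ∂ρ ≠ ∞ := by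
  have := hρ.1
  refine lintegral_normBound_ne_top_of_cube (a := 0) (l := 2) hp hΛ0 (by norm_num) ?_
  refine measure_mono_null (Set.compl_subset_compl.2 ?_) hρ.2.1
  intro x hx i hi
  have := hx i hi
  exact ⟨this.1, by simpa using this.2.trans_lt (by norm_num)⟩

lemma unifCube_mem_leaking : unifCube d ∈ leaking d :=
  ⟨inferInstance, measure_mono_null (Set.compl_subset_compl.2 cube_subset_closedCube) unifCube_compl,
    fun _ _ _ => le_rfl⟩

lemma measurable_infCost_leaking (hp : 0 < p) (hΛ : ∀ x, nrm x ≤ Λ * ‖x‖) (hΛ0 : 0 ≤ Λ) (N : ℕ) :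
    Measurable fun x : Fin N → Fin d → ℝ => infCost (normCost nrm p) (leaking d) (emp x) :=
  measurable_infCost_emp (goodCost_normCost hp hΛ hΛ0)
    (fun _ hρ => lintegral_normBound_ne_top_of_leaking hp.le hΛ0 hρ) N

/-- Closure under averages is what makes the leaking cost monotone in the number of points. -/
lemma leaking_average {n : ℕ} (hn : n ≠ 0) (ρ : Fin n → Measure (Fin d → ℝ))
    (hρ : ∀ j, ρ j ∈ leaking d) : (n : ℝ≥0∞)⁻¹ • ∑ j, ρ j ∈ leaking d := by
  have hn0 : (n : ℝ≥0∞) ≠ 0 := by exact_mod_cast hn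
  have hnt := ENNReal.natCast_ne_top n
  refine ⟨⟨?_⟩, ?_, fun A hA hAo => ?_⟩
  · rw [Measure.smul_apply, Measure.finsetSum_apply]
    simp_rw [fun j => (hρ j).1.measure_univ]
    simp [ENNReal.inv_mul_cancel hn0 hnt]
  · rw [Measure.smul_apply, Measure.finsetSum_apply]
    simp_rw [fun j => (hρ j).2.1]
    simp
  · rw [Measure.smul_apply, Measure.finsetSum_apply, smul_eq_mul]
    calc (n : ℝ≥0∞)⁻¹ * ∑ j, ρ j A ≤ (n : ℝ≥0∞)⁻¹ * ∑ _j : Fin n, unifCube d A := by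
          gcongr (n : ℝ≥0∞)⁻¹ * ?_
          exact Finset.sum_le_sum fun j _ => (hρ j).2.2 A hA hAo
      _ = _ := by
          simp [← mul_assoc, ENNReal.inv_mul_cancel hn0 hnt]

lemma leakMean_antitone (hp : 0 < p) (hΛ : ∀ x, nrm x ≤ Λ * ‖x‖) (hΛ0 : 0 ≤ Λ)
    {n m : ℕ} (hn : n ≠ 0) (hnm : n ≤ m) : leakMean d nrm p m ≤ leakMean d nrm p n := by
  induction m, hnm using Nat.le_induction with
  | base => exact le_rfl
  | succ m hm ih =>
    exact (avgEmp_infCost_succ_le (by omega) (fun ρ hρ => leaking_average (Nat.succ_ne_zero m) ρ hρ)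
      (measurable_infCost_leaking hp hΛ hΛ0 m) _).trans ih

lemma leakMean_le_meanCost (N : ℕ) :
    leakMean d nrm p N ≤ meanCost (normCost nrm p) N (unifCube d) :=
  lintegral_mono fun _ => iInf₂_le _ unifCube_mem_leaking

/-- Every point of the cube has a boundary point that is at least as close as any point outside of
the open cube. -/
lemma exists_boundary_point (hd : d ≠ 0) {y : Fin d → ℝ} (hy : y ∈ closedCube d) :
    ∃ z ∈ closedCube d, z ∉ openCube d ∧ ∀ x ∉ openCube d, nrm (z - y) ≤ nrm (x - y) := by
  have hopen : IsOpen (openCube d) := isOpen_set_pi Set.finite_univ fun _ _ => isOpen_Ioo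
  have hclosed : IsClosed (closedCube d) := isClosed_set_pi fun _ _ => isClosed_Icc
  have hcomp : IsCompact (closedCube d \ openCube d) :=
    IsCompact.diff (isCompact_univ_pi fun _ => isCompact_Icc) hopen
  have hne : (closedCube d \ openCube d).Nonempty := by
    refine ⟨0, fun i _ => by simp, fun h => ?_⟩
    have := h ⟨0, Nat.pos_of_ne_zero hd⟩ (Set.mem_univ _)
    simp at this
  have hcont : Continuous fun z => nrm (z - y) :=
    (continuous_seminorm nrm).comp (continuous_id.sub continuous_const)
  obtain ⟨z, hz, hmin⟩ := hcomp.exists_isMinOn hne hcont.continuousOn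
  refine ⟨z, hz.1, hz.2, fun x hx => ?_⟩
  have hfr : frontier (openCube d) ⊆ closedCube d \ openCube d := by
    intro u hu
    refine ⟨closure_minimal openCube_subset_closedCube hclosed hu.1, ?_⟩
    have := hu.2
    rwa [hopen.interior_eq] at this
  -- The segment from `y` to a point outside the open cube meets the boundary. The meeting point is
  -- at distance `t * nrm (x - y)` from `y` with `t ≤ 1`, and `z` is at least as close.
  have hmeet : (segment ℝ y x ∩ (closedCube d \ openCube d)).Nonempty := by
    by_contra hcon
    have hdisj : Disjoint (segment ℝ y x) (closedCube d \ openCube d) := by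
      rwa [Set.disjoint_iff_inter_eq_empty, ← Set.not_nonempty_iff_eq_empty]
    rcases subset_or_disjoint_of_disjoint_frontier (convex_segment y x).isPreconnected
      (hdisj.mono_right hfr) with h | h
    · exact hx (h (right_mem_segment ℝ y x))
    · exact hcon ⟨y, left_mem_segment ℝ y x, hy,
        Set.disjoint_left.1 h (left_mem_segment ℝ y x)⟩
  obtain ⟨u, hu, hu'⟩ := hmeet
  refine (hmin hu').trans ?_
  rw [segment_eq_image'] at hu
  obtain ⟨t, ht, rfl⟩ := hu
  change nrm (y + t • (x - y) - y) ≤ _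
  rw [add_sub_cancel_left, map_smul_eq_mul, Real.norm_of_nonneg ht.1]
  exact mul_le_of_le_one_left (apply_nonneg nrm _) ht.2

/-- A family of measures that transports to the points `x` yields a leaking transport to the points
`y` of the unit cube. -/
lemma infCost_leaking_le (hd : d ≠ 0) (hp : 0 ≤ p) (hΛ : ∀ x, nrm x ≤ Λ * ‖x‖) (hΛ0 : 0 ≤ Λ)
    {n : ℕ} (hn : n ≠ 0) {w : ℝ≥0∞} (hw0 : w ≠ 0) (hwt : w ≠ ∞) (x y : Fin n → Fin d → ℝ)
    (hy : ∀ k, y k ∈ closedCube d) (m : Fin n → Measure (Fin d → ℝ))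
    (hm : ∀ k, m k Set.univ = w) {l : ℝ≥0∞} (hl : l ≠ ∞) {Nul : Set (Fin d → ℝ)}
    (hNul : MeasurableSet Nul)
    (hdom : ∀ A, MeasurableSet A → A ⊆ openCube d \ Nul → ∑ k, m k A ≤ l * unifCube d A) :
    n * w * infCost (normCost nrm p) (leaking d) (emp y) ≤
      (∑ k, ∫⁻ u, normCost nrm p u (x k) ∂(m k)) + ENNReal.ofReal Λ ^ p *
        (∑ k, m k (openCube d ∩ Nul) + (l - n * w) + ∑ k, if x k = y k then 0 else w) := by
  have hn0 : (n : ℝ≥0∞) ≠ 0 := by exact_mod_cast hn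
  have hnt := ENNReal.natCast_ne_top n
  have hnw0 : n * w ≠ 0 := mul_ne_zero hn0 hw0
  have hnwt : n * w ≠ ∞ := ENNReal.mul_ne_top hnt hwt
  -- The restricted family has mass `n * w` but is dominated by `l` times the uniform law. Damping
  -- by `θ` restores domination after normalisation, and the damped mass amounts to at most `l - n *
  -- w`.
  obtain ⟨θ, hθ1, hθl, hθl'⟩ : ∃ θ : ℝ≥0∞, θ ≤ 1 ∧ θ * l ≤ n * w ∧ (1 - θ) * l ≤ l - n * w := by
    rcases le_total l (n * w) with h | h
    · exact ⟨1, le_rfl, by simpa using h, by simp⟩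
    · have hl0 : l ≠ 0 := (pos_iff_ne_zero.2 hnw0 |>.trans_le h).ne'
      refine ⟨n * w / l, ENNReal.div_le_of_le_mul (by simpa using h), ?_, ?_⟩
      · rw [ENNReal.div_mul_cancel hl0 hl]
      · rw [ENNReal.sub_mul (fun _ _ => hl), one_mul, ENNReal.div_mul_cancel hl0 hl]
  choose z hz1 hz2 hz3 using fun k => exists_boundary_point (nrm := nrm) hd (hy k)
  set P := openCube d \ Nul with hP
  have hPm : MeasurableSet P := measurableSet_openCube.diff hNul
  set D := ENNReal.ofReal Λ ^ p with hD
  have hθP : ∀ k, θ * m k P ≤ w := fun k => by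
    calc θ * m k P ≤ 1 * m k Set.univ := mul_le_mul' hθ1 (measure_mono (Set.subset_univ _))
      _ = w := by rw [one_mul, hm]
  -- Keep the damped mass in the admissible part of the open cube and put the rest at the boundary
  -- point `z k`, where the leaking condition imposes nothing.
  set m' : Fin n → Measure (Fin d → ℝ) := fun k =>
    (n * w)⁻¹ • (θ • (m k).restrict P + (w - θ * m k P) • Measure.dirac (z k)) with hm'
  have hm'A : ∀ k A, MeasurableSet A → m' k A = (n * w)⁻¹ *
      (θ * m k (A ∩ P) + (w - θ * m k P) * A.indicator 1 (z k)) := by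
    intro k A hA
    simp only [hm', Measure.smul_apply, Measure.add_apply, smul_eq_mul, Measure.restrict_apply hA,
      Measure.dirac_apply' _ hA]
  have hmass : ∀ k, m' k Set.univ = (n : ℝ≥0∞)⁻¹ := by
    intro k
    rw [hm'A k _ MeasurableSet.univ, Set.univ_inter, Set.indicator_univ, Pi.one_apply, mul_one,
      add_tsub_cancel_of_le (hθP k), ENNReal.mul_inv (Or.inl hn0) (Or.inl hnt), mul_assoc,
      ENNReal.inv_mul_cancel hw0 hwt, mul_one]
  have hleak : ∑ k, m' k ∈ leaking d := by
    refine ⟨⟨?_⟩, ?_, fun A hA hAo => ?_⟩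
    · rw [Measure.finsetSum_apply]
      simp_rw [hmass]
      simp [ENNReal.mul_inv_cancel hn0 hnt]
    · rw [Measure.finsetSum_apply]
      refine Finset.sum_eq_zero fun k _ => ?_
      change m' k (closedCube d)ᶜ = 0
      rw [hm'A k _ measurableSet_closedCube.compl]
      have h1 : (closedCube d)ᶜ ∩ P = ∅ := by
        refine Set.eq_empty_iff_forall_notMem.2 fun u hu => hu.1 (openCube_subset_closedCube hu.2.1)
      have h2 : (closedCube d)ᶜ.indicator (1 : (Fin d → ℝ) → ℝ≥0∞) (z k) = 0 :=
        Set.indicator_of_notMem (Set.notMem_compl_iff.2 (hz1 k)) _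
      rw [h1, h2]; simp
    · rw [Measure.finsetSum_apply]
      calc ∑ k, m' k A = ∑ k, (n * w)⁻¹ * (θ * m k (A ∩ P)) := by
            refine Finset.sum_congr rfl fun k _ => ?_
            rw [hm'A k A hA, Set.indicator_of_notMem (fun h => hz2 k (hAo h)), mul_zero, add_zero]
        _ = (n * w)⁻¹ * (θ * ∑ k, m k (A ∩ P)) := by rw [← Finset.mul_sum, ← Finset.mul_sum]
        _ ≤ (n * w)⁻¹ * (θ * (l * unifCube d A)) := by
            gcongr
            refine (hdom _ (hA.inter hPm) Set.inter_subset_right).trans ?_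
            gcongr
            exact Set.inter_subset_left
        _ = (n * w)⁻¹ * (θ * l) * unifCube d A := by ring
        _ ≤ (n * w)⁻¹ * (n * w) * unifCube d A := by gcongr
        _ = _ := by rw [ENNReal.inv_mul_cancel hnw0 hnwt, one_mul]
  have hcm : ∀ k, Measurable fun u => normCost nrm p u (y k) := fun k => by
    have := continuous_seminorm nrm
    unfold normCost
    exact ((this.comp (continuous_id.sub continuous_const)).measurable.ennreal_ofReal).pow_const _
  have hterm : ∀ k, θ * ∫⁻ u in P, normCost nrm p u (y k) ∂(m k) +
      (w - θ * m k P) * normCost nrm p (z k) (y k) ≤ ∫⁻ u, normCost nrm p u (x k) ∂(m k) +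
      D * (m k (openCube d ∩ Nul) + (1 - θ) * m k P + if x k = y k then 0 else w) := by
    intro k
    have hzD : normCost nrm p (z k) (y k) ≤ D :=
      normCost_le_of_mem_closedCube hp hΛ hΛ0 (hz1 k) (hy k)
    by_cases hxy : x k = y k
    · rw [if_pos hxy, add_zero, hxy]
      set O := (openCube d)ᶜ with hO
      have hOm : MeasurableSet O := measurableSet_openCube.compl
      -- Mass relocated to `z k` comes from outside the open cube, from `Nul`, or from damping. The
      -- first kind becomes no dearer by the choice of `z k`; the others are charged at most `D`
      -- each.
      have hsplit : w - θ * m k P ≤ m k O + (m k (openCube d ∩ Nul) + (1 - θ) * m k P) := by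
        rw [tsub_le_iff_right]
        calc w = m k O + (m k (openCube d ∩ Nul) + m k P) := by
              rw [← hm k, ← measure_add_measure_compl measurableSet_openCube (μ := m k),
                ← measure_inter_add_sdiff (openCube d) hNul, add_comm]
          _ ≤ m k O + (m k (openCube d ∩ Nul) + ((1 - θ) * m k P + θ * m k P)) := by
              rw [← add_mul, tsub_add_cancel_of_le hθ1, one_mul]
          _ = _ := by ring
      have h1 : m k O * normCost nrm p (z k) (y k) ≤ ∫⁻ u in O, normCost nrm p u (y k) ∂(m k) := by
        rw [mul_comm, ← setLIntegral_const]
        refine setLIntegral_mono (hcm k) fun u hu => ?_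
        exact ENNReal.rpow_le_rpow (ENNReal.ofReal_le_ofReal (hz3 k u hu)) hp
      have h2 : ∫⁻ u in P, normCost nrm p u (y k) ∂(m k) + ∫⁻ u in O, normCost nrm p u (y k) ∂(m k) ≤
          ∫⁻ u, normCost nrm p u (y k) ∂(m k) := by
        rw [← lintegral_union hOm (Set.disjoint_left.2 fun u hu hu' => hu' hu.1)]
        exact setLIntegral_le_lintegral _ _
      calc _ ≤ 1 * ∫⁻ u in P, normCost nrm p u (y k) ∂(m k) +
            (m k O + (m k (openCube d ∩ Nul) + (1 - θ) * m k P)) * normCost nrm p (z k) (y k) := by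
            gcongr
        _ = ∫⁻ u in P, normCost nrm p u (y k) ∂(m k) + m k O * normCost nrm p (z k) (y k) +
            normCost nrm p (z k) (y k) * (m k (openCube d ∩ Nul) + (1 - θ) * m k P) := by ring
        _ ≤ _ := by
            refine add_le_add ((add_le_add le_rfl h1).trans h2) ?_
            gcongr
    -- If the two points differ, the original transport is of no use and all of the mass `w` is
    -- charged at the cost bound `D`.
    · rw [if_neg hxy]
      refine le_trans ?_ le_add_self
      calc _ ≤ θ * (D * m k P) + (w - θ * m k P) * D := by
            gcongr
            rw [← setLIntegral_const]
            refine setLIntegral_mono measurable_const fun u hu => ?_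
            exact normCost_le_of_mem_closedCube hp hΛ hΛ0 (openCube_subset_closedCube hu.1) (hy k)
        _ = D * (θ * m k P + (w - θ * m k P)) := by ring
        _ = D * w := by rw [add_tsub_cancel_of_le (hθP k)]
        _ ≤ _ := by
            gcongr
            exact le_add_self
  have hcost : infCost (normCost nrm p) (leaking d) (emp y) ≤
      (n * w)⁻¹ * ∑ k, (θ * ∫⁻ u in P, normCost nrm p u (y k) ∂(m k) +
      (w - θ * m k P) * normCost nrm p (z k) (y k)) := by
    refine (iInf₂_le _ hleak).trans ((otCost_family_le _ y m' hmass).trans_eq ?_)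
    rw [Finset.mul_sum]
    refine Finset.sum_congr rfl fun k _ => ?_
    rw [hm', lintegral_smul_measure, lintegral_add_measure, lintegral_smul_measure,
      lintegral_smul_measure, lintegral_dirac' _ (hcm k)]
    rfl
  calc n * w * infCost (normCost nrm p) (leaking d) (emp y)
      ≤ n * w * ((n * w)⁻¹ * ∑ k, (θ * ∫⁻ u in P, normCost nrm p u (y k) ∂(m k) +
      (w - θ * m k P) * normCost nrm p (z k) (y k))) := by gcongr
    _ = ∑ k, (θ * ∫⁻ u in P, normCost nrm p u (y k) ∂(m k) +
      (w - θ * m k P) * normCost nrm p (z k) (y k)) := by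
        rw [← mul_assoc, ENNReal.mul_inv_cancel hnw0 hnwt, one_mul]
    _ ≤ ∑ k, (∫⁻ u, normCost nrm p u (x k) ∂(m k) +
      D * (m k (openCube d ∩ Nul) + (1 - θ) * m k P + if x k = y k then 0 else w)) :=
        Finset.sum_le_sum fun k _ => hterm k
    _ = (∑ k, ∫⁻ u, normCost nrm p u (x k) ∂(m k)) +
        D * (∑ k, m k (openCube d ∩ Nul) + (1 - θ) * ∑ k, m k P +
          ∑ k, if x k = y k then 0 else w) := by
        rw [Finset.sum_add_distrib, ← Finset.mul_sum, Finset.sum_add_distrib,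
          Finset.sum_add_distrib, ← Finset.mul_sum]
    _ ≤ _ := by
        gcongr
        refine le_trans ?_ hθl'
        gcongr
        refine (hdom P hPm le_rfl).trans ?_
        exact mul_le_of_le_one_right' prob_le_one

end Leaking

/-! ### Leaking transports in all cells of a grid simultaneously. -/

section LeakingCells

variable {d : ℕ} {nrm : Seminorm ℝ (Fin d → ℝ)} {p Λ : ℝ}

/-- The affine map that carries a grid cell to the unit cube. -/
def toUnit (r : ℝ) (v : Fin d → ℤ) : (Fin d → ℝ) → Fin d → ℝ :=
  cubeMap (-(r⁻¹ • fun i => (v i : ℝ) * r)) r⁻¹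

lemma measurable_toUnit (r : ℝ) (v : Fin d → ℤ) : Measurable (toUnit r v) := measurable_cubeMap _ _

lemma cubeMap_toUnit {r : ℝ} (hr : 0 < r) (v : Fin d → ℤ) (x : Fin d → ℝ) :
    cubeMap (fun i => (v i : ℝ) * r) r (toUnit r v x) = x := by
  funext i
  simp only [toUnit, cubeMap, Pi.add_apply, Pi.neg_apply, Pi.smul_apply, smul_eq_mul]
  field_simp
  ring

lemma toUnit_injective {r : ℝ} (hr : 0 < r) (v : Fin d → ℤ) : Function.Injective (toUnit r v) :=
  Function.LeftInverse.injective (cubeMap_toUnit hr v)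

lemma toUnit_preimage_cube {r : ℝ} (hr : 0 < r) (v : Fin d → ℤ) :
    toUnit r v ⁻¹' (cube 0 1) = gridCell r v := by
  rw [toUnit, cubeMap_preimage _ _ (inv_pos.2 hr), gridCell]
  simp [smul_smul, mul_inv_cancel₀ hr.ne']

lemma toUnit_preimage_openCube_subset {r : ℝ} (hr : 0 < r) (v : Fin d → ℤ) :
    toUnit r v ⁻¹' (openCube d) ⊆ gridCell r v := by
  rw [← toUnit_preimage_cube hr]
  exact Set.preimage_mono openCube_subset_cube

lemma map_toUnit_uniform {r : ℝ} (hr : 0 < r) (v : Fin d → ℤ) :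
    (uniform (gridCell r v)).map (toUnit r v) = unifCube d :=
  (unifCube_eq_map _ hr).symm

lemma ofReal_rpow_mul_normCost_toUnit (hp : 0 ≤ p) {r : ℝ} (hr : 0 < r) (v : Fin d → ℤ)
    (x y : Fin d → ℝ) :
    ENNReal.ofReal r ^ p * normCost nrm p (toUnit r v x) (toUnit r v y) = normCost nrm p x y := by
  rw [← normCost_cubeMap hp (fun i => (v i : ℝ) * r) hr, cubeMap_toUnit hr, cubeMap_toUnit hr]

lemma measurable_normCost_left (y : Fin d → ℝ) : Measurable fun u => normCost nrm p u y := by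
  have := continuous_seminorm nrm
  unfold normCost
  exact ((this.comp (continuous_id.sub continuous_const)).measurable.ennreal_ofReal).pow_const _

lemma sum_orderEmbOfFin {N : ℕ} (J : Finset (Fin N)) (f : Fin N → ℝ≥0∞) :
    ∑ k : Fin J.card, f (J.orderEmbOfFin rfl k) = ∑ j ∈ J, f j := by
  conv_rhs => rw [← J.map_orderEmbOfFin_univ rfl]
  rw [Finset.sum_map]
  rfl

/-- The estimate `infCost_leaking_le` for the points of `y` in the cell, after the cell has been
mapped onto the unit cube; the scaling accounts for the factor `r ^ p`. -/
lemma emp_mul_infCost_leaking_le (hd : d ≠ 0) (hp : 0 ≤ p) (hΛ : ∀ x, nrm x ≤ Λ * ‖x‖) (hΛ0 : 0 ≤ Λ)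
    {N : ℕ} (x y : Fin N → Fin d → ℝ) (m : Fin N → Measure (Fin d → ℝ))
    (hm : ∀ k, m k Set.univ = (N : ℝ≥0∞)⁻¹) {r : ℝ} (hr : 0 < r) (v : Fin d → ℤ) {l : ℝ≥0∞}
    (hl : l ≠ ∞) {Nul : Set (Fin d → ℝ)} (hNul : MeasurableSet Nul)
    (hdom : ∀ A, MeasurableSet A → A ⊆ toUnit r v ⁻¹' (openCube d) \ Nul →
      ∑ k, m k A ≤ l * uniform (gridCell r v) A) :
    emp y (gridCell r v) * (ENNReal.ofReal r ^ p * infCost (normCost nrm p) (leaking d)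
        ((ProbabilityTheory.cond (emp y) (gridCell r v)).map (toUnit r v))) ≤
      (∑ k ∈ idx (gridCell r v) y, ∫⁻ u, normCost nrm p u (x k) ∂(m k)) +
        ENNReal.ofReal r ^ p * ENNReal.ofReal Λ ^ p *
        (∑ k ∈ idx (gridCell r v) y, m k (gridCell r v ∩ Nul) + (l - emp y (gridCell r v)) +
          ∑ k ∈ idx (gridCell r v) y, if x k = y k then 0 else (N : ℝ≥0∞)⁻¹) := by
  have hBm := measurableSet_gridCell r v
  set B := gridCell r v with hB
  set J := idx B y with hJ
  have hTm := measurable_toUnit r v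
  set T := toUnit r v with hT
  set U := cubeMap (fun i => (v i : ℝ) * r) r with hU
  have hUm : Measurable U := measurable_cubeMap _ _
  rcases Nat.eq_zero_or_pos J.card with h0 | h0
  · have : emp y B = 0 := by
      rw [emp_apply y hBm, cnt, ← hJ, h0]; simp
    rw [this, zero_mul]
    exact zero_le
  have hN : N ≠ 0 := by
    rintro rfl
    have := J.card_le_univ
    rw [Fintype.card_fin] at this
    omega
  have hNE : (N : ℝ≥0∞) ≠ 0 := by exact_mod_cast hN
  have hw0 : (N : ℝ≥0∞)⁻¹ ≠ 0 := ENNReal.inv_ne_zero.2 (ENNReal.natCast_ne_top N)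
  have hwt : (N : ℝ≥0∞)⁻¹ ≠ ∞ := ENNReal.inv_ne_top.2 hNE
  set e := J.orderEmbOfFin rfl with he
  have heB : ∀ k, y (e k) ∈ B := fun k => by
    have : e k ∈ J := Finset.orderEmbOfFin_mem J rfl k
    simp only [hJ, idx, Finset.mem_filter] at this
    exact this.2
  have hempB : emp y B = J.card * (N : ℝ≥0∞)⁻¹ := by
    rw [emp_apply y hBm, cnt, ← hJ, mul_comm]
  have hcond : (ProbabilityTheory.cond (emp y) B).map T = emp (fun k => T (y (e k))) := by
    rw [cond_emp y hBm, emp_map hTm]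
  have main := infCost_leaking_le (nrm := nrm) hd hp hΛ hΛ0 h0.ne' hw0 hwt
    (fun k => T (x (e k))) (fun k => T (y (e k))) (fun k => ?_) (fun k => (m (e k)).map T)
    (fun k => ?_) hl (hUm hNul) (fun A hA hAo => ?_)
  · rw [hcond, hempB]
    calc _ = ENNReal.ofReal r ^ p * (J.card * (N : ℝ≥0∞)⁻¹ *
          infCost (normCost nrm p) (leaking d) (emp fun k => T (y (e k)))) := by ring
      _ ≤ _ := mul_le_mul_of_nonneg_left main zero_le
      _ ≤ _ := ?_
    rw [mul_add, ← mul_assoc, Finset.mul_sum, ← sum_orderEmbOfFin J, ← sum_orderEmbOfFin J,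
      ← sum_orderEmbOfFin J]
    refine add_le_add (le_of_eq ?_) ?_
    · refine Finset.sum_congr rfl fun k _ => ?_
      have hcT : Measurable fun u => normCost nrm p (T u) (T (x (e k))) :=
        (measurable_normCost_left _).comp hTm
      rw [lintegral_map (measurable_normCost_left _) hTm, ← lintegral_const_mul _ hcT]
      exact lintegral_congr fun u => ofReal_rpow_mul_normCost_toUnit hp hr v _ _
    · refine mul_le_mul_of_nonneg_left (add_le_add (add_le_add (Finset.sum_le_sum fun k _ => ?_)
        le_rfl) (Finset.sum_le_sum fun k _ => ?_)) zero_le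
      · rw [Measure.map_apply hTm (measurableSet_openCube.inter (hUm hNul))]
        refine measure_mono fun u hu => ⟨toUnit_preimage_openCube_subset hr v hu.1, ?_⟩
        have : U (T u) ∈ Nul := hu.2
        rwa [hU, cubeMap_toUnit hr] at this
      · simp only [(toUnit_injective hr v).eq_iff, hT]
        exact le_rfl
  · have h1 : y (e k) ∈ T ⁻¹' (cube 0 1) := by
      rw [toUnit_preimage_cube hr]
      exact heB k
    exact cube_subset_closedCube h1
  · rw [Measure.map_apply hTm MeasurableSet.univ, Set.preimage_univ, hm]
  · have hsub : T ⁻¹' A ⊆ T ⁻¹' (openCube d) \ Nul := by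
      intro u hu
      refine ⟨(hAo hu).1, fun hn => (hAo hu).2 ?_⟩
      change U (T u) ∈ Nul
      rwa [hU, cubeMap_toUnit hr]
    simp_rw [Measure.map_apply hTm hA]
    calc ∑ k, m (e k) (T ⁻¹' A) = ∑ j ∈ J, m j (T ⁻¹' A) :=
          sum_orderEmbOfFin J fun j => m j (T ⁻¹' A)
      _ ≤ ∑ j, m j (T ⁻¹' A) := Finset.sum_le_univ_sum_of_nonneg fun _ => zero_le
      _ ≤ l * uniform B (T ⁻¹' A) := hdom _ (hTm hA) hsub
      _ = _ := by rw [← Measure.map_apply hTm hA, map_toUnit_uniform hr]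

/-- The sum over grid cells of the leaking transport costs of the points `y` is bounded by the
transport cost of the points `x`, up to an error that accounts for the difference of the points. -/
lemma sum_infCost_leaking_le (hd : d ≠ 0) (hp : 0 ≤ p) (hΛ : ∀ x, nrm x ≤ Λ * ‖x‖) (hΛ0 : 0 ≤ Λ)
    {N : ℕ} (z : Fin N → (Fin d → ℝ) × (Fin d → ℝ)) {r : ℝ} (hr : 0 < r)
    (S : Finset (Fin d → ℤ)) {l : (Fin d → ℤ) → ℝ≥0∞} (hl : ∀ v, l v ≠ ∞) {τ : ℝ≥0∞}
    {Nul : Set (Fin d → ℝ)} (hNul : MeasurableSet Nul) {C : Set (Measure (Fin d → ℝ))}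
    (hdom : ∀ ρ ∈ C, ∀ v ∈ S, ∀ A, MeasurableSet A → A ⊆ toUnit r v ⁻¹' (openCube d) \ Nul →
      ρ A ≤ l v * uniform (gridCell r v) A)
    (hτ : ∀ ρ ∈ C, ρ ((⋃ v ∈ S, gridCell r v) ∩ Nul) ≤ τ) :
    ∑ v ∈ S, emp (fun j => (z j).2) (gridCell r v) * (ENNReal.ofReal r ^ p *
        infCost (normCost nrm p) (leaking d)
        ((ProbabilityTheory.cond (emp fun j => (z j).2) (gridCell r v)).map (toUnit r v))) ≤
      infCost (normCost nrm p) C (emp fun j => (z j).1) +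
        ENNReal.ofReal r ^ p * ENNReal.ofReal Λ ^ p *
        (τ + ∑ v ∈ S, (l v - emp (fun j => (z j).2) (gridCell r v)) +
          emp z {z | z.2 ∈ ⋃ v ∈ S, gridCell r v ∧ z.1 ≠ z.2}) := by
  classical
  set y := fun j => (z j).2 with hy
  set x := fun j => (z j).1 with hx
  set D := ENNReal.ofReal r ^ p * ENNReal.ofReal Λ ^ p with hD
  set G := ⋃ v ∈ S, gridCell r v with hG
  have hGm : MeasurableSet G := Finset.measurableSet_biUnion _ fun v _ => measurableSet_gridCell r v
  -- Each point of `y` lies in at most one cell, so each piece `m j` is spent at most once. This is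
  -- the source of superadditivity.
  have hdisj : (S : Set (Fin d → ℤ)).PairwiseDisjoint fun v => idx (gridCell r v) y := by
    intro v _ w _ hvw
    refine Finset.disjoint_left.2 fun j hj hj' => ?_
    simp only [idx, Finset.mem_filter] at hj hj'
    exact Set.disjoint_left.1 (disjoint_gridCell hr hvw) hj.2 hj'.2
  have hsum : ∀ f : Fin N → ℝ≥0∞, ∑ v ∈ S, ∑ j ∈ idx (gridCell r v) y, f j =
      ∑ j ∈ S.biUnion fun v => idx (gridCell r v) y, f j := fun f =>
    (Finset.sum_biUnion hdisj).symm
  rw [infCost_emp, ENNReal.iInf_add]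
  refine le_iInf fun m => ?_
  rw [ENNReal.iInf_add]
  refine le_iInf fun hm => ?_
  obtain ⟨hmC, hmass⟩ := hm
  refine (Finset.sum_le_sum fun v hv => emp_mul_infCost_leaking_le hd hp hΛ hΛ0 x y m hmass hr v
    (hl v) hNul fun A hA hA' => ?_).trans ?_
  · rw [← Measure.finsetSum_apply]
    exact hdom _ hmC v hv A hA hA'
  rw [Finset.sum_add_distrib, ← Finset.mul_sum, Finset.sum_add_distrib, Finset.sum_add_distrib,
    hsum, hsum]
  gcongr ?_ + D * (?_ + _ + ?_)
  · exact Finset.sum_le_univ_sum_of_nonneg fun _ => zero_le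
  · refine le_trans ?_ (hτ _ hmC)
    rw [hG, Set.iUnion₂_inter, measure_biUnion_finset]
    · refine Finset.sum_le_sum fun v _ => ?_
      rw [Measure.finsetSum_apply]
      exact Finset.sum_le_univ_sum_of_nonneg fun _ => zero_le
    · intro v _ w _ hvw
      exact (disjoint_gridCell hr hvw).mono Set.inter_subset_left Set.inter_subset_left
    · exact fun v _ => (measurableSet_gridCell r v).inter hNul
  · have hBm : MeasurableSet {z : (Fin d → ℝ) × (Fin d → ℝ) | z.2 ∈ G ∧ z.1 ≠ z.2} :=
      (measurable_snd hGm).inter (measurableSet_eq_fun measurable_fst measurable_snd).compl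
    rw [emp_apply z hBm, cnt, mul_comm, ← nsmul_eq_mul, ← Finset.sum_const]
    simp_rw [fun j => (ite_not (x j = y j) (N : ℝ≥0∞)⁻¹ 0).symm]
    rw [← Finset.sum_filter]
    refine Finset.sum_le_sum_of_subset fun j hj => ?_
    simp only [idx, Finset.mem_filter, Finset.mem_biUnion, Finset.mem_univ, true_and] at hj ⊢
    obtain ⟨⟨v, hv, hjv⟩, hne⟩ := hj
    exact ⟨Set.mem_biUnion hv hjv, hne⟩

lemma avgEmp_map {Z Z' : Type*} [MeasurableSpace Z] [MeasurableSpace Z'] {T : Z → Z'}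
    (hT : Measurable T) {F : Measure Z' → ℝ≥0∞} {N : ℕ}
    (hF : Measurable fun z : Fin N → Z' => F (emp z)) (μ : Measure Z) [IsFiniteMeasure μ] :
    avgEmp F N (μ.map T) = ∫⁻ z : Fin N → Z, F (emp fun j => T (z j)) ∂(Measure.pi fun _ => μ) := by
  have h := Measure.pi_map_pi (μ := fun _ : Fin N => μ) (f := fun _ => T)
    (fun _ => hT.aemeasurable)
  rw [avgEmp, ← h, lintegral_map hF (by fun_prop)]

/-- The pairs of points are independent with law `γ`. The first components form the sample whose
cost is to be bounded below; the second components are uniform within each cell, so conditioning on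
their number produces `leakMean`. The pairs with different components are charged separately. -/
lemma sum_leakMean_le (hd : d ≠ 0) (hp : 0 < p) (hΛ : ∀ x, nrm x ≤ Λ * ‖x‖) (hΛ0 : 0 ≤ Λ)
    {N : ℕ} (hN : N ≠ 0) (γ : Measure ((Fin d → ℝ) × (Fin d → ℝ))) [IsProbabilityMeasure γ] {r : ℝ}
    (hr : 0 < r) (S : Finset (Fin d → ℤ)) {l : (Fin d → ℤ) → ℝ≥0∞} (hl : ∀ v, l v ≠ ∞) {τ : ℝ≥0∞}
    {Nul : Set (Fin d → ℝ)} (hNul : MeasurableSet Nul) {C : Set (Measure (Fin d → ℝ))}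
    (hCb : ∀ ρ ∈ C, ∫⁻ x, normBound Λ p x ∂ρ ≠ ∞)
    (hdom : ∀ ρ ∈ C, ∀ v ∈ S, ∀ A, MeasurableSet A → A ⊆ toUnit r v ⁻¹' (openCube d) \ Nul →
      ρ A ≤ l v * uniform (gridCell r v) A)
    (hτ : ∀ ρ ∈ C, ρ ((⋃ v ∈ S, gridCell r v) ∩ Nul) ≤ τ)
    (hcond : ∀ v ∈ S, (γ.map Prod.snd) (gridCell r v) ≠ 0 →
      ProbabilityTheory.cond (γ.map Prod.snd) (gridCell r v) = uniform (gridCell r v)) :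
    ∑ v ∈ S, ENNReal.ofReal r ^ p * ∫⁻ y : Fin N → Fin d → ℝ, (N : ℝ≥0∞)⁻¹ *
        (cnt (gridCell r v) y : ℝ≥0∞) * leakMean d nrm p (cnt (gridCell r v) y)
        ∂(Measure.pi fun _ => γ.map Prod.snd) ≤
      avgEmp (infCost (normCost nrm p) C) N (γ.map Prod.fst) +
        ENNReal.ofReal r ^ p * ENNReal.ofReal Λ ^ p *
        (τ + (∑ v ∈ S, ∫⁻ y : Fin N → Fin d → ℝ, (l v - (N : ℝ≥0∞)⁻¹ *
          (cnt (gridCell r v) y : ℝ≥0∞)) ∂(Measure.pi fun _ => γ.map Prod.snd)) +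
          γ {z | z.2 ∈ ⋃ v ∈ S, gridCell r v ∧ z.1 ≠ z.2}) := by
  set μ' := γ.map Prod.snd with hμ'
  have : IsProbabilityMeasure μ' := Measure.isProbabilityMeasure_map measurable_snd.aemeasurable
  have hNE : (N : ℝ≥0∞) ≠ 0 := by exact_mod_cast hN
  have hNt := ENNReal.natCast_ne_top N
  have hBm := measurableSet_gridCell (d := d) r
  set c := normCost nrm p with hc
  set G := ⋃ v ∈ S, gridCell r v with hG
  have hGm : MeasurableSet G := Finset.measurableSet_biUnion _ fun v _ => hBm v
  set Bad : Set ((Fin d → ℝ) × (Fin d → ℝ)) := {z | z.2 ∈ G ∧ z.1 ≠ z.2} with hBad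
  have hBadm : MeasurableSet Bad :=
    (measurable_snd hGm).inter (measurableSet_eq_fun measurable_fst measurable_snd).compl
  set R := ENNReal.ofReal r ^ p with hR
  have hRt : R ≠ ∞ := ofReal_rpow_ne_top hr
  set D := R * ENNReal.ofReal Λ ^ p with hD
  set P := Measure.pi fun _ : Fin N => γ with hP
  have hsndm : Measurable fun (z : Fin N → (Fin d → ℝ) × (Fin d → ℝ)) (j : Fin N) => (z j).2 := by
    fun_prop
  have hfstm : Measurable fun (z : Fin N → (Fin d → ℝ) × (Fin d → ℝ)) (j : Fin N) => (z j).1 := by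
    fun_prop
  have hPμ' : P.map (fun z j => (z j).2) = Measure.pi fun _ => μ' :=
    Measure.pi_map_pi (μ := fun _ : Fin N => γ) (f := fun _ => Prod.snd)
      (fun _ => measurable_snd.aemeasurable)
  have hIm : Measurable fun x : Fin N → Fin d → ℝ => infCost c C (emp x) :=
    measurable_infCost_emp (goodCost_normCost hp hΛ hΛ0) hCb N
  set F : (Fin d → ℤ) → Measure (Fin d → ℝ) → ℝ≥0∞ := fun v ρ =>
    R * infCost c (leaking d) (ρ.map (toUnit r v)) with hF
  have hFm : ∀ v n, Measurable fun y : Fin n → Fin d → ℝ => F v (emp y) := by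
    intro v n
    have h1 : Measurable fun (y : Fin n → Fin d → ℝ) (j : Fin n) => toUnit r v (y j) :=
      measurable_pi_lambda _ fun j => (measurable_toUnit r v).comp (measurable_pi_apply j)
    simp_rw [hF, emp_map (measurable_toUnit r v)]
    exact ((measurable_infCost_leaking hp hΛ hΛ0 n).comp h1).const_mul _
  have hleft : ∀ v ∈ S, R * ∫⁻ y : Fin N → Fin d → ℝ, (N : ℝ≥0∞)⁻¹ *
        (cnt (gridCell r v) y : ℝ≥0∞) * leakMean d nrm p (cnt (gridCell r v) y)
        ∂(Measure.pi fun _ => μ') ≤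
      ∫⁻ z : Fin N → (Fin d → ℝ) × (Fin d → ℝ), emp (fun j => (z j).2) (gridCell r v) *
        F v (ProbabilityTheory.cond (emp fun j => (z j).2) (gridCell r v)) ∂P := by
    intro v hv
    have hm1 : Measurable fun y : Fin N → Fin d → ℝ =>
        (N : ℝ≥0∞)⁻¹ * (cnt (gridCell r v) y : ℝ≥0∞) *
          F v (ProbabilityTheory.cond (emp y) (gridCell r v)) :=
      measurable_weight_cond (hBm v) (fun n => (N : ℝ≥0∞)⁻¹ * (n : ℝ≥0∞)) (hFm v)
    have e1 : ∫⁻ z : Fin N → (Fin d → ℝ) × (Fin d → ℝ), emp (fun j => (z j).2) (gridCell r v) *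
        F v (ProbabilityTheory.cond (emp fun j => (z j).2) (gridCell r v)) ∂P =
        ∫⁻ y : Fin N → Fin d → ℝ, (N : ℝ≥0∞)⁻¹ * (cnt (gridCell r v) y : ℝ≥0∞) *
          avgEmp (F v) (cnt (gridCell r v) y) (ProbabilityTheory.cond μ' (gridCell r v))
          ∂(Measure.pi fun _ => μ') := by
      rw [← lintegral_weight_cond μ' (hBm v) (fun n => (N : ℝ≥0∞)⁻¹ * (n : ℝ≥0∞)) (hFm v), ← hPμ',
        lintegral_map hm1 hsndm]
      simp_rw [emp_apply _ (hBm v)]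
    rw [e1, ← lintegral_const_mul' _ _ hRt]
    rcases eq_or_ne (μ' (gridCell r v)) 0 with h0 | h0
    · refine lintegral_mono_ae ?_
      filter_upwards [ae_cnt_eq_zero (hBm v) h0] with y hy
      simp [hy]
    · rw [hcond v hv h0]
      refine lintegral_mono fun y => ?_
      rw [mul_left_comm]
      gcongr
      have : IsProbabilityMeasure (uniform (gridCell r v)) := isProbabilityMeasure_uniform_cube _ hr
      rw [leakMean, ← map_toUnit_uniform hr v]
      simp only [avgEmp, hF]
      rw [lintegral_const_mul' _ _ hRt]
      -- The uniform law on the cell is carried to the unit cube, so the average over the cell is at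
      -- least the leaking mean of the unit cube.
      exact mul_le_mul_of_nonneg_left (avgEmp_map_le (measurable_toUnit r v)
        (infCost c (leaking d)) _ (uniform (gridCell r v))) zero_le
  have hcntm : ∀ v, Measurable fun z : Fin N → (Fin d → ℝ) × (Fin d → ℝ) =>
      l v - emp (fun j => (z j).2) (gridCell r v) := by
    intro v
    simp_rw [emp_apply _ (hBm v)]
    exact (measurable_comp_cnt (hBm v) fun n => l v - (N : ℝ≥0∞)⁻¹ * (n : ℝ≥0∞)).comp hsndm
  have hempBad : Measurable fun z : Fin N → (Fin d → ℝ) × (Fin d → ℝ) => emp z Bad := by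
    simp_rw [emp_apply _ hBadm]
    exact measurable_comp_cnt hBadm fun n => (N : ℝ≥0∞)⁻¹ * (n : ℝ≥0∞)
  have hsm : Measurable fun z : Fin N → (Fin d → ℝ) × (Fin d → ℝ) =>
      τ + ∑ v ∈ S, (l v - emp (fun j => (z j).2) (gridCell r v)) :=
    (Finset.measurable_sum _ fun v _ => hcntm v).const_add _
  calc _ ≤ ∑ v ∈ S, ∫⁻ z : Fin N → (Fin d → ℝ) × (Fin d → ℝ),
        emp (fun j => (z j).2) (gridCell r v) *
        F v (ProbabilityTheory.cond (emp fun j => (z j).2) (gridCell r v)) ∂P :=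
        Finset.sum_le_sum hleft
    _ = ∫⁻ z : Fin N → (Fin d → ℝ) × (Fin d → ℝ), ∑ v ∈ S,
        emp (fun j => (z j).2) (gridCell r v) *
        F v (ProbabilityTheory.cond (emp fun j => (z j).2) (gridCell r v)) ∂P := by
        rw [lintegral_finsetSum]
        intro v _
        simp_rw [emp_apply _ (hBm v)]
        exact (measurable_weight_cond (hBm v) (N := N)
          (fun n => (N : ℝ≥0∞)⁻¹ * (n : ℝ≥0∞)) (hFm v)).comp hsndm
    _ ≤ ∫⁻ z : Fin N → (Fin d → ℝ) × (Fin d → ℝ), (infCost c C (emp fun j => (z j).1) +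
        D * (τ + ∑ v ∈ S, (l v - emp (fun j => (z j).2) (gridCell r v)) + emp z Bad)) ∂P :=
        lintegral_mono fun z => sum_infCost_leaking_le hd hp.le hΛ hΛ0 z hr S hl hNul hdom hτ
    _ = _ := by
        have hIm' : Measurable fun z : Fin N → (Fin d → ℝ) × (Fin d → ℝ) =>
            infCost c C (emp fun j => (z j).1) := hIm.comp hfstm
        have hsm' : Measurable fun z : Fin N → (Fin d → ℝ) × (Fin d → ℝ) =>
            τ + ∑ v ∈ S, (l v - emp (fun j => (z j).2) (gridCell r v)) + emp z Bad :=
          hsm.add hempBad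
        rw [lintegral_add_left hIm', lintegral_const_mul _ hsm',
          lintegral_add_left hsm, lintegral_add_left measurable_const,
          lintegral_finsetSum _ fun v _ => hcntm v, avgEmp_map measurable_fst hIm γ]
        have e2 : ∫⁻ z : Fin N → (Fin d → ℝ) × (Fin d → ℝ), emp z Bad ∂P = γ Bad := by
          simp_rw [emp_apply _ hBadm]
          have hm2 : Measurable fun z : Fin N → (Fin d → ℝ) × (Fin d → ℝ) =>
              (cnt Bad z : ℝ≥0∞) := measurable_comp_cnt hBadm _
          rw [lintegral_const_mul _ hm2, lintegral_cnt γ hBadm, ← mul_assoc,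
            ENNReal.inv_mul_cancel hNE hNt, one_mul]
        have e3 : ∀ v, ∫⁻ z : Fin N → (Fin d → ℝ) × (Fin d → ℝ),
            (l v - emp (fun j => (z j).2) (gridCell r v)) ∂P =
            ∫⁻ y : Fin N → Fin d → ℝ, (l v - (N : ℝ≥0∞)⁻¹ * (cnt (gridCell r v) y : ℝ≥0∞))
              ∂(Measure.pi fun _ => μ') := by
          intro v
          have hm3 : Measurable fun y : Fin N → Fin d → ℝ =>
              l v - (N : ℝ≥0∞)⁻¹ * (cnt (gridCell r v) y : ℝ≥0∞) :=
            measurable_comp_cnt (hBm v) fun n => l v - (N : ℝ≥0∞)⁻¹ * (n : ℝ≥0∞)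
          rw [← hPμ', lintegral_map hm3 hsndm]
          simp_rw [emp_apply _ (hBm v)]
        rw [hP] at e2 e3
        simp_rw [hP, e2, e3]
        simp

end LeakingCells

/-! ### Lower estimates for functions of the number of points. -/

section Counting

variable {Z : Type*} [MeasurableSpace Z]

/-- The mirror image of `limsup_le_liminf_of_forall_eventually_le`: for fixed `m`, choose a large
`N` with `v N` close to the liminf. -/
lemma limsup_le_liminf_of_eventually_le_liminf {u v : ℕ → ℝ≥0∞}
    (h : ∀ ε : ℝ, 0 < ε → ∃ δ : ℕ → ℝ≥0∞, Tendsto δ atTop (𝓝 0) ∧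
      ∀ m, m ≠ 0 → ∀ᶠ N in atTop, u m ≤ ENNReal.ofReal (1 + ε) * v N + δ m) :
    limsup u atTop ≤ liminf v atTop := by
  refine le_of_forall_gt_imp_ge_of_dense fun L hL => ?_
  have hfreq : ∃ᶠ N in atTop, v N < L := frequently_lt_of_liminf_lt (h := hL)
  have key : ∀ ε : ℝ, 0 < ε → limsup u atTop ≤ ENNReal.ofReal (1 + ε) * L := by
    intro ε hε
    obtain ⟨δ, hδ, hm⟩ := h ε hε
    have hle : ∀ᶠ m in atTop, u m ≤ ENNReal.ofReal (1 + ε) * L + δ m := by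
      filter_upwards [eventually_ne_atTop 0] with m hm0
      obtain ⟨N, hN1, hN2⟩ := (hfreq.and_eventually (hm m hm0)).exists
      refine hN2.trans ?_
      gcongr
    have hlim : Tendsto (fun m => ENNReal.ofReal (1 + ε) * L + δ m) atTop
        (𝓝 (ENNReal.ofReal (1 + ε) * L + 0)) := hδ.const_add _
    rw [add_zero] at hlim
    exact (limsup_le_limsup hle).trans_eq hlim.limsup_eq
  have hlim : Tendsto (fun ε : ℝ => ENNReal.ofReal (1 + ε) * L) (𝓝[>] 0)
      (𝓝 (ENNReal.ofReal (1 + 0) * L)) := by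
    refine ENNReal.Tendsto.mul_const ?_ (Or.inl (by simp))
    refine (ENNReal.continuous_ofReal.tendsto _).comp ?_
    exact (tendsto_const_nhds.add tendsto_id).mono_left nhdsWithin_le_nhds
  rw [add_zero, ENNReal.ofReal_one, one_mul] at hlim
  exact ge_of_tendsto hlim (eventually_mem_nhdsWithin.mono fun ε hε => key ε hε)

/-- A lower bound of a decreasing mean cost, evaluated at the number of points in a set whose mean is
less than `m₀`. -/
lemma mul_le_lintegral_cnt_mul {μ : Measure Z} [IsProbabilityMeasure μ] {N : ℕ} {B : Set Z}
    (hB : MeasurableSet B) {φ : ℕ → ℝ≥0∞} (hφ : ∀ n m, n ≠ 0 → n ≤ m → φ m ≤ φ n)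
    {m₀ : ℕ} (hm : N * μ B < (m₀ : ℝ≥0∞)) :
    N * μ B * φ m₀ ≤ (∫⁻ z : Fin N → Z, (cnt B z : ℝ≥0∞) * φ (cnt B z)
      ∂(Measure.pi fun _ => μ)) +
        φ m₀ * (m₀ * (m₀ - N * μ B)⁻¹) * (N * μ B) ^ (1 / 2 : ℝ) := by
  set m : ℝ≥0∞ := N * μ B with hmdef
  have hd0 : (m₀ - m : ℝ≥0∞) ≠ 0 := (tsub_pos_iff_lt.2 hm).ne'
  have hdt : (m₀ - m : ℝ≥0∞) ≠ ∞ := ne_top_of_le_ne_top (ENNReal.natCast_ne_top _) tsub_le_self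
  have hmt : m ≠ ∞ := (hm.trans_le le_top).ne
  have hpt : ∀ n : ℕ, (n : ℝ≥0∞) * φ m₀ ≤ n * φ n + φ m₀ * (m₀ * (m₀ - m)⁻¹) * adist n m := by
    intro n
    rcases le_or_gt n m₀ with h | h
    · refine le_trans ?_ le_self_add
      rcases Nat.eq_zero_or_pos n with h0 | h0
      · simp [h0]
      · exact mul_le_mul_of_nonneg_left (hφ _ _ h0.ne' h) zero_le
    · refine le_trans ?_ le_add_self
      have h1 : (m₀ : ℝ≥0∞) ≤ n := by exact_mod_cast h.le
      -- For `n > m₀` the count `n` is at most `m₀ / (m₀ - m)` times its deviation from the mean,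
      -- because `n * m ≥ m₀ * m`.
      have h2 : (n : ℝ≥0∞) * (m₀ - m) ≤ m₀ * (n - m) := by
        rw [ENNReal.mul_sub fun _ _ => ENNReal.natCast_ne_top _,
          ENNReal.mul_sub fun _ _ => ENNReal.natCast_ne_top _, mul_comm (n : ℝ≥0∞) m₀]
        gcongr
      calc (n : ℝ≥0∞) * φ m₀ = φ m₀ * ((n : ℝ≥0∞) * (m₀ - m) * (m₀ - m)⁻¹) := by
            rw [mul_assoc (n : ℝ≥0∞), ENNReal.mul_inv_cancel hd0 hdt, mul_one, mul_comm]
        _ ≤ φ m₀ * (m₀ * adist n m * (m₀ - m)⁻¹) := by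
            refine mul_le_mul_of_nonneg_left (mul_le_mul' (h2.trans ?_) le_rfl) zero_le
            exact mul_le_mul_of_nonneg_left le_self_add zero_le
        _ = _ := by ring
  have hm1 : Measurable fun z : Fin N → Z => (cnt B z : ℝ≥0∞) := measurable_comp_cnt hB _
  have hm2 : Measurable fun z : Fin N → Z => (cnt B z : ℝ≥0∞) * φ (cnt B z) :=
    measurable_comp_cnt hB fun n => (n : ℝ≥0∞) * φ n
  calc m * φ m₀ = ∫⁻ z : Fin N → Z, (cnt B z : ℝ≥0∞) * φ m₀ ∂(Measure.pi fun _ => μ) := by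
        rw [lintegral_mul_const _ hm1, lintegral_cnt μ hB]
    _ ≤ ∫⁻ z : Fin N → Z, ((cnt B z : ℝ≥0∞) * φ (cnt B z) +
        φ m₀ * (m₀ * (m₀ - m)⁻¹) * adist (cnt B z) m) ∂(Measure.pi fun _ => μ) :=
        lintegral_mono fun z => hpt _
    _ = (∫⁻ z : Fin N → Z, (cnt B z : ℝ≥0∞) * φ (cnt B z) ∂(Measure.pi fun _ => μ)) +
        φ m₀ * (m₀ * (m₀ - m)⁻¹) *
          ∫⁻ z : Fin N → Z, adist (cnt B z) m ∂(Measure.pi fun _ => μ) := by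
        rw [lintegral_add_left hm2, lintegral_const_mul _ (measurable_adist_cnt hB _)]
    _ ≤ _ := by
        gcongr
        exact lintegral_adist_cnt_le μ hB

/-- The expected deficit of the number of points in a set. -/
lemma lintegral_sub_cnt_le {μ : Measure Z} [IsProbabilityMeasure μ] {N : ℕ} (hN : N ≠ 0) {B : Set Z}
    (hB : MeasurableSet B) {l : ℝ≥0∞} :
    ∫⁻ z : Fin N → Z, (l - (N : ℝ≥0∞)⁻¹ * (cnt B z : ℝ≥0∞)) ∂(Measure.pi fun _ => μ) ≤
      (l - μ B) + (N : ℝ≥0∞)⁻¹ * (N * μ B) ^ (1 / 2 : ℝ) := by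
  have hNE : (N : ℝ≥0∞) ≠ 0 := by exact_mod_cast hN
  have hNt := ENNReal.natCast_ne_top N
  calc _ ≤ ∫⁻ z : Fin N → Z, ((l - μ B) + (N : ℝ≥0∞)⁻¹ * adist (cnt B z) (N * μ B))
        ∂(Measure.pi fun _ => μ) := by
        refine lintegral_mono fun z => ?_
        have h1 : l - (N : ℝ≥0∞)⁻¹ * (cnt B z : ℝ≥0∞) ≤
            (l - μ B) + (μ B - (N : ℝ≥0∞)⁻¹ * (cnt B z : ℝ≥0∞)) := tsub_le_tsub_add_tsub
        refine h1.trans (add_le_add le_rfl ?_)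
        rw [adist, mul_add]
        refine le_trans (le_of_eq ?_) le_add_self
        rw [ENNReal.mul_sub fun _ _ => ENNReal.inv_ne_top.2 hNE, ← mul_assoc,
          ENNReal.inv_mul_cancel hNE hNt, one_mul]
    _ = (l - μ B) + (N : ℝ≥0∞)⁻¹ *
        ∫⁻ z : Fin N → Z, adist (cnt B z) (N * μ B) ∂(Measure.pi fun _ => μ) := by
        rw [lintegral_add_left measurable_const, lintegral_const,
          lintegral_const_mul _ (measurable_adist_cnt hB _), measure_univ, mul_one]
    _ ≤ _ := by
        gcongr
        exact lintegral_adist_cnt_le μ hB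

end Counting

/-! ### The leaking constant: existence and positivity. -/

section LeakLimit

variable {d : ℕ} {nrm : Seminorm ℝ (Fin d → ℝ)} {p Λ : ℝ}

/-- The labels of the grid cells of edge length `1 / k` in the unit cube. -/
def unitLabels (d k : ℕ) : Finset (Fin d → ℤ) := Fintype.piFinset fun _ => Finset.Ico (0 : ℤ) k

lemma card_unitLabels (d k : ℕ) : (unitLabels d k).card = k ^ d := by
  simp [unitLabels]

lemma gridCell_subset_cube {k : ℕ} (hk : k ≠ 0) {v : Fin d → ℤ} (hv : v ∈ unitLabels d k) :
    gridCell (1 / (k : ℝ)) v ⊆ cube 0 1 := by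
  intro x hx i hi
  have h := hx i hi
  simp only [unitLabels, Fintype.mem_piFinset, Finset.mem_Ico] at hv
  obtain ⟨h0, h1⟩ := hv i
  have h0' : (0 : ℝ) ≤ v i := by exact_mod_cast h0
  have h1' : (v i : ℝ) + 1 ≤ k := by exact_mod_cast h1
  have hk0 : (0 : ℝ) < k := by positivity
  simp only [Pi.zero_apply, zero_add]
  refine ⟨le_trans (by positivity) h.1, h.2.trans_le ?_⟩
  rw [← add_one_mul, mul_one_div, div_le_one hk0]
  exact h1'

lemma toUnit_preimage_openCube_subset_openCube {k : ℕ} (hk : k ≠ 0) {v : Fin d → ℤ}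
    (hv : v ∈ unitLabels d k) : toUnit (1 / (k : ℝ)) v ⁻¹' (openCube d) ⊆ openCube d := by
  intro x hx i hi
  have hk0 : (0 : ℝ) < k := by positivity
  have hr : 0 < 1 / (k : ℝ) := by positivity
  have h := hx i hi
  have hc : x ∈ cube 0 1 := gridCell_subset_cube hk hv (toUnit_preimage_openCube_subset hr v hx)
  refine ⟨?_, by simpa using (hc i hi).2⟩
  simp only [unitLabels, Fintype.mem_piFinset, Finset.mem_Ico] at hv
  have h0' : (0 : ℝ) ≤ v i := by exact_mod_cast (hv i).1
  have e := congrFun (cubeMap_toUnit hr v x) i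
  simp only [cubeMap, Pi.add_apply, Pi.smul_apply, smul_eq_mul] at e
  rw [← e]
  have : 0 < 1 / (k : ℝ) * toUnit (1 / (k : ℝ)) v x i := mul_pos hr h.1
  positivity

lemma volume_gridCell_one_div {k : ℕ} (hk : k ≠ 0) (v : Fin d → ℤ) :
    volume (gridCell (1 / (k : ℝ)) v) = ((k : ℝ≥0∞) ^ d)⁻¹ := by
  have hk0 : (0 : ℝ) < k := by positivity
  rw [volume_gridCell, ENNReal.ofReal_div_of_pos hk0, ENNReal.ofReal_one, ENNReal.ofReal_natCast,
    one_div, ENNReal.inv_pow]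

/-- The leaking cost of `N` points is bounded from below by that of the cells. -/
lemma lintegral_cnt_mul_leakMean_le (hd : d ≠ 0) (hp : 0 < p) (hΛ : ∀ x, nrm x ≤ Λ * ‖x‖)
    (hΛ0 : 0 ≤ Λ) {N k : ℕ} (hN : N ≠ 0) (hk : k ≠ 0) {m₀ : ℕ} {m : ℝ≥0∞}
    (hm : m = N * ((k : ℝ≥0∞) ^ d)⁻¹) (hmm : m < m₀) :
    m ^ (p / d) * leakMean d nrm p m₀ ≤ (N : ℝ≥0∞) ^ (p / d) * leakMean d nrm p N +
      m ^ (p / d) * m ^ (-(1 / 2) : ℝ) *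
        (ENNReal.ofReal Λ ^ p + leakMean d nrm p m₀ * (m₀ * (m₀ - m)⁻¹)) := by
  set r : ℝ := 1 / (k : ℝ) with hr
  have hk0 : (0 : ℝ) < k := by positivity
  have hr0 : 0 < r := by positivity
  have hdr : (d : ℝ) ≠ 0 := by exact_mod_cast hd
  have hkE : (k : ℝ≥0∞) ≠ 0 := by exact_mod_cast hk
  have hkt := ENNReal.natCast_ne_top k
  have hNE : (N : ℝ≥0∞) ≠ 0 := by exact_mod_cast hN
  have hNt := ENNReal.natCast_ne_top N
  have hkd0 : (k : ℝ≥0∞) ^ d ≠ 0 := pow_ne_zero _ hkE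
  have hkdt : (k : ℝ≥0∞) ^ d ≠ ∞ := ENNReal.pow_ne_top hkt
  have hs0 : 0 ≤ p / d := by positivity
  have hmt : m ≠ ∞ := hm ▸ ENNReal.mul_ne_top hNt (ENNReal.inv_ne_top.2 hkd0)
  have hm0 : m ≠ 0 := hm ▸ mul_ne_zero hNE (ENNReal.inv_ne_zero.2 hkdt)
  have hrk : ENNReal.ofReal r = (k : ℝ≥0∞)⁻¹ := by
    rw [hr, ENNReal.ofReal_div_of_pos hk0, ENNReal.ofReal_one, ENNReal.ofReal_natCast, one_div]
  have hrs : (N : ℝ≥0∞) ^ (p / d) * ENNReal.ofReal r ^ p = m ^ (p / d) := by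
    rw [hm, ENNReal.mul_rpow_of_nonneg _ _ hs0, hrk]
    congr 1
    rw [ENNReal.inv_rpow, ENNReal.inv_rpow, ← ENNReal.rpow_natCast, ← ENNReal.rpow_mul,
      mul_div_cancel₀ _ hdr]
  set S := unitLabels d k with hS
  have hdiag : Measurable fun x : Fin d → ℝ => (x, x) := by fun_prop
  -- Both samples coincide here, so no pair is charged for different components.
  set γ := (unifCube d).map fun x => (x, x) with hγ
  have : IsProbabilityMeasure γ := Measure.isProbabilityMeasure_map hdiag.aemeasurable
  have hfst : γ.map Prod.fst = unifCube d := by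
    rw [hγ, Measure.map_map measurable_fst hdiag]
    exact Measure.map_id
  have hsnd : γ.map Prod.snd = unifCube d := by
    rw [hγ, Measure.map_map measurable_snd hdiag]
    exact Measure.map_id
  have hvol : ∀ v ∈ S, unifCube d (gridCell r v) = ((k : ℝ≥0∞) ^ d)⁻¹ := by
    intro v hv
    rw [unifCube_eq, Measure.restrict_apply (measurableSet_gridCell r v),
      Set.inter_eq_left.2 (gridCell_subset_cube hk hv), volume_gridCell_one_div hk]
  -- The sources are all leaking measures of the large cube. Inside an open cell they are dominated
  -- by the uniform law, so no exceptional set is needed and `τ = 0`.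
  have hmain := sum_leakMean_le (nrm := nrm) hd hp hΛ hΛ0 hN γ hr0 S
    (l := fun _ => ((k : ℝ≥0∞) ^ d)⁻¹) (fun _ => ENNReal.inv_ne_top.2 hkd0) (τ := 0) (Nul := ∅)
    MeasurableSet.empty (C := leaking d)
    (fun ρ hρ => lintegral_normBound_ne_top_of_leaking hp.le hΛ0 hρ)
    (fun ρ hρ v hv A hA hAs => ?_) (fun ρ hρ => by simp) (fun v hv _ => ?_)
  rotate_left
  · rw [Set.sdiff_empty] at hAs
    refine (hρ.2.2 A hA (hAs.trans (toUnit_preimage_openCube_subset_openCube hk hv))).trans ?_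
    rw [unifCube_eq, uniform, Measure.smul_apply, Measure.restrict_apply hA,
      Measure.restrict_apply hA, volume_gridCell_one_div hk, smul_eq_mul, inv_inv, ← mul_assoc,
      ENNReal.inv_mul_cancel hkd0 hkdt, one_mul]
    exact measure_mono (Set.subset_inter Set.inter_subset_left (Set.inter_subset_left.trans
      (hAs.trans (toUnit_preimage_openCube_subset hr0 v))))
  · rw [hsnd, uniform_eq_cond]
    refine cond_congr_restrict one_ne_zero ENNReal.one_ne_top ?_
    rw [unifCube_eq, Measure.restrict_restrict (measurableSet_gridCell r v),
      Set.inter_eq_left.2 (gridCell_subset_cube hk hv), one_smul]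
  rw [hfst, hsnd] at hmain
  have hγ0 : γ {z | z.2 ∈ ⋃ v ∈ S, gridCell r v ∧ z.1 ≠ z.2} = 0 := by
    have : MeasurableSet {z : (Fin d → ℝ) × (Fin d → ℝ) | z.1 ≠ z.2} :=
      (measurableSet_eq_fun measurable_fst measurable_snd).compl
    refine measure_mono_null (t := {z | z.1 ≠ z.2}) (fun z hz => hz.2) ?_
    rw [hγ, Measure.map_apply hdiag this]
    simp
  have hNm : (N : ℝ≥0∞)⁻¹ = ((k : ℝ≥0∞) ^ d)⁻¹ * m⁻¹ := by
    rw [hm, ENNReal.mul_inv (Or.inl hNE) (Or.inl hNt), inv_inv, mul_left_comm,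
      ENNReal.inv_mul_cancel hkd0 hkdt, mul_one]
  have hm12 : m⁻¹ * m ^ (1 / 2 : ℝ) = m ^ (-(1 / 2) : ℝ) := by
    rw [← ENNReal.rpow_neg_one, ← ENNReal.rpow_add _ _ hm0 hmt]
    norm_num
  have hdef : ∑ v ∈ S, ∫⁻ y : Fin N → Fin d → ℝ, (((k : ℝ≥0∞) ^ d)⁻¹ -
      (N : ℝ≥0∞)⁻¹ * (cnt (gridCell r v) y : ℝ≥0∞)) ∂(Measure.pi fun _ => unifCube d) ≤
      m ^ (-(1 / 2) : ℝ) := by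
    calc _ ≤ ∑ v ∈ S, ((k : ℝ≥0∞) ^ d)⁻¹ * m ^ (-(1 / 2) : ℝ) := by
          refine Finset.sum_le_sum fun v hv => ?_
          refine (lintegral_sub_cnt_le hN (measurableSet_gridCell r v)).trans_eq ?_
          rw [hvol v hv, tsub_self, zero_add, ← hm, hNm, mul_assoc, hm12]
      _ = _ := by
          rw [Finset.sum_const, card_unitLabels, nsmul_eq_mul, Nat.cast_pow, ← mul_assoc,
            ENNReal.mul_inv_cancel hkd0 hkdt, one_mul]
  set φ := leakMean d nrm p with hφ
  set Y := φ m₀ * (m₀ * (m₀ - m)⁻¹) with hY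
  have hlow : φ m₀ ≤ (∑ v ∈ S, ∫⁻ y : Fin N → Fin d → ℝ, (N : ℝ≥0∞)⁻¹ *
      (cnt (gridCell r v) y : ℝ≥0∞) * φ (cnt (gridCell r v) y) ∂(Measure.pi fun _ => unifCube d)) +
      Y * m ^ (-(1 / 2) : ℝ) := by
    have h1 : ∀ v ∈ S, ((k : ℝ≥0∞) ^ d)⁻¹ * φ m₀ ≤ (∫⁻ y : Fin N → Fin d → ℝ, (N : ℝ≥0∞)⁻¹ *
        (cnt (gridCell r v) y : ℝ≥0∞) * φ (cnt (gridCell r v) y)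
        ∂(Measure.pi fun _ => unifCube d)) + ((k : ℝ≥0∞) ^ d)⁻¹ * (Y * m ^ (-(1 / 2) : ℝ)) := by
      intro v hv
      have hmv : N * unifCube d (gridCell r v) = m := by rw [hvol v hv, hm]
      have h := mul_le_lintegral_cnt_mul (μ := unifCube d) (N := N) (measurableSet_gridCell r v)
        (φ := φ) (fun n m hn hnm => leakMean_antitone hp hΛ hΛ0 hn hnm) (m₀ := m₀)
        (hmv.symm ▸ hmm)
      rw [hmv] at h
      have h2 := mul_le_mul_of_nonneg_left h (zero_le (a := (N : ℝ≥0∞)⁻¹))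
      have hcm : Measurable fun z : Fin N → Fin d → ℝ =>
          (cnt (gridCell r v) z : ℝ≥0∞) * φ (cnt (gridCell r v) z) :=
        measurable_comp_cnt (measurableSet_gridCell r v) (fun n => (n : ℝ≥0∞) * φ n)
      simp_rw [mul_assoc (N : ℝ≥0∞)⁻¹]
      rw [lintegral_const_mul _ hcm]
      calc _ = (N : ℝ≥0∞)⁻¹ * (m * φ m₀) := by
            rw [← mul_assoc, hNm, mul_assoc (((k : ℝ≥0∞) ^ d)⁻¹), ENNReal.inv_mul_cancel hm0 hmt,
              mul_one]
        _ ≤ _ := h2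
        _ = _ := by
            rw [mul_add, ← hm12]
            congr 1
            rw [hNm]
            ring
    have h2 := Finset.sum_le_sum h1
    rw [Finset.sum_add_distrib, Finset.sum_const, Finset.sum_const, card_unitLabels, nsmul_eq_mul,
      nsmul_eq_mul, Nat.cast_pow, ← mul_assoc, ← mul_assoc, ENNReal.mul_inv_cancel hkd0 hkdt,
      one_mul, one_mul] at h2
    exact h2
  rw [← Finset.mul_sum, hγ0, zero_add, add_zero] at hmain
  calc m ^ (p / d) * φ m₀ ≤ m ^ (p / d) * ((∑ v ∈ S, ∫⁻ y : Fin N → Fin d → ℝ, (N : ℝ≥0∞)⁻¹ *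
      (cnt (gridCell r v) y : ℝ≥0∞) * φ (cnt (gridCell r v) y) ∂(Measure.pi fun _ => unifCube d)) +
      Y * m ^ (-(1 / 2) : ℝ)) := by gcongr
    _ = (N : ℝ≥0∞) ^ (p / d) * (ENNReal.ofReal r ^ p * (∑ v ∈ S, ∫⁻ y : Fin N → Fin d → ℝ,
        (N : ℝ≥0∞)⁻¹ * (cnt (gridCell r v) y : ℝ≥0∞) * φ (cnt (gridCell r v) y)
        ∂(Measure.pi fun _ => unifCube d))) + m ^ (p / d) * (Y * m ^ (-(1 / 2) : ℝ)) := by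
        rw [← hrs]; ring
    _ ≤ (N : ℝ≥0∞) ^ (p / d) * (φ N + ENNReal.ofReal r ^ p * ENNReal.ofReal Λ ^ p *
        m ^ (-(1 / 2) : ℝ)) + m ^ (p / d) * (Y * m ^ (-(1 / 2) : ℝ)) := by
        refine add_le_add (mul_le_mul_of_nonneg_left (hmain.trans ?_) zero_le) le_rfl
        refine add_le_add le_rfl (mul_le_mul_of_nonneg_left hdef zero_le)
    _ = (N : ℝ≥0∞) ^ (p / d) * φ N + ((N : ℝ≥0∞) ^ (p / d) * ENNReal.ofReal r ^ p) *
        m ^ (-(1 / 2) : ℝ) * ENNReal.ofReal Λ ^ p + m ^ (p / d) * (Y * m ^ (-(1 / 2) : ℝ)) := by ring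
    _ = _ := by rw [hrs]; ring

/-- The scaled leaking costs converge. -/
lemma exists_tendsto_leakMean (hp : 0 < p) (hpd : p < (d : ℝ) / 2) (hΛ : ∀ x, nrm x ≤ Λ * ‖x‖)
    (hΛ0 : 0 ≤ Λ) : ∃ L, Tendsto (fun N : ℕ => (N : ℝ≥0∞) ^ (p / d) * leakMean d nrm p N)
      atTop (𝓝 L) := by
  have hd : 0 < (d : ℝ) := by linarith
  have hd0 : d ≠ 0 := by rintro rfl; simp at hd
  have hs0 : 0 < p / d := by positivity
  have hs2 : p / d < 1 / 2 := by rw [div_lt_iff₀ hd]; linarith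
  set s := p / d with hs
  set A := cubeConst d p Λ with hA
  have hAt : A ≠ ∞ := cubeConst_ne_top hp hpd
  refine ⟨_, exists_tendsto_of_limsup_le_liminf ?_⟩
  refine limsup_le_liminf_of_eventually_le_liminf fun ε hε => ?_
  set q := ENNReal.ofReal (1 + ε) with hq
  have hq0 : q ≠ 0 := (ENNReal.ofReal_pos.2 (by linarith)).ne'
  have hqt : q ≠ ∞ := ENNReal.ofReal_ne_top
  have hε0 : ENNReal.ofReal ε ≠ 0 := (ENNReal.ofReal_pos.2 hε).ne'
  have hεt : (ENNReal.ofReal ε)⁻¹ ≠ ∞ := ENNReal.inv_ne_top.2 hε0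
  set F := ENNReal.ofReal Λ ^ p + A * (q * (ENNReal.ofReal ε)⁻¹) with hF
  have hFt : F ≠ ∞ := ENNReal.add_ne_top.2 ⟨ENNReal.rpow_ne_top_of_nonneg hp.le
    ENNReal.ofReal_ne_top, ENNReal.mul_ne_top hAt (ENNReal.mul_ne_top hqt hεt)⟩
  set c := q * ((q ^ 2)⁻¹) ^ (s - 1 / 2) * F with hc
  have hq20 : (q ^ 2)⁻¹ ≠ 0 := ENNReal.inv_ne_zero.2 (ENNReal.pow_ne_top hqt)
  have hq2t : (q ^ 2)⁻¹ ≠ ∞ := ENNReal.inv_ne_top.2 (pow_ne_zero _ hq0)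
  have hct : c ≠ ∞ := ENNReal.mul_ne_top (ENNReal.mul_ne_top hqt
    (ENNReal.rpow_ne_top_of_ne_zero hq20 hq2t)) hFt
  refine ⟨fun m => c * (m : ℝ≥0∞) ^ (s - 1 / 2), ?_, ?_⟩
  · have h := ENNReal.Tendsto.const_mul (a := c)
      (tendsto_natCast_rpow_neg (s := s - 1 / 2) (by linarith)) (Or.inr hct)
    rwa [mul_zero] at h
  intro m₀ hm₀
  have hm₀r : (0 : ℝ) < m₀ := by positivity
  have hm₀E : (m₀ : ℝ≥0∞) ≠ 0 := by exact_mod_cast hm₀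
  have hm₀t := ENNReal.natCast_ne_top m₀
  -- With this `t`, the mean number `m` per cell lies between `m₀ / (1 + ε) ^ 2` and `m₀ / (1 + ε)`:
  -- close to `m₀`, yet below it by a fixed proportion.
  filter_upwards [eventually_exists_div_pow hd0 (t := m₀ / (1 + ε) ^ 2) (by positivity) hε,
    eventually_ne_atTop 0] with N ⟨k, hk, h1, h2⟩ hN
  set m : ℝ≥0∞ := N * ((k : ℝ≥0∞) ^ d)⁻¹ with hm
  have hm' : m = ENNReal.ofReal ((N : ℝ) / (k : ℝ) ^ d) := natCast_div_pow_eq N hk d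
  have hup : q * m ≤ m₀ := by
    rw [hm', hq, ← ENNReal.ofReal_mul (by positivity), ← ENNReal.ofReal_natCast]
    refine ENNReal.ofReal_le_ofReal ?_
    calc (1 + ε) * ((N : ℝ) / (k : ℝ) ^ d) ≤ (1 + ε) * (m₀ / (1 + ε) ^ 2 * (1 + ε)) := by gcongr
      _ = m₀ := by field_simp
  have hlow : (q ^ 2)⁻¹ * m₀ ≤ m := by
    rw [hm', hq, ← ENNReal.ofReal_pow (by positivity), ← ENNReal.ofReal_inv_of_pos (by positivity),
      ← ENNReal.ofReal_natCast, ← ENNReal.ofReal_mul (by positivity)]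
    refine ENNReal.ofReal_le_ofReal (le_trans (le_of_eq ?_) h1)
    field_simp
  have hm0 : m ≠ 0 := by
    refine (lt_of_lt_of_le ?_ hlow).ne'
    exact pos_iff_ne_zero.2 (mul_ne_zero hq20 hm₀E)
  have hmt : m ≠ ∞ := hm' ▸ ENNReal.ofReal_ne_top
  have hq1 : q = 1 + ENNReal.ofReal ε := by
    rw [hq, ENNReal.ofReal_add zero_le_one hε.le, ENNReal.ofReal_one]
  have hlt : m < m₀ := by
    refine lt_of_lt_of_le ?_ hup
    rw [hq1, add_mul, one_mul]
    exact ENNReal.lt_add_right hmt (mul_ne_zero hε0 hm0)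
  have hdiff : ENNReal.ofReal ε * m₀ ≤ q * (m₀ - m) := by
    rw [ENNReal.mul_sub fun _ _ => hqt]
    refine le_trans ?_ (tsub_le_tsub_left hup _)
    rw [hq1, add_mul, one_mul, ENNReal.add_sub_cancel_left hm₀t]
  have hratio : (m₀ : ℝ≥0∞) * (m₀ - m)⁻¹ ≤ q * (ENNReal.ofReal ε)⁻¹ := by
    have hd0' : (m₀ - m : ℝ≥0∞) ≠ 0 := (tsub_pos_iff_lt.2 hlt).ne'
    have hdt' : (m₀ - m : ℝ≥0∞) ≠ ∞ := ne_top_of_le_ne_top hm₀t tsub_le_self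
    calc (m₀ : ℝ≥0∞) * (m₀ - m)⁻¹
        = (ENNReal.ofReal ε)⁻¹ * (ENNReal.ofReal ε * m₀) * (m₀ - m)⁻¹ := by
          rw [← mul_assoc, ENNReal.inv_mul_cancel hε0 ENNReal.ofReal_ne_top, one_mul]
      _ ≤ (ENNReal.ofReal ε)⁻¹ * (q * (m₀ - m)) * (m₀ - m)⁻¹ := by gcongr
      _ = (ENNReal.ofReal ε)⁻¹ * q * ((m₀ - m) * (m₀ - m)⁻¹) := by ring
      _ = _ := by rw [ENNReal.mul_inv_cancel hd0' hdt', mul_one, mul_comm]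
  have hrec := lintegral_cnt_mul_leakMean_le (nrm := nrm) hd0 hp hΛ hΛ0 hN hk hm hlt
  set φ := leakMean d nrm p with hφ
  have hφA : φ m₀ ≤ A := by
    refine (leakMean_le_meanCost m₀).trans ((meanCost_unif_le hp hpd hΛ hΛ0 hm₀).trans ?_)
    refine mul_le_of_le_one_right zero_le ?_
    rw [ENNReal.rpow_neg, ENNReal.inv_le_one]
    exact ENNReal.one_le_rpow (by exact_mod_cast Nat.one_le_iff_ne_zero.2 hm₀) hs0
  have hq1' : 1 ≤ q := hq1 ▸ le_self_add
  have hms : (m₀ : ℝ≥0∞) ^ s ≤ q * m ^ s := by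
    have h3 : (m₀ : ℝ≥0∞) ≤ q ^ (2 : ℝ) * m := by
      calc (m₀ : ℝ≥0∞) = q ^ 2 * ((q ^ 2)⁻¹ * m₀) := by
            rw [← mul_assoc, ENNReal.mul_inv_cancel (pow_ne_zero _ hq0) (ENNReal.pow_ne_top hqt),
              one_mul]
        _ ≤ q ^ (2 : ℝ) * m := by
            rw [ENNReal.rpow_two]
            gcongr
    refine (ENNReal.rpow_le_rpow h3 hs0.le).trans ?_
    rw [ENNReal.mul_rpow_of_nonneg _ _ hs0.le, ← ENNReal.rpow_mul]
    refine mul_le_mul' ?_ le_rfl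
    calc q ^ (2 * s) ≤ q ^ (1 : ℝ) := ENNReal.rpow_le_rpow_of_exponent_le hq1' (by linarith)
      _ = _ := ENNReal.rpow_one _
  have hmneg : m ^ s * m ^ (-(1 / 2) : ℝ) ≤ ((q ^ 2)⁻¹) ^ (s - 1 / 2) * (m₀ : ℝ≥0∞) ^ (s - 1 / 2) := by
    rw [← ENNReal.rpow_add _ _ hm0 hmt, ← ENNReal.mul_rpow_of_ne_top hq2t hm₀t,
      ← sub_eq_add_neg, ← neg_sub (1 / 2) s, ENNReal.rpow_neg, ENNReal.rpow_neg]
    gcongr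
  calc (m₀ : ℝ≥0∞) ^ s * φ m₀ ≤ q * m ^ s * φ m₀ := by gcongr
    _ = q * (m ^ s * φ m₀) := mul_assoc _ _ _
    _ ≤ q * ((N : ℝ≥0∞) ^ s * φ N + ((q ^ 2)⁻¹) ^ (s - 1 / 2) * (m₀ : ℝ≥0∞) ^ (s - 1 / 2) * F) := by
        refine mul_le_mul_of_nonneg_left (hrec.trans (add_le_add le_rfl (mul_le_mul' hmneg ?_)))
          zero_le
        exact add_le_add le_rfl (mul_le_mul' hφA hratio)
    _ = _ := by rw [hc]; ring

lemma volume_ball_fin (x : Fin d → ℝ) {δ : ℝ} (hδ : 0 < δ) :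
    volume (Metric.ball x δ) = ENNReal.ofReal (2 * δ) ^ d := by
  rw [Real.volume_pi_ball _ hδ, Fintype.card_fin, ENNReal.ofReal_pow (by positivity)]

/-- The scaled leaking costs are bounded away from zero. -/
lemma le_rpow_mul_leakMean (hd : d ≠ 0) (hp : 0 < p) {l : ℝ} (hl0 : 0 < l)
    (hl : ∀ x, l * ‖x‖ ≤ nrm x) {N : ℕ} (hN : N ≠ 0) :
    ENNReal.ofReal (l / 4) ^ p * 2⁻¹ * (2 ^ d)⁻¹ ≤
      (N : ℝ≥0∞) ^ (p / d) * leakMean d nrm p N := by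
  have hN0 : (0 : ℝ) < N := by positivity
  have hNE : (N : ℝ≥0∞) ≠ 0 := by exact_mod_cast hN
  have hNt := ENNReal.natCast_ne_top N
  have hdr : (d : ℝ) ≠ 0 := by exact_mod_cast hd
  have hd0 : (0 : ℝ) < d := by positivity
  set η : ℝ := (N : ℝ) ^ (-(1 / (d : ℝ))) with hη
  have hη0 : 0 < η := Real.rpow_pos_of_pos hN0 _
  have hη1 : η ≤ 1 := Real.rpow_le_one_of_one_le_of_nonpos
    (by exact_mod_cast Nat.one_le_iff_ne_zero.2 hN) (by rw [neg_nonpos]; positivity)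
  have hηd : η ^ d = (N : ℝ)⁻¹ := by
    rw [hη, ← Real.rpow_natCast, ← Real.rpow_mul hN0.le, neg_mul, one_div, inv_mul_cancel₀ hdr,
      Real.rpow_neg_one]
  -- A ball of radius `δ` has volume at most `1 / (2 * N)`, so at least half of the mass assigned to
  -- a point of the middle cube `B` comes from distance `δ` or more.
  set δ := η / 4 with hδ
  have hδ0 : 0 < δ := by positivity
  -- Since `δ ≤ 1/4`, balls around points of `B` stay in the open cube, where a leaking measure is
  -- bounded by the uniform one.
  set B := cube (d := d) (fun _ => 1 / 4) (1 / 2) with hB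
  have hBm : MeasurableSet B := measurableSet_cube _ _
  have hballsub : ∀ x ∈ B, Metric.ball x δ ⊆ openCube d := by
    intro x hx u hu i hi
    have h1 := hx i hi
    have h2 := (dist_le_pi_dist u x i).trans_lt (Metric.mem_ball.1 hu)
    rw [Real.dist_eq, abs_lt] at h2
    constructor <;> linarith [h1.1, h1.2, h2.1, h2.2]
  have hballvol : ∀ x : Fin d → ℝ, volume (Metric.ball x δ) ≤ (N : ℝ≥0∞)⁻¹ * 2⁻¹ := by
    intro x
    rw [volume_ball_fin x hδ0]
    have e : (2 * δ) ^ d = (N : ℝ)⁻¹ * (2⁻¹) ^ d := by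
      rw [← hηd, ← mul_pow]
      congr 1
      rw [hδ]; ring
    rw [← ENNReal.ofReal_pow (by positivity), e, ENNReal.ofReal_mul (by positivity),
      ENNReal.ofReal_inv_of_pos hN0, ENNReal.ofReal_natCast]
    refine mul_le_mul_of_nonneg_left ?_ zero_le
    rw [show (2⁻¹ : ℝ≥0∞) = ENNReal.ofReal 2⁻¹ by
      rw [ENNReal.ofReal_inv_of_pos two_pos]; simp]
    exact ENNReal.ofReal_le_ofReal (pow_le_of_le_one (by norm_num) (by norm_num) hd)
  have hpt : ∀ x : Fin N → Fin d → ℝ, ENNReal.ofReal (l * δ) ^ p * 2⁻¹ * ((N : ℝ≥0∞)⁻¹ * cnt B x) ≤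
      infCost (normCost nrm p) (leaking d) (emp x) := by
    intro x
    rw [infCost_emp]
    refine le_iInf₂ fun m hm => ?_
    obtain ⟨hm1, hm2⟩ := hm
    have hj : ∀ j ∈ idx B x, ENNReal.ofReal (l * δ) ^ p * 2⁻¹ * (N : ℝ≥0∞)⁻¹ ≤
        ∫⁻ u, normCost nrm p u (x j) ∂(m j) := by
      intro j hj
      have hjB : x j ∈ B := by simpa [idx] using hj
      have h1 : m j (Metric.ball (x j) δ) ≤ (N : ℝ≥0∞)⁻¹ * 2⁻¹ := by
        calc m j (Metric.ball (x j) δ) ≤ (∑ i, m i) (Metric.ball (x j) δ) := by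
              rw [Measure.finsetSum_apply]
              exact Finset.single_le_sum (f := fun i => m i (Metric.ball (x j) δ))
                (fun _ _ => zero_le) (Finset.mem_univ j)
          _ ≤ unifCube d (Metric.ball (x j) δ) := hm1.2.2 _ measurableSet_ball (hballsub _ hjB)
          _ ≤ volume (Metric.ball (x j) δ) := by
              rw [unifCube_eq]; exact Measure.restrict_apply_le _ _
          _ ≤ _ := hballvol _
      have h2 : (N : ℝ≥0∞)⁻¹ * 2⁻¹ ≤ m j (Metric.ball (x j) δ)ᶜ := by
        have h3 : m j (Metric.ball (x j) δ) + m j (Metric.ball (x j) δ)ᶜ = (N : ℝ≥0∞)⁻¹ := by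
          rw [measure_add_measure_compl measurableSet_ball, hm2]
        have h4 : (N : ℝ≥0∞)⁻¹ * 2⁻¹ + (N : ℝ≥0∞)⁻¹ * 2⁻¹ = (N : ℝ≥0∞)⁻¹ := by
          rw [← mul_add, ENNReal.inv_two_add_inv_two, mul_one]
        have h5 : (N : ℝ≥0∞)⁻¹ * 2⁻¹ ≠ ∞ :=
          ENNReal.mul_ne_top (ENNReal.inv_ne_top.2 hNE) (by simp)
        refine (ENNReal.add_le_add_iff_left h5).1 ?_
        rw [h4]
        exact h3.symm.le.trans (add_le_add h1 le_rfl)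
      calc _ = ENNReal.ofReal (l * δ) ^ p * ((N : ℝ≥0∞)⁻¹ * 2⁻¹) := by ring
        _ ≤ ENNReal.ofReal (l * δ) ^ p * m j (Metric.ball (x j) δ)ᶜ := by gcongr
        _ ≤ ENNReal.ofReal (l * δ) ^ p *
            m j {u | ENNReal.ofReal (l * δ) ^ p ≤ normCost nrm p u (x j)} := by
            refine mul_le_mul_of_nonneg_left (measure_mono fun u hu => ?_) zero_le
            have h6 : δ ≤ ‖u - x j‖ := by
              rw [← dist_eq_norm]
              simpa using hu
            refine ENNReal.rpow_le_rpow (ENNReal.ofReal_le_ofReal ?_) hp.le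
            exact (mul_le_mul_of_nonneg_left h6 hl0.le).trans (hl _)
        _ ≤ _ := mul_meas_ge_le_lintegral (measurable_normCost_left _) _
    calc _ = ∑ j ∈ idx B x, ENNReal.ofReal (l * δ) ^ p * 2⁻¹ * (N : ℝ≥0∞)⁻¹ := by
          rw [Finset.sum_const, nsmul_eq_mul, cnt]; ring
      _ ≤ ∑ j ∈ idx B x, ∫⁻ u, normCost nrm p u (x j) ∂(m j) := Finset.sum_le_sum hj
      _ ≤ _ := Finset.sum_le_univ_sum_of_nonneg fun _ => zero_le
  have hvolB : unifCube d B = (2 ^ d)⁻¹ := by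
    have hsub : B ⊆ cube 0 1 := by
      intro x hx i hi
      have := hx i hi
      exact ⟨by simp only [Pi.zero_apply]; linarith [this.1],
        by simp only [Pi.zero_apply]; linarith [this.2]⟩
    rw [unifCube_eq, Measure.restrict_apply hBm, Set.inter_eq_left.2 hsub, volume_cube, one_div,
      ENNReal.ofReal_inv_of_pos two_pos, ENNReal.inv_pow]
    simp
  have hcm : Measurable fun x : Fin N → Fin d → ℝ => (cnt B x : ℝ≥0∞) := measurable_comp_cnt hBm _
  have hmean : ENNReal.ofReal (l * δ) ^ p * 2⁻¹ * (2 ^ d)⁻¹ ≤ leakMean d nrm p N := by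
    calc _ = ∫⁻ x : Fin N → Fin d → ℝ, ENNReal.ofReal (l * δ) ^ p * 2⁻¹ *
          ((N : ℝ≥0∞)⁻¹ * cnt B x) ∂(Measure.pi fun _ => unifCube d) := by
          rw [lintegral_const_mul _ (hcm.const_mul _), lintegral_const_mul _ hcm,
            lintegral_cnt _ hBm, ← mul_assoc (N : ℝ≥0∞)⁻¹, ENNReal.inv_mul_cancel hNE hNt, one_mul,
            hvolB]
      _ ≤ _ := lintegral_mono hpt
  have hscale : (N : ℝ≥0∞) ^ (p / d) * ENNReal.ofReal (l * δ) ^ p = ENNReal.ofReal (l / 4) ^ p := by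
    rw [div_eq_inv_mul p, ENNReal.rpow_mul, ← ENNReal.mul_rpow_of_nonneg _ _ hp.le,
      ← ENNReal.ofReal_natCast, ENNReal.ofReal_rpow_of_pos hN0, ← ENNReal.ofReal_mul (by positivity)]
    congr 2
    have : (N : ℝ) ^ (d : ℝ)⁻¹ * η = 1 := by
      rw [hη, ← Real.rpow_add hN0]
      simp
    rw [hδ]
    linear_combination l / 4 * this
  calc _ = (N : ℝ≥0∞) ^ (p / d) * (ENNReal.ofReal (l * δ) ^ p * 2⁻¹ * (2 ^ d)⁻¹) := by
        rw [← hscale]; ring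
    _ ≤ _ := by gcongr

end LeakLimit

/-! ### Cells with many points, and couplings along a common part. -/

section LowerCells

/-- The expected value of `n ↦ n * φ n` at the number of points in a set of large mean, for a
decreasing function `φ` that behaves like a power. -/
lemma exists_le_lintegral_cnt_mul {φ : ℕ → ℝ≥0∞} (hφ : ∀ n m, n ≠ 0 → n ≤ m → φ m ≤ φ n) {s : ℝ}
    (hs0 : 0 < s) (hs2 : s < 1 / 2) {L : ℝ≥0∞} (hLt : L ≠ ∞)
    (hL : Tendsto (fun n : ℕ => (n : ℝ≥0∞) ^ s * φ n) atTop (𝓝 L)) {A D : ℝ≥0∞} (hA : A < L)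
    (hD : D ≠ ∞) :
    ∃ M : ℝ, 0 < M ∧ ∀ {Z : Type} [MeasurableSpace Z] (μ : Measure Z) [IsProbabilityMeasure μ]
      (N : ℕ) (B : Set Z), MeasurableSet B → ENNReal.ofReal M ≤ N * μ B →
      A * (N * μ B) ^ (1 - s) + D * (N * μ B) ^ (1 / 2 : ℝ) ≤
        ∫⁻ z : Fin N → Z, (cnt B z : ℝ≥0∞) * φ (cnt B z) ∂(Measure.pi fun _ => μ) := by
  have hAt : A ≠ ∞ := (hA.trans_le le_top).ne
  obtain ⟨A₂, hAA₂, hA₂L⟩ := exists_between hA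
  have hA₂t : A₂ ≠ ∞ := (hA₂L.trans_le le_top).ne
  -- The gap between `A` and `A₂` leaves room for the loss factor `1 + 2 * ε` of rounding the mean
  -- up to an integer `m₀`.
  obtain ⟨ε, hε1, hε0⟩ : ∃ ε : ℝ, A * ENNReal.ofReal (1 + 2 * ε) < A₂ ∧ 0 < ε := by
    have hlim : Tendsto (fun ε : ℝ => A * ENNReal.ofReal (1 + 2 * ε)) (𝓝[>] 0)
        (𝓝 (A * ENNReal.ofReal (1 + 2 * 0))) := by
      refine ENNReal.Tendsto.const_mul ?_ (Or.inl (by simp))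
      refine (ENNReal.continuous_ofReal.tendsto _).comp ?_
      exact (tendsto_const_nhds.add (tendsto_const_nhds.mul tendsto_id)).mono_left
        nhdsWithin_le_nhds
    rw [mul_zero, add_zero, ENNReal.ofReal_one, mul_one] at hlim
    exact ((hlim.eventually_lt_const hAA₂).and eventually_mem_nhdsWithin).exists
  set q := ENNReal.ofReal (1 + 2 * ε) with hq
  have hq0 : q ≠ 0 := (ENNReal.ofReal_pos.2 (by linarith)).ne'
  have hqt : q ≠ ∞ := ENNReal.ofReal_ne_top
  have hq1 : 1 ≤ q := by rw [hq, ENNReal.one_le_ofReal]; linarith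
  set A₁ := A₂ * q⁻¹ with hA₁
  have hAA₁ : A < A₁ := by
    rw [hA₁, ← div_eq_mul_inv]
    exact (ENNReal.lt_div_iff_mul_lt (Or.inl hq0) (Or.inl hqt)).2 hε1
  have hε0' : ENNReal.ofReal ε ≠ 0 := (ENNReal.ofReal_pos.2 hε0).ne'
  set C := L + 1 with hC
  have hCt : C ≠ ∞ := ENNReal.add_ne_top.2 ⟨hLt, ENNReal.one_ne_top⟩
  set E := C * (q * (ENNReal.ofReal ε)⁻¹) with hE
  have hEt : E ≠ ∞ := ENNReal.mul_ne_top hCt (ENNReal.mul_ne_top hqt (ENNReal.inv_ne_top.2 hε0'))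
  obtain ⟨n₀, hn₀⟩ := eventually_atTop.1
    ((hL.eventually_const_lt hA₂L).and (hL.eventually_lt_const (ENNReal.lt_add_right hLt
      one_ne_zero)))
  have hlim : Tendsto (fun β : ℝ≥0∞ => A + (D + E) * β ^ (s - 1 / 2)) (𝓝 ∞) (𝓝 (A + (D + E) * 0)) := by
    refine tendsto_const_nhds.add (ENNReal.Tendsto.const_mul ?_
      (Or.inr (ENNReal.add_ne_top.2 ⟨hD, hEt⟩)))
    have := (ENNReal.continuous_rpow_const (y := s - 1 / 2)).tendsto ∞
    rwa [ENNReal.top_rpow_of_neg (by linarith)] at this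
  rw [mul_zero, add_zero] at hlim
  -- Terms of order `β ^ (1/2)` are absorbed by `β ^ (1 - s)` for a large mean `β`, because `s <
  -- 1/2`.
  obtain ⟨b, hbt, hb⟩ : ∃ b : ℝ≥0∞, b < ∞ ∧ ∀ β, b < β → A + (D + E) * β ^ (s - 1 / 2) < A₁ := by
    have h := hlim.eventually_lt_const hAA₁
    obtain ⟨b, hb, hb'⟩ := (ENNReal.nhds_top_basis.eventually_iff).1 h
    exact ⟨b, hb, fun β hβ => hb' hβ⟩
  refine ⟨b.toReal + n₀ + 1 / ε + 1, by positivity, fun {Z} _ μ _ N B hB hM => ?_⟩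
  set β : ℝ≥0∞ := N * μ B with hβ
  have hβt : β ≠ ∞ := ENNReal.mul_ne_top (ENNReal.natCast_ne_top _) (measure_ne_top _ _)
  set t := β.toReal with ht
  have hβt' : β = ENNReal.ofReal t := (ENNReal.ofReal_toReal hβt).symm
  have htM : b.toReal + n₀ + 1 / ε + 1 ≤ t := by
    rw [hβt', ENNReal.ofReal_le_ofReal_iff ENNReal.toReal_nonneg] at hM
    exact hM
  have hb0 := ENNReal.toReal_nonneg (a := b)
  have hεi : 0 < 1 / ε := by positivity
  have hn0 : (0 : ℝ) ≤ n₀ := Nat.cast_nonneg _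
  have ht1 : 1 ≤ t := by linarith
  have hβ1 : 1 ≤ β := by rw [hβt', ENNReal.one_le_ofReal]; exact ht1
  have hβ0 : β ≠ 0 := (zero_lt_one.trans_le hβ1).ne'
  have hbβ : b < β := by
    rw [hβt', ← ENNReal.ofReal_toReal hbt.ne]
    exact (ENNReal.ofReal_lt_ofReal_iff (by linarith)).2 (by linarith)
  -- Exceeds the mean by a fixed proportion, so that `m₀ / (m₀ - β)` stays bounded; the rounding is
  -- covered by `ε * t ≥ 1`.
  set m₀ := ⌈(1 + ε) * t⌉₊ with hm₀
  have hm1 : (1 + ε) * t ≤ m₀ := Nat.le_ceil _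
  have hm2 : (m₀ : ℝ) ≤ (1 + 2 * ε) * t := by
    have h1 := (Nat.ceil_lt_add_one (show 0 ≤ (1 + ε) * t by positivity)).le
    have h2 : 1 ≤ ε * t := by
      calc 1 = ε * (1 / ε) := by field_simp
        _ ≤ ε * t := by gcongr; linarith
    linarith
  have hm0n : n₀ ≤ m₀ := by
    have : (n₀ : ℝ) ≤ m₀ := by nlinarith
    exact_mod_cast this
  have hm0pos : (m₀ : ℝ≥0∞) ≠ 0 := by
    have : (0 : ℝ) < m₀ := by nlinarith
    have : 0 < m₀ := by exact_mod_cast this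
    exact_mod_cast this.ne'
  have hm0t := ENNReal.natCast_ne_top m₀
  have hβm : β < m₀ := by
    rw [hβt', ← ENNReal.ofReal_natCast]
    exact (ENNReal.ofReal_lt_ofReal_iff (by nlinarith)).2 (by nlinarith)
  have hmq : (m₀ : ℝ≥0∞) ≤ q * β := by
    rw [hβt', ← ENNReal.ofReal_natCast, hq, ← ENNReal.ofReal_mul (by positivity)]
    exact ENNReal.ofReal_le_ofReal hm2
  have hratio : (m₀ : ℝ≥0∞) * (m₀ - β)⁻¹ ≤ q * (ENNReal.ofReal ε)⁻¹ := by
    have h1 : ENNReal.ofReal ε * β ≤ m₀ - β := by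
      rw [hβt', ← ENNReal.ofReal_natCast, ← ENNReal.ofReal_sub _ (by linarith),
        ← ENNReal.ofReal_mul hε0.le]
      exact ENNReal.ofReal_le_ofReal (by linarith)
    calc (m₀ : ℝ≥0∞) * (m₀ - β)⁻¹ ≤ q * β * (ENNReal.ofReal ε * β)⁻¹ := by gcongr
      _ = q * (ENNReal.ofReal ε)⁻¹ * (β * β⁻¹) := by
          rw [ENNReal.mul_inv (Or.inl hε0') (Or.inl ENNReal.ofReal_ne_top)]; ring
      _ = _ := by rw [ENNReal.mul_inv_cancel hβ0 hβt, mul_one]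
  obtain ⟨hlow, hupp⟩ := hn₀ m₀ hm0n
  have hφlow : A₁ * β ^ (1 - s) ≤ β * φ m₀ := by
    have h1 : A₂ ≤ q * (β ^ s * φ m₀) := by
      refine hlow.le.trans ?_
      rw [← mul_assoc]
      refine mul_le_mul' ((ENNReal.rpow_le_rpow hmq hs0.le).trans ?_) le_rfl
      rw [ENNReal.mul_rpow_of_nonneg _ _ hs0.le]
      refine mul_le_mul' ?_ le_rfl
      calc q ^ s ≤ q ^ (1 : ℝ) := ENNReal.rpow_le_rpow_of_exponent_le hq1 (by linarith)
        _ = _ := ENNReal.rpow_one _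
    calc A₁ * β ^ (1 - s) ≤ q * (β ^ s * φ m₀) * q⁻¹ * β ^ (1 - s) := by
          rw [hA₁]; gcongr
      _ = (q * q⁻¹) * (β ^ s * β ^ (1 - s)) * φ m₀ := by ring
      _ = _ := by
          rw [ENNReal.mul_inv_cancel hq0 hqt, one_mul, ← ENNReal.rpow_add _ _ hβ0 hβt,
            add_sub_cancel, ENNReal.rpow_one]
  have hφupp : φ m₀ * β ^ (1 / 2 : ℝ) ≤ C * β ^ (1 / 2 - s) := by
    have h1 : β ^ s * φ m₀ ≤ C := by
      refine le_trans ?_ hupp.le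
      gcongr
    calc φ m₀ * β ^ (1 / 2 : ℝ) = (β ^ s * φ m₀) * β ^ (1 / 2 - s) := by
          rw [mul_right_comm, ← ENNReal.rpow_add _ _ hβ0 hβt, add_sub_cancel, mul_comm]
      _ ≤ _ := by gcongr
  have hmain := mul_le_lintegral_cnt_mul (μ := μ) (N := N) hB hφ (m₀ := m₀) hβm
  set X := ∫⁻ z : Fin N → Z, (cnt B z : ℝ≥0∞) * φ (cnt B z) ∂(Measure.pi fun _ => μ)
  have herr : φ m₀ * (m₀ * (m₀ - β)⁻¹) * β ^ (1 / 2 : ℝ) ≤ E * β ^ (1 / 2 : ℝ) := by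
    calc φ m₀ * (m₀ * (m₀ - β)⁻¹) * β ^ (1 / 2 : ℝ)
        = φ m₀ * β ^ (1 / 2 : ℝ) * (m₀ * (m₀ - β)⁻¹) := by ring
      _ ≤ C * β ^ (1 / 2 - s) * (q * (ENNReal.ofReal ε)⁻¹) := mul_le_mul' hφupp hratio
      _ = E * β ^ (1 / 2 - s) := by rw [hE]; ring
      _ ≤ _ := by gcongr; linarith
  have hsum : A * β ^ (1 - s) + D * β ^ (1 / 2 : ℝ) + E * β ^ (1 / 2 : ℝ) ≤
      X + E * β ^ (1 / 2 : ℝ) := by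
    calc A * β ^ (1 - s) + D * β ^ (1 / 2 : ℝ) + E * β ^ (1 / 2 : ℝ)
        = (A + (D + E) * β ^ (s - 1 / 2)) * β ^ (1 - s) := by
          have e : β ^ (1 / 2 : ℝ) = β ^ (s - 1 / 2) * β ^ (1 - s) := by
            rw [← ENNReal.rpow_add _ _ hβ0 hβt]
            congr 1; ring
          rw [e]; ring
      _ ≤ A₁ * β ^ (1 - s) := by gcongr; exact (hb β hbβ).le
      _ ≤ β * φ m₀ := hφlow
      _ ≤ _ := hmain.trans (add_le_add le_rfl herr)
  exact (ENNReal.add_le_add_iff_right (ENNReal.mul_ne_top hEt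
    (ENNReal.rpow_ne_top_of_nonneg (by norm_num) hβt))).1 hsum

/-- Two probability measures have a coupling that is diagonal on a common part. -/
lemma exists_coupling_of_le {Z : Type*} [MeasurableSpace Z] [MeasurableEq Z] (μ μ' α : Measure Z)
    [IsProbabilityMeasure μ] [IsProbabilityMeasure μ'] (h : α ≤ μ) (h' : α ≤ μ') :
    ∃ γ : Measure (Z × Z), IsProbabilityMeasure γ ∧ γ.map Prod.fst = μ ∧ γ.map Prod.snd = μ' ∧
      ∀ G, MeasurableSet G → γ {z | z.2 ∈ G ∧ z.1 ≠ z.2} ≤ μ' G - α G := by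
  have hα : IsFiniteMeasure α := isFiniteMeasure_of_le μ h
  have hdiag : Measurable fun x : Z => (x, x) := by fun_prop
  have hmass : (μ - α) Set.univ = (μ' - α) Set.univ := by
    rw [Measure.sub_apply MeasurableSet.univ h, Measure.sub_apply MeasurableSet.univ h',
      measure_univ (μ := μ), measure_univ (μ := μ')]
  set t := (μ - α) Set.univ with ht
  have htt : t ≠ ∞ := measure_ne_top _ _
  -- The common part is coupled diagonally and the remainders, of equal mass, by a product; only the
  -- remainders can give distinct components.
  set ξ := t⁻¹ • (μ - α).prod (μ' - α) with hξ
  have hprod : ∀ σ : Measure Z, IsFiniteMeasure σ → σ Set.univ = t → t⁻¹ • t • σ = σ := by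
    intro σ _ hσ
    rcases eq_or_ne t 0 with h0 | h0
    · rw [h0] at hσ
      rw [Measure.measure_univ_eq_zero.1 hσ]
      simp
    · rw [smul_smul, ENNReal.inv_mul_cancel h0 htt, one_smul]
  have hξ1 : ξ.map Prod.fst = μ - α := by
    rw [hξ, Measure.map_smul, Measure.map_fst_prod, ← hmass, hprod _ inferInstance rfl]
  have hξ2 : ξ.map Prod.snd = μ' - α := by
    rw [hξ, Measure.map_smul, Measure.map_snd_prod, hprod _ inferInstance hmass.symm]
  have e1 : (α.map fun x => (x, x)).map Prod.fst = α := by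
    rw [Measure.map_map measurable_fst hdiag]; exact Measure.map_id
  have e2 : (α.map fun x => (x, x)).map Prod.snd = α := by
    rw [Measure.map_map measurable_snd hdiag]; exact Measure.map_id
  have hfst : (α.map (fun x => (x, x)) + ξ).map Prod.fst = μ := by
    rw [Measure.map_add _ _ measurable_fst, e1, hξ1, add_comm]
    exact Measure.sub_add_cancel_of_le h
  have hsnd : (α.map (fun x => (x, x)) + ξ).map Prod.snd = μ' := by
    rw [Measure.map_add _ _ measurable_snd, e2, hξ2, add_comm]
    exact Measure.sub_add_cancel_of_le h'
  refine ⟨α.map (fun x => (x, x)) + ξ, ⟨?_⟩, hfst, hsnd, fun G hG => ?_⟩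
  · rw [← measure_univ (μ := μ), ← hfst, Measure.map_apply measurable_fst MeasurableSet.univ,
      Set.preimage_univ]
  · rw [Measure.add_apply]
    have h0 : (α.map fun x => (x, x)) {z | z.2 ∈ G ∧ z.1 ≠ z.2} = 0 := by
      have hm : MeasurableSet {z : Z × Z | z.1 ≠ z.2} :=
        (measurableSet_eq_fun measurable_fst measurable_snd).compl
      refine measure_mono_null (t := {z | z.1 ≠ z.2}) (fun z hz => hz.2) ?_
      rw [Measure.map_apply hdiag hm]
      simp
    rw [h0, zero_add, ← Measure.sub_apply hG h', ← hξ2, Measure.map_apply measurable_snd hG]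
    exact measure_mono fun z hz => hz.1

end LowerCells

/-! ### The lower bound for finitely many points. -/

section LowerBound

variable {d : ℕ} {nrm : Seminorm ℝ (Fin d → ℝ)} {p Λ : ℝ}

lemma acPart_le (μ : Measure (Fin d → ℝ)) : acPart μ ≤ μ := Measure.withDensity_rnDeriv_le _ _

/-- A probability measure has a coupling with a measure that is a multiple of a given density on the
set `G`, which is diagonal on `G` up to a small mass. -/
lemma exists_coupling_withDensity (μ : Measure (Fin d → ℝ)) [IsProbabilityMeasure μ]
    {g : (Fin d → ℝ) → ℝ≥0∞} (hg : Measurable g) (hfg : acPart μ ≤ volume.withDensity g)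
    {ε c : ℝ≥0∞} (hε : (volume.withDensity g - acPart μ) Set.univ ≤ ε) (hc : c ≤ 1)
    {G : Set (Fin d → ℝ)} (hG : MeasurableSet G) (hcG : c * volume.withDensity g G ≤ 1)
    {y₀ : Fin d → ℝ} (hy₀ : y₀ ∉ G) :
    ∃ γ : Measure ((Fin d → ℝ) × (Fin d → ℝ)), IsProbabilityMeasure γ ∧ γ.map Prod.fst = μ ∧
      (∀ A, MeasurableSet A → A ⊆ G → γ.map Prod.snd A = c * volume.withDensity g A) ∧
      γ {z | z.2 ∈ G ∧ z.1 ≠ z.2} ≤ ε := by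
  set ν := volume.withDensity g with hν
  set f := acDensity μ with hf
  have hfm : Measurable f := measurable_acDensity μ
  have hct : c ≠ ∞ := ne_top_of_le_ne_top ENNReal.one_ne_top hc
  -- The mass missing from a probability measure is parked at `y₀`, outside the cells of interest.
  set μ' := c • ν.restrict G + (1 - c * ν G) • Measure.dirac y₀ with hμ'
  have hμ'A : ∀ A, MeasurableSet A → A ⊆ G → μ' A = c * ν A := by
    intro A hA hAG
    rw [hμ', Measure.add_apply, Measure.smul_apply, Measure.smul_apply, Measure.restrict_apply hA,
      Set.inter_eq_left.2 hAG, Measure.dirac_apply' _ hA,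
      Set.indicator_of_notMem fun h => hy₀ (hAG h)]
    simp
  have : IsProbabilityMeasure μ' := ⟨by
    rw [hμ', Measure.add_apply, Measure.smul_apply, Measure.smul_apply,
      Measure.restrict_apply_univ, measure_univ, smul_eq_mul, smul_eq_mul, mul_one]
    exact add_tsub_cancel_of_le hcG⟩
  -- The common part has density `min f (c * g)` on `G`. Since `c ≤ 1`, it falls short of `c * g` by
  -- at most `g - f`.
  set h : (Fin d → ℝ) → ℝ≥0∞ := fun x => min (f x) (c * g x) with hh
  have hcg : Measurable fun x => c * g x := hg.const_mul c
  have hhm : Measurable h := hfm.min hcg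
  set α := (volume.withDensity h).restrict G with hα
  have hαμ : α ≤ μ := Measure.restrict_le_self.trans
    ((withDensity_mono (Eventually.of_forall fun x => min_le_left _ _)).trans (acPart_le μ))
  have hαμ' : α ≤ μ' := by
    refine le_trans ?_ (Measure.le_add_right le_rfl)
    rw [← Measure.restrict_smul, hν, ← withDensity_smul _ hg]
    exact Measure.restrict_mono_measure (withDensity_mono
      (Eventually.of_forall fun x => min_le_right _ _)) _
  obtain ⟨γ, hγ, h1, h2, h3⟩ := exists_coupling_of_le μ μ' α hαμ hαμ'
  refine ⟨γ, hγ, h1, fun A hA hAG => by rw [h2, hμ'A A hA hAG], (h3 G hG).trans ?_⟩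
  have hacf : IsFiniteMeasure (acPart μ) := isFiniteMeasure_of_le μ (acPart_le μ)
  have hfi : ∫⁻ x, f x ≠ ∞ := by
    have := measure_ne_top (acPart μ) Set.univ
    rwa [acPart, withDensity_apply _ MeasurableSet.univ, Measure.restrict_univ] at this
  have hfgae : f ≤ᵐ[volume] g := ae_le_of_withDensity_le hfm hfg
  have hdiff : ∫⁻ x, (g x - f x) ≤ ε := by
    rw [← lintegral_tsub_of_withDensity hfm hfi hfgae]
    exact hε
  rw [tsub_le_iff_right, hμ'A G hG subset_rfl, hν, withDensity_apply _ hG, hα,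
    Measure.restrict_apply_self, withDensity_apply _ hG, ← lintegral_const_mul _ hg]
  calc ∫⁻ x in G, c * g x ≤ ∫⁻ x in G, ((g x - f x) + h x) := by
        refine lintegral_mono fun x => ?_
        rcases le_total (f x) (c * g x) with hx | hx
        · simp only [hh, min_eq_left hx]
          exact (mul_le_of_le_one_left zero_le hc).trans le_tsub_add
        · simp only [hh, min_eq_right hx]
          exact le_add_self
    _ = (∫⁻ x in G, (g x - f x)) + ∫⁻ x in G, h x := by
        rw [lintegral_add_right _ hhm]
    _ ≤ _ := add_le_add ((setLIntegral_le_lintegral _ _).trans hdiff) le_rfl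

/-- The lower bound for the cost of `N` points, by the leaking costs of the cells. -/
lemma setLIntegral_le_meanCost (hp : 0 < p) (hpd : p < (d : ℝ) / 2) (hΛ : ∀ x, nrm x ≤ Λ * ‖x‖)
    (hΛ0 : 0 ≤ Λ) (μ : Measure (Fin d → ℝ)) [IsProbabilityMeasure μ]
    (hμ : ∫⁻ x, normBound Λ p x ∂μ ≠ ∞) {K : Set (Fin d → ℝ)} {g : (Fin d → ℝ) → ℝ≥0∞}
    (hg : IsStepOff K g) (hfg : acPart μ ≤ volume.withDensity g) {ε : ℝ≥0∞} (hεt : ε ≠ ∞)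
    (hε : (volume.withDensity g - acPart μ) Set.univ ≤ ε)
    (hK : μ.singularPart volume Kᶜ ≤ ε) {A τ : ℝ≥0∞} {m M : ℝ} (hM : 0 < M)
    (hcell : ∀ (μ' : Measure (Fin d → ℝ)) [IsProbabilityMeasure μ'] (N : ℕ) (B : Set (Fin d → ℝ)),
      MeasurableSet B → ENNReal.ofReal m ≤ N * μ' B →
      A * (N * μ' B) ^ (1 - p / d) + ENNReal.ofReal Λ ^ p * (N * μ' B) ^ (1 / 2 : ℝ) ≤
        ∫⁻ z : Fin N → Fin d → ℝ, (cnt B z : ℝ≥0∞) * leakMean d nrm p (cnt B z)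
          ∂(Measure.pi fun _ => μ'))
    (hτ0 : τ ≠ 0) (hτ : ENNReal.ofReal m ≤ (1 + ε)⁻¹ * τ * ENNReal.ofReal M) {N : ℕ} (hN : N ≠ 0) :
    A * ((1 + ε)⁻¹) ^ (1 - p / d) * ∫⁻ x in (badCells ((M / N) ^ (1 / (d : ℝ))) K)ᶜ,
        (if τ ≤ g x then g x ^ (1 - p / d) else 0) ≤
      (N : ℝ≥0∞) ^ (p / d) * meanCost (normCost nrm p) N μ +
        ENNReal.ofReal M ^ (p / d) * ENNReal.ofReal Λ ^ p * (3 * ε) := by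
  have hd : 0 < (d : ℝ) := by linarith
  have hd0 : d ≠ 0 := by rintro rfl; simp at hd
  have hs0 : 0 < p / d := by positivity
  have hs2 : p / d < 1 / 2 := by rw [div_lt_iff₀ hd]; linarith
  set s := p / d with hs
  have hN0 : (0 : ℝ) < N := by positivity
  have hNE : (N : ℝ≥0∞) ≠ 0 := by exact_mod_cast hN
  have hNt := ENNReal.natCast_ne_top N
  -- Cells have volume `M / N`, so the mean number of points in a cell does not depend on `N`.
  set r : ℝ := (M / N) ^ (1 / (d : ℝ)) with hr
  have hr0 : 0 < r := by positivity
  set ρ := ENNReal.ofReal r with hρ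
  set M' := ENNReal.ofReal M with hM'
  have hM0 : M' ≠ 0 := (ENNReal.ofReal_pos.2 hM).ne'
  have hMt : M' ≠ ∞ := ENNReal.ofReal_ne_top
  have hρ' : ρ = (M' * (N : ℝ≥0∞)⁻¹) ^ (1 / (d : ℝ)) := by
    rw [hρ, hr, ← ENNReal.ofReal_rpow_of_pos (by positivity), ENNReal.ofReal_div_of_pos hN0,
      ENNReal.ofReal_natCast, div_eq_mul_inv]
  have hρd : ρ ^ d = M' * (N : ℝ≥0∞)⁻¹ := by
    rw [hρ', ← ENNReal.rpow_natCast, ← ENNReal.rpow_mul, one_div, inv_mul_cancel₀ hd.ne',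
      ENNReal.rpow_one]
  have hρp : (N : ℝ≥0∞) ^ s * ρ ^ p = M' ^ s := by
    rw [hρ', ← ENNReal.rpow_mul, one_div_mul_eq_div, ← hs, ← ENNReal.mul_rpow_of_nonneg _ _ hs0.le,
      mul_left_comm, ENNReal.mul_inv_cancel hNE hNt, mul_one]
  set c := (1 + ε)⁻¹ with hc
  have h1ε0 : 1 + ε ≠ 0 := by simp
  have h1εt : 1 + ε ≠ ∞ := ENNReal.add_ne_top.2 ⟨ENNReal.one_ne_top, hεt⟩
  have hc0 : c ≠ 0 := ENNReal.inv_ne_zero.2 h1εt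
  have hc1 : c ≤ 1 := ENNReal.inv_le_one.2 le_self_add
  have hct : c ≠ ∞ := ne_top_of_le_ne_top ENNReal.one_ne_top hc1
  set ν := volume.withDensity g with hν
  have hacf : IsFiniteMeasure (acPart μ) := isFiniteMeasure_of_le μ (acPart_le μ)
  have hνu : ν Set.univ ≤ 1 + ε := by
    rw [← Measure.sub_add_cancel_of_le hfg, Measure.add_apply, add_comm]
    exact add_le_add ((acPart_le μ Set.univ).trans prob_le_one) hε
  -- Only cells with density at least `τ` are used; there the mean number of points reaches `m`, as
  -- `hcell` requires.
  obtain ⟨S, hS, hψ⟩ := hg.exists_finset hr0 (φ := fun t => if τ ≤ t then t else 0) (by simp)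
  have hSτ : ∀ v ∈ S, τ ≤ stepVal g r v := fun v hv => by
    by_contra hcon
    exact (hS v hv).2 (if_neg hcon)
  set G := ⋃ v ∈ S, gridCell r v with hG
  have hGm : MeasurableSet G := Finset.measurableSet_biUnion _ fun v _ => measurableSet_gridCell r v
  have hsubG : ∀ v ∈ S, gridCell r v ⊆ G := fun v hv => Set.subset_biUnion_of_mem hv
  have hgcell : ∀ v ∈ S, ∀ x ∈ gridCell r v, g x = stepVal g r v := fun v hv x hx =>
    hg.eq_stepVal hr0 (hS v hv).1 hx
  have hνA : ∀ v ∈ S, ∀ B, MeasurableSet B → B ⊆ gridCell r v → ν B = stepVal g r v * volume B := by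
    intro v hv B hB hBv
    rw [hν, withDensity_apply _ hB, setLIntegral_congr_fun hB fun x hx => hgcell v hv x (hBv hx),
      setLIntegral_const]
  obtain ⟨y₀, hy₀⟩ : ∃ y₀, y₀ ∉ G := by
    have : Nonempty (Fin d) := ⟨⟨0, Nat.pos_of_ne_zero hd0⟩⟩
    obtain ⟨R, hR⟩ := hg.supp.subset_closedBall 0
    obtain ⟨y, hy⟩ := NormedSpace.exists_lt_norm ℝ (Fin d → ℝ) R
    refine ⟨y, fun hyG => ?_⟩
    obtain ⟨v, hv, hyv⟩ := Set.mem_iUnion₂.1 hyG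
    have h0 : g y ≠ 0 := by
      rw [hgcell v hv y hyv]
      exact ((pos_iff_ne_zero.2 hτ0).trans_le (hSτ v hv)).ne'
    have := hR h0
    rw [mem_closedBall_zero_iff] at this
    linarith
  have hcG : c * ν G ≤ 1 := by
    calc c * ν G ≤ c * (1 + ε) := by gcongr; exact (measure_mono (Set.subset_univ _)).trans hνu
      _ = 1 := ENNReal.inv_mul_cancel h1ε0 h1εt
  obtain ⟨γ, hγ, hfst, hsnd, hγbad⟩ :=
    exists_coupling_withDensity μ hg.meas hfg hε hc1 hGm hcG hy₀
  set μ' := γ.map Prod.snd with hμ'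
  have hμ'p : IsProbabilityMeasure μ' :=
    Measure.isProbabilityMeasure_map measurable_snd.aemeasurable
  set l : (Fin d → ℤ) → ℝ≥0∞ := fun v => stepVal g r v * ρ ^ d with hl
  have hlt : ∀ v, l v ≠ ∞ := fun v => ENNReal.mul_ne_top (hg.stepVal_ne_top r v)
    (ENNReal.pow_ne_top ENNReal.ofReal_ne_top)
  have hνcell : ∀ v ∈ S, ν (gridCell r v) = l v := fun v hv => by
    rw [hνA v hv _ (measurableSet_gridCell r v) subset_rfl, volume_gridCell]
  have hμ'cell : ∀ v ∈ S, μ' (gridCell r v) = c * l v := fun v hv => by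
    rw [hsnd _ (measurableSet_gridCell r v) (hsubG v hv), ← hν, hνcell v hv]
  have hms := μ.mutuallySingular_singularPart volume
  -- A Lebesgue-null set that carries the singular part. Off it `μ` is bounded by the mixture, and
  -- the selected cells miss `K`, so they hold singular mass at most `ε`.
  set Nul := hms.nullSetᶜ with hNul
  have hNulm : MeasurableSet Nul := hms.measurableSet_nullSet.compl
  have hvolNul : volume Nul = 0 := hms.measure_compl_nullSet
  have hac : acPart μ ≪ volume := withDensity_absolutelyContinuous _ _
  have hμdec : ∀ B, μ B = μ.singularPart volume B + acPart μ B := fun B => by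
    rw [← Measure.add_apply, singularPart_add_acPart]
  have hmain := sum_leakMean_le (nrm := nrm) hd0 hp hΛ hΛ0 hN γ hr0 S (l := l) hlt (τ := ε)
    hNulm (C := {μ}) (fun ρ hρ => by rw [Set.mem_singleton_iff.1 hρ]; exact hμ)
    (fun ρ' hρ' v hv B hB hBs => ?_) (fun ρ' hρ' => ?_) (fun v hv _ => ?_)
  rotate_left
  · rw [Set.mem_singleton_iff.1 hρ', hμdec B]
    have h0 : μ.singularPart volume B = 0 := by
      refine measure_mono_null (fun x hx => ?_) hms.measure_nullSet
      exact not_not.1 (hBs hx).2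
    have hBv : B ⊆ gridCell r v :=
      hBs.trans (Set.sdiff_subset.trans (toUnit_preimage_openCube_subset hr0 v))
    rw [h0, zero_add]
    refine (hfg B).trans_eq ?_
    rw [hνA v hv B hB hBv, uniform, Measure.smul_apply, Measure.restrict_apply hB,
      Set.inter_eq_left.2 hBv, volume_gridCell, hl, smul_eq_mul, mul_assoc, ← mul_assoc (ρ ^ d),
      ENNReal.mul_inv_cancel (pow_ne_zero _ (ENNReal.ofReal_pos.2 hr0).ne')
        (ENNReal.pow_ne_top ENNReal.ofReal_ne_top), one_mul]
  · rw [Set.mem_singleton_iff.1 hρ', hμdec, hac (measure_mono_null Set.inter_subset_right hvolNul),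
      add_zero]
    refine le_trans (measure_mono ?_) hK
    rintro x ⟨hx, -⟩ hxK
    obtain ⟨v, hv, hxv⟩ := Set.mem_iUnion₂.1 hx
    exact Set.disjoint_left.1 (hS v hv).1 hxv hxK
  · rw [uniform_eq_cond]
    refine cond_congr_restrict (t := c * stepVal g r v)
      (mul_ne_zero hc0 ((pos_iff_ne_zero.2 hτ0).trans_le (hSτ v hv)).ne')
      (ENNReal.mul_ne_top hct (hg.stepVal_ne_top r v)) ?_
    ext B hB
    have hBm := hB.inter (measurableSet_gridCell r v)
    rw [Measure.restrict_apply hB, Measure.smul_apply, Measure.restrict_apply hB, smul_eq_mul,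
      hsnd _ hBm (Set.inter_subset_right.trans (hsubG v hv)), ← hν,
      hνA v hv _ hBm Set.inter_subset_right, mul_assoc]
  rw [hfst] at hmain
  have hmean : avgEmp (infCost (normCost nrm p) {μ}) N μ = meanCost (normCost nrm p) N μ := by
    simp only [meanCost, avgEmp, infCost_singleton]
  rw [hmean] at hmain
  set Λ' := ENNReal.ofReal Λ ^ p with hΛ'
  have hΛt : Λ' ≠ ∞ := ENNReal.rpow_ne_top_of_nonneg hp.le ENNReal.ofReal_ne_top
  have hρpt : ρ ^ p ≠ ∞ := ofReal_rpow_ne_top hr0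
  set β : (Fin d → ℤ) → ℝ≥0∞ := fun v => N * μ' (gridCell r v) with hβ
  have hβt : ∀ v, β v ≠ ∞ := fun v => ENNReal.mul_ne_top hNt (measure_ne_top _ _)
  have hβeq : ∀ v ∈ S, β v = c * stepVal g r v * M' := fun v hv => by
    simp only [hβ, hl, hμ'cell v hv, hρd]
    calc _ = c * stepVal g r v * M' * (N * (N : ℝ≥0∞)⁻¹) := by ring
      _ = _ := by rw [ENNReal.mul_inv_cancel hNE hNt, mul_one]
  have hsuml : ∑ v ∈ S, l v ≤ 1 + ε := by
    calc ∑ v ∈ S, l v = ν G := by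
          rw [hG, measure_biUnion_finset (fun v _ w _ hvw => disjoint_gridCell hr0 hvw)
            fun v _ => measurableSet_gridCell r v]
          exact Finset.sum_congr rfl fun v hv => (hνcell v hv).symm
      _ ≤ _ := (measure_mono (Set.subset_univ _)).trans hνu
  have hdef : ∑ v ∈ S, ∫⁻ y : Fin N → Fin d → ℝ, (l v -
      (N : ℝ≥0∞)⁻¹ * (cnt (gridCell r v) y : ℝ≥0∞)) ∂(Measure.pi fun _ => μ') ≤
      ε + ∑ v ∈ S, (N : ℝ≥0∞)⁻¹ * β v ^ (1 / 2 : ℝ) := by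
    calc _ ≤ ∑ v ∈ S, ((1 - c) * l v + (N : ℝ≥0∞)⁻¹ * β v ^ (1 / 2 : ℝ)) := by
          refine Finset.sum_le_sum fun v hv => ?_
          refine (lintegral_sub_cnt_le hN (measurableSet_gridCell r v)).trans_eq ?_
          rw [ENNReal.sub_mul fun _ _ => hlt v, one_mul, hμ'cell v hv]
          simp only [hβ, hμ'cell v hv]
      _ = (1 - c) * (∑ v ∈ S, l v) + ∑ v ∈ S, (N : ℝ≥0∞)⁻¹ * β v ^ (1 / 2 : ℝ) := by
          rw [Finset.sum_add_distrib, Finset.mul_sum]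
      _ ≤ (1 - c) * (1 + ε) + ∑ v ∈ S, (N : ℝ≥0∞)⁻¹ * β v ^ (1 / 2 : ℝ) := by gcongr
      _ = _ := by
          rw [ENNReal.sub_mul fun _ _ => h1εt, one_mul, hc, ENNReal.inv_mul_cancel h1ε0 h1εt,
            ENNReal.add_sub_cancel_left ENNReal.one_ne_top]
  set Y := ∑ v ∈ S, (N : ℝ≥0∞)⁻¹ * β v ^ (1 / 2 : ℝ) with hY
  have hYt : Y ≠ ∞ := ENNReal.sum_ne_top.2 fun v _ => ENNReal.mul_ne_top (ENNReal.inv_ne_top.2 hNE)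
    (ENNReal.rpow_ne_top_of_nonneg (by norm_num) (hβt v))
  -- The three `ε` stand for singular mass, for the normalisation by `c`, and for pairs with
  -- different components. The fluctuation term `Y` was built into `hcell` and cancels.
  have hlow : ρ ^ p * (∑ v ∈ S, (N : ℝ≥0∞)⁻¹ * (A * β v ^ (1 - s))) + ρ ^ p * Λ' * Y ≤
      meanCost (normCost nrm p) N μ + ρ ^ p * Λ' * (3 * ε) + ρ ^ p * Λ' * Y := by
    calc _ = ∑ v ∈ S, ρ ^ p * ((N : ℝ≥0∞)⁻¹ * (A * β v ^ (1 - s) + Λ' * β v ^ (1 / 2 : ℝ))) := by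
          rw [hY, Finset.mul_sum, Finset.mul_sum, ← Finset.sum_add_distrib]
          exact Finset.sum_congr rfl fun v _ => by ring
      _ ≤ _ := Finset.sum_le_sum fun v hv => mul_le_mul_of_nonneg_left ?_ zero_le
      _ ≤ _ := hmain
      _ ≤ meanCost (normCost nrm p) N μ + ρ ^ p * Λ' * (ε + (ε + Y) + ε) :=
          add_le_add le_rfl (mul_le_mul_of_nonneg_left
            (add_le_add (add_le_add le_rfl hdef) hγbad) zero_le)
      _ = _ := by ring
    have hβm : ENNReal.ofReal m ≤ β v := by
      rw [hβeq v hv]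
      refine hτ.trans ?_
      gcongr
      exact hSτ v hv
    have hcm : Measurable fun z : Fin N → Fin d → ℝ =>
        (cnt (gridCell r v) z : ℝ≥0∞) * leakMean d nrm p (cnt (gridCell r v) z) :=
      measurable_comp_cnt (measurableSet_gridCell r v) (fun n => (n : ℝ≥0∞) * leakMean d nrm p n)
    simp_rw [mul_assoc (N : ℝ≥0∞)⁻¹]
    rw [lintegral_const_mul _ hcm]
    exact mul_le_mul_of_nonneg_left (hcell μ' N _ (measurableSet_gridCell r v) hβm) zero_le
  have hlow' := (ENNReal.add_le_add_iff_right (ENNReal.mul_ne_top (ENNReal.mul_ne_top hρpt hΛt)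
    hYt)).1 hlow
  have hint : ∫⁻ x in (badCells r K)ᶜ, (if τ ≤ g x then g x ^ (1 - s) else 0) =
      ∑ v ∈ S, stepVal g r v ^ (1 - s) * ρ ^ d := by
    rw [← lintegral_indicator (measurableSet_badCells r K).compl]
    have h := hψ (fun t => if τ ≤ t then t ^ (1 - s) else 0) fun t ht => by
      split_ifs at ht ⊢ with h
      · rw [ht]; exact ENNReal.zero_rpow_of_pos (by linarith)
      · rfl
    simp_rw [h]
    rw [lintegral_sum_indicator_gridCell]
    refine Finset.sum_congr rfl fun v hv => ?_
    rw [if_pos (hSτ v hv), volume_gridCell]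
  rw [hint]
  calc A * c ^ (1 - s) * ∑ v ∈ S, stepVal g r v ^ (1 - s) * ρ ^ d
      = (N : ℝ≥0∞) ^ s * (ρ ^ p * (∑ v ∈ S, (N : ℝ≥0∞)⁻¹ * (A * β v ^ (1 - s)))) := by
        rw [← mul_assoc ((N : ℝ≥0∞) ^ s), hρp, Finset.mul_sum, Finset.mul_sum]
        refine Finset.sum_congr rfl fun v hv => ?_
        have hMs : M' ^ s * M' ^ (1 - s) = M' := by
          rw [← ENNReal.rpow_add _ _ hM0 hMt, add_sub_cancel, ENNReal.rpow_one]
        rw [hβeq v hv, ENNReal.mul_rpow_of_nonneg _ _ (by linarith),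
          ENNReal.mul_rpow_of_nonneg _ _ (by linarith), hρd]
        calc _ = A * c ^ (1 - s) * stepVal g r v ^ (1 - s) * (N : ℝ≥0∞)⁻¹ *
              (M' ^ s * M' ^ (1 - s)) := by rw [hMs]; ring
          _ = _ := by ring
    _ ≤ (N : ℝ≥0∞) ^ s * (meanCost (normCost nrm p) N μ + ρ ^ p * Λ' * (3 * ε)) := by gcongr
    _ = _ := by rw [← hρp]; ring

end LowerBound

/-! ### The lower bound in the limit. -/

section LowerLimit

variable {d : ℕ} {nrm : Seminorm ℝ (Fin d → ℝ)} {p Λ : ℝ}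

/-- If `u N` were often below a level `L` with `L + e < a`, convergence of `w` would contradict the
bound. -/
lemma le_liminf_add_of_eventually_le {u w : ℕ → ℝ≥0∞} {a e : ℝ≥0∞} (hw : Tendsto w atTop (𝓝 e))
    (h : ∀ᶠ N in atTop, a ≤ u N + w N) : a ≤ liminf u atTop + e := by
  rw [← tsub_le_iff_right]
  refine le_of_forall_gt_imp_ge_of_dense fun L hL => ?_
  have hfreq : ∃ᶠ N in atTop, u N < L := frequently_lt_of_liminf_lt (h := hL)
  rw [tsub_le_iff_right]
  by_contra hcon
  rw [not_le] at hcon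
  have h2 := (tendsto_const_nhds (x := L)).add hw |>.eventually_lt_const hcon
  obtain ⟨N, h1, h2, h3⟩ := (hfreq.and_eventually (h.and h2)).exists
  exact absurd h3 (not_lt.2 (h2.trans (add_le_add h1.le le_rfl)))

/-- The power `t ^ s` cut off below the threshold `τ` is monotone. -/
lemma monotone_ite_rpow {s : ℝ} (hs : 0 ≤ s) (τ : ℝ≥0∞) :
    Monotone fun t : ℝ≥0∞ => if τ ≤ t then t ^ s else 0 := by
  intro a b hab
  dsimp only
  split_ifs with h1 h2 h2
  · exact ENNReal.rpow_le_rpow hab hs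
  · exact absurd (h1.trans hab) h2
  · exact zero_le
  · exact le_rfl

/-- The lower bound for the scaled costs, with the density cut off below a threshold. -/
lemma lintegral_ite_le_liminf (hp : 0 < p) (hpd : p < (d : ℝ) / 2) (hΛ : ∀ x, nrm x ≤ Λ * ‖x‖)
    (hΛ0 : 0 ≤ Λ) (μ : Measure (Fin d → ℝ)) [IsProbabilityMeasure μ]
    (hμ : ∫⁻ x, normBound Λ p x ∂μ ≠ ∞) (happ : ApproachableFromAbove (acPart μ))
    {A : ℝ≥0∞} (hAt : A ≠ ∞) {m M : ℝ} (hm : 0 < m) (hM : 0 < M)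
    (hcell : ∀ (μ' : Measure (Fin d → ℝ)) [IsProbabilityMeasure μ'] (N : ℕ) (B : Set (Fin d → ℝ)),
      MeasurableSet B → ENNReal.ofReal m ≤ N * μ' B →
      A * (N * μ' B) ^ (1 - p / d) + ENNReal.ofReal Λ ^ p * (N * μ' B) ^ (1 / 2 : ℝ) ≤
        ∫⁻ z : Fin N → Fin d → ℝ, (cnt B z : ℝ≥0∞) * leakMean d nrm p (cnt B z)
          ∂(Measure.pi fun _ => μ'))
    {ε : ℝ} (hε0 : 0 < ε) (hε1 : ε ≤ 1) :
    A * ((1 + ENNReal.ofReal ε)⁻¹) ^ (1 - p / d) *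
      ∫⁻ x, (if ENNReal.ofReal (2 * m / M) ≤ acDensity μ x then acDensity μ x ^ (1 - p / d) else 0) ≤
      liminf (fun N : ℕ => (N : ℝ≥0∞) ^ (p / d) * meanCost (normCost nrm p) N μ) atTop +
        ENNReal.ofReal M ^ (p / d) * ENNReal.ofReal Λ ^ p * (3 * ENNReal.ofReal ε) := by
  have hd : 0 < (d : ℝ) := by linarith
  have hs1 : p / d < 1 := by rw [div_lt_one hd]; linarith
  set s := p / d with hs
  have hs' : 0 < 1 - s := by linarith
  set τ := ENNReal.ofReal (2 * m / M) with hτ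
  have hτ0 : τ ≠ 0 := (ENNReal.ofReal_pos.2 (by positivity)).ne'
  set e := ENNReal.ofReal ε with he
  have he0 : e ≠ 0 := (ENNReal.ofReal_pos.2 hε0).ne'
  have he1 : e ≤ 1 := by rw [he, ENNReal.ofReal_le_one]; exact hε1
  have het : e ≠ ∞ := ENNReal.ofReal_ne_top
  obtain ⟨ν, hνmix, hνle, hνε⟩ := happ ε hε0
  obtain ⟨K₀, g, hg₀, rfl⟩ := hνmix.exists_isStepOff
  obtain ⟨K₁, hK₁c, hK₁0, hK₁⟩ := exists_isCompact_singularPart μ he0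
  have hg := hg₀.union hK₁c hK₁0
  set K := K₀ ∪ K₁ with hK
  have hKs : μ.singularPart volume Kᶜ ≤ e :=
    (measure_mono (Set.compl_subset_compl.2 Set.subset_union_right)).trans hK₁
  obtain ⟨C, hCt, hgC⟩ := hg.bdd
  set ψ : ℝ≥0∞ → ℝ≥0∞ := fun t => if τ ≤ t then t ^ (1 - s) else 0 with hψ
  have hψmono : Monotone ψ := monotone_ite_rpow hs'.le τ
  have hψm : Measurable ψ := hψmono.measurable
  set a := A * ((1 + e)⁻¹) ^ (1 - s) with ha
  have hinv1 : (1 + e)⁻¹ ≤ 1 := ENNReal.inv_le_one.2 le_self_add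
  have hat : a ≠ ∞ := ENNReal.mul_ne_top hAt (ENNReal.rpow_ne_top_of_nonneg hs'.le
    (ne_top_of_le_ne_top ENNReal.one_ne_top hinv1))
  -- The factor 2 in the threshold compensates for `(1 + e)⁻¹ ≥ 1/2`.
  have hτm : ENNReal.ofReal m ≤ (1 + e)⁻¹ * τ * ENNReal.ofReal M := by
    calc ENNReal.ofReal m = 2⁻¹ * ENNReal.ofReal (2 * m) := by
          rw [ENNReal.ofReal_mul two_pos.le, ENNReal.ofReal_ofNat, ← mul_assoc,
            ENNReal.inv_mul_cancel two_ne_zero ENNReal.ofNat_ne_top, one_mul]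
      _ = 2⁻¹ * τ * ENNReal.ofReal M := by
          rw [mul_assoc, hτ, ← ENNReal.ofReal_mul (by positivity), div_mul_cancel₀ _ hM.ne']
      _ ≤ _ := by
          gcongr
          rw [← one_add_one_eq_two]
          gcongr
  set E := ENNReal.ofReal M ^ s * ENNReal.ofReal Λ ^ p * (3 * e) with hE
  set rad : ℕ → ℝ := fun N => (M / N) ^ (1 / (d : ℝ)) with hrad
  have hradlim : Tendsto rad atTop (𝓝[>] 0) := by
    refine tendsto_nhdsWithin_iff.2 ⟨?_, ?_⟩
    · have h1 : Tendsto (fun N : ℕ => M / (N : ℝ)) atTop (𝓝 0) := tendsto_const_div_atTop_nhds_zero_nat M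
      have h2 := h1.rpow_const (p := 1 / (d : ℝ)) (Or.inr (by positivity))
      rwa [Real.zero_rpow (by positivity)] at h2
    · filter_upwards [eventually_gt_atTop 0] with N hN
      have : (0 : ℝ) < N := by exact_mod_cast hN
      exact Real.rpow_pos_of_pos (by positivity) _
  have hbad : Tendsto (fun N => E + a * (C ^ (1 - s) * volume (badCells (rad N) K))) atTop (𝓝 E) := by
    have h1 := (tendsto_volume_badCells hg.compact hg.null).comp hradlim
    have h2 := ENNReal.Tendsto.const_mul (a := a * C ^ (1 - s)) h1
      (Or.inr (ENNReal.mul_ne_top hat (ENNReal.rpow_ne_top_of_nonneg hs'.le hCt)))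
    have h3 := h2.const_add E
    rw [mul_zero, add_zero] at h3
    simpa only [mul_assoc, Function.comp_def] using h3
  refine le_liminf_add_of_eventually_le hbad ?_
  filter_upwards [eventually_ne_atTop 0] with N hN
  have hmain := setLIntegral_le_meanCost hp hpd hΛ hΛ0 μ hμ hg hνle het hνε hKs hM hcell hτ0 hτm hN
  have hBm := measurableSet_badCells (rad N) K
  have hfg : acDensity μ ≤ᵐ[volume] g := ae_le_of_withDensity_le (measurable_acDensity μ) hνle
  calc a * ∫⁻ x, ψ (acDensity μ x) ≤ a * ∫⁻ x, ψ (g x) := by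
        gcongr 1
        exact lintegral_mono_ae (hfg.mono fun x hx => hψmono hx)
    -- The bad cells shrink to the null set `K` as `N` grows and `g` is bounded, so their part is
    -- absorbed in the vanishing error.
    _ = a * (∫⁻ x in (badCells (rad N) K)ᶜ, ψ (g x)) + a * ∫⁻ x in badCells (rad N) K, ψ (g x) := by
        rw [← mul_add, add_comm, lintegral_add_compl _ hBm]
    _ ≤ ((N : ℝ≥0∞) ^ s * meanCost (normCost nrm p) N μ + E) +
        a * (C ^ (1 - s) * volume (badCells (rad N) K)) := by
        refine add_le_add hmain (mul_le_mul_of_nonneg_left ?_ zero_le)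
        rw [← setLIntegral_const]
        refine lintegral_mono fun x => ?_
        simp only [hψ]
        split_ifs
        · exact ENNReal.rpow_le_rpow (hgC x) hs'.le
        · exact zero_le
    _ = _ := add_assoc _ _ _

/-- The lower bound for measures whose absolutely continuous part is approachable from above. -/
theorem le_liminf_meanCost (hp : 0 < p) (hpd : p < (d : ℝ) / 2) (hΛ : ∀ x, nrm x ≤ Λ * ‖x‖)
    (hΛ0 : 0 ≤ Λ) {L : ℝ≥0∞} (hLt : L ≠ ∞)
    (hL : Tendsto (fun N : ℕ => (N : ℝ≥0∞) ^ (p / d) * leakMean d nrm p N) atTop (𝓝 L))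
    (μ : Measure (Fin d → ℝ)) [IsProbabilityMeasure μ] (hμ : ∫⁻ x, normBound Λ p x ∂μ ≠ ∞)
    (happ : ApproachableFromAbove (acPart μ)) :
    L * ∫⁻ x, acDensity μ x ^ (1 - p / d) ≤
      liminf (fun N : ℕ => (N : ℝ≥0∞) ^ (p / d) * meanCost (normCost nrm p) N μ) atTop := by
  have hd : 0 < (d : ℝ) := by linarith
  have hs0 : 0 < p / d := by positivity
  have hs2 : p / d < 1 / 2 := by rw [div_lt_iff₀ hd]; linarith
  set s := p / d with hs
  have hs' : 0 < 1 - s := by linarith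
  set f := acDensity μ with hf
  have hfm : Measurable f := measurable_acDensity μ
  set X := liminf (fun N : ℕ => (N : ℝ≥0∞) ^ s * meanCost (normCost nrm p) N μ) atTop with hX
  -- The order of choices matters: `A` determines the mean `m` required per cell, `J` then
  -- determines `M = n + 1`, and `ε` tends to zero last.
  refine ENNReal.mul_le_of_forall_lt fun A hA J hJ => ?_
  have hAt : A ≠ ∞ := (hA.trans_le le_top).ne
  have hJt : J ≠ ∞ := (hJ.trans_le le_top).ne
  have hΛt : ENNReal.ofReal Λ ^ p ≠ ∞ := ENNReal.rpow_ne_top_of_nonneg hp.le ENNReal.ofReal_ne_top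
  obtain ⟨m, hm, hcell⟩ := exists_le_lintegral_cnt_mul (φ := leakMean d nrm p)
    (fun n m hn hnm => leakMean_antitone hp hΛ hΛ0 hn hnm) hs0 hs2 hLt hL hA hΛt
  set τ : ℕ → ℝ≥0∞ := fun n => ENNReal.ofReal (2 * m / ((n : ℝ) + 1)) with hτ
  have hτanti : Antitone τ := fun i j hij => by
    have : (i : ℝ) ≤ j := by exact_mod_cast hij
    refine ENNReal.ofReal_le_ofReal ?_
    gcongr
  have hτlim : Tendsto τ atTop (𝓝 0) := by
    have h1 : Tendsto (fun n : ℕ => 2 * m / ((n : ℝ) + 1)) atTop (𝓝 0) := by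
      have := (tendsto_one_div_add_atTop_nhds_zero_nat (𝕜 := ℝ)).const_mul (2 * m)
      simpa only [mul_zero, mul_one_div] using this
    have h2 := (ENNReal.continuous_ofReal.tendsto 0).comp h1
    rwa [ENNReal.ofReal_zero] at h2
  -- Monotone convergence: enlarging the cells lowers the threshold on the density to zero.
  have hconv : Tendsto (fun n => ∫⁻ x, (if τ n ≤ f x then f x ^ (1 - s) else 0)) atTop
      (𝓝 (∫⁻ x, f x ^ (1 - s))) := by
    refine lintegral_tendsto_of_tendsto_of_monotone (fun n =>
      ((monotone_ite_rpow hs'.le (τ n)).measurable.comp hfm).aemeasurable)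
      (Eventually.of_forall fun x i j hij => ?_) (Eventually.of_forall fun x => ?_)
    · dsimp only
      split_ifs with h1 h2
      · exact le_rfl
      · exact absurd ((hτanti hij).trans h1) h2
      · exact zero_le
      · exact le_rfl
    · rcases eq_or_ne (f x) 0 with h0 | h0
      · simp only [h0, ENNReal.zero_rpow_of_pos hs', ite_self]
        exact tendsto_const_nhds
      · refine tendsto_const_nhds.congr' ?_
        filter_upwards [hτlim.eventually_le_const (pos_iff_ne_zero.2 h0)] with n hn
        rw [if_pos hn]
  obtain ⟨n, hn⟩ := (hconv.eventually_const_lt hJ).exists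
  have hM : (0 : ℝ) < (n : ℝ) + 1 := by positivity
  set F := ENNReal.ofReal ((n : ℝ) + 1) ^ s * ENNReal.ofReal Λ ^ p with hF
  have hFt : F ≠ ∞ := ENNReal.mul_ne_top (ENNReal.rpow_ne_top_of_nonneg hs0.le
    ENNReal.ofReal_ne_top) hΛt
  have hle : ∀ᶠ ε : ℝ in 𝓝[>] 0, A * ((1 + ENNReal.ofReal ε)⁻¹) ^ (1 - s) * J ≤
      X + F * (3 * ENNReal.ofReal ε) := by
    filter_upwards [eventually_mem_nhdsWithin, eventually_nhdsWithin_of_eventually_nhds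
      (eventually_le_nhds (show (0 : ℝ) < 1 from one_pos))] with ε hε0 hε1
    refine le_trans ?_ (lintegral_ite_le_liminf hp hpd hΛ hΛ0 μ hμ happ hAt hm hM
      (fun μ' _ N B hB h => hcell μ' N B hB h) hε0 hε1)
    gcongr
  have hof : Tendsto (fun ε : ℝ => ENNReal.ofReal ε) (𝓝[>] 0) (𝓝 0) := by
    have := (ENNReal.continuous_ofReal.tendsto 0).mono_left (nhdsWithin_le_nhds (s := Set.Ioi 0))
    rwa [ENNReal.ofReal_zero] at this
  have hlim1 : Tendsto (fun ε : ℝ => A * ((1 + ENNReal.ofReal ε)⁻¹) ^ (1 - s) * J) (𝓝[>] 0)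
      (𝓝 (A * ((1 + 0)⁻¹) ^ (1 - s) * J)) := by
    refine ENNReal.Tendsto.mul_const (ENNReal.Tendsto.const_mul ?_ (Or.inr hAt)) (Or.inr hJt)
    exact (ENNReal.continuous_rpow_const.tendsto _).comp
      (tendsto_inv_iff.2 (tendsto_const_nhds.add hof))
  have hlim2 : Tendsto (fun ε : ℝ => X + F * (3 * ENNReal.ofReal ε)) (𝓝[>] 0)
      (𝓝 (X + F * (3 * 0))) :=
    tendsto_const_nhds.add (ENNReal.Tendsto.const_mul (ENNReal.Tendsto.const_mul hof
      (Or.inr (by norm_num))) (Or.inr hFt))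
  rw [add_zero, inv_one, ENNReal.one_rpow, mul_one] at hlim1
  rw [mul_zero, mul_zero, add_zero] at hlim2
  exact le_of_tendsto_of_tendsto hlim1 hlim2 hle

end LowerLimit

/-! ### Passage to `p`-th roots. -/

section Roots

lemma natCast_rpow_mul_rpow {d : ℕ} {p : ℝ} (hp : 0 < p) (N : ℕ) (t : ℝ≥0∞) :
    (N : ℝ≥0∞) ^ (1 / (d : ℝ)) * t ^ (1 / p) = ((N : ℝ≥0∞) ^ (p / d) * t) ^ (1 / p) := by
  rw [ENNReal.mul_rpow_of_nonneg _ _ (by positivity), ← ENNReal.rpow_mul]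
  congr 2
  field_simp

lemma limsup_rpow {u : ℕ → ℝ≥0∞} {s : ℝ} (hs : 0 < s) :
    limsup (fun N => u N ^ s) atTop = (limsup u atTop) ^ s :=
  ((ENNReal.orderIsoRpow s hs).limsup_apply (u := u) (f := atTop)).symm

lemma liminf_rpow {u : ℕ → ℝ≥0∞} {s : ℝ} (hs : 0 < s) :
    liminf (fun N => u N ^ s) atTop = (liminf u atTop) ^ s :=
  ((ENNReal.orderIsoRpow s hs).liminf_apply (u := u) (f := atTop)).symm

end Roots

end

end EmpQuant

/-! ### The theorem, assembled from the limits and the two bounds. -/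

theorem theorem4p4 (d : ℕ) (nrm : Seminorm ℝ (Fin d → ℝ)) (hnrm : ∀ x, nrm x = 0 → x = 0)
    (p : ℝ) (hp1 : 1 ≤ p) (hpd : p < (d : ℝ) / 2) :
    ∃ κ κ' : ℝ≥0, 0 < κ ∧ 0 < κ' ∧
      Tendsto (fun N : ℕ => (N : ℝ≥0∞) ^ (1 / (d : ℝ)) * randError nrm p N (unifCube d))
        atTop (𝓝 (κ : ℝ≥0∞)) ∧
      Tendsto (fun N : ℕ => (N : ℝ≥0∞) ^ (1 / (d : ℝ)) * leakError d nrm p N)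
        atTop (𝓝 (κ' : ℝ≥0∞)) ∧
      ∀ (μ : Measure (Fin d → ℝ)) [IsProbabilityMeasure μ] (q : ℝ),
        (d : ℝ) * p / ((d : ℝ) - p) < q →
        ∫⁻ x, ENNReal.ofReal (nrm x) ^ q ∂μ < ⊤ →
        (ApproachableFromBelow (acPart μ) →
          limsup (fun N : ℕ => (N : ℝ≥0∞) ^ (1 / (d : ℝ)) * randError nrm p N μ) atTop
            ≤ (κ : ℝ≥0∞) * (∫⁻ x, acDensity μ x ^ (1 - p / (d : ℝ))) ^ (1 / p)) ∧
        (ApproachableFromAbove (acPart μ) →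
          (κ' : ℝ≥0∞) * (∫⁻ x, acDensity μ x ^ (1 - p / (d : ℝ))) ^ (1 / p)
            ≤ liminf (fun N : ℕ => (N : ℝ≥0∞) ^ (1 / (d : ℝ)) * randError nrm p N μ) atTop) := by
  have hp : 0 < p := by linarith
  have hd : 0 < (d : ℝ) := by linarith
  have hd0 : d ≠ 0 := by rintro rfl; simp at hd
  have h1p : 0 < 1 / p := by positivity
  obtain ⟨Λ, hΛ0, hΛ⟩ := exists_seminorm_le nrm
  obtain ⟨l, hl0, hl⟩ := exists_le_seminorm nrm hnrm
  obtain ⟨L, hLle, hL⟩ := exists_tendsto_meanCost_unif hp hpd hΛ hΛ0.le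
  obtain ⟨L', hL'⟩ := exists_tendsto_leakMean hp hpd hΛ hΛ0.le
  have hLt : L ≠ ∞ := ne_top_of_le_ne_top (cubeConst_ne_top hp hpd) hLle
  have hLL' : L' ≤ L := le_of_tendsto_of_tendsto' hL' hL fun N =>
    mul_le_mul_of_nonneg_left (leakMean_le_meanCost N) zero_le
  have hL't : L' ≠ ∞ := ne_top_of_le_ne_top hLt hLL'
  -- Only the leaking constant needs a direct lower bound; it lies below the uniform constant, which
  -- is therefore positive too.
  have hL'0 : L' ≠ 0 := by
    have h1 := ge_of_tendsto hL' ((eventually_ne_atTop 0).mono fun N hN =>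
      le_rpow_mul_leakMean hd0 hp hl0 hl hN)
    have h2 : ENNReal.ofReal (l / 4) ^ p * 2⁻¹ * (2 ^ d)⁻¹ ≠ 0 :=
      mul_ne_zero (mul_ne_zero (ofReal_rpow_ne_zero (by positivity)) (by simp)) (by simp)
    exact ((pos_iff_ne_zero.2 h2).trans_le h1).ne'
  have hL0 : L ≠ 0 := ((pos_iff_ne_zero.2 hL'0).trans_le hLL').ne'
  have hrt : ∀ {t : ℝ≥0∞}, t ≠ ∞ → t ^ (1 / p) ≠ ∞ := fun ht =>
    ENNReal.rpow_ne_top_of_nonneg h1p.le ht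
  have hpos : ∀ {t : ℝ≥0∞}, t ≠ 0 → t ≠ ∞ → 0 < (t ^ (1 / p)).toNNReal := fun h0 ht =>
    ENNReal.toNNReal_pos (ENNReal.rpow_pos (pos_iff_ne_zero.2 h0) ht).ne' (hrt ht)
  refine ⟨(L ^ (1 / p)).toNNReal, (L' ^ (1 / p)).toNNReal, hpos hL0 hLt, hpos hL'0 hL't, ?_, ?_,
    fun μ _ q hq hμ => ⟨fun happ => ?_, fun happ => ?_⟩⟩
  · rw [ENNReal.coe_toNNReal (hrt hLt)]
    simp_rw [randError_eq hp, natCast_rpow_mul_rpow hp]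
    exact (ENNReal.continuous_rpow_const.tendsto _).comp hL
  · rw [ENNReal.coe_toNNReal (hrt hL't)]
    simp_rw [leakError_eq, natCast_rpow_mul_rpow hp]
    exact (ENNReal.continuous_rpow_const.tendsto _).comp hL'
  · rw [ENNReal.coe_toNNReal (hrt hLt), ← ENNReal.mul_rpow_of_nonneg _ _ h1p.le]
    simp_rw [randError_eq hp, natCast_rpow_mul_rpow hp]
    rw [limsup_rpow h1p]
    exact ENNReal.rpow_le_rpow (limsup_meanCost_le hp hpd hΛ hΛ0.le hL μ
      (lintegral_normBound_ne_top_of_moment hp hpd hΛ0.le hl0 hl hq hμ.ne)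
      (shellSum_ne_top_of_moment hp hpd hl0 hl hq hμ.ne) happ) h1p.le
  · rw [ENNReal.coe_toNNReal (hrt hL't), ← ENNReal.mul_rpow_of_nonneg _ _ h1p.le]
    simp_rw [randError_eq hp, natCast_rpow_mul_rpow hp]
    rw [liminf_rpow h1p]
    exact ENNReal.rpow_le_rpow (le_liminf_meanCost hp hpd hΛ hΛ0.le hL't hL' μ
      (lintegral_normBound_ne_top_of_moment hp hpd hΛ0.le hl0 hl hq hμ.ne) happ) h1p.le
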